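/- A \emph{rectangular diagram} with $n$ vertical edges is a link diagram in the plane $\mathbb{R}^2$ composed of $n$ vertical and $n$ horizontal segments (edges), no two vertical ones collinear and no two horizontal ones collinear, in which the vertical edge passes over the horizontal edge at each crossing; we normalize it so that the vertical edges lie on the lines $x=0,\dots,n-1$ and the horizontal edges on the lines $y=0,\dots,n-1$. Two horizontal edges are \emph{interleaved} if the abscissae of their endpoints (strictly) alternate. An \emph{exterior horizontal exchange} exchanges the heights of the top and the bottom horizontal edge, provided these are not interleaved. An \emph{exterior horizontal merge} applies when the top and the bottom horizontal edge are connected by exactly one vertical edge; it amalgamates these three edges into a single horizontal edge, placed either at the top or at the bottom, and leaves $n-1$ vertical edges. A \emph{horizontal rotation} moves the top horizontal edge to the bottom, or the bottom one to the top, keeping the order of the other edges. The \emph{vertical} versions of these moves are obtained by exchanging the roles of horizontal and vertical edges. Link diagrams are considered up to ambient isotopy of the plane, and a Reidemeister move is a move of type I, II or III, in either direction, performed in a disk of the plane. Let $n\ge 2$ be an integer and let $\epsilon\in\{0,1\}$ with $n\equiv\epsilon \pmod 2$. Let $D$ be a rectangular diagram with $n$ vertical edges. (a) If $D'$ is obtained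 from $D$ by an exterior (horizontal or vertical) exchange, then a sequence of at most $3n^2-4n-4-3\epsilon$ Reidemeister moves either (1) deforms $D$ into a knot diagram with no crossings, or (2) deforms $D$ into a disconnected link diagram, or (3) deforms $D$ into $D'$. (b) If $D'$ is obtained from $D$ by an exterior (horizontal or vertical) merge, then a sequence of at most $(3n^2-4n-4-3\epsilon)/2$ Reidemeister moves does (1), (2) or (3). (c) If $D'$ is obtained from $D$ by any (horizontal or vertical) rotation, then a sequence of at most $(3n^2-4n-2-3\epsilon)/2$ Reidemeister moves does (1), (2) or (3). -/

import Mathlib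

open Set Topology

/-! ## Link diagrams in the plane -/

/-- The plane `ℝ²`. Only its topology is used. -/
abbrev Plane : Type := ℝ × ℝ

/-- The closed square `[-1,1] × [-1,1]`, the model of a disk in the plane. -/
def Box : Set Plane := {q | |q.1| ≤ 1 ∧ |q.2| ≤ 1}

/-- A vertical segment. -/
def vseg (x a b : ℝ) : Set Plane := {q | q.1 = x ∧ q.2 ∈ uIcc a b}

/-- A horizontal segment. -/
def hseg (y a b : ℝ) : Set Plane := {q | q.2 = y ∧ q.1 ∈ uIcc a b}

/-- Raw data of a (local or global) diagram: the underlying point set, the set of crossings, and,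
for each crossing `c`, a set `overAt c` whose germ at `c` is the overstrand at `c`.
The values of `overAt` away from crossings, and of `overAt c` far from `c`, carry no information. -/
structure Picture where
  shadow : Set Plane
  cross : Set Plane
  overAt : Plane → Set Plane

/-- A link diagram in the plane: a compact set that is, near each point, a (locally flat) arc,
except for finitely many crossings, near which it consists of two transverse arcs
one of which is singled out as the overstrand. -/
structure LinkDiagram extends Picture where
  isCompact_shadow : IsCompact shadow
  finite_cross : cross.Finite
  arc_chart : ∀ p ∈ shadow, p ∉ cross → ∃ h : Plane ≃ₜ Plane, h 0 = p ∧
    ∀ q ∈ Box, (h q ∈ shadow ↔ q.2 = 0)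
  cross_chart : ∀ c ∈ cross, ∃ h : Plane ≃ₜ Plane, h 0 = c ∧
    ∀ q ∈ Box, (h q ∈ shadow ↔ q.1 = 0 ∨ q.2 = 0) ∧ (h q ∈ overAt c ↔ q.1 = 0)

namespace LinkDiagram

/-- A diagram of a knot without crossings: a simple closed curve. -/
def IsTrivialKnotDiagram (D : LinkDiagram) : Prop :=
  D.cross = ∅ ∧ IsConnected D.shadow

/-- The diagram is disconnected as a subset of the plane. -/
def IsDisconnected (D : LinkDiagram) : Prop :=
  ¬ IsPreconnected D.shadow

/-- The homeomorphism `φ` of the plane carries the diagram `D` to the diagram `D'`,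
overstrands to overstrands. -/
def Carries (φ : Plane ≃ₜ Plane) (D D' : LinkDiagram) : Prop :=
  (∀ p, φ p ∈ D'.shadow ↔ p ∈ D.shadow) ∧
  (∀ p, φ p ∈ D'.cross ↔ p ∈ D.cross) ∧
  ∀ c ∈ D.cross, ∀ᶠ p in 𝓝 c, (φ p ∈ D'.overAt (φ c) ↔ p ∈ D.overAt c)

/-- `D` and `D'` are related by an ambient isotopy of the plane. -/
def PlanarIsotopic (D D' : LinkDiagram) : Prop :=
  ∃ Φ : unitInterval → Plane ≃ₜ Plane,
    Continuous (fun z : unitInterval × Plane => Φ z.1 z.2) ∧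
    Φ 0 = Homeomorph.refl Plane ∧ Carries (Φ 1) D D'

end LinkDiagram

/-! ## Reidemeister moves -/

/-- Seen through the homeomorphism `h`, the diagram `D` shows the picture `P` inside the disk
`h '' Box`. -/
def Shows (h : Plane ≃ₜ Plane) (P : Picture) (D : LinkDiagram) : Prop :=
  (∀ q ∈ Box, (h q ∈ D.shadow ↔ q ∈ P.shadow)) ∧
  (∀ q ∈ Box, (h q ∈ D.cross ↔ q ∈ P.cross)) ∧
  ∀ c ∈ P.cross, ∀ᶠ q in 𝓝 c, (h q ∈ D.overAt (h c) ↔ q ∈ P.overAt c)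

/-- The diagrams `D` and `D'` agree outside the disk `h '' Box`. -/
def AgreeOutside (h : Plane ≃ₜ Plane) (D D' : LinkDiagram) : Prop :=
  (∀ q ∉ Box, (h q ∈ D.shadow ↔ h q ∈ D'.shadow)) ∧
  (∀ q ∉ Box, (h q ∈ D.cross ↔ h q ∈ D'.cross)) ∧
  ∀ q ∉ Box, h q ∈ D.cross → ∀ᶠ p in 𝓝 (h q), (p ∈ D.overAt (h q) ↔ p ∈ D'.overAt (h q))

/-- `D'` arises from `D` by replacing the picture `P` by `P'` in a disk of the plane. -/
def Replace (P P' : Picture) (D D' : LinkDiagram) : Prop :=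
  ∃ h : Plane ≃ₜ Plane, Shows h P D ∧ Shows h P' D' ∧ AgreeOutside h D D'

/-- First move, plain side: an arc with a corner at the origin. -/
def pictureI : Picture where
  shadow := hseg 0 (-1) 0 ∪ vseg 0 (-1) 0
  cross := ∅
  overAt := fun _ => ∅

/-- First move, kinked side: the arc from `(-1,0)` runs right through the origin, turns
counterclockwise around a small square and runs down through the origin to `(0,-1)`.
The flag `b` says whether the horizontal strand is over. -/
def pictureI' (b : Bool) : Picture where
  shadow := hseg 0 (-1) (1/2) ∪ vseg (1/2) 0 (1/2) ∪ hseg (1/2) 0 (1/2) ∪ vseg 0 (-1) (1/2)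
  cross := {0}
  overAt := fun _ => if b then {q | q.2 = 0} else {q | q.1 = 0}

/-- Second move, plain side: two parallel arcs. -/
def pictureII : Picture where
  shadow := hseg 0 (-1) 1 ∪ hseg (1/2) (-1) 1
  cross := ∅
  overAt := fun _ => ∅

/-- Second move, crossed side: the upper arc is pushed across the lower one, creating a bigon.
The flag `b` says whether the lower (straight) arc is over. -/
def pictureII' (b : Bool) : Picture where
  shadow := hseg 0 (-1) 1 ∪
    (hseg (1/2) (-1) (-1/2) ∪ vseg (-1/2) (-1/2) (1/2) ∪ hseg (-1/2) (-1/2) (1/2) ∪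
      vseg (1/2) (-1/2) (1/2) ∪ hseg (1/2) (1/2) 1)
  cross := {(-1/2, 0), (1/2, 0)}
  overAt := fun c => if b then {q | q.2 = 0} else {q | q.1 = c.1}

/-- The three strands in the third move: the two axes, and a staircase from `(-1,-1/2)` to
`(1,1/2)` that climbs along the line `x = t`. -/
def strandIII (t : ℝ) : Fin 3 → Set Plane :=
  ![hseg 0 (-1) 1, vseg 0 (-1) 1,
    hseg (-1/2) (-1) t ∪ vseg t (-1/2) (1/2) ∪ hseg (1/2) t 1]

/-- The two sides of the third move are `t = 1/2` and `t = -1/2`: the staircase is pushed across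
the crossing of the axes. The permutation `r` gives the heights of the strands: at each
crossing the strand with the larger value of `r` is over. -/
def pictureIII (r : Equiv.Perm (Fin 3)) (t : ℝ) : Picture where
  shadow := ⋃ i, strandIII t i
  cross := {q | ∃ i j, i ≠ j ∧ q ∈ strandIII t i ∧ q ∈ strandIII t j}
  overAt := fun c => {q | ∃ i, q ∈ strandIII t i ∧ c ∈ strandIII t i ∧
    ∀ j, c ∈ strandIII t j → r j ≤ r i}

/-- The pairs of local pictures of the three Reidemeister moves. -/
inductive ReidemeisterPair : Picture → Picture → Prop
  | RI (b : Bool) : ReidemeisterPair pictureI (pictureI' b)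
  | RII (b : Bool) : ReidemeisterPair pictureII (pictureII' b)
  | RIII (r : Equiv.Perm (Fin 3)) :
      ReidemeisterPair (pictureIII r (1/2)) (pictureIII r (-1/2))

/-- A single Reidemeister move, in either direction. -/
def ReidemeisterMove (D D' : LinkDiagram) : Prop :=
  ∃ P P', ReidemeisterPair P P' ∧ (Replace P P' D D' ∨ Replace P' P D D')

/-- `ReidemeisterSeq k D D'`: a sequence of exactly `k` Reidemeister moves, interspersed with
planar isotopies, deforms `D` into `D'`. -/
inductive ReidemeisterSeq : ℕ → LinkDiagram → LinkDiagram → Prop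
  | isotopy {D D' : LinkDiagram} : D.PlanarIsotopic D' → ReidemeisterSeq 0 D D'
  | move {k : ℕ} {D D₁ D₂ D' : LinkDiagram} : ReidemeisterSeq k D D₁ →
      ReidemeisterMove D₁ D₂ → D₂.PlanarIsotopic D' → ReidemeisterSeq (k + 1) D D'

/-- A sequence of at most `B` Reidemeister moves either deforms `D` into a knot diagram with no
crossings, or deforms `D` into a disconnected link diagram, or deforms `D` into `D'`. -/
def UnknotsSplitsOrRealizes (B : ℚ) (D D' : LinkDiagram) : Prop :=
  ∃ (k : ℕ) (E : LinkDiagram), (k : ℚ) ≤ B ∧ ReidemeisterSeq k D E ∧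
    (E.IsTrivialKnotDiagram ∨ E.IsDisconnected ∨ E = D')

/-! ## Rectangular diagrams -/

/-- A rectangular diagram with `n` vertical and `n` horizontal edges. The vertical edges lie on the
lines `x = 0, …, n - 1` and the horizontal ones on the lines `y = 0, …, n - 1`; the endpoints of
the `i`-th vertical edge are at the heights `X i` and `O i`, so that the `j`-th horizontal edge
joins the abscissae `X⁻¹ j` and `O⁻¹ j`. -/
@[ext]
structure RectDiagram (n : ℕ) where
  X : Equiv.Perm (Fin n)
  O : Equiv.Perm (Fin n)
  ne : ∀ i, X i ≠ O i

namespace RectDiagram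

variable {n : ℕ}

/-- The `i`-th vertical edge from the left. -/
def vEdge (D : RectDiagram n) (i : Fin n) : Set Plane :=
  vseg (i : ℕ) (D.X i : ℕ) (D.O i : ℕ)

/-- The `j`-th horizontal edge from the bottom. -/
def hEdge (D : RectDiagram n) (j : Fin n) : Set Plane :=
  hseg (j : ℕ) (D.X.symm j : ℕ) (D.O.symm j : ℕ)

/-- The drawing of a rectangular diagram. The crossings are the common points of a vertical and a
horizontal edge that are endpoints of neither; there the vertical edge is over. -/
def picture (D : RectDiagram n) : Picture where
  shadow := (⋃ i, D.vEdge i) ∪ ⋃ j, D.hEdge j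
  cross := {q | ∃ i j, q ∈ D.vEdge i ∧ q ∈ D.hEdge j ∧ j ≠ D.X i ∧ j ≠ D.O i}
  overAt := fun _ => ⋃ i, D.vEdge i

/-- Exchange of the roles of rows and columns (reflection in the diagonal). -/
def transpose (D : RectDiagram n) : RectDiagram n where
  X := D.X.symm
  O := D.O.symm
  ne := fun j h => D.ne (D.X.symm j) (by rw [Equiv.apply_symm_apply, h, Equiv.apply_symm_apply])

/-- Move each horizontal edge from height `j` to height `π j`. -/
def permRows (D : RectDiagram n) (π : Equiv.Perm (Fin n)) : RectDiagram n where
  X := D.X.trans π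
  O := D.O.trans π
  ne := fun i h => D.ne i (π.injective h)

/-- Move each vertical edge from abscissa `i` to abscissa `π i`. -/
def permCols (D : RectDiagram n) (π : Equiv.Perm (Fin n)) : RectDiagram n :=
  (D.transpose.permRows π).transpose

/-- The pairs `{a, b}` and `{c, d}` alternate on the line. -/
def Interleaved (a b c d : Fin n) : Prop :=
  (min a b < min c d ∧ min c d < max a b ∧ max a b < max c d) ∨
  (min c d < min a b ∧ min a b < max c d ∧ max c d < max a b)

/-- `D'` is obtained from `D` by an exterior horizontal exchange: the top and the bottom edge are
not interleaved, and their heights are exchanged. -/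
def IsExteriorHorizontalExchange (D D' : RectDiagram n) : Prop :=
  ∃ t b : Fin n, (t : ℕ) + 1 = n ∧ (b : ℕ) = 0 ∧
    ¬ Interleaved (D.X.symm t) (D.O.symm t) (D.X.symm b) (D.O.symm b) ∧
    D' = D.permRows (Equiv.swap t b)

/-- An exterior exchange, horizontal or vertical. -/
def IsExteriorExchange (D D' : RectDiagram n) : Prop :=
  D.IsExteriorHorizontalExchange D' ∨ D.transpose.IsExteriorHorizontalExchange D'.transpose

/-- `D'` is obtained from `D` by an exterior horizontal merge: the `i`-th vertical edge joins the
top and the bottom edge, and these three edges are amalgamated into one horizontal edge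
(`D'` being a rectangular diagram, this edge is nondegenerate: the top and the bottom edge are
joined by one vertical edge only). The new edge is placed at the top, so that the other horizontal
edges move down by one, or at the bottom. -/
def IsExteriorHorizontalMerge {m : ℕ} (D : RectDiagram (m + 1)) (D' : RectDiagram m) : Prop :=
  ∃ i : Fin (m + 1),
    ((D.X i = Fin.last m ∧ D.O i = 0) ∨ (D.X i = 0 ∧ D.O i = Fin.last m)) ∧
    ∃ ρ : Fin (m + 1) → ℕ,
      ((∀ j, ρ j = if j = 0 then m - 1 else (j : ℕ) - 1) ∨
        (∀ j, ρ j = if j = Fin.last m then 0 else (j : ℕ))) ∧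
      ∀ k : Fin m, (D'.X k : ℕ) = ρ (D.X (i.succAbove k)) ∧
        (D'.O k : ℕ) = ρ (D.O (i.succAbove k))

/-- An exterior merge, horizontal or vertical. -/
def IsExteriorMerge {m : ℕ} (D : RectDiagram (m + 1)) (D' : RectDiagram m) : Prop :=
  D.IsExteriorHorizontalMerge D' ∨ D.transpose.IsExteriorHorizontalMerge D'.transpose

/-- A rotation move: the top edge is moved to the bottom or vice versa, or the leftmost edge is
moved to the right end or vice versa, the order of the other edges being kept. -/
def IsRotation (D D' : RectDiagram n) : Prop :=
  ∃ π : Equiv.Perm (Fin n), (π = finRotate n ∨ π = (finRotate n).symm) ∧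
    (D' = D.permRows π ∨ D' = D.permCols π)

/-! ### A rectangular diagram is a link diagram -/

/-- Rescaled charts: a property that holds near `0` holds on a small copy of the box. -/
theorem exists_scale (g : Plane ≃ₜ Plane) {Q : Plane → Prop} (hQ : ∀ᶠ v in 𝓝 (0 : Plane), Q v) :
    ∃ δ : ℝ, 0 < δ ∧ ∀ q ∈ Box, Q (δ • g q) := by
  have hBox : IsCompact Box := by
    have : Box = Icc (-1 : ℝ) 1 ×ˢ Icc (-1 : ℝ) 1 := by
      ext q; simp only [Box, abs_le, mem_ofPred_eq, mem_prod, mem_Icc]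
    rw [this]; exact isCompact_Icc.prod isCompact_Icc
  obtain ⟨r, hr, hb⟩ := Metric.eventually_nhds_iff.1 hQ
  obtain ⟨C, hC⟩ := (hBox.image g.continuous).isBounded.exists_norm_le
  have hC' : 0 < |C| + 1 := by positivity
  refine ⟨r / (|C| + 1), by positivity, fun q hq => hb ?_⟩
  have h1 : ‖g q‖ ≤ C := hC _ ⟨q, hq, rfl⟩
  rw [dist_zero_right, norm_smul, Real.norm_of_nonneg (by positivity)]
  calc r / (|C| + 1) * ‖g q‖ < r / (|C| + 1) * (|C| + 1) := by
        apply mul_lt_mul_of_pos_left _ (by positivity)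
        linarith [le_abs_self C]
    _ = r := by field_simp

/-- The homeomorphism `q ↦ p + δ g(q)`. -/
theorem exists_chart (p : Plane) (g : Plane ≃ₜ Plane) (g0 : g 0 = 0) {Q : Plane → Prop}
    (hQ : ∀ᶠ q in 𝓝 p, Q q) :
    ∃ (h : Plane ≃ₜ Plane) (δ : ℝ), 0 < δ ∧ h 0 = p ∧ (∀ q, h q = p + δ • g q) ∧
      ∀ q ∈ Box, Q (h q) := by
  have h0 : ∀ᶠ v in 𝓝 (0 : Plane), Q (p + v) := by
    have : Filter.Tendsto (fun v : Plane => p + v) (𝓝 0) (𝓝 p) := by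
      have := (continuous_const_add p).tendsto (0 : Plane)
      rwa [add_zero] at this
    exact this.eventually hQ
  obtain ⟨δ, hδ, hδQ⟩ := exists_scale g h0
  refine ⟨(g.trans (Homeomorph.smulOfNeZero δ hδ.ne')).trans (Homeomorph.addLeft p), δ, hδ,
    ?_, fun q => rfl, fun q hq => hδQ q hq⟩
  change p + δ • g 0 = p
  rw [g0, smul_zero, add_zero]

/-- A homeomorphism that bends the horizontal axis to a right angle. -/
noncomputable def bend (σ τ : ℝ) (hσ : σ * σ = 1) (hτ : τ * τ = 1) : Plane ≃ₜ Plane where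
  toFun q := (τ * ((q.2 + |q.1| + q.1) / 2), σ * ((q.2 + |q.1| - q.1) / 2))
  invFun p := (τ * p.1 - σ * p.2, τ * p.1 + σ * p.2 - |τ * p.1 - σ * p.2|)
  left_inv q := by
    have h1 : ∀ a, τ * (τ * a) = a := fun a => by rw [← mul_assoc, hτ, one_mul]
    have h2 : ∀ a, σ * (σ * a) = a := fun a => by rw [← mul_assoc, hσ, one_mul]
    simp only [h1, h2]
    have h3 : (q.2 + |q.1| + q.1) / 2 - (q.2 + |q.1| - q.1) / 2 = q.1 := by ring
    rw [h3]
    ext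
    · rfl
    · simp only; ring
  right_inv p := by
    ext
    · simp only
      linear_combination p.1 * hτ
    · simp only
      linear_combination p.2 * hσ
  continuous_toFun := by fun_prop
  continuous_invFun := by fun_prop

theorem isClosed_vseg (x a b : ℝ) : IsClosed (vseg x a b) :=
  (isClosed_eq continuous_fst continuous_const).inter
    ((isClosed_Icc (a := min a b) (b := max a b)).preimage continuous_snd)

theorem isClosed_hseg (y a b : ℝ) : IsClosed (hseg y a b) :=
  (isClosed_eq continuous_snd continuous_const).inter
    ((isClosed_Icc (a := min a b) (b := max a b)).preimage continuous_fst)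

/-- Near a point inside it, an interval is everything; near an end, it is a half line. -/
theorem eventually_uIcc {a b y : ℝ} (hab : a ≠ b) (hy : y ∈ uIcc a b) :
    (y ≠ a → y ≠ b → ∀ᶠ z in 𝓝 y, z ∈ uIcc a b) ∧
    ((y = a ∨ y = b) → ∃ σ : ℝ, σ * σ = 1 ∧ ∀ᶠ z in 𝓝 y, (z ∈ uIcc a b ↔ 0 ≤ σ * (z - y))) := by
  wlog h : a < b generalizing a b
  · have h' : b < a := lt_of_le_of_ne (not_lt.1 h) hab.symm
    rw [uIcc_comm] at hy ⊢
    obtain ⟨h1, h2⟩ := this hab.symm hy h'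
    exact ⟨fun x y => h1 y x, fun x => h2 x.symm⟩
  rw [uIcc_of_le h.le] at hy ⊢
  constructor
  · intro h1 h2
    exact Icc_mem_nhds (lt_of_le_of_ne hy.1 h1.symm) (lt_of_le_of_ne hy.2 h2)
  · rintro (rfl | rfl)
    · refine ⟨1, by norm_num, ?_⟩
      filter_upwards [Iio_mem_nhds h] with z hz
      have : z < b := hz
      constructor
      · intro hh; linarith [hh.1]
      · intro hh; exact ⟨by linarith, by linarith⟩
    · refine ⟨-1, by norm_num, ?_⟩
      filter_upwards [Ioi_mem_nhds h] with z hz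
      have : a < z := hz
      constructor
      · intro hh; linarith [hh.2]
      · intro hh; exact ⟨by linarith, by linarith⟩

theorem natCast_fin_ne {a b : Fin n} (h : a ≠ b) : ((a : ℕ) : ℝ) ≠ ((b : ℕ) : ℝ) := by
  intro h'
  exact h (Fin.ext (Nat.cast_injective h'))

theorem natCast_fin_inj {a b : Fin n} (h : ((a : ℕ) : ℝ) = ((b : ℕ) : ℝ)) : a = b :=
  Fin.ext (Nat.cast_injective h)

/-- The vertical edges near a point of a vertical edge. -/
theorem eventually_vEdge (D : RectDiagram n) (i : Fin n) (p : Plane) (hp : p ∈ D.vEdge i) :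
    ∀ᶠ q in 𝓝 p, (q ∈ ⋃ k, D.vEdge k) ↔ q ∈ D.vEdge i := by
  have hc : IsClosed (⋃ k ∈ {k : Fin n | k ≠ i}, D.vEdge k) :=
    (toFinite _).isClosed_biUnion fun k _ => isClosed_vseg _ _ _
  have hn : p ∉ ⋃ k ∈ {k : Fin n | k ≠ i}, D.vEdge k := by
    simp only [mem_iUnion, not_exists]
    intro k hk hk'
    exact hk (natCast_fin_inj (hk'.1.symm.trans hp.1))
  filter_upwards [hc.isOpen_compl.mem_nhds hn] with q hq
  constructor
  · intro h
    obtain ⟨k, hk⟩ := mem_iUnion.1 h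
    by_cases hki : k = i
    · exact hki ▸ hk
    · exact absurd (mem_biUnion (show k ∈ {k : Fin n | k ≠ i} from hki) hk) hq
  · intro h
    exact mem_iUnion.2 ⟨i, h⟩

/-- The horizontal edges near a point of a horizontal edge. -/
theorem eventually_hEdge (D : RectDiagram n) (j : Fin n) (p : Plane) (hp : p ∈ D.hEdge j) :
    ∀ᶠ q in 𝓝 p, (q ∈ ⋃ k, D.hEdge k) ↔ q ∈ D.hEdge j := by
  have hc : IsClosed (⋃ k ∈ {k : Fin n | k ≠ j}, D.hEdge k) :=
    (toFinite _).isClosed_biUnion fun k _ => isClosed_hseg _ _ _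
  have hn : p ∉ ⋃ k ∈ {k : Fin n | k ≠ j}, D.hEdge k := by
    simp only [mem_iUnion, not_exists]
    intro k hk hk'
    exact hk (natCast_fin_inj (hk'.1.symm.trans hp.1))
  filter_upwards [hc.isOpen_compl.mem_nhds hn] with q hq
  constructor
  · intro h
    obtain ⟨k, hk⟩ := mem_iUnion.1 h
    by_cases hki : k = j
    · exact hki ▸ hk
    · exact absurd (mem_biUnion (show k ∈ {k : Fin n | k ≠ j} from hki) hk) hq
  · intro h
    exact mem_iUnion.2 ⟨j, h⟩

theorem isClosed_iUnion_vEdge (D : RectDiagram n) : IsClosed (⋃ k, D.vEdge k) :=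
  isClosed_iUnion_of_finite fun _ => isClosed_vseg _ _ _

theorem isClosed_iUnion_hEdge (D : RectDiagram n) : IsClosed (⋃ k, D.hEdge k) :=
  isClosed_iUnion_of_finite fun _ => isClosed_hseg _ _ _

theorem symm_ne (D : RectDiagram n) (j : Fin n) : D.X.symm j ≠ D.O.symm j :=
  D.transpose.ne j

/-- A vertical edge near a point in its interior. -/
theorem eventually_vEdge_interior (D : RectDiagram n) (i : Fin n) (p : Plane) (hp : p ∈ D.vEdge i)
    (h1 : p.2 ≠ (D.X i : ℕ)) (h2 : p.2 ≠ (D.O i : ℕ)) :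
    ∀ᶠ q in 𝓝 p, (q ∈ ⋃ k, D.vEdge k) ↔ q.1 = p.1 := by
  have h := (eventually_uIcc (natCast_fin_ne (D.ne i)) hp.2).1 h1 h2
  filter_upwards [D.eventually_vEdge i p hp, continuous_snd.continuousAt.eventually h] with q hq hq'
  rw [hq, hp.1]
  exact ⟨fun h => h.1, fun h => ⟨h, hq'⟩⟩

/-- A horizontal edge near a point in its interior. -/
theorem eventually_hEdge_interior (D : RectDiagram n) (j : Fin n) (p : Plane) (hp : p ∈ D.hEdge j)
    (h1 : p.1 ≠ (D.X.symm j : ℕ)) (h2 : p.1 ≠ (D.O.symm j : ℕ)) :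
    ∀ᶠ q in 𝓝 p, (q ∈ ⋃ k, D.hEdge k) ↔ q.2 = p.2 := by
  have h := (eventually_uIcc (natCast_fin_ne (D.symm_ne j)) hp.2).1 h1 h2
  filter_upwards [D.eventually_hEdge j p hp, continuous_fst.continuousAt.eventually h] with q hq hq'
  rw [hq, hp.1]
  exact ⟨fun h => h.1, fun h => ⟨h, hq'⟩⟩

/-- The endpoints of a vertical edge lie on horizontal edges. -/
theorem exists_hEdge (D : RectDiagram n) (i : Fin n) (p : Plane) (hp : p ∈ D.vEdge i)
    (h : p.2 = (D.X i : ℕ) ∨ p.2 = (D.O i : ℕ)) : p ∈ ⋃ j, D.hEdge j := by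
  rcases h with h | h
  · exact mem_iUnion.2 ⟨D.X i, h, by rw [Equiv.symm_apply_apply, hp.1]; exact left_mem_uIcc⟩
  · exact mem_iUnion.2 ⟨D.O i, h, by rw [Equiv.symm_apply_apply, hp.1]; exact right_mem_uIcc⟩

/-- The endpoints of a horizontal edge lie on vertical edges. -/
theorem exists_vEdge (D : RectDiagram n) (j : Fin n) (p : Plane) (hp : p ∈ D.hEdge j)
    (h : p.1 = (D.X.symm j : ℕ) ∨ p.1 = (D.O.symm j : ℕ)) : p ∈ ⋃ i, D.vEdge i := by
  rcases h with h | h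
  · exact mem_iUnion.2 ⟨D.X.symm j, h, by rw [Equiv.apply_symm_apply, hp.1]; exact left_mem_uIcc⟩
  · exact mem_iUnion.2 ⟨D.O.symm j, h, by rw [Equiv.apply_symm_apply, hp.1]; exact right_mem_uIcc⟩

theorem arc_chart_aux (D : RectDiagram n) (p : Plane) (hp : p ∈ D.picture.shadow)
    (hc : p ∉ D.picture.cross) : ∃ h : Plane ≃ₜ Plane, h 0 = p ∧
      ∀ q ∈ Box, (h q ∈ D.picture.shadow ↔ q.2 = 0) := by
  by_cases hv : p ∈ ⋃ i, D.vEdge i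
  · obtain ⟨i, hi⟩ := mem_iUnion.1 hv
    by_cases hh : p ∈ ⋃ j, D.hEdge j
    · obtain ⟨j, hj⟩ := mem_iUnion.1 hh
      have hji : j = D.X i ∨ j = D.O i := by
        by_contra hcon
        rw [not_or] at hcon
        exact hc ⟨i, j, hi, hj, hcon.1, hcon.2⟩
      have hy : p.2 = (D.X i : ℕ) ∨ p.2 = (D.O i : ℕ) := by
        rcases hji with rfl | rfl
        · exact Or.inl hj.1
        · exact Or.inr hj.1
      have hx : p.1 = (D.X.symm j : ℕ) ∨ p.1 = (D.O.symm j : ℕ) := by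
        rcases hji with rfl | rfl
        · left; rw [Equiv.symm_apply_apply]; exact hi.1
        · right; rw [Equiv.symm_apply_apply]; exact hi.1
      obtain ⟨σ, hσ, eσ⟩ := (eventually_uIcc (natCast_fin_ne (D.ne i)) hi.2).2 hy
      obtain ⟨τ, hτ, eτ⟩ := (eventually_uIcc (natCast_fin_ne (D.symm_ne j)) hj.2).2 hx
      have ev : ∀ᶠ q in 𝓝 p, q ∈ D.picture.shadow ↔
          (q.1 = p.1 ∧ 0 ≤ σ * (q.2 - p.2)) ∨ (q.2 = p.2 ∧ 0 ≤ τ * (q.1 - p.1)) := by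
        filter_upwards [D.eventually_vEdge i p hi, D.eventually_hEdge j p hj,
          continuous_snd.continuousAt.eventually eσ, continuous_fst.continuousAt.eventually eτ]
          with q h1 h2 h3 h4
        change (q ∈ (⋃ i, D.vEdge i) ∪ ⋃ j, D.hEdge j) ↔ _
        rw [mem_union, h1, h2, hi.1, hj.1, ← hi.1, ← hj.1, ← h3, ← h4, hi.1, hj.1]
        rfl
      obtain ⟨h, δ, hδ, h0, hq, hQ⟩ := exists_chart p (bend σ τ hσ hτ) (by simp [bend]) ev
      refine ⟨h, h0, fun q hqB => ?_⟩
      rw [hQ q hqB, hq q]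
      have e1 : (p + δ • bend σ τ hσ hτ q).1 = p.1 + δ * (τ * ((q.2 + |q.1| + q.1) / 2)) := rfl
      have e2 : (p + δ • bend σ τ hσ hτ q).2 = p.2 + δ * (σ * ((q.2 + |q.1| - q.1) / 2)) := rfl
      have τ0 : τ ≠ 0 := by rintro rfl; norm_num at hτ
      have σ0 : σ ≠ 0 := by rintro rfl; norm_num at hσ
      have f1 : σ * (p.2 + δ * (σ * ((q.2 + |q.1| - q.1) / 2)) - p.2) =
          δ * ((q.2 + |q.1| - q.1) / 2) := by
        linear_combination δ * ((q.2 + |q.1| - q.1) / 2) * hσ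
      have f2 : τ * (p.1 + δ * (τ * ((q.2 + |q.1| + q.1) / 2)) - p.1) =
          δ * ((q.2 + |q.1| + q.1) / 2) := by
        linear_combination δ * ((q.2 + |q.1| + q.1) / 2) * hτ
      rw [e1, e2, f1, f2, mul_nonneg_iff_of_pos_left hδ, mul_nonneg_iff_of_pos_left hδ]
      simp only [add_eq_left, mul_eq_zero, hδ.ne', τ0, σ0, false_or]
      constructor
      · rintro (⟨ha, hb⟩ | ⟨ha, hb⟩)
        · have : |q.1| = -q.1 := abs_of_nonpos (by linarith)
          linarith
        · have : |q.1| = q.1 := abs_of_nonneg (by linarith)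
          linarith
      · intro h0
        rw [h0]
        rcases le_total 0 q.1 with hs | hs
        · right
          rw [abs_of_nonneg hs]
          exact ⟨by ring, by linarith⟩
        · left
          rw [abs_of_nonpos hs]
          exact ⟨by ring, by linarith⟩
    · have h1 : ¬ (p.2 = (D.X i : ℕ) ∨ p.2 = (D.O i : ℕ)) := fun h => hh (D.exists_hEdge i p hi h)
      rw [not_or] at h1
      have ev : ∀ᶠ q in 𝓝 p, q ∈ D.picture.shadow ↔ q.1 = p.1 := by
        filter_upwards [D.eventually_vEdge_interior i p hi h1.1 h1.2,
          D.isClosed_iUnion_hEdge.isOpen_compl.mem_nhds hh] with q a1 a2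
        change (q ∈ (⋃ i, D.vEdge i) ∪ ⋃ j, D.hEdge j) ↔ _
        rw [mem_union, a1]
        exact or_iff_left a2
      obtain ⟨h, δ, hδ, h0, hq, hQ⟩ := exists_chart p (Homeomorph.prodComm ℝ ℝ) rfl ev
      refine ⟨h, h0, fun q hqB => ?_⟩
      rw [hQ q hqB, hq q]
      change p.1 + δ * q.2 = p.1 ↔ _
      simp [hδ.ne']
  · have hh : p ∈ ⋃ j, D.hEdge j := hp.resolve_left hv
    obtain ⟨j, hj⟩ := mem_iUnion.1 hh
    have h1 : ¬ (p.1 = (D.X.symm j : ℕ) ∨ p.1 = (D.O.symm j : ℕ)) :=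
      fun h => hv (D.exists_vEdge j p hj h)
    rw [not_or] at h1
    have ev : ∀ᶠ q in 𝓝 p, q ∈ D.picture.shadow ↔ q.2 = p.2 := by
      filter_upwards [D.eventually_hEdge_interior j p hj h1.1 h1.2,
        D.isClosed_iUnion_vEdge.isOpen_compl.mem_nhds hv] with q a1 a2
      change (q ∈ (⋃ i, D.vEdge i) ∪ ⋃ j, D.hEdge j) ↔ _
      rw [mem_union, a1]
      exact or_iff_right a2
    obtain ⟨h, δ, hδ, h0, hq, hQ⟩ := exists_chart p (Homeomorph.refl Plane) rfl ev
    refine ⟨h, h0, fun q hqB => ?_⟩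
    rw [hQ q hqB, hq q]
    change p.2 + δ * q.2 = p.2 ↔ _
    simp [hδ.ne']

theorem cross_chart_aux (D : RectDiagram n) (c : Plane) (hc : c ∈ D.picture.cross) :
    ∃ h : Plane ≃ₜ Plane, h 0 = c ∧ ∀ q ∈ Box,
      (h q ∈ D.picture.shadow ↔ q.1 = 0 ∨ q.2 = 0) ∧ (h q ∈ D.picture.overAt c ↔ q.1 = 0) := by
  obtain ⟨i, j, hi, hj, hX, hO⟩ := hc
  have v1 : c.2 ≠ (D.X i : ℕ) := by rw [hj.1]; exact natCast_fin_ne hX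
  have v2 : c.2 ≠ (D.O i : ℕ) := by rw [hj.1]; exact natCast_fin_ne hO
  have h1 : c.1 ≠ (D.X.symm j : ℕ) := by
    rw [hi.1]; exact natCast_fin_ne fun h => hX (by rw [h, Equiv.apply_symm_apply])
  have h2 : c.1 ≠ (D.O.symm j : ℕ) := by
    rw [hi.1]; exact natCast_fin_ne fun h => hO (by rw [h, Equiv.apply_symm_apply])
  have ev : ∀ᶠ q in 𝓝 c, (q ∈ D.picture.shadow ↔ q.1 = c.1 ∨ q.2 = c.2) ∧
      (q ∈ D.picture.overAt c ↔ q.1 = c.1) := by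
    filter_upwards [D.eventually_vEdge_interior i c hi v1 v2,
      D.eventually_hEdge_interior j c hj h1 h2] with q a1 a2
    exact ⟨or_congr a1 a2, a1⟩
  obtain ⟨h, δ, hδ, h0, hq, hQ⟩ := exists_chart c (Homeomorph.refl Plane) rfl ev
  refine ⟨h, h0, fun q hqB => ?_⟩
  have e1 : (h q).1 = c.1 + δ * q.1 := by rw [hq q]; rfl
  have e2 : (h q).2 = c.2 + δ * q.2 := by rw [hq q]; rfl
  rw [(hQ q hqB).1, (hQ q hqB).2, e1, e2]
  simp [hδ.ne']

theorem isCompact_vseg (x a b : ℝ) : IsCompact (vseg x a b) := by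
  have : vseg x a b = {x} ×ˢ uIcc a b := by ext q; simp [vseg]
  rw [this]; exact isCompact_singleton.prod isCompact_uIcc

theorem isCompact_hseg (y a b : ℝ) : IsCompact (hseg y a b) := by
  have : hseg y a b = uIcc a b ×ˢ {y} := by ext q; simp [hseg, and_comm]
  rw [this]; exact isCompact_uIcc.prod isCompact_singleton

/-- The link diagram drawn by a rectangular diagram. -/
def toLinkDiagram (D : RectDiagram n) : LinkDiagram where
  toPicture := D.picture
  isCompact_shadow := (isCompact_iUnion fun _ => isCompact_vseg _ _ _).union
    (isCompact_iUnion fun _ => isCompact_hseg _ _ _)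
  finite_cross := by
    refine (finite_range fun z : Fin n × Fin n => (((z.1 : ℕ) : ℝ), ((z.2 : ℕ) : ℝ))).subset ?_
    rintro q ⟨i, j, hi, hj, -, -⟩
    exact ⟨(i, j), Prod.ext hi.1.symm hj.1.symm⟩
  arc_chart := D.arc_chart_aux
  cross_chart := D.cross_chart_aux

end RectDiagram

/-! ## Isotopies and homeomorphisms of the plane -/

namespace LinkDiagram

/-! Alternatives (1) and (2) are never needed: the deformation into `D'` itself is always found
within the bound. The top horizontal edge of a rectangular diagram carries no crossing, and its two
adjacent vertical edges are over at all their crossings. These three edges therefore form an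
overpass, and an overpass may be moved freely above the rest of the diagram (the frame) while its
ends stay fixed. The proof lets the top edge sweep down over the other rows in this way.

To pass one row `j`, the overpass is lowered column by column. First its left end drops from height
`j + 1/2` to `j - 1/2`, which creates a step; then the step travels to the right past each
intermediate column; finally the right end drops (`reach_left`, `reach_interior`, `reach_right`,
combined in `reach_row`). Each stage takes place in a small box around one grid point, where the
frame consists of at most one vertical and one horizontal piece. A list of local pictures shows that
a stage is an isotopy if row `j` misses the column, and otherwise costs at most one Reidemeister
move: the third at a crossing, the second at certain corners and ends, the first where the end of
the overpass is joined to the row. Passing a row therefore costs at most `n` moves, and sweeping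
past all rows at most `n (n - 1)`.

A rotation is a full sweep (`reach_rotate`). For an exchange, the top edge is swept to just above
the bottom edge. If no vertical edge at the bottom edge crosses it there, the result is also the
rotation of the exchanged diagram, so one sweep that stops a row early and one reversed full sweep
suffice; since the edges are not interleaved, this holds for the diagram or for its exchanged
partner (`reach_exchange`). For a merge, the top edge is swept next to the bottom edge, just above
or just below it, so that the three edges to be amalgamated can be unfolded by an isotopy
(`reach_merge_bottom`).

Vertical moves reduce to horizontal ones by reflection in the diagonal combined with switching all
crossings; a merge placed at the top reduces to one at the bottom by reflection in the horizontal
axis. The crude count `n (n - 1)` lies within the bounds for `n ≥ 4`. For `n = 3` a finite check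
lowers the sweep cost to `4`, and for `n = 2` all diagrams coincide up to labels.

The planar topology is done by explicit homeomorphisms: graphs pushed along the fibres of suitable
coordinates, made into isotopies by Alexander's trick or by linear interpolation. -/

theorem Carries.refl (D : LinkDiagram) : Carries (Homeomorph.refl Plane) D D :=
  ⟨fun _ => Iff.rfl, fun _ => Iff.rfl, fun _ _ => Filter.Eventually.of_forall fun _ => Iff.rfl⟩

theorem Carries.trans {φ ψ : Plane ≃ₜ Plane} {D E F : LinkDiagram} (h : Carries φ D E)
    (k : Carries ψ E F) : Carries (φ.trans ψ) D F := by
  refine ⟨fun p => (k.1 _).trans (h.1 p), fun p => (k.2.1 _).trans (h.2.1 p), fun c hc => ?_⟩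
  filter_upwards [h.2.2 c hc,
    φ.continuous.continuousAt.eventually (k.2.2 (φ c) ((h.2.1 c).2 hc))] with p h1 h2
  exact h2.trans h1

theorem Carries.symm {φ : Plane ≃ₜ Plane} {D E : LinkDiagram} (h : Carries φ D E) :
    Carries φ.symm E D := by
  refine ⟨fun p => ?_, fun p => ?_, fun c hc => ?_⟩
  · simpa using (h.1 (φ.symm p)).symm
  · simpa using (h.2.1 (φ.symm p)).symm
  · have hc' : φ.symm c ∈ D.cross := by
      rw [← h.2.1]; simpa using hc
    filter_upwards [φ.symm.continuous.continuousAt.eventually (h.2.2 _ hc')] with p hp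
    simpa using hp.symm

theorem PlanarIsotopic.trans {D E F : LinkDiagram} (h : D.PlanarIsotopic E)
    (k : E.PlanarIsotopic F) : D.PlanarIsotopic F := by
  obtain ⟨Φ, hΦ, h0, h1⟩ := h
  obtain ⟨Ψ, hΨ, k0, k1⟩ := k
  refine ⟨fun t => (Φ t).trans (Ψ t), ?_, ?_, h1.trans k1⟩
  · exact hΨ.comp (continuous_fst.prodMk hΦ)
  · ext p <;> simp [h0, k0]

/-- The isotopy is run backwards after applying the inverse of its final map. Only that one inverse
occurs, so joint continuity of the inverses of all stages is not needed. -/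
theorem PlanarIsotopic.symm {D E : LinkDiagram} (h : D.PlanarIsotopic E) :
    E.PlanarIsotopic D := by
  obtain ⟨Φ, hΦ, h0, h1⟩ := h
  refine ⟨fun t => (Φ 1).symm.trans (Φ (unitInterval.symm t)), ?_, ?_, ?_⟩
  · exact hΦ.comp ((unitInterval.continuous_symm.comp continuous_fst).prodMk
      ((Φ 1).symm.continuous.comp continuous_snd))
  · ext p <;> simp
  · have : (Φ 1).symm.trans (Φ (unitInterval.symm 1)) = (Φ 1).symm := by
      ext p <;> simp [h0]
    change Carries ((Φ 1).symm.trans (Φ (unitInterval.symm 1))) E D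
    rw [this]
    exact h1.symm

theorem Carries.planarIsotopic_of_refl {D E : LinkDiagram}
    (h : Carries (Homeomorph.refl Plane) D E) : D.PlanarIsotopic E :=
  ⟨fun _ => Homeomorph.refl Plane, continuous_snd, rfl, h⟩

theorem PlanarIsotopic.refl (D : LinkDiagram) : D.PlanarIsotopic D :=
  (Carries.refl D).planarIsotopic_of_refl

end LinkDiagram

/-- Alexander's trick: a homeomorphism of the plane with bounded support, shrunk by the factor `t`. -/
noncomputable def alexander (φ : Plane ≃ₜ Plane) (t : unitInterval) : Plane ≃ₜ Plane :=
  if h : (t : ℝ) = 0 then Homeomorph.refl Plane else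
    ((Homeomorph.smulOfNeZero (t : ℝ) h).symm.trans φ).trans (Homeomorph.smulOfNeZero (t : ℝ) h)

theorem alexander_apply (φ : Plane ≃ₜ Plane) (t : unitInterval) (ht : (t : ℝ) ≠ 0) (p : Plane) :
    alexander φ t p = (t : ℝ) • φ ((t : ℝ)⁻¹ • p) := by
  rw [alexander, dif_neg ht]; rfl

/-- Bounded support bounds the displacement of `φ`, and shrinking by `t` multiplies the displacement
by `t`. Hence the maps tend uniformly to the identity as `t` tends to `0`, the only place where
continuity is in doubt. -/
theorem continuous_alexander (φ : Plane ≃ₜ Plane) (r : ℝ) (hφ : ∀ p, r < ‖p‖ → φ p = p) :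
    Continuous fun z : unitInterval × Plane => alexander φ z.1 z.2 := by
  have hb : ∃ C, 0 < C ∧ ∀ p, ‖φ p - p‖ ≤ C := by
    have hK : IsCompact (Metric.closedBall (0 : Plane) r) := isCompact_closedBall _ _
    obtain ⟨C, hC⟩ := (hK.image (φ.continuous.sub continuous_id)).isBounded.exists_norm_le
    refine ⟨|C| + 1, by positivity, fun p => ?_⟩
    by_cases hp : r < ‖p‖
    · rw [hφ p hp, sub_self, norm_zero]; positivity
    · have := hC _ ⟨p, by simpa using not_lt.1 hp, rfl⟩
      have h2 := le_abs_self C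
      simp only [id, Pi.sub_apply] at this
      linarith
  obtain ⟨C, hC, hb⟩ := hb
  have key : ∀ (t : unitInterval) (p : Plane), ‖alexander φ t p - p‖ ≤ t * C := by
    intro t p
    by_cases ht : (t : ℝ) = 0
    · rw [alexander, dif_pos ht, ht]; simp
    · rw [alexander_apply φ t ht]
      have h1 : (t : ℝ) • φ ((t : ℝ)⁻¹ • p) - p = (t : ℝ) • (φ ((t : ℝ)⁻¹ • p) - (t : ℝ)⁻¹ • p) := by
        rw [smul_sub, smul_inv_smul₀ ht]
      rw [h1, norm_smul, Real.norm_of_nonneg t.2.1]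
      exact mul_le_mul_of_nonneg_left (hb _) t.2.1
  rw [continuous_iff_continuousAt]
  rintro ⟨t, p⟩
  by_cases ht : (t : ℝ) = 0
  · have h1 : Filter.Tendsto (fun z : unitInterval × Plane => alexander φ z.1 z.2 - z.2)
        (𝓝 (t, p)) (𝓝 0) := by
      have : Continuous fun z : unitInterval × Plane => (z.1 : ℝ) * C :=
        (continuous_subtype_val.comp continuous_fst).mul continuous_const
      have h := this.tendsto (t, p)
      have h5 : Filter.Tendsto (fun z : unitInterval × Plane => (z.1 : ℝ) * C) (𝓝 (t, p)) (𝓝 0) := by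
        have e : (t : ℝ) * C = 0 := by rw [ht, zero_mul]
        exact e ▸ h
      exact squeeze_zero_norm (a := fun z : unitInterval × Plane => (z.1 : ℝ) * C)
        (fun z => key z.1 z.2) h5
    have h2 := h1.add (continuous_snd.tendsto (t, p))
    have h3 : alexander φ t p = p := by rw [alexander, dif_pos ht]; rfl
    rw [ContinuousAt, h3]
    refine (h2.congr fun z => sub_add_cancel _ _).trans ?_
    rw [zero_add]
  · have hev : ∀ᶠ z : unitInterval × Plane in 𝓝 (t, p), (z.1 : ℝ) ≠ 0 :=
      (continuous_subtype_val.comp continuous_fst).continuousAt.eventually_ne ht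
    have : ContinuousAt (fun z : unitInterval × Plane => (z.1 : ℝ) • φ ((z.1 : ℝ)⁻¹ • z.2)) (t, p) := by
      have h0 : ContinuousAt (fun z : unitInterval × Plane => (z.1 : ℝ)) (t, p) :=
        (continuous_subtype_val.comp continuous_fst).continuousAt
      have h1 : ContinuousAt (fun z : unitInterval × Plane => (z.1 : ℝ)⁻¹ • z.2) (t, p) :=
        (h0.inv₀ ht).smul continuous_snd.continuousAt
      exact h0.smul (φ.continuous.continuousAt.comp h1)
    refine this.congr ?_
    filter_upwards [hev] with z hz
    exact (alexander_apply φ z.1 hz z.2).symm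

namespace LinkDiagram

/-- With Alexander's trick a single homeomorphism of bounded support already gives an ambient
isotopy; all local deformations below use it. -/
theorem Carries.planarIsotopic {D E : LinkDiagram} {φ : Plane ≃ₜ Plane} (h : Carries φ D E)
    (r : ℝ) (hφ : ∀ p, r < ‖p‖ → φ p = p) : D.PlanarIsotopic E := by
  refine ⟨alexander φ, continuous_alexander φ r hφ, ?_, ?_⟩
  · simp [alexander]
  · have : alexander φ 1 = φ := by
      ext1 p
      rw [alexander_apply φ 1 (by simp)]; simp
    rwa [this]

/-- The image of a diagram under a homeomorphism of the plane. -/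
def map (φ : Plane ≃ₜ Plane) (D : LinkDiagram) : LinkDiagram where
  shadow := φ.symm ⁻¹' D.shadow
  cross := φ.symm ⁻¹' D.cross
  overAt c := φ.symm ⁻¹' D.overAt (φ.symm c)
  isCompact_shadow := by
    rw [← φ.image_eq_preimage_symm]; exact D.isCompact_shadow.image φ.continuous
  finite_cross := D.finite_cross.preimage φ.symm.injective.injOn
  arc_chart p hp hc := by
    obtain ⟨h, h0, hq⟩ := D.arc_chart _ hp hc
    exact ⟨h.trans φ, by simp [h0], fun q hqB => by simpa using hq q hqB⟩
  cross_chart c hc := by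
    obtain ⟨h, h0, hq⟩ := D.cross_chart _ hc
    exact ⟨h.trans φ, by simp [h0], fun q hqB => by simpa using hq q hqB⟩

theorem carries_map (φ : Plane ≃ₜ Plane) (D : LinkDiagram) : Carries φ D (D.map φ) := by
  refine ⟨fun p => ?_, fun p => ?_, fun c _ => Filter.Eventually.of_forall fun p => ?_⟩ <;>
    simp [map]

/-- The diagram with all crossings switched. -/
def mirror (D : LinkDiagram) : LinkDiagram where
  shadow := D.shadow
  cross := D.cross
  overAt c := {p | (p ∈ D.shadow ∧ p ∉ D.overAt c) ∨ p = c}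
  isCompact_shadow := D.isCompact_shadow
  finite_cross := D.finite_cross
  arc_chart := D.arc_chart
  cross_chart c hc := by
    obtain ⟨h, h0, hq⟩ := D.cross_chart c hc
    refine ⟨(Homeomorph.prodComm ℝ ℝ).trans h, h0, fun q hqB => ?_⟩
    have hB : (q.2, q.1) ∈ Box := ⟨hqB.2, hqB.1⟩
    have h1 := hq _ hB
    -- Interchanging the axes of the chart turns the understrand into the vertical axis; the point
    -- `c` belongs to both strands and had to be put back into the new overstrand.
    have e : ((Homeomorph.prodComm ℝ ℝ).trans h) q = h (q.2, q.1) := rfl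
    have e2 : h (q.2, q.1) = c ↔ q.2 = 0 ∧ q.1 = 0 := by
      rw [← h0, h.injective.eq_iff, Prod.ext_iff]; rfl
    rw [e]
    refine ⟨h1.1.trans or_comm, ?_⟩
    simp only [mem_ofPred_eq, h1.1, h1.2, e2]
    tauto

theorem Carries.mirror {φ : Plane ≃ₜ Plane} {D E : LinkDiagram} (h : Carries φ D E) :
    Carries φ D.mirror E.mirror := by
  refine ⟨h.1, h.2.1, fun c hc => ?_⟩
  filter_upwards [h.2.2 c hc] with p hp
  change (_ ∨ _) ↔ (_ ∨ _)
  rw [h.1, hp, φ.injective.eq_iff]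

theorem PlanarIsotopic.mirror {D E : LinkDiagram} (h : D.PlanarIsotopic E) :
    D.mirror.PlanarIsotopic E.mirror := by
  obtain ⟨Φ, hΦ, h0, h1⟩ := h
  exact ⟨Φ, hΦ, h0, h1.mirror⟩

theorem PlanarIsotopic.map {D E : LinkDiagram} (φ : Plane ≃ₜ Plane) (h : D.PlanarIsotopic E) :
    (D.map φ).PlanarIsotopic (E.map φ) := by
  obtain ⟨Φ, hΦ, h0, h1⟩ := h
  refine ⟨fun t => (φ.symm.trans (Φ t)).trans φ, ?_, ?_, ?_⟩
  · exact φ.continuous.comp (hΦ.comp (continuous_fst.prodMk (φ.symm.continuous.comp continuous_snd)))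
  · ext p <;> simp [h0]
  · exact ((carries_map φ D).symm.trans h1).trans (carries_map φ E)

end LinkDiagram

/-! ## Symmetries of sequences of Reidemeister moves -/

theorem AgreeOutside.symm {h : Plane ≃ₜ Plane} {D D' : LinkDiagram} (H : AgreeOutside h D D') :
    AgreeOutside h D' D := by
  refine ⟨fun q hq => (H.1 q hq).symm, fun q hq => (H.2.1 q hq).symm, fun q hq hc => ?_⟩
  filter_upwards [H.2.2 q hq ((H.2.1 q hq).2 hc)] with p hp
  exact hp.symm

theorem Replace.symm {P P' : Picture} {D D' : LinkDiagram} (H : Replace P P' D D') :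
    Replace P' P D' D := by
  obtain ⟨h, h1, h2, h3⟩ := H
  exact ⟨h, h2, h1, h3.symm⟩

theorem ReidemeisterMove.symm {D D' : LinkDiagram} (H : ReidemeisterMove D D') :
    ReidemeisterMove D' D := by
  obtain ⟨P, P', hP, h | h⟩ := H
  · exact ⟨P, P', hP, Or.inr h.symm⟩
  · exact ⟨P, P', hP, Or.inl h.symm⟩

namespace ReidemeisterSeq

theorem trans_isotopy {k : ℕ} {D E F : LinkDiagram} (h : ReidemeisterSeq k D E)
    (hEF : E.PlanarIsotopic F) : ReidemeisterSeq k D F := by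
  cases h with
  | isotopy h => exact isotopy (h.trans hEF)
  | move h1 h2 h3 => exact move h1 h2 (h3.trans hEF)

theorem trans {k l : ℕ} {D E F : LinkDiagram} (h : ReidemeisterSeq k D E)
    (h' : ReidemeisterSeq l E F) : ReidemeisterSeq (k + l) D F := by
  induction h' with
  | isotopy h' => exact h.trans_isotopy h'
  | move _ h2 h3 ih => exact move (ih h) h2 h3

theorem of_move {D E : LinkDiagram} (h : ReidemeisterMove D E) : ReidemeisterSeq 1 D E :=
  move (isotopy (LinkDiagram.PlanarIsotopic.refl D)) h (LinkDiagram.PlanarIsotopic.refl E)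

theorem symm {k : ℕ} {D E : LinkDiagram} (h : ReidemeisterSeq k D E) : ReidemeisterSeq k E D := by
  induction h with
  | isotopy h => exact isotopy h.symm
  | @move k D D₁ D₂ D' _ h2 h3 ih =>
    rw [add_comm]
    exact ((isotopy h3.symm).trans (of_move h2.symm)).trans ih |> fun h => by simpa using h

end ReidemeisterSeq

theorem Replace.map {P P' : Picture} {D D' : LinkDiagram} (φ : Plane ≃ₜ Plane)
    (H : Replace P P' D D') : Replace P P' (D.map φ) (D'.map φ) := by
  obtain ⟨h, h1, h2, h3⟩ := H
  refine ⟨h.trans φ, ?_, ?_, ?_⟩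
  · simpa [Shows, LinkDiagram.map] using h1
  · simpa [Shows, LinkDiagram.map] using h2
  · refine ⟨by simpa [LinkDiagram.map] using h3.1, by simpa [LinkDiagram.map] using h3.2.1, ?_⟩
    intro q hq hc
    have := h3.2.2 q hq (by simpa [LinkDiagram.map] using hc)
    have h4 : Filter.Tendsto φ.symm (𝓝 ((h.trans φ) q)) (𝓝 (h q)) := by
      have := φ.symm.continuous.tendsto ((h.trans φ) q)
      simpa using this
    filter_upwards [h4.eventually this] with p hp
    simpa [LinkDiagram.map] using hp

theorem ReidemeisterSeq.map {k : ℕ} {D E : LinkDiagram} (φ : Plane ≃ₜ Plane)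
    (h : ReidemeisterSeq k D E) : ReidemeisterSeq k (D.map φ) (E.map φ) := by
  induction h with
  | isotopy h => exact isotopy (h.map φ)
  | move _ h2 h3 ih =>
    obtain ⟨P, P', hP, h⟩ := h2
    exact move ih ⟨P, P', hP, h.imp (Replace.map φ) (Replace.map φ)⟩ (h3.map φ)

/-- At most `B` Reidemeister moves deform `D` into `E`. -/
def Reach (B : ℕ) (D E : LinkDiagram) : Prop := ∃ k ≤ B, ReidemeisterSeq k D E

namespace Reach

theorem of_isotopic {D E : LinkDiagram} (h : D.PlanarIsotopic E) : Reach 0 D E :=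
  ⟨0, le_rfl, .isotopy h⟩

theorem trans {k l : ℕ} {D E F : LinkDiagram} (h : Reach k D E) (h' : Reach l E F) :
    Reach (k + l) D F := by
  obtain ⟨a, ha, h⟩ := h
  obtain ⟨b, hb, h'⟩ := h'
  exact ⟨a + b, by omega, h.trans h'⟩

theorem symm {k : ℕ} {D E : LinkDiagram} (h : Reach k D E) : Reach k E D := by
  obtain ⟨a, ha, h⟩ := h
  exact ⟨a, ha, h.symm⟩

theorem mono {k l : ℕ} (hkl : k ≤ l) {D E : LinkDiagram} (h : Reach k D E) : Reach l D E := by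
  obtain ⟨a, ha, h⟩ := h
  exact ⟨a, ha.trans hkl, h⟩

theorem map {k : ℕ} {D E : LinkDiagram} (φ : Plane ≃ₜ Plane) (h : Reach k D E) :
    Reach k (D.map φ) (E.map φ) := by
  obtain ⟨a, ha, h⟩ := h
  exact ⟨a, ha, h.map φ⟩

end Reach

/-! ## Fibrewise increasing homeomorphisms -/

/-- The homeomorphism `(x, y) ↦ (x, f (x, y))`, where `f` is increasing in the second variable. -/
noncomputable def fiberHomeo (f : Plane → ℝ) (hf : Continuous f)
    (hm : ∀ x, StrictMono fun y => f (x, y)) (hs : ∀ x, Function.Surjective fun y => f (x, y)) :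
    Plane ≃ₜ Plane where
  toFun p := (p.1, f p)
  invFun p := (p.1, (hs p.1 p.2).choose)
  left_inv p := by
    ext
    · rfl
    · exact (hm p.1).injective (hs p.1 (f p)).choose_spec
  right_inv p := by
    ext
    · rfl
    · exact (hs p.1 p.2).choose_spec
  continuous_toFun := by fun_prop
  continuous_invFun := by
    -- By monotonicity on fibres, the preimage of a half-line under the inverse is given by
    -- comparing `f (x, a)` with `y`. Continuity of `f` makes this open, and no uniformity across
    -- fibres is used.
    refine continuous_fst.prodMk (OrderTopology.continuous_iff.2 fun a => ?_)
    have hsp : ∀ p : Plane, f (p.1, (hs p.1 p.2).choose) = p.2 := fun p => (hs p.1 p.2).choose_spec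
    constructor
    · have : (fun p : Plane => (hs p.1 p.2).choose) ⁻¹' Ioi a = {p : Plane | f (p.1, a) < p.2} := by
        ext p
        simp only [mem_preimage, mem_Ioi, mem_ofPred_eq]
        rw [← (hm p.1).lt_iff_lt]
        exact (hsp p).symm ▸ Iff.rfl
      rw [this]
      exact isOpen_lt (by fun_prop) (by fun_prop)
    · have : (fun p : Plane => (hs p.1 p.2).choose) ⁻¹' Iio a = {p : Plane | p.2 < f (p.1, a)} := by
        ext p
        simp only [mem_preimage, mem_Iio, mem_ofPred_eq]
        rw [← (hm p.1).lt_iff_lt]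
        exact (hsp p).symm ▸ Iff.rfl
      rw [this]
      exact isOpen_lt (by fun_prop) (by fun_prop)

/-- The increasing bijection of the line that takes `a` to `b ≥ a` and is the identity outside
`[a - 1/2, b + 1/2]`. -/
noncomputable def pushUp (a b t : ℝ) : ℝ :=
  max t (min (a - 1/2 + (t - a + 1/2) * (2 * (b - a) + 1)) (b + (t - a) / (2 * (b - a) + 1)))

theorem pushUp_strictMono {a b : ℝ} (h : a ≤ b) : StrictMono (pushUp a b) := by
  intro s t hst
  have hd : 0 < 2 * (b - a) + 1 := by linarith
  unfold pushUp
  refine max_lt_max hst (min_lt_min ?_ ?_)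
  · nlinarith
  · have := div_lt_div_of_pos_right (sub_lt_sub_right hst a) hd
    linarith

theorem pushUp_self {a b : ℝ} (h : a ≤ b) : pushUp a b a = b := by
  unfold pushUp
  have e : a - 1/2 + (a - a + 1/2) * (2 * (b - a) + 1) = b := by ring
  rw [e]; simp [h]

theorem pushUp_eq_iff {a b : ℝ} (h : a ≤ b) {t : ℝ} : pushUp a b t = b ↔ t = a := by
  constructor
  · intro ht
    exact (pushUp_strictMono h).injective (ht.trans (pushUp_self h).symm)
  · rintro rfl; exact pushUp_self h

theorem pushUp_of_le {a b : ℝ} (h : a ≤ b) {t : ℝ} (ht : t ≤ a - 1/2) : pushUp a b t = t := by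
  unfold pushUp
  refine max_eq_left (min_le_of_left_le ?_)
  nlinarith

theorem pushUp_of_ge {a b : ℝ} (h : a ≤ b) {t : ℝ} (ht : b + 1/2 ≤ t) : pushUp a b t = t := by
  unfold pushUp
  have hd : 0 < 2 * (b - a) + 1 := by linarith
  refine max_eq_left (min_le_of_right_le ?_)
  have : (t - a) / (2 * (b - a) + 1) ≤ t - b := by
    rw [div_le_iff₀ hd]; nlinarith
  linarith

theorem pushUp_same (a t : ℝ) : pushUp a a t = t := by
  unfold pushUp; simp

theorem continuous_pushUp {a b t : Plane → ℝ} (ha : Continuous a) (hb : Continuous b)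
    (ht : Continuous t) (h : ∀ p, a p ≤ b p) : Continuous fun p => pushUp (a p) (b p) (t p) := by
  unfold pushUp
  have : ∀ p, 2 * (b p - a p) + 1 ≠ 0 := fun p => by have := h p; linarith
  fun_prop (disch := exact this)

theorem pushUp_surjective {a b : ℝ} (h : a ≤ b) : Function.Surjective (pushUp a b) := by
  have hc : Continuous (pushUp a b) := by
    unfold pushUp
    have : (2 * (b - a) + 1) ≠ 0 := by linarith
    fun_prop
  refine hc.surjective ?_ ?_
  · refine Filter.tendsto_id.congr' ?_
    filter_upwards [Filter.eventually_ge_atTop (b + 1/2)] with t ht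
    exact (pushUp_of_ge h ht).symm
  · refine Filter.tendsto_id.congr' ?_
    filter_upwards [Filter.eventually_le_atBot (a - 1/2)] with t ht
    exact (pushUp_of_le h ht).symm

/-- The homeomorphism that pushes the graph of `k` to the graph of `l ≥ k` along vertical lines. -/
noncomputable def graphPush (k l : ℝ → ℝ) (hk : Continuous k) (hl : Continuous l)
    (h : ∀ x, k x ≤ l x) : Plane ≃ₜ Plane :=
  fiberHomeo (fun p => pushUp (k p.1) (l p.1) p.2)
    (continuous_pushUp (hk.comp continuous_fst) (hl.comp continuous_fst) continuous_snd
      fun p => h p.1)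
    (fun x => pushUp_strictMono (h x)) (fun x => pushUp_surjective (h x))

/-! ## Flipping three sides of a square to the fourth one -/

/-- Restriction of a number to the interval `[-1,1]`. -/
noncomputable def clamp (t : ℝ) : ℝ := max (-1) (min 1 t)

theorem clamp_mono {s t : ℝ} (h : s ≤ t) : clamp s ≤ clamp t := by
  unfold clamp; gcongr

theorem clamp_le (t : ℝ) : clamp t ≤ 1 := by unfold clamp; simp

theorem le_clamp (t : ℝ) : -1 ≤ clamp t := by unfold clamp; simp

theorem clamp_of_mem {t : ℝ} (h : -1 ≤ t) (h' : t ≤ 1) : clamp t = t := by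
  unfold clamp; rw [min_eq_right h', max_eq_right h]

theorem clamp_of_ge {t : ℝ} (h : 1 ≤ t) : clamp t = 1 := by
  unfold clamp; rw [min_eq_left h]; norm_num

theorem clamp_of_le {t : ℝ} (h : t ≤ -1) : clamp t = -1 := by
  unfold clamp; rw [max_eq_left]; exact min_le_of_right_le h

@[fun_prop] theorem continuous_clamp : Continuous clamp := by unfold clamp; fun_prop

/-- The coordinates `(x (1 + clamp y / 5), y)`. -/
noncomputable def fingerCoord : Plane ≃ₜ Plane :=
  ((Homeomorph.prodComm ℝ ℝ).trans
    (fiberHomeo (fun p => p.2 * (1 + clamp p.1 / 5)) (by fun_prop)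
      (fun x => by
        intro s t hst
        have := le_clamp x
        have h5 : 0 < 1 + clamp x / 5 := by linarith
        exact mul_lt_mul_of_pos_right hst h5)
      (fun x y => by
        have := le_clamp x
        have h5 : 1 + clamp x / 5 ≠ 0 := by linarith
        exact ⟨y / (1 + clamp x / 5), div_mul_cancel₀ y h5⟩))).trans (Homeomorph.prodComm ℝ ℝ)

theorem fingerCoord_apply (p : Plane) :
    fingerCoord p = (p.1 * (1 + clamp p.2 / 5), p.2) := rfl

/-- The left, lower and right sides of the square can be flipped to the upper side. -/
theorem exists_fingerFlip : ∃ φ : Plane ≃ₜ Plane,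
    (∀ p : Plane, (3/2 ≤ |p.1| ∨ 3/2 ≤ |p.2|) → φ p = p) ∧
    (∀ p : Plane, 1 ≤ |p.1| → 1 ≤ p.2 → φ p = p) ∧
    (∀ p : Plane, φ p ∈ hseg 1 (-1) 1 ↔
      p ∈ vseg (-1) (-1) 1 ∪ hseg (-1) (-1) 1 ∪ vseg 1 (-1) 1) := by
  -- In the coordinates `fingerCoord` the lateral sides become the slanted segments `|l| = 1 + y /
  -- 5`. The three sides together are then the graph of `clamp (5 * (|l| - 1))`, which can be pushed
  -- up to the graph of the constant `1`.
  have hk : Continuous fun l : ℝ => clamp (5 * (|l| - 1)) := by fun_prop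
  let V := graphPush (fun l => clamp (5 * (|l| - 1))) (fun _ => 1) hk continuous_const
    (fun l => clamp_le _)
  have hl : ∀ p : Plane, |(fingerCoord p).1| = |p.1| * (1 + clamp p.2 / 5) := fun p => by
    have := le_clamp p.2
    rw [fingerCoord_apply, abs_mul, abs_of_pos (a := 1 + clamp p.2 / 5) (by linarith)]
  have hfix : ∀ p : Plane, V (fingerCoord p) = fingerCoord p →
      (fingerCoord.trans (V.trans fingerCoord.symm)) p = p := fun p hp => by
    simp [hp]
  -- From `|l| = 6/5` on, the two graphs coincide. This covers `|x| ≥ 3/2`, where the factor is at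
  -- least `4/5`, and the outside of the upper corners, where it equals `6/5`.
  have hV : ∀ q : Plane, 6/5 ≤ |q.1| → V q = q := fun q hq => by
    have : clamp (5 * (|q.1| - 1)) = 1 := clamp_of_ge (by linarith)
    change (q.1, pushUp (clamp (5 * (|q.1| - 1))) 1 q.2) = q
    rw [this, pushUp_same]
  refine ⟨fingerCoord.trans (V.trans fingerCoord.symm), ?_, ?_, ?_⟩
  · intro p hp
    apply hfix
    by_cases h1 : 3/2 ≤ |p.1|
    · apply hV
      rw [hl]
      have := le_clamp p.2
      nlinarith
    · have h2 : 3/2 ≤ |p.2| := hp.resolve_left h1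
      change ((fingerCoord p).1, pushUp _ _ _) = fingerCoord p
      have e : (fingerCoord p).2 = p.2 := rfl
      ext
      · rfl
      · change pushUp (clamp (5 * (|(fingerCoord p).1| - 1))) 1 (fingerCoord p).2 = _
        rw [e]
        have := le_clamp (5 * (|(fingerCoord p).1| - 1))
        rcases le_abs.1 h2 with h | h
        · exact pushUp_of_ge (clamp_le _) (by linarith)
        · exact pushUp_of_le (clamp_le _) (by linarith)
  · intro p h1 h2
    apply hfix
    apply hV
    rw [hl, clamp_of_ge h2]
    linarith
  · intro p
    set q := (fingerCoord.trans (V.trans fingerCoord.symm)) p with hq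
    have e : fingerCoord q = V (fingerCoord p) := by simp [hq]
    have e1 : (fingerCoord q).1 = (fingerCoord p).1 := by rw [e]; rfl
    have e2 : q.2 = pushUp (clamp (5 * (|(fingerCoord p).1| - 1))) 1 p.2 := by
      change (fingerCoord q).2 = _
      rw [e]; rfl
    have e3 : q.2 = 1 ↔ p.2 = clamp (5 * (|(fingerCoord p).1| - 1)) := by
      rw [e2]; exact pushUp_eq_iff (clamp_le _)
    have hs : (q ∈ hseg 1 (-1) 1) ↔ q.2 = 1 ∧ |q.1| ≤ 1 := by
      simp [hseg, abs_le]
    have hs' : (p ∈ vseg (-1) (-1) 1 ∪ hseg (-1) (-1) 1 ∪ vseg 1 (-1) 1) ↔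
        ((|p.1| = 1 ∧ |p.2| ≤ 1) ∨ (p.2 = -1 ∧ |p.1| ≤ 1)) := by
      simp only [vseg, hseg, mem_union, mem_ofPred_eq, uIcc_of_le (show (-1 : ℝ) ≤ 1 by norm_num),
        mem_Icc, abs_le, abs_eq (show (0 : ℝ) ≤ 1 by norm_num)]
      tauto
    rw [hs, hs', e3]
    have h1 := hl p
    have c1 := le_clamp p.2
    have c2 := clamp_le p.2
    have hq1 : q.2 = 1 → (|q.1| ≤ 1 ↔ |(fingerCoord p).1| ≤ 6/5) := fun h => by
      rw [← e1, hl q, h, clamp_of_ge le_rfl]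
      constructor <;> intro h <;> linarith
    have habs := abs_nonneg p.1
    constructor
    · rintro ⟨h2, h3⟩
      rw [hq1 (e3.2 h2)] at h3
      by_cases h4 : |(fingerCoord p).1| ≤ 4/5
      · right
        have : p.2 = -1 := by rw [h2]; exact clamp_of_le (by linarith)
        refine ⟨this, ?_⟩
        rw [this, clamp_of_le le_rfl] at h1
        linarith
      · left
        have h5 : p.2 = 5 * (|(fingerCoord p).1| - 1) := by
          rw [h2]; exact clamp_of_mem (by linarith) (by linarith)
        have h6 : |p.2| ≤ 1 := abs_le.2 ⟨by linarith, by linarith⟩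
        rw [clamp_of_mem (by linarith) (by linarith)] at h1
        refine ⟨?_, h6⟩
        have h7 : (|p.1| - 1) * (1 + p.2 / 5) = 0 := by linarith
        rcases mul_eq_zero.1 h7 with h | h <;> linarith
    · intro h2
      have h3 : p.2 = clamp (5 * (|(fingerCoord p).1| - 1)) ∧ |(fingerCoord p).1| ≤ 6/5 := by
        rcases h2 with ⟨h2, h3⟩ | ⟨h2, h3⟩
        · rw [h1, h2]
          rw [abs_le] at h3
          rw [clamp_of_mem h3.1 h3.2]
          have e5 : 5 * (1 * (1 + p.2 / 5) - 1) = p.2 := by ring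
          rw [e5, clamp_of_mem h3.1 h3.2]
          exact ⟨rfl, by linarith⟩
        · rw [h1, h2, clamp_of_le le_rfl]
          rw [clamp_of_le (by linarith)]
          exact ⟨rfl, by linarith⟩
      exact ⟨h3.1, (hq1 (e3.2 h3.1)).2 h3.2⟩

/-! ## Flipping two sides of a square to the other two -/

/-- For fixed `c` in `[-1, 1]` the expression has slopes `1 ± c/2 ≥ 1/2` in `l`, and it is monotone
in `c`, strictly so unless `l = 0`. So it repairs functions `l` that are only weakly increasing,
except at their zeros. -/
theorem add_abs_mul_lt {l l' c c' : ℝ} (hc : -1 ≤ c) (hc' : c' ≤ 1) (hcc : c ≤ c') (hl : l ≤ l')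
    (h : l < l' ∨ (c < c' ∧ l ≠ 0)) : l + |l| * c / 2 < l' + |l'| * c' / 2 := by
  have h1 : l + |l| * c / 2 ≤ l + |l| * c' / 2 := by
    have := mul_le_mul_of_nonneg_left hcc (abs_nonneg l); linarith
  rcases h with h | ⟨h, h0⟩
  · refine h1.trans_lt ?_
    rcases abs_cases l with ⟨e, _⟩ | ⟨e, _⟩ <;> rcases abs_cases l' with ⟨e', _⟩ | ⟨e', _⟩ <;>
      rw [e, e'] <;> nlinarith
  · have h2 : l + |l| * c / 2 < l + |l| * c' / 2 := by
      have := mul_lt_mul_of_pos_left h (abs_pos.2 h0); linarith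
    refine h2.trans_le ?_
    rcases abs_cases l with ⟨e, _⟩ | ⟨e, _⟩ <;> rcases abs_cases l' with ⟨e', _⟩ | ⟨e', _⟩ <;>
      rw [e, e'] <;> nlinarith

/-- The function `η + w ξ` of `ξ = x - y`, `η = x + y`, modified without changing its zeros so that
it increases along horizontal and vertical segments that avoid its zeros. -/
noncomputable def level (w : ℝ → ℝ) (p : Plane) : ℝ :=
  p.2 + w p.1 + |p.2 + w p.1| * clamp (p.2 / 2) / 2

theorem level_eq_zero {w : ℝ → ℝ} {p : Plane} : level w p = 0 ↔ p.2 + w p.1 = 0 := by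
  unfold level
  have h1 := le_clamp (p.2 / 2)
  have h2 := clamp_le (p.2 / 2)
  constructor
  · intro h
    rcases abs_cases (p.2 + w p.1) with ⟨e, _⟩ | ⟨e, _⟩ <;> rw [e] at h <;> nlinarith
  · intro h; simp [h]

/-- A path from `(-1,-1)` to `(1,1)` along the boundary of the square, extended along the diagonal,
as a graph in the coordinates `ξ = x - y`, `η = x + y`. -/
noncomputable def tent (σ η : ℝ) : ℝ := σ * max 0 (2 - |η|)

theorem tent_of_ge {σ η : ℝ} (h : 2 ≤ |η|) : tent σ η = 0 := by
  unfold tent; rw [max_eq_left (by linarith), mul_zero]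

theorem abs_tent_sub_le {σ : ℝ} (hσ : |σ| = 1) (s t : ℝ) : |tent σ s - tent σ t| ≤ |s - t| := by
  unfold tent
  rw [← mul_sub, abs_mul, hσ, one_mul]
  have h1 := abs_max_sub_max_le_abs (2 - |s|) (2 - |t|) 0
  rw [max_comm 0, max_comm 0]
  refine h1.trans ?_
  have : 2 - |s| - (2 - |t|) = -(|s| - |t|) := by ring
  rw [this, abs_neg]
  exact abs_abs_sub_abs_le s t

/-- A curve `η = - w ξ` that meets each of the two paths around the square exactly once. -/
structure Transversal (w : ℝ → ℝ) : Prop where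
  lip : ∀ s t, |w s - w t| ≤ |s - t|
  zero : w 0 = 0
  unique : ∀ σ : ℝ, |σ| = 1 → ∀ s t, s + w (tent σ s) = 0 → t + w (tent σ t) = 0 → s = t

theorem Transversal.continuous {w : ℝ → ℝ} (hw : Transversal w) : Continuous w := by
  have : LipschitzWith 1 w := LipschitzWith.of_dist_le_mul fun s t => by
    simpa [Real.dist_eq] using hw.lip s t
  exact this.continuous

theorem Transversal.continuous_level {w : ℝ → ℝ} (hw : Transversal w) : Continuous (level w) := by
  have := hw.continuous
  unfold level; fun_prop

/-- As `w` is 1-Lipschitz, `η + w ξ` cannot decrease inside the cone `|Δξ| ≤ Δη`, and neither can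
the clamped factor. -/
theorem Transversal.level_le {w : ℝ → ℝ} (hw : Transversal w) {p q : Plane} (h : |q.1 - p.1| ≤ q.2 - p.2) : level w p ≤ level w q := by
  have h0 := hw.lip q.1 p.1
  have h1 := abs_le.1 (h0.trans h)
  have h2 : p.2 ≤ q.2 := by linarith [abs_nonneg (q.1 - p.1)]
  have h3 : clamp (p.2 / 2) ≤ clamp (q.2 / 2) := clamp_mono (by linarith)
  have hl : p.2 + w p.1 ≤ q.2 + w q.1 := by linarith
  rcases hl.lt_or_eq with hl' | hl'
  · exact (add_abs_mul_lt (le_clamp _) (clamp_le _) h3 hl (Or.inl hl')).le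
  · unfold level
    rw [← hl']
    have := mul_le_mul_of_nonneg_left h3 (abs_nonneg (p.2 + w p.1))
    linarith

theorem Transversal.level_lt {w : ℝ → ℝ} (hw : Transversal w) {p q : Plane} (h : |q.1 - p.1| < q.2 - p.2) : level w p < level w q := by
  have h0 := hw.lip q.1 p.1
  have h1 := abs_lt.1 (h0.trans_lt h)
  have h2 : p.2 ≤ q.2 := by linarith [abs_nonneg (q.1 - p.1)]
  exact add_abs_mul_lt (le_clamp _) (clamp_le _) (clamp_mono (by linarith)) (by linarith)
    (Or.inl (by linarith))

/-- The path has slopes `±1` in these coordinates, so `η + w ξ` may be constant on parts of it.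
There the clamped factor increases strictly, which suffices off the zero set; the zero set is met
only once, by `unique`. -/
theorem Transversal.level_tent_strictMono {w : ℝ → ℝ} (hw : Transversal w) {σ : ℝ} (hσ : |σ| = 1) :
    StrictMono fun η => level w (tent σ η, η) := by
  intro s t hst
  have h1 := hw.lip (tent σ t) (tent σ s)
  have h2 := h1.trans (abs_tent_sub_le hσ t s)
  rw [abs_of_pos (sub_pos.2 hst)] at h2
  have h3 := abs_le.1 h2
  refine add_abs_mul_lt (le_clamp _) (clamp_le _) (clamp_mono (by simp only; linarith))
    (by simp only; linarith) ?_
  by_cases hlt : s + w (tent σ s) < t + w (tent σ t)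
  · exact Or.inl hlt
  · have heq : s + w (tent σ s) = t + w (tent σ t) := le_antisymm (by linarith) (not_lt.1 hlt)
    refine Or.inr ⟨?_, fun h0 => hst.ne (hw.unique σ hσ s t h0 (heq ▸ h0))⟩
    -- Beyond `|η| = 2` the path is the diagonal, where `η + w ξ = η` is strictly increasing. Hence
    -- a constant stretch has `s < 2` and `-2 < t`, so `clamp (s / 2) < clamp (t / 2)`.
    have ha : s < 2 := by
      by_contra hs
      rw [tent_of_ge (le_abs.2 (Or.inl (not_lt.1 hs))),
        tent_of_ge (η := t) (le_abs.2 (Or.inl (by linarith)))] at heq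
      linarith
    have hb : -2 < t := by
      by_contra hs
      rw [tent_of_ge (le_abs.2 (Or.inr (by linarith))),
        tent_of_ge (η := t) (le_abs.2 (Or.inr (by linarith)))] at heq
      linarith
    unfold clamp
    simp only
    rcases le_total (s / 2) (-1) with h | h
    · rw [min_eq_right (by linarith), max_eq_left h]
      exact lt_max_of_lt_right (lt_min (by norm_num) (by linarith))
    · rw [min_eq_right (by linarith), max_eq_right h]
      exact lt_max_of_lt_right (lt_min (by linarith) (by linarith))

theorem Transversal.level_tent_surjective {w : ℝ → ℝ} (hw : Transversal w) (σ : ℝ) :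
    Function.Surjective fun η => level w (tent σ η, η) := by
  have hc : Continuous fun η => level w (tent σ η, η) :=
    hw.continuous_level.comp (by unfold tent; fun_prop)
  have h0 : ∀ η, 2 ≤ |η| → level w (tent σ η, η) = η + |η| * clamp (η / 2) / 2 := fun η h => by
    simp [level, tent_of_ge h, hw.zero]
  refine hc.surjective ?_ ?_
  · refine Filter.tendsto_atTop_mono' _ ?_ Filter.tendsto_id
    filter_upwards [Filter.eventually_ge_atTop 2] with η h
    rw [h0 η (le_abs.2 (Or.inl h)), clamp_of_ge (by linarith)]
    have := abs_nonneg η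
    simp only [id]; linarith
  · refine Filter.tendsto_atBot_mono' _ ?_ Filter.tendsto_id
    filter_upwards [Filter.eventually_le_atBot (-2)] with η h
    rw [h0 η (le_abs.2 (Or.inr (by linarith))), clamp_of_le (by linarith)]
    have := abs_nonneg η
    simp only [id]; linarith

/-- The coordinates `(x - y, x + y)`. -/
noncomputable def diagCoord : Plane ≃ₜ Plane where
  toFun p := (p.1 - p.2, p.1 + p.2)
  invFun p := ((p.2 + p.1) / 2, (p.2 - p.1) / 2)
  left_inv p := by ext <;> simp
  right_inv p := by ext <;> simp <;> ring
  continuous_toFun := by fun_prop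
  continuous_invFun := by fun_prop

theorem mem_left_union_top {p : Plane} : p ∈ vseg (-1) (-1) 1 ∪ hseg 1 (-1) 1 ↔
    p.1 - p.2 = tent (-1) (p.1 + p.2) ∧ |p.1 + p.2| ≤ 2 := by
  simp only [vseg, hseg, mem_union, mem_ofPred_eq, uIcc_of_le (show (-1 : ℝ) ≤ 1 by norm_num),
    mem_Icc, tent]
  constructor
  · rintro (⟨h1, h2⟩ | ⟨h1, h2⟩)
    · have e : |p.1 + p.2| = -(p.1 + p.2) := abs_of_nonpos (by linarith)
      rw [e, max_eq_right (by linarith)]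
      constructor <;> linarith
    · have e : |p.1 + p.2| = p.1 + p.2 := abs_of_nonneg (by linarith)
      rw [e, max_eq_right (by linarith)]
      constructor <;> linarith
  · rintro ⟨h1, h2⟩
    rw [max_eq_right (by linarith)] at h1
    rcases abs_cases (p.1 + p.2) with ⟨e, _⟩ | ⟨e, _⟩ <;> rw [e] at h1 h2
    · right; refine ⟨?_, ?_, ?_⟩ <;> linarith
    · left; refine ⟨?_, ?_, ?_⟩ <;> linarith

theorem mem_bottom_union_right {p : Plane} : p ∈ hseg (-1) (-1) 1 ∪ vseg 1 (-1) 1 ↔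
    p.1 - p.2 = tent 1 (p.1 + p.2) ∧ |p.1 + p.2| ≤ 2 := by
  simp only [vseg, hseg, mem_union, mem_ofPred_eq, uIcc_of_le (show (-1 : ℝ) ≤ 1 by norm_num),
    mem_Icc, tent]
  constructor
  · rintro (⟨h1, h2⟩ | ⟨h1, h2⟩)
    · have e : |p.1 + p.2| = -(p.1 + p.2) := abs_of_nonpos (by linarith)
      rw [e, max_eq_right (by linarith)]
      constructor <;> linarith
    · have e : |p.1 + p.2| = p.1 + p.2 := abs_of_nonneg (by linarith)
      rw [e, max_eq_right (by linarith)]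
      constructor <;> linarith
  · rintro ⟨h1, h2⟩
    rw [max_eq_right (by linarith)] at h1
    rcases abs_cases (p.1 + p.2) with ⟨e, _⟩ | ⟨e, _⟩ <;> rw [e] at h1 h2
    · right; refine ⟨?_, ?_, ?_⟩ <;> linarith
    · left; refine ⟨?_, ?_, ?_⟩ <;> linarith

/-- The left and the upper side of the square can be flipped to the lower and the right side
by a homeomorphism that preserves a transversal curve. -/
theorem exists_monoFlip {w : ℝ → ℝ} (hw : Transversal w) : ∃ φ : Plane ≃ₜ Plane,
    (∀ p : Plane, (3/2 ≤ |p.1| ∨ 3/2 ≤ |p.2|) → φ p = p) ∧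
    (∀ p : Plane, p.1 ≤ -1 → p.2 ≤ -1 → φ p = p) ∧
    (∀ p : Plane, 1 ≤ p.1 → 1 ≤ p.2 → φ p = p) ∧
    (∀ p : Plane, φ p ∈ hseg (-1) (-1) 1 ∪ vseg 1 (-1) 1 ↔ p ∈ vseg (-1) (-1) 1 ∪ hseg 1 (-1) 1) ∧
    (∀ p : Plane, (φ p).1 + (φ p).2 + w ((φ p).1 - (φ p).2) = 0 ↔ p.1 + p.2 + w (p.1 - p.2) = 0) := by
  have hm1 : |(-1 : ℝ)| = 1 := by norm_num
  have h1 : |(1 : ℝ)| = 1 := by norm_num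
  -- Both paths around the square are graphs over the values of `level w`. Pushing one graph to the
  -- other with `level w` kept fixed preserves every level set, in particular the transversal curve,
  -- which is the zero level.
  let m₀ := StrictMono.orderIsoOfSurjective _ (hw.level_tent_strictMono hm1)
    (hw.level_tent_surjective (-1))
  let m₁ := StrictMono.orderIsoOfSurjective _ (hw.level_tent_strictMono h1)
    (hw.level_tent_surjective 1)
  have em₀ : ∀ η, m₀ η = level w (tent (-1) η, η) := fun η => rfl
  have em₁ : ∀ η, m₁ η = level w (tent 1 η, η) := fun η => rfl
  have htc : ∀ σ, Continuous (tent σ) := fun σ => by unfold tent; fun_prop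
  let k₀ : ℝ → ℝ := fun l => tent (-1) (m₀.symm l)
  let k₁ : ℝ → ℝ := fun l => tent 1 (m₁.symm l)
  have hk₀ : Continuous k₀ := (htc _).comp m₀.symm.continuous
  have hk₁ : Continuous k₁ := (htc _).comp m₁.symm.continuous
  have hkk : ∀ l, k₀ l ≤ k₁ l := fun l => by
    have a := le_max_left 0 (2 - |m₀.symm l|)
    have b := le_max_left 0 (2 - |m₁.symm l|)
    simp only [k₀, k₁, tent]; linarith
  let V := graphPush k₀ k₁ hk₀ hk₁ hkk
  let Q : Plane ≃ₜ Plane := (diagCoord.trans (fiberHomeo (level w) hw.continuous_level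
    (fun x s t hst => hw.level_lt (by simpa using hst))
    (fun x => by
      have hc : Continuous fun y => level w (x, y) := hw.continuous_level.comp (by fun_prop)
      refine hc.surjective ?_ ?_
      · refine Filter.tendsto_atTop_mono' _ ?_ (Filter.tendsto_atTop_add_const_right _ (w x) Filter.tendsto_id)
        filter_upwards [Filter.eventually_ge_atTop 2] with η h
        simp only [level, id]
        rw [clamp_of_ge (by linarith)]
        linarith [abs_nonneg (η + w x)]
      · refine Filter.tendsto_atBot_mono' _ ?_ (Filter.tendsto_atBot_add_const_right _ (w x) Filter.tendsto_id)
        filter_upwards [Filter.eventually_le_atBot (-2)] with η h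
        simp only [level, id]
        rw [clamp_of_le (by linarith)]
        linarith [abs_nonneg (η + w x)]))).trans (Homeomorph.prodComm ℝ ℝ)
  have hQ : ∀ p : Plane, Q p = (level w (p.1 - p.2, p.1 + p.2), p.1 - p.2) := fun p => rfl
  have hfix : ∀ p : Plane, V (Q p) = Q p → (Q.trans (V.trans Q.symm)) p = p := fun p hp => by
    simp [hp]
  have hVq : ∀ q : Plane, V q = (q.1, pushUp (k₀ q.1) (k₁ q.1) q.2) := fun q => rfl
  have hend : ∀ η, 2 ≤ |η| → m₀ η = m₁ η := fun η h => by rw [em₀, em₁, tent_of_ge h, tent_of_ge h]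
  have hlow : ∀ l, l ≤ m₀ (-2) → k₀ l = 0 ∧ k₁ l = 0 := fun l hl => by
    constructor
    · have : m₀.symm l ≤ -2 := by rwa [OrderIso.symm_apply_le]
      exact tent_of_ge (le_abs.2 (Or.inr (by linarith)))
    · have : m₁.symm l ≤ -2 := by rwa [OrderIso.symm_apply_le, ← hend (-2) (by norm_num)]
      exact tent_of_ge (le_abs.2 (Or.inr (by linarith)))
  have hhigh : ∀ l, m₀ 2 ≤ l → k₀ l = 0 ∧ k₁ l = 0 := fun l hl => by
    constructor
    · have : 2 ≤ m₀.symm l := by rwa [OrderIso.le_symm_apply]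
      exact tent_of_ge (le_abs.2 (Or.inl this))
    · have : 2 ≤ m₁.symm l := by rwa [OrderIso.le_symm_apply, ← hend 2 (by norm_num)]
      exact tent_of_ge (le_abs.2 (Or.inl this))
  have hVfix : ∀ q : Plane, (q.1 ≤ m₀ (-2) ∨ m₀ 2 ≤ q.1) → V q = q := fun q hq => by
    have : k₀ q.1 = 0 ∧ k₁ q.1 = 0 := hq.elim (hlow _) (hhigh _)
    rw [hVq, this.1, this.2, pushUp_same]
  refine ⟨Q.trans (V.trans Q.symm), ?_, ?_, ?_, ?_, ?_⟩
  · intro p hp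
    apply hfix
    set l := level w (p.1 - p.2, p.1 + p.2) with hl
    by_cases hr : l ≤ m₀ (-2) ∨ m₀ 2 ≤ l
    · exact hVfix _ hr
    push Not at hr
    have hQ1 : (Q p).1 = l := rfl
    have hQ2 : (Q p).2 = p.1 - p.2 := rfl
    suffices h : p.1 - p.2 ≤ k₀ l - 1/2 ∨ k₁ l + 1/2 ≤ p.1 - p.2 by
      rw [hVq, hQ1, hQ2]
      rcases h with h | h
      · rw [pushUp_of_le (hkk l) h]; rfl
      · rw [pushUp_of_ge (hkk l) h]; rfl
    by_contra hcon
    push Not at hcon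
    have a1 : -2 < m₀.symm l := by rw [OrderIso.lt_symm_apply]; exact hr.1
    have a2 : m₀.symm l < 2 := by rw [OrderIso.symm_apply_lt]; exact hr.2
    have b1 : -2 < m₁.symm l := by
      rw [OrderIso.lt_symm_apply, ← hend (-2) (by norm_num)]; exact hr.1
    have b2 : m₁.symm l < 2 := by
      rw [OrderIso.symm_apply_lt, ← hend 2 (by norm_num)]; exact hr.2
    have c₀ : level w (k₀ l, m₀.symm l) = l := m₀.apply_symm_apply l
    have c₁ : level w (k₁ l, m₁.symm l) = l := m₁.apply_symm_apply l
    have e₀ : k₀ l = -(2 - |m₀.symm l|) := by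
      have : |m₀.symm l| ≤ 2 := abs_le.2 ⟨a1.le, a2.le⟩
      simp only [k₀, tent]; rw [max_eq_right (by linarith)]; ring
    have e₁ : k₁ l = 2 - |m₁.symm l| := by
      have : |m₁.symm l| ≤ 2 := abs_le.2 ⟨b1.le, b2.le⟩
      simp only [k₁, tent]; rw [max_eq_right (by linarith)]; ring
    -- The point `p` lies on the same level as one point of each path, and `level w` increases
    -- strictly inside cones. So `p` lies in no open cone above or below these two points. Together
    -- with `ξ` being within `1/2` of `[k₀ l, k₁ l]`, this keeps `p` inside the square of half-side
    -- `3/2`.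
    have n₀ : ¬ (p.1 + p.2 - m₀.symm l < -|p.1 - p.2 - k₀ l|) := fun h => by
      have := hw.level_lt (p := (p.1 - p.2, p.1 + p.2)) (q := (k₀ l, m₀.symm l))
        (by simp only; rw [abs_sub_comm]; linarith)
      rw [c₀] at this; exact lt_irrefl _ this
    have n₁ : ¬ (|p.1 - p.2 - k₁ l| < p.1 + p.2 - m₁.symm l) := fun h => by
      have := hw.level_lt (q := (p.1 - p.2, p.1 + p.2)) (p := (k₁ l, m₁.symm l)) h
      rw [c₁] at this; exact lt_irrefl _ this
    have n₂ : ¬ (|p.1 - p.2 - k₀ l| < p.1 + p.2 - m₀.symm l) := fun h => by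
      have := hw.level_lt (q := (p.1 - p.2, p.1 + p.2)) (p := (k₀ l, m₀.symm l)) h
      rw [c₀] at this; exact lt_irrefl _ this
    have n₃ : ¬ (p.1 + p.2 - m₁.symm l < -|p.1 - p.2 - k₁ l|) := fun h => by
      have := hw.level_lt (p := (p.1 - p.2, p.1 + p.2)) (q := (k₁ l, m₁.symm l))
        (by simp only; rw [abs_sub_comm]; linarith)
      rw [c₁] at this; exact lt_irrefl _ this
    rw [e₀] at hcon n₀ n₂
    rw [e₁] at hcon n₁ n₃
    have f₀ := neg_abs_le (m₀.symm l)
    have f₀' := le_abs_self (m₀.symm l)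
    have f₁ := neg_abs_le (m₁.symm l)
    have f₁' := le_abs_self (m₁.symm l)
    rcases hp with hp | hp <;> rcases le_abs.1 hp with hp | hp
    · apply n₁; rw [abs_lt]; constructor <;> linarith
    · apply n₀; rw [lt_neg, abs_lt]; constructor <;> linarith
    · apply n₂; rw [abs_lt]; constructor <;> linarith
    · apply n₃; rw [lt_neg, abs_lt]; constructor <;> linarith
  · intro p h1 h2
    apply hfix
    apply hVfix
    left
    rw [em₀, hQ]
    apply hw.level_le
    rw [tent_of_ge (by norm_num)]
    simp only
    rw [abs_le]; constructor <;> linarith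
  · intro p h1 h2
    apply hfix
    apply hVfix
    right
    rw [em₀, hQ]
    apply hw.level_le
    rw [tent_of_ge (by norm_num)]
    simp only
    rw [abs_le]; constructor <;> linarith
  · intro p
    set q := (Q.trans (V.trans Q.symm)) p with hq
    have e : Q q = V (Q p) := by simp [hq]
    have e1 : (Q q).1 = (Q p).1 := by rw [e]; rfl
    have e2 : q.1 - q.2 = pushUp (k₀ (Q p).1) (k₁ (Q p).1) (p.1 - p.2) := by
      change (Q q).2 = _
      rw [e]; rfl
    have key₀ : ∀ r : Plane, (r.1 - r.2 = tent (-1) (r.1 + r.2) ∧ |r.1 + r.2| ≤ 2) ↔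
        r.1 - r.2 = k₀ (Q r).1 ∧ m₀ (-2) ≤ (Q r).1 ∧ (Q r).1 ≤ m₀ 2 := by
      intro r
      have hpt : r.1 - r.2 = tent (-1) (r.1 + r.2) ↔ r.1 - r.2 = k₀ (Q r).1 := by
        constructor
        · intro h
          have h5 : (Q r).1 = m₀ (r.1 + r.2) := by rw [em₀, hQ, h]
          simp only [k₀]
          rw [h5, OrderIso.symm_apply_apply]; exact h
        · intro h
          have h5 : m₀ (m₀.symm (Q r).1) = (Q r).1 := m₀.apply_symm_apply _
          rw [em₀] at h5
          -- The path point of the same level has the same two coordinates as `r`, hence equals `r`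
          -- because `Q` is injective.
          have h6 : Q (diagCoord.symm (tent (-1) (m₀.symm (Q r).1), m₀.symm (Q r).1)) = Q r := by
            have : Q (diagCoord.symm (tent (-1) (m₀.symm (Q r).1), m₀.symm (Q r).1)) =
                (level w (diagCoord (diagCoord.symm (tent (-1) (m₀.symm (Q r).1), m₀.symm (Q r).1))),
                  (diagCoord (diagCoord.symm (tent (-1) (m₀.symm (Q r).1), m₀.symm (Q r).1))).1) := rfl
            rw [this, Homeomorph.apply_symm_apply]
            exact Prod.ext h5 h.symm
          have h7 := congrArg diagCoord (Q.injective h6)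
          rw [Homeomorph.apply_symm_apply] at h7
          have h8 : m₀.symm (Q r).1 = r.1 + r.2 := congrArg Prod.snd h7
          rw [← h8]; exact h
      constructor
      · rintro ⟨h, h'⟩
        have h5 : (Q r).1 = m₀ (r.1 + r.2) := by rw [em₀, hQ, h]
        rw [abs_le] at h'
        exact ⟨hpt.1 h, by rw [h5]; exact m₀.monotone h'.1, by rw [h5]; exact m₀.monotone h'.2⟩
      · rintro ⟨h, h2, h3⟩
        have h4 := hpt.2 h
        have h5 : (Q r).1 = m₀ (r.1 + r.2) := by rw [em₀, hQ, h4]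
        rw [h5, m₀.le_iff_le] at h2 h3
        exact ⟨h4, abs_le.2 ⟨h2, h3⟩⟩
    have key₁ : ∀ r : Plane, (r.1 - r.2 = tent 1 (r.1 + r.2) ∧ |r.1 + r.2| ≤ 2) ↔
        r.1 - r.2 = k₁ (Q r).1 ∧ m₀ (-2) ≤ (Q r).1 ∧ (Q r).1 ≤ m₀ 2 := by
      intro r
      have hpt : r.1 - r.2 = tent 1 (r.1 + r.2) ↔ r.1 - r.2 = k₁ (Q r).1 := by
        constructor
        · intro h
          have h5 : (Q r).1 = m₁ (r.1 + r.2) := by rw [em₁, hQ, h]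
          simp only [k₁]
          rw [h5, OrderIso.symm_apply_apply]; exact h
        · intro h
          have h5 : m₁ (m₁.symm (Q r).1) = (Q r).1 := m₁.apply_symm_apply _
          rw [em₁] at h5
          have h6 : Q (diagCoord.symm (tent 1 (m₁.symm (Q r).1), m₁.symm (Q r).1)) = Q r := by
            have : Q (diagCoord.symm (tent 1 (m₁.symm (Q r).1), m₁.symm (Q r).1)) =
                (level w (diagCoord (diagCoord.symm (tent 1 (m₁.symm (Q r).1), m₁.symm (Q r).1))),
                  (diagCoord (diagCoord.symm (tent 1 (m₁.symm (Q r).1), m₁.symm (Q r).1))).1) := rfl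
            rw [this, Homeomorph.apply_symm_apply]
            exact Prod.ext h5 h.symm
          have h7 := congrArg diagCoord (Q.injective h6)
          rw [Homeomorph.apply_symm_apply] at h7
          have h8 : m₁.symm (Q r).1 = r.1 + r.2 := congrArg Prod.snd h7
          rw [← h8]; exact h
      rw [hend 2 (by norm_num), hend (-2) (by norm_num)]
      constructor
      · rintro ⟨h, h'⟩
        have h5 : (Q r).1 = m₁ (r.1 + r.2) := by rw [em₁, hQ, h]
        rw [abs_le] at h'
        exact ⟨hpt.1 h, by rw [h5]; exact m₁.monotone h'.1, by rw [h5]; exact m₁.monotone h'.2⟩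
      · rintro ⟨h, h2, h3⟩
        have h4 := hpt.2 h
        have h5 : (Q r).1 = m₁ (r.1 + r.2) := by rw [em₁, hQ, h4]
        rw [h5, m₁.le_iff_le] at h2 h3
        exact ⟨h4, abs_le.2 ⟨h2, h3⟩⟩
    rw [mem_left_union_top, mem_bottom_union_right, key₀, key₁, e1, e2, pushUp_eq_iff (hkk _)]
  · intro p
    set q := (Q.trans (V.trans Q.symm)) p with hq
    have e : Q q = V (Q p) := by simp [hq]
    have e1 : level w (q.1 - q.2, q.1 + q.2) = level w (p.1 - p.2, p.1 + p.2) := by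
      change (Q q).1 = (Q p).1
      rw [e]; rfl
    have h5 := level_eq_zero (w := w) (p := (q.1 - q.2, q.1 + q.2))
    have h6 := level_eq_zero (w := w) (p := (p.1 - p.2, p.1 + p.2))
    rw [e1] at h5
    exact h5.symm.trans h6

/-! ### The four transversal curves: two axes and two corners -/

/-- Here `η + ξ = 2x`, so the curve is the vertical axis. -/
theorem transversal_id : Transversal fun s => s := by
  refine ⟨fun s t => le_rfl, rfl, fun σ hσ s t => ?_⟩
  simp only [tent]
  intro h1 h2
  rcases (abs_eq (by norm_num)).1 hσ with rfl | rfl <;>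
  rcases abs_cases s with ⟨e, _⟩ | ⟨e, _⟩ <;> rcases abs_cases t with ⟨e', _⟩ | ⟨e', _⟩ <;>
  rcases max_cases 0 (2 - |s|) with ⟨f, _⟩ | ⟨f, _⟩ <;>
  rcases max_cases 0 (2 - |t|) with ⟨f', _⟩ | ⟨f', _⟩ <;> rw [f] at h1 <;> rw [f'] at h2 <;> linarith

/-- Here `η - ξ = 2y`, so the curve is the horizontal axis. -/
theorem transversal_neg : Transversal fun s => -s := by
  refine ⟨fun s t => ?_, neg_zero, fun σ hσ s t => ?_⟩
  · rw [neg_sub_neg, abs_sub_comm]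
  simp only [tent]
  intro h1 h2
  rcases (abs_eq (by norm_num)).1 hσ with rfl | rfl <;>
  rcases abs_cases s with ⟨e, _⟩ | ⟨e, _⟩ <;> rcases abs_cases t with ⟨e', _⟩ | ⟨e', _⟩ <;>
  rcases max_cases 0 (2 - |s|) with ⟨f, _⟩ | ⟨f, _⟩ <;>
  rcases max_cases 0 (2 - |t|) with ⟨f', _⟩ | ⟨f', _⟩ <;> rw [f] at h1 <;> rw [f'] at h2 <;> linarith

theorem abs_tent {σ : ℝ} (hσ : |σ| = 1) (s : ℝ) : |tent σ s| = max 0 (2 - |s|) := by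
  unfold tent
  rw [abs_mul, hσ, one_mul, abs_of_nonneg (le_max_left _ _)]

/-- Here `η + |ξ| = 2 max x y`, so the curve is the corner formed by the rays to the left and down.
-/
theorem transversal_abs : Transversal fun s => |s| := by
  refine ⟨fun s t => abs_abs_sub_abs_le s t, abs_zero, fun σ hσ s t => ?_⟩
  simp only [abs_tent hσ]
  intro h1 h2
  rcases abs_cases s with ⟨e, _⟩ | ⟨e, _⟩ <;> rcases abs_cases t with ⟨e', _⟩ | ⟨e', _⟩ <;>
  rcases max_cases 0 (2 - |s|) with ⟨f, _⟩ | ⟨f, _⟩ <;>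
  rcases max_cases 0 (2 - |t|) with ⟨f', _⟩ | ⟨f', _⟩ <;> rw [f] at h1 <;> rw [f'] at h2 <;> linarith

/-- Here `η - |ξ| = 2 min x y`, so the curve is the corner formed by the rays to the right and up.
-/
theorem transversal_neg_abs : Transversal fun s => -|s| := by
  refine ⟨fun s t => ?_, by simp, fun σ hσ s t => ?_⟩
  · rw [neg_sub_neg, abs_sub_comm s t]; exact abs_abs_sub_abs_le t s
  simp only [abs_tent hσ]
  intro h1 h2
  rcases abs_cases s with ⟨e, _⟩ | ⟨e, _⟩ <;> rcases abs_cases t with ⟨e', _⟩ | ⟨e', _⟩ <;>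
  rcases max_cases 0 (2 - |s|) with ⟨f, _⟩ | ⟨f, _⟩ <;>
  rcases max_cases 0 (2 - |t|) with ⟨f', _⟩ | ⟨f', _⟩ <;> rw [f] at h1 <;> rw [f'] at h2 <;> linarith

/-! ## Rectangular diagrams with real coordinates -/

/-- A rectangular diagram with arbitrary coordinates, in which the horizontal edges in `B` pass
over and the other horizontal edges pass under the vertical edges. -/
structure RealDiagram (ι κ : Type) where
  X : ι ≃ κ
  O : ι ≃ κ
  ne : ∀ i, X i ≠ O i
  x : ι → ℝ
  y : κ → ℝ
  x_inj : Function.Injective x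
  y_inj : Function.Injective y
  B : Set κ

namespace RealDiagram

variable {ι κ : Type} (D : RealDiagram ι κ)

/-- The vertical edge with index `i`. -/
def vEdge (i : ι) : Set Plane := vseg (D.x i) (D.y (D.X i)) (D.y (D.O i))

/-- The horizontal edge with index `j`. -/
def hEdge (j : κ) : Set Plane := hseg (D.y j) (D.x (D.X.symm j)) (D.x (D.O.symm j))

/-- The vertical edge `i` and the horizontal edge `j` have a common endpoint. -/
def Incident (i : ι) (j : κ) : Prop := j = D.X i ∨ j = D.O i

theorem symm_ne (j : κ) : D.X.symm j ≠ D.O.symm j := fun h => by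
  have := D.ne (D.X.symm j)
  rw [Equiv.apply_symm_apply, h, Equiv.apply_symm_apply] at this
  exact this rfl

open Classical in
/-- The drawing of the diagram. -/
noncomputable def picture : Picture where
  shadow := (⋃ i, D.vEdge i) ∪ ⋃ j, D.hEdge j
  cross := {q | ∃ i j, q ∈ D.vEdge i ∧ q ∈ D.hEdge j ∧ ¬ D.Incident i j}
  overAt := fun c => if ∃ j ∈ D.B, c ∈ D.hEdge j then ⋃ j, D.hEdge j else ⋃ i, D.vEdge i

theorem isClosed_vEdge (i : ι) : IsClosed (D.vEdge i) := RectDiagram.isClosed_vseg _ _ _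

theorem isClosed_hEdge (j : κ) : IsClosed (D.hEdge j) := RectDiagram.isClosed_hseg _ _ _

variable {D}

theorem eq_of_mem_vEdge {i i' : ι} {p : Plane} (h : p ∈ D.vEdge i) (h' : p ∈ D.vEdge i') :
    i = i' := D.x_inj (h.1.symm.trans h'.1)

theorem eq_of_mem_hEdge {j j' : κ} {p : Plane} (h : p ∈ D.hEdge j) (h' : p ∈ D.hEdge j') :
    j = j' := D.y_inj (h.1.symm.trans h'.1)

theorem y_ne (i : ι) : D.y (D.X i) ≠ D.y (D.O i) := fun h => D.ne i (D.y_inj h)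

theorem x_ne (j : κ) : D.x (D.X.symm j) ≠ D.x (D.O.symm j) := fun h => D.symm_ne j (D.x_inj h)

/-- A crossing lies in the interior of both edges. -/
theorem interior_of_mem {i : ι} {j : κ} {p : Plane} (hi : p ∈ D.vEdge i) (hj : p ∈ D.hEdge j)
    (h : ¬ D.Incident i j) : p.2 ≠ D.y (D.X i) ∧ p.2 ≠ D.y (D.O i) ∧
      p.1 ≠ D.x (D.X.symm j) ∧ p.1 ≠ D.x (D.O.symm j) := by
  simp only [Incident, not_or] at h
  refine ⟨?_, ?_, ?_, ?_⟩
  · rw [hj.1]; exact fun e => h.1 (D.y_inj e)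
  · rw [hj.1]; exact fun e => h.2 (D.y_inj e)
  · rw [hi.1]; exact fun e => h.1 (by rw [D.x_inj e, Equiv.apply_symm_apply])
  · rw [hi.1]; exact fun e => h.2 (by rw [D.x_inj e, Equiv.apply_symm_apply])

theorem mem_hEdge_of_incident {i : ι} {j : κ} (h : D.Incident i j) : (D.x i, D.y j) ∈ D.hEdge j := by
  rcases h with rfl | rfl
  · exact ⟨rfl, by rw [Equiv.symm_apply_apply]; exact left_mem_uIcc⟩
  · exact ⟨rfl, by rw [Equiv.symm_apply_apply]; exact right_mem_uIcc⟩

theorem mem_vEdge_of_incident {i : ι} {j : κ} (h : D.Incident i j) : (D.x i, D.y j) ∈ D.vEdge i := by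
  rcases h with rfl | rfl
  · exact ⟨rfl, left_mem_uIcc⟩
  · exact ⟨rfl, right_mem_uIcc⟩

theorem eq_of_mem_of_mem {i : ι} {j : κ} {p : Plane} (hi : p ∈ D.vEdge i) (hj : p ∈ D.hEdge j) :
    p = (D.x i, D.y j) := Prod.ext hi.1 hj.1

theorem overAt_of_mem {c : Plane} {j : κ} (hj : c ∈ D.hEdge j) (hB : j ∈ D.B) :
    D.picture.overAt c = ⋃ j, D.hEdge j := if_pos ⟨j, hB, hj⟩

theorem overAt_of_notMem {c : Plane} {j : κ} (hj : c ∈ D.hEdge j) (hB : j ∉ D.B) :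
    D.picture.overAt c = ⋃ i, D.vEdge i :=
  if_neg fun ⟨_, hk, hk'⟩ => hB (eq_of_mem_hEdge hj hk' ▸ hk)

theorem isClosed_iUnion_vEdge [Finite ι] (D : RealDiagram ι κ) : IsClosed (⋃ k, D.vEdge k) :=
  isClosed_iUnion_of_finite D.isClosed_vEdge

theorem isClosed_iUnion_hEdge [Finite κ] (D : RealDiagram ι κ) : IsClosed (⋃ k, D.hEdge k) :=
  isClosed_iUnion_of_finite D.isClosed_hEdge

theorem eventually_vEdge [Finite ι] {i : ι} {p : Plane} (hp : p ∈ D.vEdge i) :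
    ∀ᶠ q in 𝓝 p, ∀ k, q ∈ D.vEdge k → k = i := by
  rw [Filter.eventually_all]
  intro k
  by_cases hk : k = i
  · exact Filter.Eventually.of_forall fun _ _ => hk
  · have : p ∉ D.vEdge k := fun h => hk (eq_of_mem_vEdge h hp)
    filter_upwards [(D.isClosed_vEdge k).isOpen_compl.mem_nhds this] with q hq h
    exact absurd h hq

theorem eventually_hEdge [Finite κ] {j : κ} {p : Plane} (hp : p ∈ D.hEdge j) :
    ∀ᶠ q in 𝓝 p, ∀ k, q ∈ D.hEdge k → k = j := by
  rw [Filter.eventually_all]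
  intro k
  by_cases hk : k = j
  · exact Filter.Eventually.of_forall fun _ _ => hk
  · have : p ∉ D.hEdge k := fun h => hk (eq_of_mem_hEdge h hp)
    filter_upwards [(D.isClosed_hEdge k).isOpen_compl.mem_nhds this] with q hq h
    exact absurd h hq

theorem eventually_iUnion_vEdge [Finite ι] {i : ι} {p : Plane} (hp : p ∈ D.vEdge i) :
    ∀ᶠ q in 𝓝 p, (q ∈ ⋃ k, D.vEdge k) ↔ q ∈ D.vEdge i := by
  filter_upwards [eventually_vEdge hp] with q hq
  refine ⟨fun h => ?_, fun h => mem_iUnion.2 ⟨i, h⟩⟩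
  obtain ⟨k, hk⟩ := mem_iUnion.1 h
  exact hq k hk ▸ hk

theorem eventually_iUnion_hEdge [Finite κ] {j : κ} {p : Plane} (hp : p ∈ D.hEdge j) :
    ∀ᶠ q in 𝓝 p, (q ∈ ⋃ k, D.hEdge k) ↔ q ∈ D.hEdge j := by
  filter_upwards [eventually_hEdge hp] with q hq
  refine ⟨fun h => ?_, fun h => mem_iUnion.2 ⟨j, h⟩⟩
  obtain ⟨k, hk⟩ := mem_iUnion.1 h
  exact hq k hk ▸ hk

theorem eventually_vEdge_interior [Finite ι] {i : ι} {p : Plane} (hp : p ∈ D.vEdge i)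
    (h1 : p.2 ≠ D.y (D.X i)) (h2 : p.2 ≠ D.y (D.O i)) :
    ∀ᶠ q in 𝓝 p, (q ∈ ⋃ k, D.vEdge k) ↔ q.1 = p.1 := by
  have h := (RectDiagram.eventually_uIcc (y_ne i) hp.2).1 h1 h2
  filter_upwards [eventually_iUnion_vEdge hp, continuous_snd.continuousAt.eventually h] with q hq hq'
  rw [hq, hp.1]
  exact ⟨fun h => h.1, fun h => ⟨h, hq'⟩⟩

theorem eventually_hEdge_interior [Finite κ] {j : κ} {p : Plane} (hp : p ∈ D.hEdge j)
    (h1 : p.1 ≠ D.x (D.X.symm j)) (h2 : p.1 ≠ D.x (D.O.symm j)) :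
    ∀ᶠ q in 𝓝 p, (q ∈ ⋃ k, D.hEdge k) ↔ q.2 = p.2 := by
  have h := (RectDiagram.eventually_uIcc (x_ne j) hp.2).1 h1 h2
  filter_upwards [eventually_iUnion_hEdge hp, continuous_fst.continuousAt.eventually h] with q hq hq'
  rw [hq, hp.1]
  exact ⟨fun h => h.1, fun h => ⟨h, hq'⟩⟩

theorem exists_arc_chart [Finite ι] [Finite κ] (p : Plane) (hp : p ∈ D.picture.shadow)
    (hc : p ∉ D.picture.cross) : ∃ h : Plane ≃ₜ Plane, h 0 = p ∧
      ∀ q ∈ Box, (h q ∈ D.picture.shadow ↔ q.2 = 0) := by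
  by_cases hv : p ∈ ⋃ i, D.vEdge i
  · obtain ⟨i, hi⟩ := mem_iUnion.1 hv
    by_cases hh : p ∈ ⋃ j, D.hEdge j
    · obtain ⟨j, hj⟩ := mem_iUnion.1 hh
      have hji : D.Incident i j := by
        by_contra hcon
        exact hc ⟨i, j, hi, hj, hcon⟩
      have hy : p.2 = D.y (D.X i) ∨ p.2 = D.y (D.O i) := by
        rcases hji with rfl | rfl
        · exact Or.inl hj.1
        · exact Or.inr hj.1
      have hx : p.1 = D.x (D.X.symm j) ∨ p.1 = D.x (D.O.symm j) := by
        rcases hji with rfl | rfl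
        · left; rw [Equiv.symm_apply_apply]; exact hi.1
        · right; rw [Equiv.symm_apply_apply]; exact hi.1
      obtain ⟨σ, hσ, eσ⟩ := (RectDiagram.eventually_uIcc (y_ne i) hi.2).2 hy
      obtain ⟨τ, hτ, eτ⟩ := (RectDiagram.eventually_uIcc (x_ne j) hj.2).2 hx
      have ev : ∀ᶠ q in 𝓝 p, q ∈ D.picture.shadow ↔
          (q.1 = p.1 ∧ 0 ≤ σ * (q.2 - p.2)) ∨ (q.2 = p.2 ∧ 0 ≤ τ * (q.1 - p.1)) := by
        filter_upwards [eventually_iUnion_vEdge hi, eventually_iUnion_hEdge hj,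
          continuous_snd.continuousAt.eventually eσ, continuous_fst.continuousAt.eventually eτ]
          with q h1 h2 h3 h4
        change (q ∈ (⋃ i, D.vEdge i) ∪ ⋃ j, D.hEdge j) ↔ _
        rw [mem_union, h1, h2, ← h3, ← h4, hi.1, hj.1]
        rfl
      obtain ⟨h, δ, hδ, h0, hq, hQ⟩ :=
        RectDiagram.exists_chart p (RectDiagram.bend σ τ hσ hτ) (by simp [RectDiagram.bend]) ev
      refine ⟨h, h0, fun q hqB => ?_⟩
      rw [hQ q hqB, hq q]
      have e1 : (p + δ • RectDiagram.bend σ τ hσ hτ q).1 =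
        p.1 + δ * (τ * ((q.2 + |q.1| + q.1) / 2)) := rfl
      have e2 : (p + δ • RectDiagram.bend σ τ hσ hτ q).2 =
        p.2 + δ * (σ * ((q.2 + |q.1| - q.1) / 2)) := rfl
      have τ0 : τ ≠ 0 := by rintro rfl; norm_num at hτ
      have σ0 : σ ≠ 0 := by rintro rfl; norm_num at hσ
      have f1 : σ * (p.2 + δ * (σ * ((q.2 + |q.1| - q.1) / 2)) - p.2) =
          δ * ((q.2 + |q.1| - q.1) / 2) := by
        linear_combination δ * ((q.2 + |q.1| - q.1) / 2) * hσ
      have f2 : τ * (p.1 + δ * (τ * ((q.2 + |q.1| + q.1) / 2)) - p.1) =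
          δ * ((q.2 + |q.1| + q.1) / 2) := by
        linear_combination δ * ((q.2 + |q.1| + q.1) / 2) * hτ
      rw [e1, e2, f1, f2, mul_nonneg_iff_of_pos_left hδ, mul_nonneg_iff_of_pos_left hδ]
      simp only [add_eq_left, mul_eq_zero, hδ.ne', τ0, σ0, false_or]
      constructor
      · rintro (⟨ha, hb⟩ | ⟨ha, hb⟩)
        · have : |q.1| = -q.1 := abs_of_nonpos (by linarith)
          linarith
        · have : |q.1| = q.1 := abs_of_nonneg (by linarith)
          linarith
      · intro h0
        rw [h0]
        rcases le_total 0 q.1 with hs | hs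
        · right
          rw [abs_of_nonneg hs]
          exact ⟨by ring, by linarith⟩
        · left
          rw [abs_of_nonpos hs]
          exact ⟨by ring, by linarith⟩
    · have h1 : p.2 ≠ D.y (D.X i) := fun h => hh (mem_iUnion.2 ⟨D.X i, by
        rw [show p = (D.x i, D.y (D.X i)) from Prod.ext hi.1 h]
        exact mem_hEdge_of_incident (Or.inl rfl)⟩)
      have h2 : p.2 ≠ D.y (D.O i) := fun h => hh (mem_iUnion.2 ⟨D.O i, by
        rw [show p = (D.x i, D.y (D.O i)) from Prod.ext hi.1 h]
        exact mem_hEdge_of_incident (Or.inr rfl)⟩)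
      have ev : ∀ᶠ q in 𝓝 p, q ∈ D.picture.shadow ↔ q.1 = p.1 := by
        filter_upwards [eventually_vEdge_interior hi h1 h2,
          D.isClosed_iUnion_hEdge.isOpen_compl.mem_nhds hh] with q a1 a2
        change (q ∈ (⋃ i, D.vEdge i) ∪ ⋃ j, D.hEdge j) ↔ _
        rw [mem_union, a1]
        exact or_iff_left a2
      obtain ⟨h, δ, hδ, h0, hq, hQ⟩ := RectDiagram.exists_chart p (Homeomorph.prodComm ℝ ℝ) rfl ev
      refine ⟨h, h0, fun q hqB => ?_⟩
      rw [hQ q hqB, hq q]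
      change p.1 + δ * q.2 = p.1 ↔ _
      simp [hδ.ne']
  · have hh : p ∈ ⋃ j, D.hEdge j := hp.resolve_left hv
    obtain ⟨j, hj⟩ := mem_iUnion.1 hh
    have h1 : p.1 ≠ D.x (D.X.symm j) := fun h => hv (mem_iUnion.2 ⟨D.X.symm j, by
      rw [show p = (D.x (D.X.symm j), D.y j) from Prod.ext h hj.1]
      exact mem_vEdge_of_incident (Or.inl (by simp))⟩)
    have h2 : p.1 ≠ D.x (D.O.symm j) := fun h => hv (mem_iUnion.2 ⟨D.O.symm j, by
      rw [show p = (D.x (D.O.symm j), D.y j) from Prod.ext h hj.1]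
      exact mem_vEdge_of_incident (Or.inr (by simp))⟩)
    have ev : ∀ᶠ q in 𝓝 p, q ∈ D.picture.shadow ↔ q.2 = p.2 := by
      filter_upwards [eventually_hEdge_interior hj h1 h2,
        D.isClosed_iUnion_vEdge.isOpen_compl.mem_nhds hv] with q a1 a2
      change (q ∈ (⋃ i, D.vEdge i) ∪ ⋃ j, D.hEdge j) ↔ _
      rw [mem_union, a1]
      exact or_iff_right a2
    obtain ⟨h, δ, hδ, h0, hq, hQ⟩ := RectDiagram.exists_chart p (Homeomorph.refl Plane) rfl ev
    refine ⟨h, h0, fun q hqB => ?_⟩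
    rw [hQ q hqB, hq q]
    change p.2 + δ * q.2 = p.2 ↔ _
    simp [hδ.ne']

theorem exists_cross_chart [Finite ι] [Finite κ] (c : Plane) (hc : c ∈ D.picture.cross) :
    ∃ h : Plane ≃ₜ Plane, h 0 = c ∧ ∀ q ∈ Box,
      (h q ∈ D.picture.shadow ↔ q.1 = 0 ∨ q.2 = 0) ∧ (h q ∈ D.picture.overAt c ↔ q.1 = 0) := by
  obtain ⟨i, j, hi, hj, hX⟩ := hc
  obtain ⟨v1, v2, h1, h2⟩ := interior_of_mem hi hj hX
  have ev : ∀ᶠ q in 𝓝 c, ((q ∈ ⋃ i, D.vEdge i) ↔ q.1 = c.1) ∧ ((q ∈ ⋃ j, D.hEdge j) ↔ q.2 = c.2) :=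
    (eventually_vEdge_interior hi v1 v2).and (eventually_hEdge_interior hj h1 h2)
  by_cases hB : j ∈ D.B
  · obtain ⟨h, δ, hδ, h0, hq, hQ⟩ := RectDiagram.exists_chart c (Homeomorph.prodComm ℝ ℝ) rfl ev
    refine ⟨h, h0, fun q hqB => ?_⟩
    have e1 : (h q).1 = c.1 + δ * q.2 := by rw [hq q]; rfl
    have e2 : (h q).2 = c.2 + δ * q.1 := by rw [hq q]; rfl
    have h3 := hQ q hqB
    rw [e1, e2] at h3
    simp only [add_eq_left, mul_eq_zero, hδ.ne', false_or] at h3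
    rw [overAt_of_mem hj hB]
    exact ⟨(or_congr h3.1 h3.2).trans or_comm, h3.2⟩
  · obtain ⟨h, δ, hδ, h0, hq, hQ⟩ := RectDiagram.exists_chart c (Homeomorph.refl Plane) rfl ev
    refine ⟨h, h0, fun q hqB => ?_⟩
    have e1 : (h q).1 = c.1 + δ * q.1 := by rw [hq q]; rfl
    have e2 : (h q).2 = c.2 + δ * q.2 := by rw [hq q]; rfl
    have h3 := hQ q hqB
    rw [e1, e2] at h3
    simp only [add_eq_left, mul_eq_zero, hδ.ne', false_or] at h3
    rw [overAt_of_notMem hj hB]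
    exact ⟨or_congr h3.1 h3.2, h3.1⟩

variable (D)

/-- The link diagram drawn by a rectangular diagram. -/
noncomputable def toLinkDiagram [Finite ι] [Finite κ] : LinkDiagram where
  toPicture := D.picture
  isCompact_shadow := (isCompact_iUnion fun _ => RectDiagram.isCompact_vseg _ _ _).union
    (isCompact_iUnion fun _ => RectDiagram.isCompact_hseg _ _ _)
  finite_cross := by
    refine (finite_range fun z : ι × κ => (D.x z.1, D.y z.2)).subset ?_
    rintro q ⟨i, j, hi, hj, -⟩
    exact ⟨(i, j), (eq_of_mem_of_mem hi hj).symm⟩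
  arc_chart := exists_arc_chart
  cross_chart := exists_cross_chart

end RealDiagram

/-! ## Diagrams with a distinguished overpass -/

/-- The part of a diagram outside a distinguished overpass: its shadow `R`, its crossings `C`,
a set `V` that contains the overstrand at these crossings, and the endpoints `K` of the overpass. -/
structure Frame where
  R : Set Plane
  C : Set Plane
  V : Set Plane
  K : Set Plane

/-- The diagram `D` consists of the frame `F` and the overpass `S`. -/
structure Frame.Rep (F : Frame) (S : Set Plane) (D : LinkDiagram) : Prop where
  shadow : ∀ p, p ∈ D.shadow ↔ p ∈ F.R ∨ p ∈ S
  cross : ∀ p, p ∈ D.cross ↔ p ∈ F.C ∨ (p ∈ F.R ∧ p ∈ S ∧ p ∉ F.K)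
  over_frame : ∀ c ∈ F.C, ∀ᶠ p in 𝓝 c, (p ∈ D.overAt c ↔ p ∈ F.V)
  over_path : ∀ c, c ∈ F.R → c ∈ S → c ∉ F.K → ∀ᶠ p in 𝓝 c, (p ∈ D.overAt c ↔ p ∈ S)

namespace Frame.Rep

variable {F : Frame} {S S' : Set Plane} {D D' : LinkDiagram}

/-- A homeomorphism that preserves the frame and moves the overpass. -/
theorem carries {φ : Plane ≃ₜ Plane} (hD : F.Rep S D) (hD' : F.Rep S' D')
    (hR : ∀ p, φ p ∈ F.R ↔ p ∈ F.R) (hS : ∀ p, φ p ∈ S' ↔ p ∈ S) (hK : ∀ p ∈ F.K, φ p = p)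
    (hC : ∀ c ∈ F.C, ∀ᶠ p in 𝓝 c, φ p = p) : LinkDiagram.Carries φ D D' := by
  have hK' : ∀ p, φ p ∈ F.K ↔ p ∈ F.K := fun p => by
    constructor
    · intro h
      have := φ.injective (hK _ h)
      rwa [← this]
    · intro h; rwa [hK p h]
  have hCf : ∀ c ∈ F.C, φ c = c := fun c hc => (hC c hc).self_of_nhds
  have hC' : ∀ p, φ p ∈ F.C ↔ p ∈ F.C := fun p => by
    constructor
    · intro h
      have := φ.injective (hCf _ h)
      rwa [← this]
    · intro h; rwa [hCf p h]
  have hcr : ∀ p, φ p ∈ D'.cross ↔ p ∈ D.cross := fun p => by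
    rw [hD'.cross, hD.cross, hR, hS, hK', hC']
  refine ⟨fun p => by rw [hD'.shadow, hD.shadow, hR, hS], hcr, fun c hc => ?_⟩
  rcases (hD.cross c).1 hc with h | ⟨h1, h2, h3⟩
  · have h5 := hD'.over_frame c h
    rw [hCf c h]
    have h6 : Filter.Tendsto φ (𝓝 c) (𝓝 c) := by
      have := φ.continuous.tendsto c
      rwa [hCf c h] at this
    filter_upwards [hC c h, hD.over_frame c h, h5] with p p1 p2 p3
    rw [p1, p2, p3]
  · have h5 := hD'.over_path (φ c) ((hR c).2 h1) ((hS c).2 h2) (fun h => h3 ((hK' c).1 h))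
    filter_upwards [hD.over_path c h1 h2 h3, φ.continuous.continuousAt.eventually h5] with p p1 p2
    rw [p1, p2, hS]

/-- A homeomorphism that preserves the frame carries overpasses back to overpasses. -/
theorem map_symm {φ : Plane ≃ₜ Plane} (hD' : F.Rep S' D')
    (hR : ∀ p, φ p ∈ F.R ↔ p ∈ F.R) (hS : ∀ p, φ p ∈ S' ↔ p ∈ S) (hK : ∀ p ∈ F.K, φ p = p)
    (hC : ∀ c ∈ F.C, ∀ᶠ p in 𝓝 c, φ p = p) : F.Rep S (D'.map φ.symm) := by
  have hK' : ∀ p, φ p ∈ F.K ↔ p ∈ F.K := fun p => by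
    constructor
    · intro h
      have := φ.injective (hK _ h)
      rwa [← this]
    · intro h; rwa [hK p h]
  have hCf : ∀ c ∈ F.C, φ c = c := fun c hc => (hC c hc).self_of_nhds
  have hC' : ∀ p, φ p ∈ F.C ↔ p ∈ F.C := fun p => by
    constructor
    · intro h
      have := φ.injective (hCf _ h)
      rwa [← this]
    · intro h; rwa [hCf p h]
  refine ⟨fun p => ?_, fun p => ?_, fun c hc => ?_, fun c h1 h2 h3 => ?_⟩
  · change φ p ∈ D'.shadow ↔ _
    rw [hD'.shadow, hR, hS]
  · change φ p ∈ D'.cross ↔ _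
    rw [hD'.cross, hR, hS, hK', hC']
  · filter_upwards [hC c hc, hD'.over_frame c hc] with p p1 p2
    change φ p ∈ D'.overAt (φ c) ↔ _
    rw [hCf c hc, p1, p2]
  · have h5 := hD'.over_path (φ c) ((hR c).2 h1) ((hS c).2 h2) (fun h => h3 ((hK' c).1 h))
    filter_upwards [φ.continuous.continuousAt.eventually h5] with p p2
    change φ p ∈ D'.overAt (φ c) ↔ _
    rw [p2, hS]

theorem congr (hD : F.Rep S D) (h : S = S') : F.Rep S' D := h ▸ hD

end Frame.Rep

namespace RealDiagram

variable {ι κ : Type} (D : RealDiagram ι κ)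

/-- The frame of the overpass that consists of the vertical edges in `A` and the horizontal edges
in `B`. -/
def frame (A : Set ι) : Frame where
  R := {p | (∃ i ∉ A, p ∈ D.vEdge i) ∨ ∃ j ∉ D.B, p ∈ D.hEdge j}
  C := {p | ∃ i ∉ A, ∃ j ∉ D.B, p ∈ D.vEdge i ∧ p ∈ D.hEdge j ∧ ¬ D.Incident i j}
  V := {p | ∃ i ∉ A, p ∈ D.vEdge i}
  K := {p | ∃ i ∈ A, ∃ j ∉ D.B, D.Incident i j ∧ p = (D.x i, D.y j)}

/-- The overpass that consists of the vertical edges in `A` and the horizontal edges in `B`. -/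
def path (A : Set ι) : Set Plane :=
  {p | (∃ i ∈ A, p ∈ D.vEdge i) ∨ ∃ j ∈ D.B, p ∈ D.hEdge j}

/-- Edges of the overpass are over wherever they meet the frame: rows of `B` by definition, and
columns of `A` because they meet rows outside `B`. The condition `hA` makes every meeting of a row
in `B` with a frame column a genuine crossing; `hAB` excludes crossings of the overpass with itself.
-/
theorem rep_toLinkDiagram [Finite ι] [Finite κ] (A : Set ι)
    (hA : ∀ i, ∀ j ∈ D.B, D.Incident i j → i ∈ A)
    (hAB : ∀ i ∈ A, ∀ j ∈ D.B, (D.x i, D.y j) ∈ D.vEdge i → (D.x i, D.y j) ∈ D.hEdge j →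
      D.Incident i j) :
    (D.frame A).Rep (D.path A) D.toLinkDiagram := by
  have hcl : ∀ {p : Plane}, (∀ i ∈ A, p ∉ D.vEdge i) → ∀ᶠ q in 𝓝 p, ∀ i ∈ A, q ∉ D.vEdge i := by
    intro p hp
    rw [Filter.eventually_all]
    intro i
    by_cases hi : i ∈ A
    · filter_upwards [(D.isClosed_vEdge i).isOpen_compl.mem_nhds (hp i hi)] with q hq _ using hq
    · exact Filter.Eventually.of_forall fun _ h => absurd h hi
  have hcl' : ∀ {p : Plane}, (∀ j ∈ D.B, p ∉ D.hEdge j) →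
      ∀ᶠ q in 𝓝 p, ∀ j ∈ D.B, q ∉ D.hEdge j := by
    intro p hp
    rw [Filter.eventually_all]
    intro i
    by_cases hi : i ∈ D.B
    · filter_upwards [(D.isClosed_hEdge i).isOpen_compl.mem_nhds (hp i hi)] with q hq _ using hq
    · exact Filter.Eventually.of_forall fun _ h => absurd h hi
  refine ⟨fun p => ?_, fun p => ?_, fun c hc => ?_, fun c hR hS hK => ?_⟩
  · change p ∈ (⋃ i, D.vEdge i) ∪ ⋃ j, D.hEdge j ↔ _
    simp only [mem_union, mem_iUnion, frame, path, mem_ofPred_eq]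
    constructor
    · rintro (⟨i, hi⟩ | ⟨j, hj⟩)
      · by_cases h : i ∈ A
        · exact Or.inr (Or.inl ⟨i, h, hi⟩)
        · exact Or.inl (Or.inl ⟨i, h, hi⟩)
      · by_cases h : j ∈ D.B
        · exact Or.inr (Or.inr ⟨j, h, hj⟩)
        · exact Or.inl (Or.inr ⟨j, h, hj⟩)
    · rintro ((⟨i, -, hi⟩ | ⟨j, -, hj⟩) | (⟨i, -, hi⟩ | ⟨j, -, hj⟩))
      exacts [Or.inl ⟨i, hi⟩, Or.inr ⟨j, hj⟩, Or.inl ⟨i, hi⟩, Or.inr ⟨j, hj⟩]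
  · change (∃ i j, p ∈ D.vEdge i ∧ p ∈ D.hEdge j ∧ ¬ D.Incident i j) ↔ _
    constructor
    · rintro ⟨i, j, hi, hj, h⟩
      have hp := eq_of_mem_of_mem hi hj
      by_cases h1 : i ∈ A
      · have h2 : j ∉ D.B := fun h2 => h (hAB i h1 j h2 (hp ▸ hi) (hp ▸ hj))
        refine Or.inr ⟨Or.inr ⟨j, h2, hj⟩, Or.inl ⟨i, h1, hi⟩, ?_⟩
        rintro ⟨i', _, j', _, hinc, hp'⟩
        rw [hp, Prod.ext_iff] at hp'
        exact h (D.x_inj hp'.1 ▸ D.y_inj hp'.2 ▸ hinc)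
      · by_cases h2 : j ∈ D.B
        · refine Or.inr ⟨Or.inl ⟨i, h1, hi⟩, Or.inr ⟨j, h2, hj⟩, ?_⟩
          rintro ⟨i', _, j', _, hinc, hp'⟩
          rw [hp, Prod.ext_iff] at hp'
          exact h (D.x_inj hp'.1 ▸ D.y_inj hp'.2 ▸ hinc)
        · exact Or.inl ⟨i, h1, j, h2, hi, hj, h⟩
    · rintro (⟨i, _, j, _, h⟩ | ⟨h1, h2, h3⟩)
      · exact ⟨i, j, h⟩
      · rcases h1 with ⟨i, hi, hpi⟩ | ⟨j, hj, hpj⟩ <;> rcases h2 with ⟨i', hi', hpi'⟩ | ⟨j', hj', hpj'⟩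
        · exact absurd (eq_of_mem_vEdge hpi hpi' ▸ hi') hi
        · exact ⟨i, j', hpi, hpj', fun h => hi (hA i j' hj' h)⟩
        · exact ⟨i', j, hpi', hpj, fun h => h3 ⟨i', hi', j, hj, h, eq_of_mem_of_mem hpi' hpj⟩⟩
        · exact absurd (eq_of_mem_hEdge hpj hpj' ▸ hj') hj
  · obtain ⟨i, hi, j, hj, hci, hcj, h⟩ := hc
    change ∀ᶠ p in 𝓝 c, p ∈ D.picture.overAt c ↔ _
    rw [overAt_of_notMem hcj hj]
    filter_upwards [eventually_vEdge hci] with q hq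
    simp only [mem_iUnion]
    constructor
    · rintro ⟨k, hk⟩
      exact ⟨k, hq k hk ▸ hi, hk⟩
    · rintro ⟨k, _, hk⟩
      exact ⟨k, hk⟩
  · change ∀ᶠ p in 𝓝 c, p ∈ D.picture.overAt c ↔ _
    rcases hR with ⟨i, hi, hpi⟩ | ⟨j, hj, hpj⟩ <;> rcases hS with ⟨i', hi', hpi'⟩ | ⟨j', hj', hpj'⟩
    · exact absurd (eq_of_mem_vEdge hpi hpi' ▸ hi') hi
    · rw [overAt_of_mem hpj' hj']
      filter_upwards [eventually_hEdge hpj',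
        hcl fun k hk hck => hi (eq_of_mem_vEdge hpi hck ▸ hk)] with q h1 h2
      simp only [mem_iUnion]
      constructor
      · rintro ⟨k, hk⟩
        exact Or.inr ⟨k, h1 k hk ▸ hj', hk⟩
      · rintro (⟨k, hk, hk'⟩ | ⟨k, hk, hk'⟩)
        · exact absurd hk' (h2 k hk)
        · exact ⟨k, hk'⟩
    · rw [overAt_of_notMem hpj hj]
      filter_upwards [eventually_vEdge hpi',
        hcl' fun k hk hck => hj (eq_of_mem_hEdge hpj hck ▸ hk)] with q h1 h2
      simp only [mem_iUnion]
      constructor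
      · rintro ⟨k, hk⟩
        exact Or.inl ⟨k, h1 k hk ▸ hi', hk⟩
      · rintro (⟨k, hk, hk'⟩ | ⟨k, hk, hk'⟩)
        · exact ⟨k, hk'⟩
        · exact absurd hk' (h2 k hk)
    · exact absurd (eq_of_mem_hEdge hpj hpj' ▸ hj') hj

end RealDiagram

/-! ## Moving an overpass in a box -/

theorem isClosed_box : IsClosed Box := by
  have : Box = {q : Plane | |q.1| ≤ 1} ∩ {q : Plane | |q.2| ≤ 1} := rfl
  rw [this]
  exact (isClosed_le (by fun_prop) continuous_const).inter
    (isClosed_le (by fun_prop) continuous_const)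

theorem isBounded_box : Bornology.IsBounded Box := by
  refine (Metric.isBounded_iff_subset_closedBall 0).2 ⟨1, fun q hq => ?_⟩
  rw [mem_closedBall_zero_iff, Prod.norm_def]
  exact max_le hq.1 hq.2

theorem isCompact_box : IsCompact Box := Metric.isCompact_of_isClosed_isBounded isClosed_box isBounded_box

theorem box_mem_nhds {c : Plane} (h1 : |c.1| < 1) (h2 : |c.2| < 1) : Box ∈ 𝓝 c := by
  have : {q : Plane | |q.1| < 1} ∩ {q : Plane | |q.2| < 1} ∈ 𝓝 c :=
    ((isOpen_lt (by fun_prop) continuous_const).inter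
      (isOpen_lt (by fun_prop) continuous_const)).mem_nhds ⟨h1, h2⟩
  exact Filter.mem_of_superset this fun q hq => ⟨hq.1.le, hq.2.le⟩

theorem mem_box_iff_of_fix {φ : Plane ≃ₜ Plane} (hφ : ∀ q ∉ Box, φ q = q) (q : Plane) :
    φ q ∈ Box ↔ q ∈ Box := by
  constructor
  · intro h
    by_contra hq
    exact hq (hφ q hq ▸ h)
  · intro h
    by_contra hq
    exact hq ((φ.injective (hφ _ hq)).symm ▸ h)

/-- Seen through `h`, the frame `F` consists inside the box of the set `C`,
with crossings `X`, at which the vertical axis is over, and the ends `K` of the overpass. -/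
structure Placed (F : Frame) (h : Plane ≃ₜ Plane) (C K X : Set Plane) : Prop where
  R : ∀ q ∈ Box, h q ∈ F.R ↔ q ∈ C
  K : ∀ q ∈ Box, h q ∈ F.K ↔ q ∈ K
  C : ∀ q ∈ Box, h q ∈ F.C ↔ q ∈ X
  V : ∀ c ∈ X, ∀ᶠ q in 𝓝 c, (h q ∈ F.V ↔ q.1 = 0)

/-- `n` Reidemeister moves suffice to change the overpass from `S` to `S'` in a box with the
frame given by `C`, `K` and `X`. -/
def LocalMove (n : ℕ) (C K X S S' : Set Plane) : Prop :=
  ∀ (F : Frame) (h : Plane ≃ₜ Plane) (T T' : Set Plane) (D E : LinkDiagram), Placed F h C K X →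
    (∀ q ∈ Box, h q ∈ T ↔ q ∈ S) → (∀ q ∈ Box, h q ∈ T' ↔ q ∈ S') →
    (∀ q ∉ Box, h q ∈ T ↔ h q ∈ T') → F.Rep T D → F.Rep T' E → Reach n D E

/-- A homeomorphism supported in the box preserves `C` and `K` and carries `S` to `S'`. -/
def LocalIso (C K S S' : Set Plane) : Prop :=
  ∃ φ : Plane ≃ₜ Plane, (∀ q ∉ Box, φ q = q) ∧ (∀ q ∈ Box, φ q ∈ C ↔ q ∈ C) ∧
    (∀ q ∈ K, φ q = q) ∧ ∀ q ∈ Box, φ q ∈ S' ↔ q ∈ S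

theorem LocalIso.symm {C K S S' : Set Plane} (h : LocalIso C K S S') : LocalIso C K S' S := by
  obtain ⟨φ, h1, h2, h3, h4⟩ := h
  have hb : ∀ q ∈ Box, φ.symm q ∈ Box := fun q hq => by
    rw [← mem_box_iff_of_fix h1]; simpa using hq
  refine ⟨φ.symm, fun q hq => ?_, fun q hq => ?_, fun q hq => ?_, fun q hq => ?_⟩
  · rw [Homeomorph.symm_apply_eq, h1 q hq]
  · simpa using (h2 _ (hb q hq)).symm
  · rw [Homeomorph.symm_apply_eq, h3 q hq]
  · simpa using (h4 _ (hb q hq)).symm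

theorem LocalIso.trans {C K S S' S'' : Set Plane} (h : LocalIso C K S S')
    (h' : LocalIso C K S' S'') : LocalIso C K S S'' := by
  obtain ⟨φ, h1, h2, h3, h4⟩ := h
  obtain ⟨φ', h1', h2', h3', h4'⟩ := h'
  have hb : ∀ q ∈ Box, φ q ∈ Box := fun q hq => (mem_box_iff_of_fix h1 q).2 hq
  refine ⟨φ.trans φ', fun q hq => ?_, fun q hq => ?_, fun q hq => ?_, fun q hq => ?_⟩
  · simp [h1 q hq, h1' q hq]
  · exact (h2' _ (hb q hq)).trans (h2 q hq)
  · simp [h3 q hq, h3' q hq]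
  · exact (h4' _ (hb q hq)).trans (h4 q hq)

/-! ### Transporting homeomorphisms of the box through a chart -/

section conj

variable {F : Frame} {h : Plane ≃ₜ Plane} {C K : Set Plane} {φ : Plane ≃ₜ Plane}

/-- The homeomorphism `φ` seen through `h`. -/
def conjHomeo (h φ : Plane ≃ₜ Plane) : Plane ≃ₜ Plane := (h.symm.trans φ).trans h

theorem conjHomeo_apply (h φ : Plane ≃ₜ Plane) (q : Plane) : conjHomeo h φ (h q) = h (φ q) := by
  simp [conjHomeo]

theorem forall_of_conj {P : Plane → Prop} (h : Plane ≃ₜ Plane) (H : ∀ q, P (h q)) (p : Plane) : P p := by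
  simpa using H (h.symm p)

theorem conj_frame (hP : Placed F h C K ∅) (h1 : ∀ q ∉ Box, φ q = q)
    (h2 : ∀ q ∈ Box, φ q ∈ C ↔ q ∈ C) (h3 : ∀ q ∈ K, φ q = q) :
    (∀ p, conjHomeo h φ p ∈ F.R ↔ p ∈ F.R) ∧ (∀ p ∈ F.K, conjHomeo h φ p = p) ∧
    (∀ c ∈ F.C, ∀ᶠ p in 𝓝 c, conjHomeo h φ p = p) ∧
    (∃ r : ℝ, ∀ p, r < ‖p‖ → conjHomeo h φ p = p) := by
  have hb := mem_box_iff_of_fix h1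
  have hid : ∀ q ∉ Box, conjHomeo h φ (h q) = h q := fun q hq => by
    rw [conjHomeo_apply, h1 q hq]
  refine ⟨forall_of_conj h fun q => ?_, forall_of_conj h fun q hq => ?_, forall_of_conj h fun c hc => ?_, ?_⟩
  · by_cases hq : q ∈ Box
    · rw [conjHomeo_apply, hP.R _ ((hb q).2 hq), hP.R q hq, h2 q hq]
    · rw [hid q hq]
  · by_cases hqB : q ∈ Box
    · rw [conjHomeo_apply, h3 q ((hP.K q hqB).1 hq)]
    · exact hid q hqB
  · have hcB : c ∉ Box := fun hcB => (hP.C c hcB).1 hc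
    have : ∀ᶠ p in 𝓝 (h c), h.symm p ∉ Box := by
      refine (isClosed_box.isOpen_compl.preimage h.symm.continuous).mem_nhds ?_
      simpa using hcB
    filter_upwards [this] with p hp
    simpa using hid _ hp
  · obtain ⟨r, hr⟩ := (isCompact_box.image h.continuous).isBounded.exists_norm_le
    refine ⟨r, forall_of_conj h fun q hq => hid q fun hqB => ?_⟩
    exact absurd (hr _ ⟨q, hqB, rfl⟩) (not_le.2 hq)

theorem conj_path {T T' S S' : Set Plane} (h1 : ∀ q ∉ Box, φ q = q) (h4 : ∀ q ∈ Box, φ q ∈ S' ↔ q ∈ S)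
    (hT : ∀ q ∈ Box, h q ∈ T ↔ q ∈ S) (hT' : ∀ q ∈ Box, h q ∈ T' ↔ q ∈ S')
    (hTT : ∀ q ∉ Box, h q ∈ T ↔ h q ∈ T') (p : Plane) : conjHomeo h φ p ∈ T' ↔ p ∈ T := by
  revert p
  refine forall_of_conj h fun q => ?_
  rw [conjHomeo_apply]
  by_cases hq : q ∈ Box
  · rw [hT' _ ((mem_box_iff_of_fix h1 q).2 hq), hT q hq, h4 q hq]
  · rw [h1 q hq, hTT q hq]

end conj

/-- Since no crossing of the frame lies in the box, the conjugated homeomorphism is the identity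
near each of them. Its support lies in the compact image of the box, so Alexander's trick applies.
-/
theorem LocalIso.localMove {C K S S' : Set Plane} (H : LocalIso C K S S') :
    LocalMove 0 C K ∅ S S' := by
  obtain ⟨φ, h1, h2, h3, h4⟩ := H
  intro F h T T' D D' hP hT hT' hTT hD hD'
  obtain ⟨c1, c2, c3, r, c4⟩ := conj_frame hP h1 h2 h3
  exact .of_isotopic ((hD.carries hD' c1 (conj_path h1 h4 hT hT' hTT) c2 c3).planarIsotopic r c4)

/-- The final diagram is pulled back by the homeomorphism. This supplies an intermediate diagram
with overpass `S'` without constructing one by hand. -/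
theorem LocalMove.trans_iso {n : ℕ} {C K S S' S'' : Set Plane} (H : LocalMove n C K ∅ S S')
    (H' : LocalIso C K S' S'') : LocalMove n C K ∅ S S'' := by
  obtain ⟨φ, h1, h2, h3, h4⟩ := H'
  intro F h T T'' D D'' hP hT hT'' hTT hD hD''
  obtain ⟨c1, c2, c3, r, c4⟩ := conj_frame hP h1 h2 h3
  set Φ := conjHomeo h φ
  have hrep : F.Rep (Φ ⁻¹' T'') (D''.map Φ.symm) :=
    hD''.map_symm c1 (fun p => Iff.rfl) c2 c3
  have e1 : Reach n D (D''.map Φ.symm) := by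
    refine H F h T (Φ ⁻¹' T'') D _ hP hT (fun q hq => ?_) (fun q hq => ?_) hD hrep
    · rw [mem_preimage, conjHomeo_apply, hT'' _ ((mem_box_iff_of_fix h1 q).2 hq), h4 q hq]
    · rw [mem_preimage, conjHomeo_apply, h1 q hq, hTT q hq]
  have e2 : Reach 0 (D''.map Φ.symm) D'' :=
    .of_isotopic ((hrep.carries hD'' c1 (fun p => Iff.rfl) c2 c3).planarIsotopic r c4)
  exact e1.trans e2

/-- Rotation by `π` and reversal of time. -/
theorem LocalMove.rotate {n : ℕ} {C K X S S' : Set Plane} (H : LocalMove n C K X S S') :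
    LocalMove n {q | -q ∈ C} {q | -q ∈ K} {q | -q ∈ X} {q | -q ∈ S'} {q | -q ∈ S} := by
  have hB : ∀ q : Plane, -q ∈ Box ↔ q ∈ Box := fun q => by simp [Box]
  intro F h T T' D D' hP hT hT' hTT hD hD'
  refine (H F ((Homeomorph.neg Plane).trans h) T' T D' D ?_ ?_ ?_ ?_ hD' hD).symm
  · refine ⟨fun q hq => ?_, fun q hq => ?_, fun q hq => ?_, fun c hc => ?_⟩
    · simpa using hP.R (-q) ((hB q).2 hq)
    · simpa using hP.K (-q) ((hB q).2 hq)
    · simpa using hP.C (-q) ((hB q).2 hq)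
    · have := hP.V (-c) (by simpa using hc)
      have h2 : Filter.Tendsto (fun q : Plane => -q) (𝓝 c) (𝓝 (-c)) := continuous_neg.tendsto c
      filter_upwards [h2.eventually this] with q hq
      simpa using hq
  · intro q hq
    simpa using hT' (-q) ((hB q).2 hq)
  · intro q hq
    simpa using hT (-q) ((hB q).2 hq)
  · intro q hq
    exact (hTT (-q) (by rwa [hB])).symm

/-! ### Flips in a subrectangle -/

/-- The affine map `(u, v) ↦ (a + r u, b + s v)`. -/
noncomputable def scaleHomeo (a b r s : ℝ) (hr : r ≠ 0) (hs : s ≠ 0) : Plane ≃ₜ Plane :=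
  ((Homeomorph.mulLeft₀ r hr).trans (Homeomorph.addLeft a)).prodCongr
    ((Homeomorph.mulLeft₀ s hs).trans (Homeomorph.addLeft b))

theorem scaleHomeo_apply (a b r s : ℝ) (hr : r ≠ 0) (hs : s ≠ 0) (q : Plane) :
    scaleHomeo a b r s hr hs q = (a + r * q.1, b + s * q.2) := rfl

theorem scaleHomeo_mem_box {a b r s : ℝ} {hr : r ≠ 0} {hs : s ≠ 0} (ha : |a| + 3/2 * |r| ≤ 1)
    (hb : |b| + 3/2 * |s| ≤ 1) {q : Plane} (h1 : |q.1| < 3/2) (h2 : |q.2| < 3/2) :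
    scaleHomeo a b r s hr hs q ∈ Box := by
  rw [scaleHomeo_apply]
  constructor
  · refine (abs_add_le _ _).trans (le_trans ?_ ha)
    rw [abs_mul]
    have := mul_le_mul_of_nonneg_left h1.le (abs_nonneg r)
    linarith
  · refine (abs_add_le _ _).trans (le_trans ?_ hb)
    rw [abs_mul]
    have := mul_le_mul_of_nonneg_left h2.le (abs_nonneg s)
    linarith

/-- Transplants a flip of the standard square to the rectangle with centre `(a, b)` and half-sides
`|r|`, `|s|`; negative `r` or `s` reflect it. The bounds `ha`, `hb` keep the support of the flip in
the box. The set `A` is the part common to both overpasses and lies where the flip is the identity;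
the frame is either invariant inside the support or fixed pointwise. -/
theorem localIso_of_flip {φ : Plane ≃ₜ Plane} {P P' Z Fix : Set Plane}
    (hsupp : ∀ p : Plane, (3/2 ≤ |p.1| ∨ 3/2 ≤ |p.2|) → φ p = p) (hfix : ∀ p ∈ Fix, φ p = p)
    (hP : ∀ p, φ p ∈ P' ↔ p ∈ P) (hZ : ∀ p, φ p ∈ Z ↔ p ∈ Z)
    {C K S S' : Set Plane} (a b r s : ℝ) (hr : r ≠ 0) (hs : s ≠ 0)
    (ha : |a| + 3/2 * |r| ≤ 1) (hb : |b| + 3/2 * |s| ≤ 1) (A : Set Plane)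
    (hA : ∀ q ∈ A, q ∈ Fix ∨ 3/2 ≤ |q.1| ∨ 3/2 ≤ |q.2|)
    (hS : ∀ q : Plane, (a + r * q.1, b + s * q.2) ∈ S ↔ q ∈ P ∨ q ∈ A)
    (hS' : ∀ q : Plane, (a + r * q.1, b + s * q.2) ∈ S' ↔ q ∈ P' ∨ q ∈ A)
    (hC : (∀ q : Plane, |q.1| < 3/2 → |q.2| < 3/2 → ((a + r * q.1, b + s * q.2) ∈ C ↔ q ∈ Z)) ∨
      ∀ q : Plane, (a + r * q.1, b + s * q.2) ∈ C → q ∈ Fix ∨ 3/2 ≤ |q.1| ∨ 3/2 ≤ |q.2|)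
    (hK : ∀ q : Plane, (a + r * q.1, b + s * q.2) ∈ K → q ∈ Fix ∨ 3/2 ≤ |q.1| ∨ 3/2 ≤ |q.2|) :
    LocalIso C K S S' := by
  set g := scaleHomeo a b r s hr hs
  have hg : ∀ q, g q = (a + r * q.1, b + s * q.2) := fun q => rfl
  have hfx : ∀ q : Plane, q ∈ Fix ∨ 3/2 ≤ |q.1| ∨ 3/2 ≤ |q.2| → φ q = q := fun q hq =>
    hq.elim (hfix q) (hsupp q)
  have hinv : ∀ W : Set Plane, (∀ q ∈ W, φ q = q) → ∀ q, φ q ∈ W ↔ q ∈ W := fun W hW q => by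
    constructor
    · intro h
      have := φ.injective (hW _ h)
      rwa [← this]
    · intro h; rwa [hW q h]
  have hin : ∀ q : Plane, (|(φ q).1| < 3/2 ∧ |(φ q).2| < 3/2) ↔ (|q.1| < 3/2 ∧ |q.2| < 3/2) := fun q => by
    have := hinv {q : Plane | 3/2 ≤ |q.1| ∨ 3/2 ≤ |q.2|} (fun q hq => hsupp q hq) q
    simp only [mem_ofPred_eq] at this
    rw [← not_iff_not]
    simpa only [not_and_or, not_lt] using this
  refine ⟨conjHomeo g φ, forall_of_conj g fun q hq => ?_, forall_of_conj g fun q _ => ?_,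
    forall_of_conj g fun q hq => ?_, forall_of_conj g fun q _ => ?_⟩
  · rw [conjHomeo_apply, hsupp q]
    by_contra hcon
    push Not at hcon
    exact hq (scaleHomeo_mem_box ha hb hcon.1 hcon.2)
  · rw [conjHomeo_apply, hg, hg]
    rcases hC with hC | hC
    · by_cases hq : |q.1| < 3/2 ∧ |q.2| < 3/2
      · have hq' := (hin q).2 hq
        rw [hC q hq.1 hq.2, hC _ hq'.1 hq'.2, hZ]
      · have : φ q = q := hsupp q (by simpa only [not_and_or, not_lt] using hq)
        rw [this]
    · exact hinv {q | (a + r * q.1, b + s * q.2) ∈ C} (fun q hq => hfx q (hC q hq)) q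
  · rw [conjHomeo_apply, hfx q (hK q hq)]
  · rw [conjHomeo_apply, hg, hg, hS, hS', hP, hinv A (fun q hq => hfx q (hA q hq))]

/-- The left and the upper side of a subrectangle are moved to the lower and the right side. -/
theorem localIso_mono {w : ℝ → ℝ} (hw : Transversal w)
    {C K S S' : Set Plane} (a b r s : ℝ) (hr : r ≠ 0) (hs : s ≠ 0)
    (ha : |a| + 3/2 * |r| ≤ 1) (hb : |b| + 3/2 * |s| ≤ 1) (A Fix : Set Plane)
    (hFix : Fix = {q : Plane | (q.1 ≤ -1 ∧ q.2 ≤ -1) ∨ (1 ≤ q.1 ∧ 1 ≤ q.2)})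
    (hA : ∀ q ∈ A, q ∈ Fix ∨ 3/2 ≤ |q.1| ∨ 3/2 ≤ |q.2|)
    (hS : ∀ q : Plane, (a + r * q.1, b + s * q.2) ∈ S ↔
      ((q.1 = -1 ∧ -1 ≤ q.2 ∧ q.2 ≤ 1) ∨ (q.2 = 1 ∧ -1 ≤ q.1 ∧ q.1 ≤ 1)) ∨ q ∈ A)
    (hS' : ∀ q : Plane, (a + r * q.1, b + s * q.2) ∈ S' ↔
      ((q.2 = -1 ∧ -1 ≤ q.1 ∧ q.1 ≤ 1) ∨ (q.1 = 1 ∧ -1 ≤ q.2 ∧ q.2 ≤ 1)) ∨ q ∈ A)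
    (hC : (∀ q : Plane, |q.1| < 3/2 → |q.2| < 3/2 → ((a + r * q.1, b + s * q.2) ∈ C ↔
        q.1 + q.2 + w (q.1 - q.2) = 0)) ∨
      ∀ q : Plane, (a + r * q.1, b + s * q.2) ∈ C → q ∈ Fix ∨ 3/2 ≤ |q.1| ∨ 3/2 ≤ |q.2|)
    (hK : ∀ q : Plane, (a + r * q.1, b + s * q.2) ∈ K → q ∈ Fix ∨ 3/2 ≤ |q.1| ∨ 3/2 ≤ |q.2|) :
    LocalIso C K S S' := by
  obtain ⟨φ, h1, h2, h3, h4, h5⟩ := exists_monoFlip hw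
  subst hFix
  refine localIso_of_flip (φ := φ) (P := vseg (-1) (-1) 1 ∪ hseg 1 (-1) 1)
    (P' := hseg (-1) (-1) 1 ∪ vseg 1 (-1) 1) (Z := {q | q.1 + q.2 + w (q.1 - q.2) = 0})
    h1 ?_ h4 h5 a b r s hr hs ha hb A hA ?_ ?_ hC hK
  · rintro p (⟨p1, p2⟩ | ⟨p1, p2⟩)
    · exact h2 p p1 p2
    · exact h3 p p1 p2
  · intro q
    rw [hS q]
    simp only [vseg, hseg, mem_union, mem_ofPred_eq, uIcc_of_le (show (-1 : ℝ) ≤ 1 by norm_num), mem_Icc]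
  · intro q
    rw [hS' q]
    simp only [vseg, hseg, mem_union, mem_ofPred_eq, uIcc_of_le (show (-1 : ℝ) ≤ 1 by norm_num), mem_Icc]

/-- Three sides of a subrectangle are moved to the upper side. -/
theorem localIso_finger
    {C K S S' : Set Plane} (a b r s : ℝ) (hr : r ≠ 0) (hs : s ≠ 0)
    (ha : |a| + 3/2 * |r| ≤ 1) (hb : |b| + 3/2 * |s| ≤ 1) (A Fix : Set Plane)
    (hFix : Fix = {q : Plane | 1 ≤ |q.1| ∧ 1 ≤ q.2})
    (hA : ∀ q ∈ A, q ∈ Fix ∨ 3/2 ≤ |q.1| ∨ 3/2 ≤ |q.2|)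
    (hS : ∀ q : Plane, (a + r * q.1, b + s * q.2) ∈ S ↔
      ((q.1 = -1 ∧ -1 ≤ q.2 ∧ q.2 ≤ 1) ∨ (q.2 = -1 ∧ -1 ≤ q.1 ∧ q.1 ≤ 1) ∨
        (q.1 = 1 ∧ -1 ≤ q.2 ∧ q.2 ≤ 1)) ∨ q ∈ A)
    (hS' : ∀ q : Plane, (a + r * q.1, b + s * q.2) ∈ S' ↔
      (q.2 = 1 ∧ -1 ≤ q.1 ∧ q.1 ≤ 1) ∨ q ∈ A)
    (hC : ∀ q : Plane, (a + r * q.1, b + s * q.2) ∈ C → q ∈ Fix ∨ 3/2 ≤ |q.1| ∨ 3/2 ≤ |q.2|)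
    (hK : ∀ q : Plane, (a + r * q.1, b + s * q.2) ∈ K → q ∈ Fix ∨ 3/2 ≤ |q.1| ∨ 3/2 ≤ |q.2|) :
    LocalIso C K S S' := by
  obtain ⟨φ, h1, h2, h3⟩ := exists_fingerFlip
  subst hFix
  refine localIso_of_flip (φ := φ) (P := vseg (-1) (-1) 1 ∪ hseg (-1) (-1) 1 ∪ vseg 1 (-1) 1)
    (P' := hseg 1 (-1) 1) (Z := ∅)
    h1 (fun p hp => h2 p hp.1 hp.2) h3 (fun _ => Iff.rfl) a b r s hr hs ha hb A hA ?_ ?_ (Or.inr hC) hK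
  · intro q
    rw [hS q]
    simp only [vseg, hseg, mem_union, mem_ofPred_eq, uIcc_of_le (show (-1 : ℝ) ≤ 1 by norm_num),
      mem_Icc, or_assoc]
  · intro q
    rw [hS' q]
    simp only [hseg, mem_ofPred_eq, uIcc_of_le (show (-1 : ℝ) ≤ 1 by norm_num), mem_Icc]

/-! ### Local pictures -/

/-- An overpass that steps up at the abscissa `t`. -/
def stairs (t : ℝ) : Set Plane :=
  {q | (q.2 = -1/2 ∧ q.1 ≤ t) ∨ (q.1 = t ∧ -1/2 ≤ q.2 ∧ q.2 ≤ 1/2) ∨ (q.2 = 1/2 ∧ t ≤ q.1)}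

/-- An overpass that comes along the vertical axis, from the points described by `Z`,
turns to the right at the height `1/2`. -/
def highTurn (Z : Set ℝ) : Set Plane :=
  {q | (q.1 = 0 ∧ q.2 ∈ Z) ∨ (q.2 = 1/2 ∧ 0 ≤ q.1)}

/-- An overpass that comes along the vertical axis, turns to the right at the height `-1/2`
and steps up at the abscissa `1/2`. -/
def lowTurn (Z : Set ℝ) : Set Plane :=
  {q | (q.1 = 0 ∧ q.2 ∈ Z) ∨ (q.2 = -1/2 ∧ 0 ≤ q.1 ∧ q.1 ≤ 1/2) ∨
    (q.1 = 1/2 ∧ -1/2 ≤ q.2 ∧ q.2 ≤ 1/2) ∨ (q.2 = 1/2 ∧ 1/2 ≤ q.1)}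

/-- The two staircases differ by the two pairs of sides of the square of half-side `1/2`, so the
monotone flip applies whenever the frame is empty or a transversal curve. -/
theorem localIso_stairs {w : ℝ → ℝ} (hw : Transversal w) {C K : Set Plane}
    (hC : (∀ q : Plane, |q.1| < 3/2 → |q.2| < 3/2 → ((0 + 1/2 * q.1, 0 + 1/2 * q.2) ∈ C ↔
        q.1 + q.2 + w (q.1 - q.2) = 0)) ∨ C = ∅) (hK : K = ∅) :
    LocalIso C K (stairs (-1/2)) (stairs (1/2)) := by
  subst hK
  refine localIso_mono hw 0 0 (1/2) (1/2) (by norm_num) (by norm_num) (by norm_num) (by norm_num)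
    {q | (q.2 = -1 ∧ q.1 ≤ -1) ∨ (q.2 = 1 ∧ 1 ≤ q.1)} _ rfl ?_ ?_ ?_ ?_ ?_
  · rintro q (h | h) <;> left
    · left; exact ⟨h.2, h.1.le⟩
    · right; exact ⟨h.2, h.1.ge⟩
  · intro q
    simp only [stairs, mem_ofPred_eq]
    grind
  · intro q
    simp only [stairs, mem_ofPred_eq]
    grind
  · rcases hC with hC | hC
    · exact Or.inl hC
    · right; intro q hq; rw [hC] at hq; exact absurd hq (by simp)
  · intro q hq; exact absurd hq (by simp)

/-- In this family the compass letters list the rays of the frame that leave the centre of the box.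
For an empty frame, `NS`, `WE`, `NE` and `SW` an isotopy is enough: the last four are transversal
curves, met once by the step before and after. For `SE` and `NW` the number of intersections changes
between `0` and `2`, which costs a second move; the full cross costs a third move. -/
theorem localMove_stairs_empty : LocalMove 0 ∅ ∅ ∅ (stairs (-1/2)) (stairs (1/2)) :=
  (localIso_stairs transversal_id (Or.inr rfl) rfl).localMove

theorem localMove_stairs_NS : LocalMove 0 {q | q.1 = 0} ∅ ∅ (stairs (-1/2)) (stairs (1/2)) := by
  refine (localIso_stairs transversal_id (Or.inl fun q _ _ => ?_) rfl).localMove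
  simp only [mem_ofPred_eq]
  constructor <;> intro h <;> linarith

theorem localMove_stairs_WE : LocalMove 0 {q | q.2 = 0} ∅ ∅ (stairs (-1/2)) (stairs (1/2)) := by
  refine (localIso_stairs transversal_neg (Or.inl fun q _ _ => ?_) rfl).localMove
  simp only [mem_ofPred_eq]
  constructor <;> intro h <;> linarith

theorem localMove_stairs_NE : LocalMove 0 {q | (q.1 = 0 ∧ 0 ≤ q.2) ∨ (q.2 = 0 ∧ 0 ≤ q.1)} ∅ ∅
    (stairs (-1/2)) (stairs (1/2)) := by
  refine (localIso_stairs transversal_neg_abs (Or.inl fun q _ _ => ?_) rfl).localMove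
  simp only [mem_ofPred_eq]
  rcases abs_cases (q.1 - q.2) with ⟨e, _⟩ | ⟨e, _⟩ <;> rw [e] <;> grind

theorem localMove_stairs_SW : LocalMove 0 {q | (q.1 = 0 ∧ q.2 ≤ 0) ∨ (q.2 = 0 ∧ q.1 ≤ 0)} ∅ ∅
    (stairs (-1/2)) (stairs (1/2)) := by
  refine (localIso_stairs transversal_abs (Or.inl fun q _ _ => ?_) rfl).localMove
  simp only [mem_ofPred_eq]
  rcases abs_cases (q.1 - q.2) with ⟨e, _⟩ | ⟨e, _⟩ <;> rw [e] <;> grind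

/-- Crossings within the frame do not see the overpass. At the others the overstrand is the
overpass, and the complement of the box is open, so agreement outside the box gives agreement of
germs. -/
theorem Frame.Rep.agreeOutside {F : Frame} {T T' : Set Plane} {D D' : LinkDiagram} (hD : F.Rep T D)
    (hD' : F.Rep T' D') {h : Plane ≃ₜ Plane} (hT : ∀ q ∉ Box, h q ∈ T ↔ h q ∈ T') :
    AgreeOutside h D D' := by
  refine ⟨fun q hq => ?_, fun q hq => ?_, fun q hq hc => ?_⟩
  · rw [hD.shadow, hD'.shadow, hT q hq]
  · rw [hD.cross, hD'.cross, hT q hq]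
  · rcases (hD.cross _).1 hc with h1 | ⟨h1, h2, h3⟩
    · filter_upwards [hD.over_frame _ h1, hD'.over_frame _ h1] with p p1 p2
      rw [p1, p2]
    · have : ∀ᶠ p in 𝓝 (h q), h.symm p ∉ Box := by
        refine (isClosed_box.isOpen_compl.preimage h.symm.continuous).mem_nhds ?_
        simpa using hq
      filter_upwards [hD.over_path _ h1 h2 h3, hD'.over_path _ h1 ((hT q hq).1 h2) h3, this]
        with p p1 p2 p3
      rw [p1, p2]
      simpa using hT _ p3

theorem eventually_near (c : Plane) {δ : ℝ} (hδ : 0 < δ) :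
    ∀ᶠ q in 𝓝 c, |q.1 - c.1| < δ ∧ |q.2 - c.2| < δ := by
  have h1 : ∀ᶠ q : Plane in 𝓝 c, |q.1 - c.1| < δ := by
    refine (isOpen_lt (by fun_prop) continuous_const).mem_nhds ?_
    simpa using hδ
  have h2 : ∀ᶠ q : Plane in 𝓝 c, |q.2 - c.2| < δ := by
    refine (isOpen_lt (by fun_prop) continuous_const).mem_nhds ?_
    simpa using hδ
  exact h1.and h2

/-- A straight line at height `1/2` with a finger that reaches down to the height `-1/2`. -/
def finger : Set Plane :=
  {q | (q.2 = 1/2 ∧ (q.1 ≤ -1/2 ∨ 1/2 ≤ q.1)) ∨ (q.1 = -1/2 ∧ -1/2 ≤ q.2 ∧ q.2 ≤ 1/2) ∨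
    (q.1 = 1/2 ∧ -1/2 ≤ q.2 ∧ q.2 ≤ 1/2) ∨ (q.2 = -1/2 ∧ -1/2 ≤ q.1 ∧ q.1 ≤ 1/2)}

theorem mem_shadow_pictureII' {q : Plane} (hq : q ∈ Box) :
    q ∈ (pictureII' false).shadow ↔ q.2 = 0 ∨ q ∈ finger := by
  have h := abs_le.1 hq.1
  simp only [pictureII', hseg, vseg, mem_union, mem_ofPred_eq, finger,
    uIcc_of_le (show (-1 : ℝ) ≤ 1 by norm_num), uIcc_of_le (show (-1 : ℝ) ≤ -1/2 by norm_num),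
    uIcc_of_le (show (-1/2 : ℝ) ≤ 1/2 by norm_num), uIcc_of_le (show (1/2 : ℝ) ≤ 1 by norm_num),
    mem_Icc]
  obtain ⟨h1, h2⟩ := h
  clear hq
  generalize q.1 = x at *
  generalize q.2 = y at *
  grind

theorem mem_cross_pictureII' {q : Plane} :
    q ∈ (pictureII' false).cross ↔ q.2 = 0 ∧ q ∈ finger := by
  simp only [pictureII', mem_insert_iff, mem_singleton_iff, Prod.ext_iff, finger, mem_ofPred_eq]
  generalize q.1 = x at *
  generalize q.2 = y at *
  grind

theorem mem_finger_of_near {c q : Plane} (hc : c = (-1/2, 0) ∨ c = (1/2, 0))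
    (hq : |q.1 - c.1| < 1/4 ∧ |q.2 - c.2| < 1/4) : q ∈ finger ↔ q.1 = c.1 := by
  simp only [finger, mem_ofPred_eq]
  obtain ⟨⟨h1, h2⟩, h3, h4⟩ := And.imp abs_lt.1 abs_lt.1 hq
  rcases hc with rfl | rfl
  all_goals
    clear hq
    generalize q.1 = x at *
    generalize q.2 = y at *
    simp only [le_antisymm_iff] at *
    grind

/-- The second Reidemeister move in a vertical strip of the box. -/
theorem localMove_two {C K X S S' : Set Plane} (a r : ℝ) (hr : 0 < r) (ha : |a| + r ≤ 1)
    (hC : ∀ q ∈ Box, (a + r * q.1, q.2) ∈ C ↔ q.2 = 0)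
    (hS : ∀ q ∈ Box, (a + r * q.1, q.2) ∈ S ↔ q.2 = 1/2)
    (hS' : ∀ q ∈ Box, (a + r * q.1, q.2) ∈ S' ↔ q ∈ finger)
    (hout : ∀ q ∈ Box, r < |q.1 - a| → (q ∈ S ↔ q ∈ S'))
    (hK : ∀ q ∈ Box, (a + r * q.1, q.2) ∉ K) (hX : ∀ q ∈ Box, (a + r * q.1, q.2) ∉ X) :
    LocalMove 1 C K X S S' := by
  intro F h T T' D D' hP hT hT' hTT hD hD'
  set g := scaleHomeo a 0 r 1 hr.ne' one_ne_zero
  have hg : ∀ q, g q = (a + r * q.1, q.2) := fun q => by simp [g, scaleHomeo_apply]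
  have hgB : ∀ q ∈ Box, g q ∈ Box := fun q hq => by
    rw [hg]
    refine ⟨?_, hq.2⟩
    refine (abs_add_le _ _).trans (le_trans ?_ ha)
    rw [abs_mul, abs_of_pos hr]
    have := mul_le_mul_of_nonneg_left hq.1 hr.le
    linarith
  have hgC : ∀ q ∈ Box, h (g q) ∈ F.R ↔ q.2 = 0 := fun q hq => by rw [hP.R _ (hgB q hq), hg, hC q hq]
  have hgT : ∀ q ∈ Box, h (g q) ∈ T ↔ q.2 = 1/2 := fun q hq => by rw [hT _ (hgB q hq), hg, hS q hq]
  have hgT' : ∀ q ∈ Box, h (g q) ∈ T' ↔ q ∈ finger := fun q hq => by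
    rw [hT' _ (hgB q hq), hg, hS' q hq]
  have hgK : ∀ q ∈ Box, h (g q) ∉ F.K := fun q hq => by rw [hP.K _ (hgB q hq), hg]; exact hK q hq
  have hgX : ∀ q ∈ Box, h (g q) ∉ F.C := fun q hq => by rw [hP.C _ (hgB q hq), hg]; exact hX q hq
  -- The pushed arc is the overpass, so the straight arc is not over and the flag is `false`.
  refine ⟨1, le_rfl, .of_move ⟨_, _, .RII false, Or.inl ⟨g.trans h, ⟨?_, ?_, ?_⟩, ⟨?_, ?_, ?_⟩, ?_⟩⟩⟩
  · intro q hq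
    have hq1 := abs_le.1 hq.1
    rw [Homeomorph.trans_apply, hD.shadow, hgC q hq, hgT q hq]
    simp only [pictureII, hseg, mem_union, mem_ofPred_eq, uIcc_of_le (show (-1 : ℝ) ≤ 1 by norm_num),
      mem_Icc]
    tauto
  · intro q hq
    rw [Homeomorph.trans_apply, hD.cross, hgC q hq, hgT q hq]
    simp only [pictureII, mem_empty_iff_false, iff_false, not_or]
    refine ⟨hgX q hq, ?_⟩
    rintro ⟨h1, h2, -⟩
    rw [h1] at h2; norm_num at h2
  · rintro c ⟨⟩
  · intro q hq
    rw [Homeomorph.trans_apply, hD'.shadow, hgC q hq, hgT' q hq, mem_shadow_pictureII' hq]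
  · intro q hq
    rw [Homeomorph.trans_apply, hD'.cross, hgC q hq, hgT' q hq, mem_cross_pictureII']
    have h1 := hgX q hq
    have h2 := hgK q hq
    tauto
  · intro c hc
    have hcf := mem_cross_pictureII'.1 hc
    have hc' : |c.1| < 1 ∧ |c.2| < 1 := by
      rcases hc with rfl | rfl <;> constructor <;> norm_num [abs_of_nonneg, abs_of_neg]
    have hcB : c ∈ Box := ⟨hc'.1.le, hc'.2.le⟩
    have h1 := hD'.over_path (h (g c)) ((hgC c hcB).2 hcf.1) ((hgT' c hcB).2 hcf.2) (hgK c hcB)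
    filter_upwards [(g.trans h).continuous.continuousAt.eventually h1, box_mem_nhds hc'.1 hc'.2,
      eventually_near c (show (0:ℝ) < 1/4 by norm_num)] with q q1 q2 q3
    have q1' : (g.trans h) q ∈ D'.overAt ((g.trans h) c) ↔ h (g q) ∈ T' := q1
    rw [q1', hgT' q q2, mem_finger_of_near hc q3]
    simp [pictureII']
  · refine hD.agreeOutside hD' fun q hq => ?_
    change h (g q) ∈ T ↔ h (g q) ∈ T'
    by_cases hq' : g q ∈ Box
    · rw [hT _ hq', hT' _ hq']
      refine hout _ hq' ?_
      rw [hg] at hq' ⊢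
      have h3 : 1 < |q.1| := by
        by_contra hcon
        exact hq ⟨not_lt.1 hcon, hq'.2⟩
      have h4 : a + r * q.1 - a = r * q.1 := by ring
      simp only [h4, abs_mul, abs_of_pos hr]
      nlinarith
    · exact hTT _ hq'

theorem exists_fin_three {p : Fin 3 → Prop} : (∃ i, p i) ↔ p 0 ∨ p 1 ∨ p 2 := by
  simp [Fin.exists_fin_succ]

/-- The strands of the third move inside the box. -/
theorem mem_strandIII {t : ℝ} (ht : t = 1/2 ∨ t = -1/2) {q : Plane} (hq : q ∈ Box) :
    (q ∈ strandIII t 0 ↔ q.2 = 0) ∧ (q ∈ strandIII t 1 ↔ q.1 = 0) ∧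
      (q ∈ strandIII t 2 ↔ q ∈ stairs t) := by
  have hq1 := abs_le.1 hq.1
  have hq2 := abs_le.1 hq.2
  have h1 : (-1 : ℝ) ≤ t ∧ t ≤ 1 := by rcases ht with rfl | rfl <;> norm_num
  simp only [strandIII, stairs, hseg, vseg, mem_ofPred_eq, mem_union, Matrix.cons_val,
    uIcc_of_le (show (-1 : ℝ) ≤ 1 by norm_num), uIcc_of_le h1.1, uIcc_of_le h1.2,
    uIcc_of_le (show (-1/2 : ℝ) ≤ 1/2 by norm_num), mem_Icc]
  refine ⟨?_, ?_, ?_⟩ <;> grind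

theorem strandIII_subset_box {t : ℝ} (ht : t = 1/2 ∨ t = -1/2) (i : Fin 3) :
    strandIII t i ⊆ Box := by
  have h1 : (-1 : ℝ) ≤ t ∧ t ≤ 1 := by rcases ht with rfl | rfl <;> norm_num
  intro q
  simp only [Box, mem_ofPred_eq, abs_le]
  fin_cases i <;>
  simp only [strandIII, hseg, vseg, mem_ofPred_eq, mem_union, Matrix.cons_val, Fin.reduceFinMk,
    uIcc_of_le (show (-1 : ℝ) ≤ 1 by norm_num), uIcc_of_le h1.1, uIcc_of_le h1.2,
    uIcc_of_le (show (-1/2 : ℝ) ≤ 1/2 by norm_num), mem_Icc, Fin.zero_eta, Fin.mk_one]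
  · rintro ⟨e, h⟩; rw [e]; norm_num; exact h
  · rintro ⟨e, h⟩; rw [e]; norm_num; exact h
  · rintro ((⟨e, h⟩ | ⟨e, h⟩) | ⟨e, h⟩) <;> rw [e] <;>
      refine ⟨⟨?_, ?_⟩, ?_, ?_⟩ <;> linarith

/-- The crossings in the third move. -/
theorem mem_cross_pictureIII {t : ℝ} (ht : t = 1/2 ∨ t = -1/2) (r : Equiv.Perm (Fin 3)) {q : Plane} :
    q ∈ (pictureIII r t).cross ↔ q = (0, 0) ∨ q = (t, 0) ∨ q = (0, -t) := by
  constructor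
  · rintro ⟨i, j, hij, hi, hj⟩
    have hB := strandIII_subset_box ht i hi
    obtain ⟨h0, h1, h2⟩ := mem_strandIII ht hB
    simp only [stairs, mem_ofPred_eq] at h2
    simp only [Prod.ext_iff]
    fin_cases i <;> fin_cases j <;> simp only [Fin.reduceFinMk, Fin.zero_eta, Fin.mk_one] at hi hj hij <;>
      first
      | exact absurd rfl hij
      | (simp only [h0, h1, h2] at hi hj; grind)
  · intro h
    have hB : q ∈ Box := by
      rcases ht with rfl | rfl <;> rcases h with rfl | rfl | rfl <;>
        constructor <;> norm_num [abs_of_nonneg, abs_of_neg]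
    obtain ⟨h0, h1, h2⟩ := mem_strandIII ht hB
    simp only [stairs, mem_ofPred_eq] at h2
    rcases h with h | h | h
    · exact ⟨0, 1, by decide, by rw [h0, h], by rw [h1, h]⟩
    · refine ⟨0, 2, by decide, by rw [h0, h], ?_⟩
      rw [h2, h]; simp only; grind
    · refine ⟨1, 2, by decide, by rw [h1, h], ?_⟩
      rw [h2, h]; simp only; grind

/-- The third Reidemeister move in the box. -/
theorem localMove_stairs_NSWE :
    LocalMove 1 {q | q.1 = 0 ∨ q.2 = 0} ∅ {(0, 0)} (stairs (-1/2)) (stairs (1/2)) := by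
  intro F h T T' D D' hP hT hT' hTT hD hD'
  -- With the identity permutation the horizontal axis is lowest, the vertical axis is in the middle
  -- and the staircase, which is the overpass, is on top.
  have key : ∀ (t : ℝ) (T : Set Plane) (D : LinkDiagram), (t = 1/2 ∨ t = -1/2) →
      (∀ q ∈ Box, h q ∈ T ↔ q ∈ stairs t) → F.Rep T D → Shows h (pictureIII (Equiv.refl _) t) D := by
    intro t T D ht hT hD
    refine ⟨fun q hq => ?_, fun q hq => ?_, fun c hc => ?_⟩
    · obtain ⟨h0, h1, h2⟩ := mem_strandIII ht hq
      rw [hD.shadow, hP.R q hq, hT q hq]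
      simp only [pictureIII, mem_iUnion, exists_fin_three, h0, h1, h2, mem_ofPred_eq]
      tauto
    · rw [mem_cross_pictureIII ht, hD.cross, hP.R q hq, hT q hq, hP.C q hq, hP.K q hq]
      simp only [mem_singleton_iff, stairs, mem_ofPred_eq, Prod.ext_iff, mem_empty_iff_false]
      grind
    · rw [mem_cross_pictureIII ht] at hc
      have hin : |c.1| < 1 ∧ |c.2| < 1 := by
        rcases ht with rfl | rfl <;> rcases hc with rfl | rfl | rfl <;>
          constructor <;> norm_num [abs_of_nonneg, abs_of_neg]
      have hcB : c ∈ Box := ⟨hin.1.le, hin.2.le⟩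
      obtain ⟨c0, c1, c2⟩ := mem_strandIII ht hcB
      have hnh := box_mem_nhds hin.1 hin.2
      by_cases hc0 : c = (0, 0)
      · filter_upwards [hnh, hP.V c (by simp [hc0]),
          h.continuous.continuousAt.eventually (hD.over_frame (h c) ((hP.C c hcB).2 (by simp [hc0])))]
          with q q1 q2 q3
        obtain ⟨h0, h1, h2⟩ := mem_strandIII ht q1
        have c2' : c ∉ strandIII t 2 := by
          rw [c2, hc0]; simp only [stairs, mem_ofPred_eq]; grind
        rw [q3, q2]
        have c0' := c0.2 (by rw [hc0])
        have c1' := c1.2 (by rw [hc0])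
        simp only [pictureIII, mem_ofPred_eq, Fin.exists_fin_succ, Fin.forall_fin_succ]
        simp [c2', c0', c1', h1]
      · have hcR : h c ∈ F.R := by
          rw [hP.R c hcB]
          rcases hc with rfl | rfl | rfl <;> simp
        have hcS : c ∈ stairs t := by
          simp only [stairs, mem_ofPred_eq]
          rcases hc with h | h | h
          · exact absurd h hc0
          · rw [h]; simp only; grind
          · rw [h]; simp only; grind
        have hcK : h c ∉ F.K := by rw [hP.K c hcB]; simp
        have c2' := c2.2 hcS
        filter_upwards [hnh,
          h.continuous.continuousAt.eventually (hD.over_path (h c) hcR ((hT c hcB).2 hcS) hcK)]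
          with q q1 q3
        obtain ⟨h0, h1, h2⟩ := mem_strandIII ht q1
        rw [q3, hT q q1]
        simp only [pictureIII, mem_ofPred_eq, Fin.exists_fin_succ, Fin.forall_fin_succ]
        simp [c2', h2]
  -- The step travels from `-1/2` to `1/2`, opposite to the order in `ReidemeisterPair`; hence
  -- `Or.inr`.
  refine ⟨1, le_rfl, .of_move ⟨_, _, .RIII (Equiv.refl _), Or.inr ⟨h, ?_, ?_, ?_⟩⟩⟩
  · exact key _ T D (Or.inr rfl) hT hD
  · exact key _ T' D' (Or.inl rfl) hT' hD'
  · exact hD.agreeOutside hD' hTT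

/-- An overpass that steps up at `-1/2`, down at `t` and up again at `1/2`. -/
def zigzag (t : ℝ) : Set Plane :=
  {q | (q.2 = -1/2 ∧ q.1 ≤ -1/2) ∨ (q.1 = -1/2 ∧ -1/2 ≤ q.2 ∧ q.2 ≤ 1/2) ∨
    (q.2 = 1/2 ∧ -1/2 ≤ q.1 ∧ q.1 ≤ t) ∨ (q.1 = t ∧ -1/2 ≤ q.2 ∧ q.2 ≤ 1/2) ∨
    (q.2 = -1/2 ∧ t ≤ q.1 ∧ q.1 ≤ 1/2) ∨ (q.1 = 1/2 ∧ -1/2 ≤ q.2 ∧ q.2 ≤ 1/2) ∨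
    (q.2 = 1/2 ∧ 1/2 ≤ q.1)}

/-- At first the overpass misses the corner, at the end it crosses both rays. A finger is pushed
down over the right ray, one flank of it slides around the corner, and the bump that remains on the
left is retracted. -/
theorem localMove_stairs_SE : LocalMove 1 {q | (q.1 = 0 ∧ q.2 ≤ 0) ∨ (q.2 = 0 ∧ 0 ≤ q.1)} ∅ ∅
    (stairs (-1/2)) (stairs (1/2)) := by
  have s1 : LocalMove 1 {q : Plane | (q.1 = 0 ∧ q.2 ≤ 0) ∨ (q.2 = 0 ∧ 0 ≤ q.1)} ∅ ∅
      (stairs (-1/2)) (zigzag (1/4)) := by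
    -- The strip `[1/8, 5/8]` misses the downward ray, so within it the frame is a horizontal line;
    -- the flanks of the finger land at `1/4` and `1/2`.
    refine localMove_two (3/8) (1/4) (by norm_num) (by norm_num [abs_of_pos]) ?_ ?_ ?_ ?_ ?_ ?_
    · intro q hq
      obtain ⟨h1, h2⟩ := abs_le.1 hq.1
      simp only [mem_ofPred_eq]
      grind
    · intro q hq
      obtain ⟨h1, h2⟩ := abs_le.1 hq.1
      simp only [stairs, mem_ofPred_eq]
      grind
    · intro q hq
      obtain ⟨h1, h2⟩ := abs_le.1 hq.1
      simp only [zigzag, finger, mem_ofPred_eq]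
      generalize q.1 = x at *
      generalize q.2 = y at *
      clear hq
      simp only [le_antisymm_iff]
      grind
    · intro q _ hq
      simp only [zigzag, stairs, mem_ofPred_eq]
      rw [lt_abs] at hq
      generalize q.1 = x at *
      generalize q.2 = y at *
      simp only [le_antisymm_iff]
      grind
    · simp
    · simp
  have s2 : LocalIso {q : Plane | (q.1 = 0 ∧ q.2 ≤ 0) ∨ (q.2 = 0 ∧ 0 ≤ q.1)} ∅
      (zigzag (1/4)) (zigzag (-1/4)) := by
    -- The negative horizontal scale reflects the corner with rays down and right into the one with
    -- rays down and left, which is the curve of `transversal_abs`.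
    refine localIso_mono transversal_abs 0 0 (-1/4) (1/2) (by norm_num) (by norm_num)
      (by norm_num [abs_of_neg]) (by norm_num)
      {q | (q.2 = -1 ∧ 2 ≤ q.1) ∨ (q.1 = 2 ∧ -1 ≤ q.2 ∧ q.2 ≤ 1) ∨ (q.2 = 1 ∧ 1 ≤ q.1 ∧ q.1 ≤ 2) ∨
        (q.2 = -1 ∧ -2 ≤ q.1 ∧ q.1 ≤ -1) ∨ (q.1 = -2 ∧ -1 ≤ q.2 ∧ q.2 ≤ 1) ∨ (q.2 = 1 ∧ q.1 ≤ -2)}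
      _ rfl ?_ ?_ ?_ (Or.inl ?_) ?_
    · intro q hq
      simp only [le_abs, mem_ofPred_eq] at *
      grind
    · intro q
      simp only [zigzag, mem_ofPred_eq]
      grind (splits := 40)
    · intro q
      simp only [zigzag, mem_ofPred_eq]
      grind (splits := 40)
    · intro q _ _
      simp only [mem_ofPred_eq]
      rcases abs_cases (q.1 - q.2) with ⟨e, _⟩ | ⟨e, _⟩ <;> rw [e] <;> grind
    · simp
  have s3 : LocalIso {q : Plane | (q.1 = 0 ∧ q.2 ≤ 0) ∨ (q.2 = 0 ∧ 0 ≤ q.1)} ∅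
      (zigzag (-1/4)) (stairs (1/2)) := by
    -- The bump over `[-1/2, -1/4]` points upwards; the negative vertical scale turns it into the
    -- standard finger. The frame stays to its right.
    refine localIso_finger (-3/8) 0 (1/8) (-1/2) (by norm_num) (by norm_num)
      (by norm_num [abs_of_neg]) (by norm_num [abs_of_neg])
      {q | (q.2 = 1 ∧ q.1 ≤ -1) ∨ (q.2 = 1 ∧ 1 ≤ q.1 ∧ q.1 ≤ 7) ∨
        (q.1 = 7 ∧ -1 ≤ q.2 ∧ q.2 ≤ 1) ∨ (q.2 = -1 ∧ 7 ≤ q.1)} _ rfl ?_ ?_ ?_ ?_ ?_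
    · intro q hq
      simp only [le_abs, mem_ofPred_eq] at *
      grind
    · intro q
      simp only [zigzag, mem_ofPred_eq]
      grind (splits := 40)
    · intro q
      simp only [stairs, mem_ofPred_eq]
      grind
    · intro q hq
      simp only [le_abs, mem_ofPred_eq] at *
      grind
    · simp
  exact (s1.trans_iso s2).trans_iso s3

/-- A half turn exchanges the corners `SE` and `NW` and interchanges the two staircases; reversal of
time restores their order. -/
theorem localMove_stairs_NW : LocalMove 1 {q | (q.1 = 0 ∧ 0 ≤ q.2) ∨ (q.2 = 0 ∧ q.1 ≤ 0)} ∅ ∅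
    (stairs (-1/2)) (stairs (1/2)) := by
  have h : ∀ t : ℝ, {q : Plane | -q ∈ stairs t} = stairs (-t) := fun t => by
    ext q
    simp only [stairs, mem_ofPred_eq, Prod.fst_neg, Prod.snd_neg]
    grind
  have := localMove_stairs_SE.rotate
  rw [h, h] at this
  convert this using 2
  · simp
  · simp
  · simp
  · norm_num
  · norm_num

/-! ### Left ends of the overpass -/

/-- An overpass that arrives from below crosses the horizontal line once both before and after; its
crossing slides from the abscissa `0` to `1/2`. -/
theorem localMove_south {C : Set Plane} (hC : C = ∅ ∨ C = {q : Plane | q.2 = 0}) :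
    LocalMove 0 C ∅ ∅ (highTurn (Iic (1/2))) (lowTurn (Iic (-1/2))) := by
  refine (localIso_mono transversal_neg (1/4) 0 (1/4) (1/2) (by norm_num) (by norm_num)
    (by norm_num [abs_of_pos]) (by norm_num) {q | (q.1 = -1 ∧ q.2 ≤ -1) ∨ (q.2 = 1 ∧ 1 ≤ q.1)}
    _ rfl ?_ ?_ ?_ ?_ ?_).localMove
  · intro q hq
    simp only [mem_ofPred_eq] at *
    grind
  · intro q
    simp only [highTurn, mem_ofPred_eq, mem_Iic]
    grind
  · intro q
    simp only [lowTurn, mem_ofPred_eq, mem_Iic]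
    grind
  · rcases hC with rfl | rfl
    · right; intro q hq; simp at hq
    · left; intro q _ _
      simp only [mem_ofPred_eq]
      grind
  · simp

theorem localMove_north : LocalMove 0 ∅ ∅ ∅ (highTurn (Ici (1/2))) (lowTurn (Ici (-1/2))) := by
  refine (localIso_finger (1/4) 0 (1/4) (1/2) (by norm_num) (by norm_num)
    (by norm_num [abs_of_pos]) (by norm_num) {q | (q.1 = -1 ∧ 1 ≤ q.2) ∨ (q.2 = 1 ∧ 1 ≤ q.1)}
    _ rfl ?_ ?_ ?_ ?_ ?_).symm.localMove
  · intro q hq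
    simp only [mem_ofPred_eq, le_abs] at *
    grind
  · intro q
    simp only [lowTurn, mem_ofPred_eq, mem_Ici]
    grind
  · intro q
    simp only [highTurn, mem_ofPred_eq, mem_Ici]
    grind
  · simp
  · simp

/-- An overpass that arrives from above the line crosses it twice in the end. The second move makes
both crossings with a finger over `[1/4, 1/2]`; then the left flank of the finger slides to the
abscissa `0`. -/
theorem localMove_north_WE :
    LocalMove 1 {q | q.2 = 0} ∅ ∅ (highTurn (Ici (1/2))) (lowTurn (Ici (-1/2))) := by
  have s1 : LocalMove 1 {q : Plane | q.2 = 0} ∅ ∅ (highTurn (Ici (1/2)))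
      {q | (q.1 = 0 ∧ 1/2 ≤ q.2) ∨ (q.2 = 1/2 ∧ 0 ≤ q.1 ∧ q.1 ≤ 1/4) ∨
        (q.1 = 1/4 ∧ -1/2 ≤ q.2 ∧ q.2 ≤ 1/2) ∨ (q.2 = -1/2 ∧ 1/4 ≤ q.1 ∧ q.1 ≤ 1/2) ∨
        (q.1 = 1/2 ∧ -1/2 ≤ q.2 ∧ q.2 ≤ 1/2) ∨ (q.2 = 1/2 ∧ 1/2 ≤ q.1)} := by
    refine localMove_two (3/8) (1/4) (by norm_num) (by norm_num [abs_of_pos]) ?_ ?_ ?_ ?_ ?_ ?_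
    · intro q hq
      simp only [mem_ofPred_eq]
    · intro q hq
      obtain ⟨h1, h2⟩ := abs_le.1 hq.1
      simp only [highTurn, mem_ofPred_eq, mem_Ici]
      grind
    · intro q hq
      obtain ⟨h1, h2⟩ := abs_le.1 hq.1
      simp only [finger, mem_ofPred_eq]
      generalize q.1 = x at *
      generalize q.2 = y at *
      clear hq
      simp only [le_antisymm_iff]
      grind
    · intro q _ hq
      simp only [highTurn, mem_ofPred_eq, mem_Ici]
      rw [lt_abs] at hq
      generalize q.1 = x at *
      generalize q.2 = y at *
      simp only [le_antisymm_iff]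
      grind
    · simp
    · simp
  refine s1.trans_iso (localIso_mono transversal_neg (1/8) 0 (-1/8) (1/2) (by norm_num) (by norm_num)
      (by norm_num [abs_of_neg, abs_of_pos]) (by norm_num)
      {q | (q.1 = 1 ∧ 1 ≤ q.2) ∨ (q.2 = -1 ∧ -3 ≤ q.1 ∧ q.1 ≤ -1) ∨
        (q.1 = -3 ∧ -1 ≤ q.2 ∧ q.2 ≤ 1) ∨ (q.2 = 1 ∧ q.1 ≤ -3)}
      _ rfl ?_ ?_ ?_ (Or.inl ?_) ?_)
  · intro q hq
    simp only [le_abs, mem_ofPred_eq] at *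
    grind
  · intro q
    simp only [mem_ofPred_eq]
    grind (splits := 40)
  · intro q
    simp only [lowTurn, mem_ofPred_eq, mem_Ici]
    grind (splits := 40)
  · intro q _ _
    simp only [mem_ofPred_eq]
    grind
  · simp

/-- The frame leaves to the left, so nothing blocks the arcs on the right. Both are deformed, with
the common endpoint fixed, to the arc that leaves the origin along the positive axis and then turns
up. -/
theorem localMove_joined_W : LocalMove 0 {q | q.2 = 0 ∧ q.1 ≤ 0} {0} ∅
    (highTurn (Icc 0 (1/2))) (lowTurn (Icc (-1/2) 0)) := by
  have s1 : LocalIso {q : Plane | q.2 = 0 ∧ q.1 ≤ 0} {0} (highTurn (Icc 0 (1/2)))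
      {q | (q.2 = 0 ∧ 0 ≤ q.1 ∧ q.1 ≤ 1/2) ∨ (q.1 = 1/2 ∧ 0 ≤ q.2 ∧ q.2 ≤ 1/2) ∨
        (q.2 = 1/2 ∧ 1/2 ≤ q.1)} := by
    refine localIso_mono transversal_id (1/4) (1/4) (1/4) (1/4) (by norm_num) (by norm_num)
      (by norm_num [abs_of_pos]) (by norm_num [abs_of_pos]) {q | q.2 = 1 ∧ 1 ≤ q.1}
      _ rfl ?_ ?_ ?_ (Or.inr ?_) ?_
    · intro q hq
      simp only [mem_ofPred_eq] at *
      grind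
    · intro q
      simp only [highTurn, mem_ofPred_eq, mem_Icc]
      grind
    · intro q
      simp only [mem_ofPred_eq]
      grind
    · intro q hq
      simp only [mem_ofPred_eq] at *
      grind
    · intro q hq
      simp only [mem_ofPred_eq, mem_singleton_iff, Prod.ext_iff, Prod.fst_zero, Prod.snd_zero] at *
      grind
  have s2 : LocalIso {q : Plane | q.2 = 0 ∧ q.1 ≤ 0} {0} (lowTurn (Icc (-1/2) 0))
      {q | (q.2 = 0 ∧ 0 ≤ q.1 ∧ q.1 ≤ 1/2) ∨ (q.1 = 1/2 ∧ 0 ≤ q.2 ∧ q.2 ≤ 1/2) ∨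
        (q.2 = 1/2 ∧ 1/2 ≤ q.1)} := by
    refine localIso_finger (1/4) (-1/4) (1/4) (1/4) (by norm_num) (by norm_num)
      (by norm_num [abs_of_pos]) (by norm_num [abs_of_pos, abs_of_neg])
      {q | (q.1 = 1 ∧ 1 ≤ q.2 ∧ q.2 ≤ 3) ∨ (q.2 = 3 ∧ 1 ≤ q.1)} _ rfl ?_ ?_ ?_ ?_ ?_
    · intro q hq
      simp only [mem_ofPred_eq, le_abs] at *
      grind
    · intro q
      simp only [lowTurn, mem_ofPred_eq, mem_Icc]
      grind (splits := 40)
    · intro q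
      simp only [mem_ofPred_eq]
      grind
    · intro q hq
      simp only [mem_ofPred_eq, le_abs] at *
      grind
    · intro q hq
      simp only [mem_ofPred_eq, le_abs, mem_singleton_iff, Prod.ext_iff, Prod.fst_zero, Prod.snd_zero] at *
      grind
  exact (s1.trans s2.symm).localMove

/-- The homeomorphism of the line that contracts the negative half line by the factor `4`. -/
noncomputable def halfScale : ℝ ≃ₜ ℝ where
  toFun t := max t (t / 4)
  invFun t := min t (4 * t)
  left_inv t := by
    beta_reduce
    rcases le_total 0 t with h | h
    · rw [max_eq_left (by linarith), min_eq_left (by linarith)]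
    · rw [max_eq_right (by linarith), min_eq_right (by linarith)]; ring
  right_inv t := by
    beta_reduce
    rcases le_total 0 t with h | h
    · rw [min_eq_left (by linarith), max_eq_left (by linarith)]
    · rw [min_eq_right (by linarith), max_eq_right (by linarith)]; ring
  continuous_toFun := by fun_prop
  continuous_invFun := by fun_prop

theorem halfScale_of_nonneg {t : ℝ} (h : 0 ≤ t) : halfScale t = t := max_eq_left (by linarith)

theorem halfScale_of_nonpos {t : ℝ} (h : t ≤ 0) : halfScale t = t / 4 := max_eq_right (by linarith)

/-- The chart of the first move. -/
noncomputable def kinkChart : Plane ≃ₜ Plane :=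
  (halfScale.trans (Homeomorph.subLeft (1/2 : ℝ))).prodCongr (halfScale.trans (Homeomorph.neg ℝ))

theorem kinkChart_apply (q : Plane) : kinkChart q = (1/2 - halfScale q.1, -halfScale q.2) := rfl

/-! ### The first move at an end of the overpass -/

/-- The chart sends the origin to `(1/2, 0)` and the loop of the kink to the boundary of `[0, 1/2] ×
[-1/2, 0]`. Contracting the negative half-lines keeps the image of the box in `[-1/2, 3/4] × [-1,
1/4]`, which avoids the horizontal strand at height `1/2`. -/
theorem mem_pictureI {q : Plane} (hq : q ∈ Box) :
    q ∈ pictureI.shadow ↔ kinkChart q ∈ ({q | (q.2 = 0 ∧ 1/2 ≤ q.1) ∨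
      (q.1 = 1/2 ∧ 0 ≤ q.2 ∧ q.2 ≤ 1/2) ∨ (q.2 = 1/2 ∧ 1/2 ≤ q.1)} : Set Plane) := by
  obtain ⟨⟨h1, h2⟩, h3, h4⟩ := And.imp abs_le.1 abs_le.1 hq
  rw [kinkChart_apply]
  simp only [pictureI, hseg, vseg, mem_union, mem_ofPred_eq,
    uIcc_of_le (show (-1 : ℝ) ≤ 0 by norm_num), mem_Icc]
  rcases le_total 0 q.1 with a | a <;> rcases le_total 0 q.2 with b | b <;>
    simp only [halfScale_of_nonneg, halfScale_of_nonpos, a, b] <;> clear hq <;>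
    generalize q.1 = x at * <;> generalize q.2 = y at * <;> simp only [le_antisymm_iff] <;> grind

theorem mem_pictureI' {q : Plane} (hq : q ∈ Box) :
    q ∈ (pictureI' false).shadow ↔ ((kinkChart q).2 = 0 ∧ 0 ≤ (kinkChart q).1) ∨
      kinkChart q ∈ lowTurn (Icc (-1/2) 0) := by
  obtain ⟨⟨h1, h2⟩, h3, h4⟩ := And.imp abs_le.1 abs_le.1 hq
  rw [kinkChart_apply]
  simp only [pictureI', lowTurn, hseg, vseg, mem_union, mem_ofPred_eq,
    uIcc_of_le (show (-1 : ℝ) ≤ 1/2 by norm_num), uIcc_of_le (show (0 : ℝ) ≤ 1/2 by norm_num), mem_Icc]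
  rcases le_total 0 q.1 with a | a <;> rcases le_total 0 q.2 with b | b <;>
    simp only [halfScale_of_nonneg, halfScale_of_nonpos, a, b] <;> clear hq <;>
    generalize q.1 = x at * <;> generalize q.2 = y at * <;> simp only [le_antisymm_iff] <;>
    grind (splits := 40)

theorem mem_cross_pictureI' {q : Plane} :
    q ∈ (pictureI' false).cross ↔ ((kinkChart q).2 = 0 ∧ 0 ≤ (kinkChart q).1) ∧
      kinkChart q ∈ lowTurn (Icc (-1/2) 0) ∧ kinkChart q ≠ 0 := by
  rw [kinkChart_apply]
  simp only [pictureI', lowTurn, mem_singleton_iff, mem_ofPred_eq, mem_Icc, ne_eq, Prod.ext_iff,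
    Prod.fst_zero, Prod.snd_zero]
  rcases le_total 0 q.1 with a | a <;> rcases le_total 0 q.2 with b | b <;>
    simp only [halfScale_of_nonneg, halfScale_of_nonpos, a, b] <;>
    generalize q.1 = x at * <;> generalize q.2 = y at * <;> simp only [le_antisymm_iff] <;>
    grind (splits := 40)

theorem kinkChart_mem_lowTurn_of_near {q : Plane} (hq : |q.1| < 1/4 ∧ |q.2| < 1/4) :
    kinkChart q ∈ lowTurn (Icc (-1/2) 0) ↔ q.1 = 0 := by
  obtain ⟨⟨h1, h2⟩, h3, h4⟩ := And.imp abs_lt.1 abs_lt.1 hq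
  rw [kinkChart_apply]
  simp only [lowTurn, mem_ofPred_eq, mem_Icc]
  rcases le_total 0 q.1 with a | a <;> rcases le_total 0 q.2 with b | b <;>
    simp only [halfScale_of_nonneg, halfScale_of_nonpos, a, b] <;> clear hq <;>
    generalize q.1 = x at * <;> generalize q.2 = y at * <;> simp only [le_antisymm_iff] <;>
    grind (splits := 40)

theorem kinkChart_mem_box {q : Plane} (hq : q ∈ Box) : kinkChart q ∈ Box := by
  obtain ⟨⟨h1, h2⟩, h3, h4⟩ := And.imp abs_le.1 abs_le.1 hq
  rw [kinkChart_apply]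
  simp only [Box, mem_ofPred_eq, abs_le]
  rcases le_total 0 q.1 with a | a <;> rcases le_total 0 q.2 with b | b <;>
    simp only [halfScale_of_nonneg, halfScale_of_nonpos, a, b] <;>
    refine ⟨⟨?_, ?_⟩, ?_, ?_⟩ <;> linarith

/-- Outside the chart of the first move, the two sides agree. -/
theorem kink_agree {q : Plane} (hq : q ∉ Box) (hk : kinkChart q ∈ Box) :
    (kinkChart q ∈ ({q | (q.2 = 0 ∧ 1/2 ≤ q.1) ∨
      (q.1 = 1/2 ∧ 0 ≤ q.2 ∧ q.2 ≤ 1/2) ∨ (q.2 = 1/2 ∧ 1/2 ≤ q.1)} : Set Plane) ↔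
      (((kinkChart q).2 = 0 ∧ 0 ≤ (kinkChart q).1) ∨ kinkChart q ∈ lowTurn (Icc (-1/2) 0))) := by
  obtain ⟨⟨h1, h2⟩, h3, h4⟩ := And.imp abs_le.1 abs_le.1 hk
  rw [kinkChart_apply] at *
  simp only [Box, mem_ofPred_eq, abs_le, not_and_or, not_le] at hq
  simp only [lowTurn, mem_ofPred_eq, mem_Icc]
  rcases le_total 0 q.1 with a | a <;> rcases le_total 0 q.2 with b | b <;>
    simp only [halfScale_of_nonneg, halfScale_of_nonpos, a, b] at h1 h2 h3 h4 ⊢ <;> clear hk <;>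
    generalize q.1 = x at * <;> generalize q.2 = y at * <;> simp only [le_antisymm_iff] <;>
    grind (splits := 40)

/-- The bend at the end of the overpass is straightened. -/
theorem localIso_straighten : LocalIso ∅ ∅
    {q | (q.1 = 0 ∧ 0 ≤ q.2) ∨ (q.2 = 0 ∧ 0 ≤ q.1 ∧ q.1 ≤ 1/2) ∨ (q.1 = 1/2 ∧ 0 ≤ q.2)}
    {q | (q.1 = 0 ∧ 1/2 ≤ q.2) ∨ (q.2 = 1/2 ∧ 0 ≤ q.1 ∧ q.1 ≤ 1/2) ∨ (q.1 = 1/2 ∧ 1/2 ≤ q.2)} := by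
  refine localIso_finger (1/4) (1/4) (1/4) (1/4) (by norm_num) (by norm_num)
    (by norm_num [abs_of_pos]) (by norm_num [abs_of_pos])
    {q | (q.1 = -1 ∧ 1 ≤ q.2) ∨ (q.1 = 1 ∧ 1 ≤ q.2)} _ rfl ?_ ?_ ?_ ?_ ?_
  · intro q hq
    simp only [mem_ofPred_eq, le_abs] at *
    grind
  · intro q
    simp only [mem_ofPred_eq]
    grind (splits := 40)
  · intro q
    simp only [mem_ofPred_eq]
    grind (splits := 40)
  · simp
  · simp

/-- The frame leaves to the right, on the same side as the overpass. Lowered, the overpass first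
goes down from the common end, then right, and crosses the frame at `(1/2, 0)`: together they form a
kink, which the first move creates. -/
theorem localMove_joined_E : LocalMove 1 {q | q.2 = 0 ∧ 0 ≤ q.1} {0} ∅
    (highTurn (Icc 0 (1/2))) (lowTurn (Icc (-1/2) 0)) := by
  intro F h T T' D D' hP hT hT' hTT hD hD'
  obtain ⟨φ, f1, -, -, f4⟩ := localIso_straighten
  set h' := (Homeomorph.prodComm ℝ ℝ).trans h with hh'
  have hsw : ∀ q : Plane, h' q.swap = h q := fun q => rfl
  -- Straightening the bend moves part of the frame along with the overpass, so the intermediate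
  -- diagram is an image under `Φ` and not another overpass on the same frame. The axes are
  -- interchanged because the straightening was stated for a bend that opens upwards.
  set Φ := conjHomeo h' φ with hΦ
  have hΦ1 : ∀ q, Φ (h' q) = h' (φ q) := conjHomeo_apply h' φ
  have hbox : ∀ q : Plane, q.swap ∈ Box ↔ q ∈ Box := fun q => and_comm
  have hb := mem_box_iff_of_fix f1
  have hid : ∀ q ∉ Box, Φ (h q) = h q := fun q hq => by
    rw [← hsw, hΦ1, f1 _ (fun hc => hq ((hbox q).1 hc))]
  obtain ⟨c1, c2, c3⟩ := LinkDiagram.carries_map Φ D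
  set D₁ := D.map Φ
  have hiso : D.PlanarIsotopic D₁ := by
    obtain ⟨r, hr⟩ := (isCompact_box.image h.continuous).isBounded.exists_norm_le
    refine LinkDiagram.Carries.planarIsotopic ⟨c1, c2, c3⟩ r
      (forall_of_conj h fun q hq => hid q fun hqB => ?_)
    exact absurd (hr _ ⟨q, hqB, rfl⟩) (not_le.2 hq)
  have hin : ∀ q ∈ Box, h q ∈ D.shadow ↔ q.swap ∈ ({q | (q.1 = 0 ∧ 0 ≤ q.2) ∨
      (q.2 = 0 ∧ 0 ≤ q.1 ∧ q.1 ≤ 1/2) ∨ (q.1 = 1/2 ∧ 0 ≤ q.2)} : Set Plane) := fun q hq => by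
    rw [hD.shadow, hP.R q hq, hT q hq]
    simp only [highTurn, mem_ofPred_eq, mem_Icc, Prod.fst_swap, Prod.snd_swap]
  have hex : ∀ q ∈ Box, ∃ v ∈ Box, h q = Φ (h v) ∧ φ v.swap = q.swap := fun q hq => by
    refine ⟨(φ.symm q.swap).swap, ?_, ?_, by simp⟩
    · rw [hbox, ← hb]; simpa [hbox] using hq
    · rw [← hsw (φ.symm q.swap).swap, hΦ1]; simp [hsw]
  have hsh : ∀ q ∈ Box, h q ∈ D₁.shadow ↔ q ∈ ({q | (q.2 = 0 ∧ 1/2 ≤ q.1) ∨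
      (q.1 = 1/2 ∧ 0 ≤ q.2 ∧ q.2 ≤ 1/2) ∨ (q.2 = 1/2 ∧ 1/2 ≤ q.1)} : Set Plane) := fun q hq => by
    obtain ⟨v, hv, e1, e2⟩ := hex q hq
    rw [e1, c1, hin v hv, ← f4 _ ((hbox v).2 hv), e2]
    rfl
  have hcr : ∀ q ∈ Box, h q ∉ D₁.cross := fun q hq => by
    obtain ⟨v, hv, e1, -⟩ := hex q hq
    rw [e1, c2, hD.cross, hP.C v hv, hP.R v hv, hT v hv, hP.K v hv]
    simp only [highTurn, mem_empty_iff_false, false_or, mem_ofPred_eq, mem_singleton_iff, mem_Icc,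
      Prod.ext_iff, Prod.fst_zero, Prod.snd_zero]
    rintro ⟨⟨a1, a2⟩, (a3 | a3), a4⟩
    · exact a4 ⟨a3.1, a1⟩
    · rw [a1] at a3; norm_num at a3
  have hsh' : ∀ q ∈ Box, h q ∈ D'.shadow ↔ (q.2 = 0 ∧ 0 ≤ q.1) ∨ q ∈ lowTurn (Icc (-1/2) 0) :=
    fun q hq => by rw [hD'.shadow, hP.R q hq, hT' q hq]; rfl
  have hcr' : ∀ q ∈ Box, h q ∈ D'.cross ↔ (q.2 = 0 ∧ 0 ≤ q.1) ∧ q ∈ lowTurn (Icc (-1/2) 0) ∧ q ≠ 0 :=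
    fun q hq => by
      rw [hD'.cross, hP.R q hq, hT' q hq, hP.C q hq, hP.K q hq]
      simp
  have hout := hD.agreeOutside hD' hTT
  refine (Reach.of_isotopic hiso).trans (l := 1) ⟨1, le_rfl, .of_move ⟨_, _, .RI false,
    Or.inl ⟨kinkChart.trans h, ⟨?_, ?_, ?_⟩, ⟨?_, ?_, ?_⟩, ?_, ?_, ?_⟩⟩⟩
  · intro q hq
    rw [Homeomorph.trans_apply, hsh _ (kinkChart_mem_box hq), mem_pictureI hq]
  · intro q hq
    rw [Homeomorph.trans_apply]
    simp [hcr _ (kinkChart_mem_box hq), pictureI]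
  · rintro c ⟨⟩
  · intro q hq
    rw [Homeomorph.trans_apply, hsh' _ (kinkChart_mem_box hq), mem_pictureI' hq]
  · intro q hq
    rw [Homeomorph.trans_apply, hcr' _ (kinkChart_mem_box hq), mem_cross_pictureI']
  · rintro c hc
    obtain ⟨c4, c5, c6⟩ := mem_cross_pictureI'.1 hc
    obtain rfl : c = 0 := hc
    have h0 : (0 : Plane) ∈ Box := by simp [Box]
    have hk0 := kinkChart_mem_box h0
    have h1 := hD'.over_path (h (kinkChart 0)) ((hP.R _ hk0).2 c4) ((hT' _ hk0).2 c5)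
      (fun hK => c6 ((hP.K _ hk0).1 hK))
    filter_upwards [(kinkChart.trans h).continuous.continuousAt.eventually h1,
      box_mem_nhds (c := 0) (by simp) (by simp),
      eventually_near 0 (show (0:ℝ) < 1/4 by norm_num)] with q q1 q2 q3
    have q1' : (kinkChart.trans h) q ∈ D'.overAt ((kinkChart.trans h) 0) ↔ h (kinkChart q) ∈ T' := q1
    rw [q1', hT' _ (kinkChart_mem_box q2), kinkChart_mem_lowTurn_of_near (by simpa using q3)]
    simp [pictureI']
  · intro q hq
    rw [Homeomorph.trans_apply]
    -- The box of `h` is larger than the image of the chart. In the difference the two explicit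
    -- pictures agree; outside the box of `h` neither diagram has changed.
    by_cases hk : kinkChart q ∈ Box
    · rw [hsh _ hk, hsh' _ hk]
      exact kink_agree hq hk
    · rw [← hout.1 _ hk, ← c1, hid _ hk]
  · intro q hq
    rw [Homeomorph.trans_apply]
    by_cases hk : kinkChart q ∈ Box
    · rw [hcr' _ hk, ← mem_cross_pictureI']
      refine iff_of_false (hcr _ hk) ?_
      rintro rfl
      exact hq (by simp [Box])
    · rw [← hout.2.1 _ hk, ← c2, hid _ hk]
  · intro q hq hc
    rw [Homeomorph.trans_apply] at hc ⊢
    have hk : kinkChart q ∉ Box := fun hk => hcr _ hk hc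
    have hc' : h (kinkChart q) ∈ D.cross := by rwa [← c2, hid _ hk]
    have hev : ∀ᶠ p in 𝓝 (h (kinkChart q)), h.symm p ∉ Box := by
      refine (isClosed_box.isOpen_compl.preimage h.symm.continuous).mem_nhds ?_
      simpa using hk
    filter_upwards [hout.2.2 _ hk hc', c3 _ hc', hev] with p p1 p2 p3
    have : Φ p = p := by simpa using hid _ p3
    rw [← p1, ← p2, this, hid _ hk]

/-! ### Mirror images -/

/-- The picture `P'` arises from `P` by switching the crossings. -/
structure Picture.IsMirror (P P' : Picture) : Prop where
  shadow : P'.shadow = P.shadow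
  cross : P'.cross = P.cross
  inside : ∀ c ∈ P.cross, |c.1| < 1 ∧ |c.2| < 1
  overAt : ∀ c ∈ P.cross, ∀ᶠ q in 𝓝 c, q ∈ P'.overAt c ↔ (q ∈ P.shadow ∧ q ∉ P.overAt c) ∨ q = c

/-- The mirrored overstrand is defined through the shadow, which the picture controls only inside
the box; crossings are therefore required to be interior. -/
theorem Shows.mirror {h : Plane ≃ₜ Plane} {P P' : Picture} {D : LinkDiagram} (H : Shows h P D)
    (hP : P.IsMirror P') : Shows h P' D.mirror := by
  refine ⟨fun q hq => ?_, fun q hq => ?_, fun c hc => ?_⟩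
  · rw [hP.shadow]; exact H.1 q hq
  · rw [hP.cross]; exact H.2.1 q hq
  · rw [hP.cross] at hc
    have hb := hP.inside c hc
    filter_upwards [hP.overAt c hc, H.2.2 c hc, box_mem_nhds hb.1 hb.2] with q q1 q2 q3
    rw [q1, ← q2, ← H.1 q q3, ← h.injective.eq_iff]
    rfl

theorem AgreeOutside.mirror {h : Plane ≃ₜ Plane} {D D' : LinkDiagram} (H : AgreeOutside h D D') :
    AgreeOutside h D.mirror D'.mirror := by
  refine ⟨H.1, H.2.1, fun q hq hc => ?_⟩
  have hev : ∀ᶠ p in 𝓝 (h q), h.symm p ∉ Box := by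
    refine (isClosed_box.isOpen_compl.preimage h.symm.continuous).mem_nhds ?_
    simpa using hq
  filter_upwards [H.2.2 q hq hc, hev] with p p1 p2
  have p3 : p ∈ D.shadow ↔ p ∈ D'.shadow := by simpa using H.1 _ p2
  change (_ ∨ _) ↔ (_ ∨ _)
  rw [p1, p3]

theorem Replace.mirror {P P' Q Q' : Picture} {D D' : LinkDiagram} (H : Replace P P' D D')
    (hP : P.IsMirror Q) (hP' : P'.IsMirror Q') : Replace Q Q' D.mirror D'.mirror := by
  obtain ⟨h, h1, h2, h3⟩ := H
  exact ⟨h, h1.mirror hP, h2.mirror hP', h3.mirror⟩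

theorem isMirror_of_cross_eq_empty {P : Picture} (h : P.cross = ∅) : P.IsMirror P :=
  ⟨rfl, rfl, by simp [h], by simp [h]⟩

theorem isMirror_pictureI' (b : Bool) : (pictureI' b).IsMirror (pictureI' !b) := by
  refine ⟨rfl, rfl, ?_, ?_⟩
  · rintro c rfl; simp
  · rintro c rfl
    filter_upwards [eventually_near 0 (show (0:ℝ) < 1/4 by norm_num)] with q hq
    have h1 : q ∈ (pictureI' b).shadow ↔ q.1 = 0 ∨ q.2 = 0 := by
      simp only [Prod.fst_zero, Prod.snd_zero, sub_zero, abs_lt] at hq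
      simp only [pictureI', hseg, vseg, mem_union, mem_ofPred_eq,
        uIcc_of_le (show (-1 : ℝ) ≤ 1/2 by norm_num), uIcc_of_le (show (0 : ℝ) ≤ 1/2 by norm_num), mem_Icc]
      generalize q.1 = x at *
      generalize q.2 = y at *
      simp only [le_antisymm_iff]
      grind
    rw [h1, Prod.ext_iff]
    cases b <;> simp [pictureI'] <;> tauto

theorem isMirror_pictureII' (b : Bool) : (pictureII' b).IsMirror (pictureII' !b) := by
  refine ⟨rfl, rfl, ?_, ?_⟩
  · rintro c (rfl | rfl) <;> constructor <;> norm_num [abs_of_nonneg, abs_of_neg]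
  · intro c hc
    have hc2 : c.2 = 0 := by rcases hc with rfl | rfl <;> rfl
    have hb : |c.1| < 1 ∧ |c.2| < 1 := by
      rcases hc with rfl | rfl <;> constructor <;> norm_num [abs_of_nonneg, abs_of_neg]
    filter_upwards [eventually_near c (show (0:ℝ) < 1/4 by norm_num), box_mem_nhds hb.1 hb.2] with q hq hqB
    have h1 : q ∈ (pictureII' b).shadow ↔ q.2 = 0 ∨ q.1 = c.1 := by
      rw [← mem_finger_of_near hc hq]
      exact mem_shadow_pictureII' hqB
    rw [h1, Prod.ext_iff, hc2]
    cases b <;> simp [pictureII'] <;> tauto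

theorem isClosed_strandIII (t : ℝ) (i : Fin 3) : IsClosed (strandIII t i) := by
  fin_cases i
  · exact RectDiagram.isClosed_hseg _ _ _
  · exact RectDiagram.isClosed_vseg _ _ _
  · exact ((RectDiagram.isClosed_hseg _ _ _).union (RectDiagram.isClosed_vseg _ _ _)).union
      (RectDiagram.isClosed_hseg _ _ _)

theorem strandIII_not_triple {t : ℝ} (ht : t = 1/2 ∨ t = -1/2) {c : Plane} :
    ¬ (c ∈ strandIII t 0 ∧ c ∈ strandIII t 1 ∧ c ∈ strandIII t 2) := by
  rintro ⟨h0, h1, h2⟩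
  obtain ⟨e0, e1, e2⟩ := mem_strandIII ht (strandIII_subset_box ht 0 h0)
  rw [e0] at h0
  rw [e1] at h1
  rw [e2] at h2
  simp only [stairs, mem_ofPred_eq] at h2
  rw [h0, h1] at h2
  rcases ht with rfl | rfl <;> norm_num at h2

/-- No point lies on all three strands, so near a crossing there are just two, and reversing all
heights exchanges which one is over. -/
theorem isMirror_pictureIII {t : ℝ} (ht : t = 1/2 ∨ t = -1/2) (r : Equiv.Perm (Fin 3)) :
    (pictureIII r t).IsMirror (pictureIII (r.trans Fin.revPerm) t) := by
  have hfin : (pictureIII r t).cross.Finite := by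
    refine (toFinite {(0, 0), (t, 0), (0, -t)}).subset fun q hq => ?_
    simpa using (mem_cross_pictureIII ht r).1 hq
  refine ⟨rfl, rfl, ?_, ?_⟩
  · intro c hc
    rw [mem_cross_pictureIII ht] at hc
    rcases ht with rfl | rfl <;> rcases hc with rfl | rfl | rfl <;>
      constructor <;> norm_num [abs_of_nonneg, abs_of_neg]
  · rintro c ⟨i, j, hij, hi, hj⟩
    wlog hr : r j < r i generalizing i j
    · exact this j i hij.symm hj hi
        (lt_of_le_of_ne (not_lt.1 hr) fun e => hij (r.injective e))
    have h3 : ∀ k, c ∈ strandIII t k → k = i ∨ k = j := by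
      intro k hk
      by_contra hcon
      apply strandIII_not_triple ht (c := c)
      fin_cases i <;> fin_cases j <;> fin_cases k <;> simp_all
    have hev : ∀ᶠ q in 𝓝 c, ∀ k, q ∈ strandIII t k → k = i ∨ k = j := by
      rw [Filter.eventually_all]
      intro k
      by_cases hk : k = i ∨ k = j
      · exact Filter.Eventually.of_forall fun _ _ => hk
      · filter_upwards [(isClosed_strandIII t k).isOpen_compl.mem_nhds fun h => hk (h3 k h)] with q hq h
        exact absurd h hq
    have hev2 : ∀ᶠ q in 𝓝 c, q ∉ (pictureIII r t).cross \ {c} :=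
      (hfin.subset sdiff_subset).isClosed.isOpen_compl.mem_nhds (by simp)
    filter_upwards [hev, hev2] with q q1 q2
    have e1 : q ∈ (pictureIII r t).overAt c ↔ q ∈ strandIII t i := by
      constructor
      · rintro ⟨k, k1, k2, k3⟩
        rcases h3 k k2 with rfl | rfl
        · exact k1
        · exact absurd (k3 i hi) (not_le.2 hr)
      · intro h
        refine ⟨i, h, hi, fun k hk => ?_⟩
        rcases h3 k hk with rfl | rfl
        exacts [le_rfl, hr.le]
    have e2 : q ∈ (pictureIII (r.trans Fin.revPerm) t).overAt c ↔ q ∈ strandIII t j := by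
      constructor
      · rintro ⟨k, k1, k2, k3⟩
        rcases h3 k k2 with rfl | rfl
        · exact absurd (Fin.rev_le_rev.1 (k3 j hj)) (not_le.2 hr)
        · exact k1
      · intro h
        refine ⟨j, h, hj, fun k hk => ?_⟩
        rcases h3 k hk with rfl | rfl
        exacts [Fin.rev_le_rev.2 hr.le, le_rfl]
    have e3 : q ∈ (pictureIII r t).shadow ↔ q ∈ strandIII t i ∨ q ∈ strandIII t j := by
      constructor
      · intro h
        obtain ⟨k, hk⟩ := mem_iUnion.1 h
        rcases q1 k hk with rfl | rfl
        exacts [Or.inl hk, Or.inr hk]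
      · rintro (h | h)
        exacts [mem_iUnion.2 ⟨i, h⟩, mem_iUnion.2 ⟨j, h⟩]
    have e4 : q ∈ strandIII t i → q ∈ strandIII t j → q = c := fun h h' => by
      by_contra hcon
      exact q2 ⟨⟨i, j, hij, h, h'⟩, hcon⟩
    have e5 : q = c → q ∈ strandIII t j := fun h => h ▸ hj
    rw [e1, e2, e3]
    tauto

/-- The list of pairs is closed under switching crossings: the flag is negated in the first two
moves, and the heights are reversed in the third. -/
theorem ReidemeisterMove.mirror {D D' : LinkDiagram} (H : ReidemeisterMove D D') :
    ReidemeisterMove D.mirror D'.mirror := by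
  obtain ⟨P, P', hP, h⟩ := H
  obtain ⟨Q, Q', hQ, m, m'⟩ : ∃ Q Q', ReidemeisterPair Q Q' ∧ P.IsMirror Q ∧ P'.IsMirror Q' := by
    cases hP with
    | RI b => exact ⟨_, _, .RI (!b), isMirror_of_cross_eq_empty rfl, isMirror_pictureI' b⟩
    | RII b => exact ⟨_, _, .RII (!b), isMirror_of_cross_eq_empty rfl, isMirror_pictureII' b⟩
    | RIII r => exact ⟨_, _, .RIII (r.trans Fin.revPerm), isMirror_pictureIII (Or.inl rfl) r,
        isMirror_pictureIII (Or.inr rfl) r⟩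
  exact ⟨Q, Q', hQ, h.imp (fun h => h.mirror m m') fun h => h.mirror m' m⟩

theorem ReidemeisterSeq.mirror {k : ℕ} {D E : LinkDiagram} (h : ReidemeisterSeq k D E) :
    ReidemeisterSeq k D.mirror E.mirror := by
  induction h with
  | isotopy h => exact isotopy h.mirror
  | move _ h2 h3 ih => exact move ih h2.mirror h3.mirror

theorem Reach.mirror {k : ℕ} {D E : LinkDiagram} (h : Reach k D E) : Reach k D.mirror E.mirror := by
  obtain ⟨l, hl, h⟩ := h
  exact ⟨l, hl, h.mirror⟩

/-! ## Changes of coordinates -/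

/-- The order isomorphism of the line that fixes the numbers up to `c` and stretches the others
by the factor `l`. -/
noncomputable def stretch (c l : ℝ) (hl : 0 < l) : ℝ ≃o ℝ :=
  StrictMono.orderIsoOfRightInverse (fun t => c + min (t - c) 0 + l * max (t - c) 0)
    (fun s t h => by
      have h1 : min (s - c) 0 ≤ min (t - c) 0 := min_le_min_right _ (by linarith)
      have h2 : max (s - c) 0 ≤ max (t - c) 0 := max_le_max_right _ (by linarith)
      have h3 := min_add_max (s - c) 0
      have h4 := min_add_max (t - c) 0
      rcases h2.lt_or_eq with h2 | h2
      · have := mul_lt_mul_of_pos_left h2 hl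
        simp only
        linarith
      · simp only
        rw [h2]
        linarith)
    (fun t => c + min (t - c) 0 + l⁻¹ * max (t - c) 0)
    (fun t => by
      rcases le_total (t - c) 0 with h | h
      · simp [min_eq_left h, max_eq_right h]
      · have h' : 0 ≤ l⁻¹ * (t - c) := by positivity
        simp only [min_eq_right h, max_eq_left h, add_zero, add_sub_cancel_left, min_eq_right h',
          max_eq_left h']
        field_simp
        ring)

theorem stretch_apply (c l : ℝ) (hl : 0 < l) (t : ℝ) :
    stretch c l hl t = c + min (t - c) 0 + l * max (t - c) 0 := rfl

/-- A strictly increasing function on a finite set extends to an order isomorphism of the line. -/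
theorem exists_orderIso (S : Finset ℝ) (f : ℝ → ℝ) (hf : StrictMonoOn f S) :
    ∃ g : ℝ ≃o ℝ, ∀ s ∈ S, g s = f s := by
  induction S using Finset.induction_on_max with
  | empty => exact ⟨OrderIso.refl ℝ, by simp⟩
  | insert a S ha ih =>
    obtain ⟨g, hg⟩ := ih (hf.mono (by simp))
    have hfa : ∀ s ∈ S, f s < f a := fun s hs => hf (by simp [hs]) (by simp) (ha s hs)
    have hga : ∀ s ∈ S, f s < g a := fun s hs => by rw [← hg s hs]; exact g.strictMono (ha s hs)
    -- The number `c` separates the values already attained from both the present and the desired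
    -- value at `a`, so stretching above `c` corrects `a` alone.
    obtain ⟨c, hc, hcf, hcg⟩ : ∃ c, (∀ s ∈ S, f s ≤ c) ∧ c < f a ∧ c < g a := by
      rcases S.eq_empty_or_nonempty with rfl | hS
      · refine ⟨min (f a) (g a) - 1, by simp, ?_, ?_⟩
        · linarith [min_le_left (f a) (g a)]
        · linarith [min_le_right (f a) (g a)]
      · obtain ⟨t, ht, hmax⟩ := S.exists_max_image f hS
        exact ⟨f t, hmax, hfa t ht, hga t ht⟩
    refine ⟨g.trans (stretch c ((f a - c) / (g a - c)) (div_pos (by linarith) (by linarith))), ?_⟩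
    intro s hs
    rw [OrderIso.trans_apply, stretch_apply]
    rcases Finset.mem_insert.1 hs with rfl | hs
    · rw [min_eq_right (by linarith), max_eq_left (by linarith),
        div_mul_cancel₀ _ (by linarith : g s - c ≠ 0)]
      ring
    · rw [hg s hs, min_eq_left (by linarith [hc s hs]), max_eq_right (by linarith [hc s hs])]
      ring

/-- Families of reals with the same order are related by an order isomorphism of the line. -/
theorem exists_orderIso_family {ι : Type} [Finite ι] (x x' : ι → ℝ)
    (h : ∀ i j, x i < x j → x' i < x' j) (hx : Function.Injective x) :
    ∃ g : ℝ ≃o ℝ, ∀ i, g (x i) = x' i := by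
  classical
  cases nonempty_fintype ι
  obtain ⟨g, hg⟩ := exists_orderIso (Finset.univ.image x) (Function.extend x x' 0) (by
    intro s hs t ht hst
    simp only [Finset.coe_image, Finset.coe_univ, image_univ, mem_range] at hs ht
    obtain ⟨i, rfl⟩ := hs
    obtain ⟨j, rfl⟩ := ht
    rw [hx.extend_apply, hx.extend_apply]
    exact h i j hst)
  refine ⟨g, fun i => ?_⟩
  rw [hg (x i) (by simp), hx.extend_apply]

/-- The point that divides the segment from `t` to `g t` in the ratio `λ`. -/
theorem strictMono_interpolate (g : ℝ ≃o ℝ) (l : unitInterval) :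
    StrictMono fun t => (1 - (l : ℝ)) * t + l * g t := by
  intro s t hst
  have h0 := l.2.1
  have h1 := l.2.2
  have h2 := g.strictMono hst
  simp only
  rcases h0.lt_or_eq with h | h
  · have := mul_lt_mul_of_pos_left h2 h
    have := mul_le_mul_of_nonneg_left hst.le (by linarith : (0:ℝ) ≤ 1 - l)
    linarith
  · rw [← h]; linarith

theorem surjective_interpolate (g : ℝ ≃o ℝ) (l : unitInterval) :
    Function.Surjective fun t => (1 - (l : ℝ)) * t + l * g t := by
  have hg : Continuous g := g.continuous
  have hm : ∀ t s, (1 - (l : ℝ)) * t + l * s ∈ uIcc t s := fun t s => by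
    have h0 := l.2.1
    have h1 := l.2.2
    rw [mem_uIcc]
    rcases le_total t s with h | h
    · left; constructor <;> nlinarith
    · right; constructor <;> nlinarith
  refine Continuous.surjective (by fun_prop) ?_ ?_
  · refine Filter.tendsto_atTop_mono (fun t => (hm t (g t)).1) ?_
    exact Filter.tendsto_inf_atTop _ Filter.tendsto_id g.tendsto_atTop
  · refine Filter.tendsto_atBot_mono (fun t => (hm t (g t)).2) ?_
    exact Filter.tendsto_sup_atBot _ Filter.tendsto_id g.tendsto_atBot

/-- The straight line isotopy from the identity to `g`. -/
noncomputable def interpolate (g : ℝ ≃o ℝ) (l : unitInterval) : ℝ ≃ₜ ℝ :=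
  ((strictMono_interpolate g l).orderIsoOfSurjective _ (surjective_interpolate g l)).toHomeomorph

theorem interpolate_apply (g : ℝ ≃o ℝ) (l : unitInterval) (t : ℝ) :
    interpolate g l t = (1 - (l : ℝ)) * t + l * g t := rfl

/-- A product of order isomorphisms of the line gives an isotopy. -/
theorem LinkDiagram.Carries.planarIsotopic_of_prod {D E : LinkDiagram} (f g : ℝ ≃o ℝ)
    (h : Carries (f.toHomeomorph.prodCongr g.toHomeomorph) D E) : D.PlanarIsotopic E := by
  have hf : Continuous f := f.continuous
  have hg : Continuous g := g.continuous
  refine ⟨fun l => (interpolate f l).prodCongr (interpolate g l), ?_, ?_, ?_⟩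
  · change Continuous fun z : unitInterval × Plane =>
      (((1 - (z.1 : ℝ)) * z.2.1 + z.1 * f z.2.1, (1 - (z.1 : ℝ)) * z.2.2 + z.1 * g z.2.2) : Plane)
    fun_prop
  · ext p <;> simp [interpolate_apply]
  · convert h using 1
    ext p <;> simp [interpolate_apply]

namespace RealDiagram

variable {ι κ : Type} [Finite ι] [Finite κ]

theorem mem_uIcc_map (g : ℝ ≃o ℝ) (a b t : ℝ) : g t ∈ uIcc (g a) (g b) ↔ t ∈ uIcc a b := by
  simp only [mem_uIcc, g.le_iff_le]

/-- Diagrams with the same combinatorics are isotopic. -/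
theorem isotopic_of_order (G G' : RealDiagram ι κ) (hX : G'.X = G.X) (hO : G'.O = G.O)
    (hB : G'.B = G.B) (hx : ∀ i j, G.x i < G.x j → G'.x i < G'.x j)
    (hy : ∀ i j, G.y i < G.y j → G'.y i < G'.y j) :
    G.toLinkDiagram.PlanarIsotopic G'.toLinkDiagram := by
  obtain ⟨f, hf⟩ := exists_orderIso_family G.x G'.x hx G.x_inj
  obtain ⟨g, hg⟩ := exists_orderIso_family G.y G'.y hy G.y_inj
  set φ := f.toHomeomorph.prodCongr g.toHomeomorph
  have hφ : ∀ p, φ p = (f p.1, g p.2) := fun p => rfl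
  have hv : ∀ i p, φ p ∈ G'.vEdge i ↔ p ∈ G.vEdge i := fun i p => by
    simp only [vEdge, vseg, hφ, mem_ofPred_eq, hX, hO, ← hf, ← hg, mem_uIcc_map, f.injective.eq_iff]
  have hh : ∀ i p, φ p ∈ G'.hEdge i ↔ p ∈ G.hEdge i := fun i p => by
    simp only [hEdge, hseg, hφ, mem_ofPred_eq, hX, hO, ← hf, ← hg, mem_uIcc_map, g.injective.eq_iff]
  refine LinkDiagram.Carries.planarIsotopic_of_prod f g ⟨fun p => ?_, fun p => ?_, fun c hc => ?_⟩
  · change φ p ∈ (⋃ i, G'.vEdge i) ∪ ⋃ j, G'.hEdge j ↔ p ∈ (⋃ i, G.vEdge i) ∪ ⋃ j, G.hEdge j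
    simp only [mem_union, mem_iUnion, hv, hh]
  · change (∃ i j, φ p ∈ G'.vEdge i ∧ φ p ∈ G'.hEdge j ∧ ¬ G'.Incident i j) ↔
      ∃ i j, p ∈ G.vEdge i ∧ p ∈ G.hEdge j ∧ ¬ G.Incident i j
    simp only [hv, hh, Incident, hX, hO]
  · refine Filter.Eventually.of_forall fun p => ?_
    change φ p ∈ G'.picture.overAt (φ c) ↔ p ∈ G.picture.overAt c
    have e : (∃ j ∈ G'.B, φ c ∈ G'.hEdge j) ↔ ∃ j ∈ G.B, c ∈ G.hEdge j := by simp only [hh, hB]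
    by_cases hc' : ∃ j ∈ G.B, c ∈ G.hEdge j
    · simp only [picture, if_pos hc', if_pos (e.2 hc'), mem_iUnion, hh]
    · simp only [picture, if_neg hc', if_neg (mt e.1 hc'), mem_iUnion, hv]

/-- The crossings on horizontal edges without crossings need not be specified. -/
theorem isotopic_of_over (G G' : RealDiagram ι κ) (hX : G'.X = G.X) (hO : G'.O = G.O)
    (hx : G'.x = G.x) (hy : G'.y = G.y)
    (hB : ∀ i j, (G.x i, G.y j) ∈ G.vEdge i → (G.x i, G.y j) ∈ G.hEdge j → ¬ G.Incident i j →
      (j ∈ G'.B ↔ j ∈ G.B)) :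
    G.toLinkDiagram.PlanarIsotopic G'.toLinkDiagram := by
  have hv : ∀ i, G'.vEdge i = G.vEdge i := fun i => by simp only [vEdge, hX, hO, hx, hy]
  have hh : ∀ i, G'.hEdge i = G.hEdge i := fun i => by simp only [hEdge, hX, hO, hx, hy]
  refine LinkDiagram.Carries.planarIsotopic_of_refl ⟨fun p => ?_, fun p => ?_, fun c hc => ?_⟩
  · change p ∈ (⋃ i, G'.vEdge i) ∪ ⋃ j, G'.hEdge j ↔ p ∈ (⋃ i, G.vEdge i) ∪ ⋃ j, G.hEdge j
    simp only [hv, hh]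
  · change (∃ i j, p ∈ G'.vEdge i ∧ p ∈ G'.hEdge j ∧ ¬ G'.Incident i j) ↔
      ∃ i j, p ∈ G.vEdge i ∧ p ∈ G.hEdge j ∧ ¬ G.Incident i j
    simp only [hv, hh, Incident, hX, hO]
  · obtain ⟨i, j, hi, hj, hij⟩ := hc
    have e := eq_of_mem_of_mem hi hj
    have h1 := hB i j (e ▸ hi) (e ▸ hj) hij
    have h2 : G'.picture.overAt c = G.picture.overAt c := by
      have hj' : c ∈ G'.hEdge j := by rw [hh]; exact hj
      by_cases hjB : j ∈ G.B
      · rw [overAt_of_mem hj hjB, overAt_of_mem hj' (h1.2 hjB)]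
        simp only [hh]
      · rw [overAt_of_notMem hj hjB, overAt_of_notMem hj' (fun h => hjB (h1.1 h))]
        simp only [hv]
    refine Filter.Eventually.of_forall fun p => ?_
    change p ∈ G'.picture.overAt c ↔ p ∈ G.picture.overAt c
    rw [h2]

end RealDiagram

/-! ## Sweeping a horizontal edge -/

namespace RectDiagram

variable {n : ℕ}

/-- The part of the diagram outside the horizontal edge `s` and the adjacent vertical edges. -/
def rest (D : RectDiagram n) (s : Fin n) : Frame where
  R := {p | (∃ i, D.X i ≠ s ∧ D.O i ≠ s ∧ p ∈ D.vEdge i) ∨ ∃ j, j ≠ s ∧ p ∈ D.hEdge j}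
  C := {p | ∃ i j, (D.X i ≠ s ∧ D.O i ≠ s) ∧ j ≠ s ∧ p ∈ D.vEdge i ∧ p ∈ D.hEdge j ∧
    ¬ (j = D.X i ∨ j = D.O i)}
  V := {p | ∃ i, D.X i ≠ s ∧ D.O i ≠ s ∧ p ∈ D.vEdge i}
  K := {p | ∃ i j, (D.X i = s ∨ D.O i = s) ∧ j ≠ s ∧ (j = D.X i ∨ j = D.O i) ∧
    p = (((i : ℕ) : ℝ), ((j : ℕ) : ℝ))}

/-- The horizontal edge `s` has its left end on the vertical edge `l`, which joins it to `el`,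
and its right end on the vertical edge `r`, which joins it to `er`. -/
structure Ends (D : RectDiagram n) (s l r el er : Fin n) : Prop where
  lt : l < r
  ends : (D.X l = s ∧ D.O l = el ∧ D.O r = s ∧ D.X r = er) ∨
    (D.O l = s ∧ D.X l = el ∧ D.X r = s ∧ D.O r = er)

theorem exists_ends (D : RectDiagram n) (s : Fin n) : ∃ l r el er, D.Ends s l r el er := by
  rcases lt_or_gt_of_ne (D.symm_ne s) with h | h
  · exact ⟨_, _, _, _, h, Or.inl ⟨by simp, rfl, by simp, rfl⟩⟩
  · exact ⟨_, _, _, _, h, Or.inr ⟨by simp, rfl, by simp, rfl⟩⟩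

/-- The diagram with the horizontal edge `s` moved to the height `z`, as an overpass. -/
noncomputable def moveRow (D : RectDiagram n) (s : Fin n) (z : ℝ) (hz : ∀ k : Fin n, k ≠ s → z ≠ (k : ℕ)) :
    RealDiagram (Fin n) (Fin n) where
  X := D.X
  O := D.O
  ne := D.ne
  x i := (i : ℕ)
  y k := if k = s then z else (k : ℕ)
  x_inj i j h := natCast_fin_inj h
  y_inj i j h := by
    beta_reduce at h
    split_ifs at h with h1 h2 h2
    · rw [h1, h2]
    · exact absurd h (hz j h2)
    · exact absurd h.symm (hz i h1)
    · exact natCast_fin_inj h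
  B := {s}

/-- An overpass with a horizontal edge at the height `z`. -/
def rowPath (l el r er z : ℝ) : Set Plane :=
  {p | (p.1 = l ∧ p.2 ∈ uIcc el z) ∨ (p.2 = z ∧ l ≤ p.1 ∧ p.1 ≤ r) ∨ (p.1 = r ∧ p.2 ∈ uIcc er z)}

/-- An overpass with horizontal edges at the heights `zl` and `zr`, joined at the abscissa `u`. -/
def splitPath (l el r er zl zr u : ℝ) : Set Plane :=
  {p | (p.1 = l ∧ p.2 ∈ uIcc el zl) ∨ (p.2 = zl ∧ l ≤ p.1 ∧ p.1 ≤ u) ∨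
    (p.1 = u ∧ zl ≤ p.2 ∧ p.2 ≤ zr) ∨ (p.2 = zr ∧ u ≤ p.1 ∧ p.1 ≤ r) ∨
    (p.1 = r ∧ p.2 ∈ uIcc er zr)}

variable {D : RectDiagram n} {s l r el er : Fin n}

theorem Ends.eq_or_eq (h : D.Ends s l r el er) {i : Fin n} (hi : D.X i = s ∨ D.O i = s) :
    i = l ∨ i = r := by
  rcases h.ends with ⟨h1, -, h2, -⟩ | ⟨h1, -, h2, -⟩ <;> rcases hi with hi | hi
  · left; exact D.X.injective (hi.trans h1.symm)
  · right; exact D.O.injective (hi.trans h2.symm)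
  · right; exact D.X.injective (hi.trans h2.symm)
  · left; exact D.O.injective (hi.trans h1.symm)

theorem Ends.left_ne (hE : D.Ends s l r el er) : el ≠ s := by
  rcases hE.ends with ⟨h1, h2, -⟩ | ⟨h1, h2, -⟩
  · rw [← h1, ← h2]; exact (D.ne l).symm
  · rw [← h1, ← h2]; exact D.ne l

theorem Ends.right_ne (hE : D.Ends s l r el er) : er ≠ s := by
  rcases hE.ends with ⟨-, -, h1, h2⟩ | ⟨-, -, h1, h2⟩
  · rw [← h1, ← h2]; exact D.ne r
  · rw [← h1, ← h2]; exact (D.ne r).symm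

theorem moveRow_vEdge {z : ℝ} {hz : ∀ k : Fin n, k ≠ s → z ≠ (k : ℕ)} {i : Fin n} (h1 : D.X i ≠ s)
    (h2 : D.O i ≠ s) : (D.moveRow s z hz).vEdge i = D.vEdge i := by
  simp [RealDiagram.vEdge, vEdge, moveRow, h1, h2]

theorem moveRow_hEdge {z : ℝ} {hz : ∀ k : Fin n, k ≠ s → z ≠ (k : ℕ)} {j : Fin n} (h1 : j ≠ s) :
    (D.moveRow s z hz).hEdge j = D.hEdge j := by
  simp [RealDiagram.hEdge, hEdge, moveRow, h1]

/-- The frame does not depend on the height `z`; this makes drawings at different stages of the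
sweep overpasses on one common frame. -/
theorem moveRow_frame {z : ℝ} {hz : ∀ k : Fin n, k ≠ s → z ≠ (k : ℕ)} :
    (D.moveRow s z hz).frame {i | D.X i = s ∨ D.O i = s} = D.rest s := by
  have hB : ∀ j, j ∉ (D.moveRow s z hz).B ↔ j ≠ s := fun j => Iff.rfl
  have hA : ∀ i, i ∉ {i | D.X i = s ∨ D.O i = s} ↔ D.X i ≠ s ∧ D.O i ≠ s := fun i => by simp
  have hI : ∀ i j, (D.moveRow s z hz).Incident i j ↔ (j = D.X i ∨ j = D.O i) := fun i j => Iff.rfl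
  have e1 : ∀ p : Plane, (∃ i, i ∉ {i | D.X i = s ∨ D.O i = s} ∧ p ∈ (D.moveRow s z hz).vEdge i) ↔
      ∃ i, D.X i ≠ s ∧ D.O i ≠ s ∧ p ∈ D.vEdge i := fun p => by
    refine exists_congr fun i => ?_
    rw [hA, and_assoc]
    refine and_congr_right fun h1 => and_congr_right fun h2 => by rw [moveRow_vEdge h1 h2]
  have e2 : ∀ p : Plane, (∃ j, j ∉ (D.moveRow s z hz).B ∧ p ∈ (D.moveRow s z hz).hEdge j) ↔
      ∃ j, j ≠ s ∧ p ∈ D.hEdge j := fun p =>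
    exists_congr fun j => and_congr_right fun h => by rw [moveRow_hEdge h]
  simp only [RealDiagram.frame, rest, Frame.mk.injEq]
  refine ⟨?_, ?_, ?_, ?_⟩
  · ext p
    exact or_congr (e1 p) (e2 p)
  · ext p
    simp only [mem_ofPred_eq]
    constructor
    · rintro ⟨i, hi, j, hj, h1, h2, h3⟩
      have hi' := (hA i).1 hi
      rw [moveRow_vEdge hi'.1 hi'.2] at h1
      rw [moveRow_hEdge hj] at h2
      exact ⟨i, j, hi', hj, h1, h2, h3⟩
    · rintro ⟨i, j, hi, hj, h1, h2, h3⟩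
      rw [← moveRow_vEdge (hz := hz) hi.1 hi.2] at h1
      rw [← moveRow_hEdge (hz := hz) hj] at h2
      exact ⟨i, (hA i).2 hi, j, hj, h1, h2, h3⟩
  · ext p
    exact e1 p
  · ext p
    constructor
    · rintro ⟨i, hi, j, hj, h1, h2⟩
      refine ⟨i, j, hi, hj, h1, ?_⟩
      have : j ≠ s := hj
      simpa [moveRow, this] using h2
    · rintro ⟨i, j, hi, hj, h1, h2⟩
      exact ⟨i, hi, j, hj, h1, by simpa [moveRow, hj] using h2⟩

/-- The overpass consists of row `s` and its two columns. It cannot cross itself, since both columns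
are adjacent to its only row. -/
theorem rep_moveRow (hE : D.Ends s l r el er) {z : ℝ} (hz : ∀ k : Fin n, k ≠ s → z ≠ (k : ℕ)) :
    (D.rest s).Rep (rowPath (l : ℕ) (el : ℕ) (r : ℕ) (er : ℕ) z) (D.moveRow s z hz).toLinkDiagram := by
  have h := (D.moveRow s z hz).rep_toLinkDiagram {i | D.X i = s ∨ D.O i = s} ?_ ?_
  · rw [moveRow_frame] at h
    refine h.congr ?_
    ext p
    simp only [RealDiagram.path, mem_ofPred_eq]
    have hlr : ((l : ℕ) : ℝ) ≤ (r : ℕ) := by exact_mod_cast hE.lt.le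
    have e1 : p ∈ (D.moveRow s z hz).hEdge s ↔ p.2 = z ∧ (l : ℕ) ≤ p.1 ∧ p.1 ≤ (r : ℕ) := by
      simp only [RealDiagram.hEdge, hseg, mem_ofPred_eq, moveRow, if_true]
      rcases hE.ends with ⟨h1, -, h2, -⟩ | ⟨h1, -, h2, -⟩
      · rw [← h1, Equiv.symm_apply_apply, h1, ← h2, Equiv.symm_apply_apply, uIcc_of_le hlr]; rfl
      · rw [← h1, Equiv.symm_apply_apply, h1, ← h2, Equiv.symm_apply_apply, uIcc_comm, uIcc_of_le hlr]; rfl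
    have e2 : ∀ i e, e ≠ s → ((D.X i = s ∧ D.O i = e) ∨ (D.O i = s ∧ D.X i = e)) →
        (p ∈ (D.moveRow s z hz).vEdge i ↔ p.1 = (i : ℕ) ∧ p.2 ∈ uIcc ((e : ℕ) : ℝ) z) := by
      rintro i e he (⟨h1, h2⟩ | ⟨h1, h2⟩)
      · simp [RealDiagram.vEdge, vseg, moveRow, h1, h2, he, uIcc_comm]
      · simp [RealDiagram.vEdge, vseg, moveRow, h1, h2, he]
    have hl := e2 l el hE.left_ne (hE.ends.imp (fun h => ⟨h.1, h.2.1⟩) fun h => ⟨h.1, h.2.1⟩)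
    have hr := e2 r er hE.right_ne (hE.ends.symm.imp (fun h => h.2.2) fun h => h.2.2)
    constructor
    · rintro (⟨i, hi, hp⟩ | ⟨j, hj, hp⟩)
      · rcases hE.eq_or_eq hi with rfl | rfl
        · exact Or.inl (hl.1 hp)
        · exact Or.inr (Or.inr (hr.1 hp))
      · obtain rfl : j = s := hj
        exact Or.inr (Or.inl (e1.1 hp))
    · rintro (hp | hp | hp)
      · exact Or.inl ⟨l, hE.ends.imp (fun h => h.1) fun h => h.1, hl.2 hp⟩
      · exact Or.inr ⟨s, rfl, e1.2 hp⟩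
      · exact Or.inl ⟨r, hE.ends.symm.imp (fun h => h.2.2.1) fun h => h.2.2.1, hr.2 hp⟩
  · rintro i j hj (h | h)
    · exact Or.inl (h.symm.trans hj)
    · exact Or.inr (h.symm.trans hj)
  · rintro i hi j hj - -
    obtain rfl : j = s := hj
    exact hi.imp Eq.symm Eq.symm

/-- The diagram in which the horizontal edge `s` is replaced by an overpass with horizontal edges
at the heights `zX` and `zO`, which are joined at the abscissa `u`. -/
noncomputable def splitRow (D : RectDiagram n) (s : Fin n) (zX zO u : ℝ) (hX : ∀ k : Fin n, zX ≠ (k : ℕ))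
    (hO : ∀ k : Fin n, zO ≠ (k : ℕ)) (hXO : zX ≠ zO) (hu : ∀ k : Fin n, u ≠ (k : ℕ)) :
    RealDiagram (Option (Fin n)) (Option (Fin n)) where
  X := Equiv.optionCongr D.X
  -- The old column that ended in row `s` by its `O`-end now ends in the new row `none`, at height
  -- `zO`. The new column joins `none` to `some s`, which keeps the `X`-end and lies at height `zX`.
  O := (Equiv.optionCongr D.O).trans (Equiv.swap none (some s))
  ne i := by
    cases i with
    | none => simp
    | some i =>
      by_cases h : D.O i = s
      · simp [h]
      · simpa [Equiv.swap_apply_of_ne_of_ne, h] using D.ne i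
  x i := i.elim u fun k => (k : ℕ)
  y j := j.elim zO fun k => if k = s then zX else (k : ℕ)
  x_inj i j h := by
    cases i <;> cases j
    · rfl
    · exact absurd h (hu _)
    · exact absurd h.symm (hu _)
    · exact congrArg some (natCast_fin_inj h)
  y_inj i j h := by
    cases i with
    | none =>
      cases j with
      | none => rfl
      | some j =>
        simp only [Option.elim] at h
        split_ifs at h with h1
        · exact absurd h.symm hXO
        · exact absurd h (hO j)
    | some i =>
      cases j with
      | none =>
        simp only [Option.elim] at h
        split_ifs at h with h1
        · exact absurd h hXO
        · exact absurd h.symm (hO i)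
      | some j =>
        simp only [Option.elim] at h
        split_ifs at h with h1 h2 h2
        · rw [h1, h2]
        · exact absurd h (hX j)
        · exact absurd h.symm (hX i)
        · exact congrArg some (natCast_fin_inj h)
  B := {none, some s}

section split

variable {zX zO u : ℝ} {hX : ∀ k : Fin n, zX ≠ (k : ℕ)} {hO : ∀ k : Fin n, zO ≠ (k : ℕ)}
  {hXO : zX ≠ zO} {hu : ∀ k : Fin n, u ≠ (k : ℕ)}

theorem splitRow_O {i : Fin n} (h : D.O i ≠ s) :
    (D.splitRow s zX zO u hX hO hXO hu).O (some i) = some (D.O i) := by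
  simp [splitRow, Equiv.swap_apply_of_ne_of_ne, h]

theorem splitRow_O_of_eq {i : Fin n} (h : D.O i = s) :
    (D.splitRow s zX zO u hX hO hXO hu).O (some i) = none := by
  simp [splitRow, h]

theorem splitRow_O_none : (D.splitRow s zX zO u hX hO hXO hu).O none = some s := by
  simp [splitRow]

theorem splitRow_X {i : Fin n} :
    (D.splitRow s zX zO u hX hO hXO hu).X (some i) = some (D.X i) := rfl

theorem splitRow_O_symm {j : Fin n} (h : j ≠ s) :
    (D.splitRow s zX zO u hX hO hXO hu).O.symm (some j) = some (D.O.symm j) := by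
  rw [Equiv.symm_apply_eq, splitRow_O] <;> simp [h]

theorem splitRow_vEdge {i : Fin n} (h1 : D.X i ≠ s) (h2 : D.O i ≠ s) :
    (D.splitRow s zX zO u hX hO hXO hu).vEdge (some i) = D.vEdge i := by
  rw [RealDiagram.vEdge, splitRow_O h2, splitRow_X]
  simp [vEdge, splitRow, h1, h2]

theorem splitRow_hEdge {j : Fin n} (h1 : j ≠ s) :
    (D.splitRow s zX zO u hX hO hXO hu).hEdge (some j) = D.hEdge j := by
  have : (D.splitRow s zX zO u hX hO hXO hu).X.symm (some j) = some (D.X.symm j) := by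
    rw [Equiv.symm_apply_eq, splitRow_X, Equiv.apply_symm_apply]
  rw [RealDiagram.hEdge, splitRow_O_symm h1, this]
  simp [hEdge, splitRow, h1]

theorem splitRow_incident {i j : Fin n} (hj : j ≠ s) :
    (D.splitRow s zX zO u hX hO hXO hu).Incident (some i) (some j) ↔ (j = D.X i ∨ j = D.O i) := by
  simp only [RealDiagram.Incident, splitRow_X, Option.some_inj]
  by_cases h : D.O i = s
  · rw [splitRow_O_of_eq h, h]; simp [hj]
  · rw [splitRow_O h, Option.some_inj]

theorem splitRow_frame :
    (D.splitRow s zX zO u hX hO hXO hu).frame {i | ∀ k, i = some k → D.X k = s ∨ D.O k = s} =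
      D.rest s := by
  set G := D.splitRow s zX zO u hX hO hXO hu with hG
  set A : Set (Option (Fin n)) := {i | ∀ k, i = some k → D.X k = s ∨ D.O k = s} with hAd
  have hB : ∀ j, j ∉ G.B ↔ ∃ k, j = some k ∧ k ≠ s := fun j => by
    cases j <;> simp [hG, splitRow]
  have hA : ∀ i, i ∉ A ↔ ∃ k, i = some k ∧ D.X k ≠ s ∧ D.O k ≠ s := fun i => by
    simp [hAd]
  have e1 : ∀ p : Plane, (∃ i, i ∉ A ∧ p ∈ G.vEdge i) ↔
      ∃ i, D.X i ≠ s ∧ D.O i ≠ s ∧ p ∈ D.vEdge i := fun p => by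
    constructor
    · rintro ⟨i, hi, hp⟩
      obtain ⟨k, rfl, h1, h2⟩ := (hA i).1 hi
      rw [splitRow_vEdge h1 h2] at hp
      exact ⟨k, h1, h2, hp⟩
    · rintro ⟨k, h1, h2, hp⟩
      exact ⟨some k, (hA _).2 ⟨k, rfl, h1, h2⟩, by rwa [splitRow_vEdge h1 h2]⟩
  have e2 : ∀ p : Plane, (∃ j, j ∉ G.B ∧ p ∈ G.hEdge j) ↔ ∃ j, j ≠ s ∧ p ∈ D.hEdge j := fun p => by
    constructor
    · rintro ⟨j, hj, hp⟩
      obtain ⟨k, rfl, h1⟩ := (hB j).1 hj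
      rw [splitRow_hEdge h1] at hp
      exact ⟨k, h1, hp⟩
    · rintro ⟨k, h1, hp⟩
      exact ⟨some k, (hB _).2 ⟨k, rfl, h1⟩, by rwa [splitRow_hEdge h1]⟩
  simp only [RealDiagram.frame, rest, Frame.mk.injEq]
  refine ⟨?_, ?_, ?_, ?_⟩
  · ext p
    exact or_congr (e1 p) (e2 p)
  · ext p
    simp only [mem_ofPred_eq]
    constructor
    · rintro ⟨i, hi, j, hj, h1, h2, h3⟩
      obtain ⟨i, rfl, hi'⟩ := (hA i).1 hi
      obtain ⟨j, rfl, hj'⟩ := (hB j).1 hj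
      rw [splitRow_vEdge hi'.1 hi'.2] at h1
      rw [splitRow_hEdge hj'] at h2
      rw [splitRow_incident hj'] at h3
      exact ⟨i, j, hi', hj', h1, h2, h3⟩
    · rintro ⟨i, j, hi, hj, h1, h2, h3⟩
      refine ⟨some i, (hA _).2 ⟨i, rfl, hi⟩, some j, (hB _).2 ⟨j, rfl, hj⟩, ?_, ?_, ?_⟩
      · rwa [splitRow_vEdge hi.1 hi.2]
      · rwa [splitRow_hEdge hj]
      · rwa [splitRow_incident hj]
  · ext p
    exact e1 p
  · ext p
    constructor
    · rintro ⟨i, hi, j, hj, h1, h2⟩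
      obtain ⟨j, rfl, hj'⟩ := (hB j).1 hj
      cases i with
      | none =>
        rcases h1 with h1 | h1
        · exact absurd h1 (by simp [hG, splitRow])
        · rw [splitRow_O_none, Option.some_inj] at h1
          exact absurd h1 hj'
      | some i =>
        refine ⟨i, j, hi i rfl, hj', (splitRow_incident hj').1 h1, ?_⟩
        simpa [hG, splitRow, hj'] using h2
    · rintro ⟨i, j, hi, hj, h1, h2⟩
      refine ⟨some i, ?_, some j, (hB _).2 ⟨j, rfl, hj⟩, (splitRow_incident hj).2 h1, ?_⟩
      · rintro k hk
        rw [Option.some_inj] at hk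
        exact hk ▸ hi
      · simpa [hG, splitRow, hj] using h2

/-- The overpass, for `u` strictly between the ends of the horizontal edge. -/
theorem rep_splitRow {a b : Fin n} (ha : D.X a = s) (hb : D.O b = s)
    (hab : ((a : ℕ) < u ∧ u < (b : ℕ)) ∨ ((b : ℕ) < u ∧ u < (a : ℕ))) :
    (D.rest s).Rep ({p | (p.1 = (a : ℕ) ∧ p.2 ∈ uIcc ((D.O a : ℕ) : ℝ) zX) ∨
        (p.2 = zX ∧ p.1 ∈ uIcc ((a : ℕ) : ℝ) u) ∨ (p.1 = u ∧ p.2 ∈ uIcc zX zO) ∨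
        (p.2 = zO ∧ p.1 ∈ uIcc u ((b : ℕ) : ℝ)) ∨
        (p.1 = (b : ℕ) ∧ p.2 ∈ uIcc ((D.X b : ℕ) : ℝ) zO)})
      (D.splitRow s zX zO u hX hO hXO hu).toLinkDiagram := by
  set G := D.splitRow s zX zO u hX hO hXO hu with hG
  have hOa : D.O a ≠ s := fun h => D.ne a (ha.trans h.symm)
  have hXb : D.X b ≠ s := fun h => D.ne b (h.trans hb.symm)
  have ga : G.O (some a) = some (D.O a) := splitRow_O hOa
  have gb : G.O (some b) = none := splitRow_O_of_eq hb
  have gn : G.O none = some s := splitRow_O_none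
  have v1 : ∀ p, p ∈ G.vEdge (some a) ↔ p.1 = (a : ℕ) ∧ p.2 ∈ uIcc ((D.O a : ℕ) : ℝ) zX := fun p => by
    rw [RealDiagram.vEdge, ga, splitRow_X, ha, uIcc_comm]
    simp [vseg, hG, splitRow, hOa]
  have v2 : ∀ p, p ∈ G.vEdge (some b) ↔ p.1 = (b : ℕ) ∧ p.2 ∈ uIcc ((D.X b : ℕ) : ℝ) zO := fun p => by
    rw [RealDiagram.vEdge, gb, splitRow_X]
    simp [vseg, hG, splitRow, hXb]
  have v3 : ∀ p, p ∈ G.vEdge none ↔ p.1 = u ∧ p.2 ∈ uIcc zX zO := fun p => by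
    rw [RealDiagram.vEdge, gn, uIcc_comm]
    simp [vseg, hG, splitRow]
  have g1 : G.X.symm (some s) = some a := by rw [Equiv.symm_apply_eq, splitRow_X, ha]
  have g2 : G.O.symm (some s) = none := by rw [Equiv.symm_apply_eq, gn]
  have g3 : G.X.symm none = none := by rw [Equiv.symm_apply_eq]; rfl
  have g4 : G.O.symm none = some b := by rw [Equiv.symm_apply_eq, gb]
  have h1 : ∀ p, p ∈ G.hEdge (some s) ↔ p.2 = zX ∧ p.1 ∈ uIcc ((a : ℕ) : ℝ) u := fun p => by
    rw [RealDiagram.hEdge, g1, g2]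
    simp [hseg, hG, splitRow]
  have h2 : ∀ p, p ∈ G.hEdge none ↔ p.2 = zO ∧ p.1 ∈ uIcc u ((b : ℕ) : ℝ) := fun p => by
    rw [RealDiagram.hEdge, g3, g4]
    simp [hseg, hG, splitRow]
  have hA : ∀ i, i ∈ {i | ∀ k, i = some k → D.X k = s ∨ D.O k = s} ↔
      i = none ∨ i = some a ∨ i = some b := fun i => by
    cases i with
    | none => simp
    | some i =>
      simp only [mem_ofPred_eq, Option.some_inj, forall_eq', reduceCtorEq, false_or]
      rw [← ha, D.X.injective.eq_iff]
      conv_lhs => rw [ha, ← hb, D.O.injective.eq_iff]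
  have hB : ∀ j, j ∈ G.B ↔ j = none ∨ j = some s := fun j => Iff.rfl
  have h := G.rep_toLinkDiagram {i | ∀ k, i = some k → D.X k = s ∨ D.O k = s} ?_ ?_
  · rw [splitRow_frame] at h
    refine h.congr ?_
    ext p
    simp only [RealDiagram.path, hA, hB, mem_ofPred_eq, or_and_right, exists_or, exists_eq_left, v1, v2,
      v3, h1, h2]
    constructor
    · rintro ((h | h | h) | (h | h))
      exacts [Or.inr (Or.inr (Or.inl h)), Or.inl h, Or.inr (Or.inr (Or.inr (Or.inr h))),
        Or.inr (Or.inr (Or.inr (Or.inl h))), Or.inr (Or.inl h)]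
    · rintro (h | h | h | h | h)
      exacts [Or.inl (Or.inr (Or.inl h)), Or.inr (Or.inr h), Or.inl (Or.inl h), Or.inr (Or.inl h),
        Or.inl (Or.inr (Or.inr h))]
  · intro i j hj hij
    rw [hA]
    rcases (hB j).1 hj with rfl | rfl <;> rcases hij with hij | hij
    · rw [← Equiv.symm_apply_eq, g3] at hij; exact Or.inl hij.symm
    · rw [← Equiv.symm_apply_eq, g4] at hij; exact Or.inr (Or.inr hij.symm)
    · rw [← Equiv.symm_apply_eq, g1] at hij; exact Or.inr (Or.inl hij.symm)
    · rw [← Equiv.symm_apply_eq, g2] at hij; exact Or.inl hij.symm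
  · intro i hi j hj _ hj'
    rcases (hA i).1 hi with rfl | rfl | rfl <;> rcases (hB j).1 hj with rfl | rfl
    · exact Or.inl rfl
    · exact Or.inr gn.symm
    · have := ((h2 _).1 hj').2
      change ((a : ℕ) : ℝ) ∈ _ at this
      rw [mem_uIcc] at this
      rcases hab with hab | hab <;> rcases this with this | this <;> linarith
    · left; rw [splitRow_X, ha]
    · exact Or.inr gb.symm
    · have := ((h1 _).1 hj').2
      change ((b : ℕ) : ℝ) ∈ _ at this
      rw [mem_uIcc] at this
      rcases hab with hab | hab <;> rcases this with this | this <;> linarith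

end split

/-- If the left end of the row is its `X`-end, then `zl` plays the role of `zX`; otherwise it plays
that of `zO`, and the path is traversed in the opposite direction. -/
theorem exists_rep_split (hE : D.Ends s l r el er) {zl zr u : ℝ} (hzl : ∀ k : Fin n, zl ≠ (k : ℕ))
    (hzr : ∀ k : Fin n, zr ≠ (k : ℕ)) (hz : zl < zr) (hu : ∀ k : Fin n, u ≠ (k : ℕ))
    (hlu : (l : ℕ) < u) (hur : u < (r : ℕ)) :
    ∃ L, (D.rest s).Rep (splitPath (l : ℕ) (el : ℕ) (r : ℕ) (er : ℕ) zl zr u) L := by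
  rcases hE.ends with ⟨h1, h2, h3, h4⟩ | ⟨h1, h2, h3, h4⟩
  · refine ⟨_, (rep_splitRow (hX := hzl) (hO := hzr) (hXO := hz.ne) (hu := hu) h1 h3
      (Or.inl ⟨hlu, hur⟩)).congr ?_⟩
    ext p
    simp only [splitPath, mem_ofPred_eq, h2, h4, uIcc_of_le hlu.le, uIcc_of_le hur.le, uIcc_of_le hz.le,
      mem_Icc]
  · refine ⟨_, (rep_splitRow (hX := hzr) (hO := hzl) (hXO := hz.ne') (hu := hu) h3 h1
      (Or.inr ⟨hlu, hur⟩)).congr ?_⟩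
    ext p
    simp only [splitPath, mem_ofPred_eq, h2, h4, uIcc_of_ge hlu.le, uIcc_of_ge hur.le, uIcc_of_ge hz.le,
      mem_Icc]
    constructor
    · rintro (h | h | h | h | h)
      exacts [Or.inr (Or.inr (Or.inr (Or.inr h))), Or.inr (Or.inr (Or.inr (Or.inl h))),
        Or.inr (Or.inr (Or.inl h)), Or.inr (Or.inl h), Or.inl h]
    · rintro (h | h | h | h | h)
      exacts [Or.inr (Or.inr (Or.inr (Or.inr h))), Or.inr (Or.inr (Or.inr (Or.inl h))),
        Or.inr (Or.inr (Or.inl h)), Or.inr (Or.inl h), Or.inl h]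

end RectDiagram

/-! ### Passing a horizontal edge -/

theorem LocalMove.mono {n m : ℕ} (hnm : n ≤ m) {C K X S S' : Set Plane} (H : LocalMove n C K X S S') :
    LocalMove m C K X S S' :=
  fun F h T T' D D' h1 h2 h3 h4 h5 h6 => (H F h T T' D D' h1 h2 h3 h4 h5 h6).mono hnm

theorem LocalMove.congr {n : ℕ} {C C' K K' X X' S S' : Set Plane} (H : LocalMove n C K X S S')
    (hC : C' = C) (hK : K' = K) (hX : X' = X) : LocalMove n C' K' X' S S' := by
  subst hC hK hX; exact H

/-- The step of the overpass passes a vertical edge, which is `V` in the box. -/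
theorem localMove_stairs {V H : Set ℝ} {inc : Prop} {c : ℕ}
    (h : (¬ inc ∧ (V = ∅ ∨ V = univ) ∧ (H = ∅ ∨ H = univ)) ∨
      (inc ∧ (V = Ici 0 ∨ V = Iic 0) ∧ (H = Ici 0 ∨ H = Iic 0))) (hc : 0 ∈ H → 1 ≤ c) :
    LocalMove c {q | (q.1 = 0 ∧ q.2 ∈ V) ∨ (q.2 = 0 ∧ q.1 ∈ H)} ∅
      {q | q = 0 ∧ 0 ∈ V ∧ 0 ∈ H ∧ ¬ inc} (stairs (-1/2)) (stairs (1/2)) := by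
  rcases h with ⟨h0, (rfl | rfl), (rfl | rfl)⟩ | ⟨h0, (rfl | rfl), (rfl | rfl)⟩
  · exact (localMove_stairs_empty.congr (by simp) rfl (by simp)).mono (Nat.zero_le _)
  · exact (localMove_stairs_WE.congr (by simp) rfl (by simp)).mono (Nat.zero_le _)
  · exact (localMove_stairs_NS.congr (by simp) rfl (by simp)).mono (Nat.zero_le _)
  · exact (localMove_stairs_NSWE.congr (by simp) rfl (by ext q; simp [h0, Prod.ext_iff])).mono (hc (mem_univ _))
  · exact (localMove_stairs_NE.congr (by simp) rfl (by simp [h0])).mono (Nat.zero_le _)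
  · exact (localMove_stairs_NW.congr (by simp) rfl (by simp [h0])).mono (hc (by simp))
  · exact (localMove_stairs_SE.congr (by simp) rfl (by simp [h0])).mono (hc (by simp))
  · exact (localMove_stairs_SW.congr (by simp) rfl (by simp [h0])).mono (Nat.zero_le _)

/-- The end of the overpass passes a horizontal edge. -/
theorem localMove_turn {Z Z' H : Set ℝ} {K : Set Plane} {c : ℕ}
    (h : ((Z = Iic (1/2) ∧ Z' = Iic (-1/2) ∨ Z = Ici (1/2) ∧ Z' = Ici (-1/2)) ∧ K = ∅ ∧
        (H = ∅ ∨ H = univ)) ∨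
      (Z = Icc 0 (1/2) ∧ Z' = Icc (-1/2) 0 ∧ K = {0} ∧ (H = Ici 0 ∨ H = Iic 0)))
    (hc : 0 ∈ H → 1 ≤ c) :
    LocalMove c {q | q.2 = 0 ∧ q.1 ∈ H} K ∅ (highTurn Z) (lowTurn Z') := by
  rcases h with ⟨(⟨rfl, rfl⟩ | ⟨rfl, rfl⟩), rfl, (rfl | rfl)⟩ | ⟨rfl, rfl, rfl, (rfl | rfl)⟩
  · exact ((localMove_south (Or.inl rfl)).congr (by simp) rfl rfl).mono (Nat.zero_le _)
  · exact ((localMove_south (Or.inr rfl)).congr (by simp) rfl rfl).mono (Nat.zero_le _)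
  · exact (localMove_north.congr (by simp) rfl rfl).mono (Nat.zero_le _)
  · exact (localMove_north_WE.congr (by simp) rfl rfl).mono (hc (mem_univ _))
  · exact (localMove_joined_E.congr (by simp) rfl rfl).mono (hc (by simp))
  · exact (localMove_joined_W.congr (by simp) rfl rfl).mono (Nat.zero_le _)

/-- An increasing homeomorphism of the line that maps `[-1, 1]` to `[-3/4, 3/4]`. -/
structure IsBoxScale (g : ℝ ≃o ℝ) : Prop where
  neg_one : g (-1) = -3/4
  neg_half : g (-1/2) = -1/2
  zero : g 0 = 0
  half : g (1/2) = 1/2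
  one : g 1 = 3/4

theorem exists_isBoxScale : ∃ g, IsBoxScale g := by
  -- The radius `3/4` exceeds `1/2`, so the box contains both positions of the overpass, and it is
  -- less than `1`, so the box avoids the neighbouring grid lines.
  obtain ⟨g, hg⟩ := exists_orderIso {-1, -1/2, 0, 1/2, 1} (fun t => (t + max (-1/2) (min (1/2) t)) / 2) (by
    intro s _ t _ h
    have h1 : min (1/2) s ≤ min (1/2) t := min_le_min_left _ h.le
    have h2 : max (-1/2) (min (1/2) s) ≤ max (-1/2) (min (1/2) t) := max_le_max_left _ h1
    simp only
    linarith)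
  refine ⟨g, ?_, ?_, ?_, ?_, ?_⟩ <;> rw [hg _ (by simp)] <;> norm_num

namespace IsBoxScale

variable {g : ℝ ≃o ℝ}

theorem le_half (hg : IsBoxScale g) (t : ℝ) : g t ≤ 1/2 ↔ t ≤ 1/2 := by
  conv_lhs => rw [← hg.half, g.le_iff_le]

theorem half_le (hg : IsBoxScale g) (t : ℝ) : 1/2 ≤ g t ↔ 1/2 ≤ t := by
  conv_lhs => rw [← hg.half, g.le_iff_le]

theorem eq_half (hg : IsBoxScale g) (t : ℝ) : g t = 1/2 ↔ t = 1/2 := by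
  conv_lhs => rw [← hg.half, g.injective.eq_iff]

theorem le_neg_half (hg : IsBoxScale g) (t : ℝ) : g t ≤ -1/2 ↔ t ≤ -1/2 := by
  conv_lhs => rw [← hg.neg_half, g.le_iff_le]

theorem neg_half_le (hg : IsBoxScale g) (t : ℝ) : -1/2 ≤ g t ↔ -1/2 ≤ t := by
  conv_lhs => rw [← hg.neg_half, g.le_iff_le]

theorem eq_neg_half (hg : IsBoxScale g) (t : ℝ) : g t = -1/2 ↔ t = -1/2 := by
  conv_lhs => rw [← hg.neg_half, g.injective.eq_iff]

theorem le_zero (hg : IsBoxScale g) (t : ℝ) : g t ≤ 0 ↔ t ≤ 0 := by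
  conv_lhs => rw [← hg.zero, g.le_iff_le]

theorem zero_le (hg : IsBoxScale g) (t : ℝ) : 0 ≤ g t ↔ 0 ≤ t := by
  conv_lhs => rw [← hg.zero, g.le_iff_le]

theorem eq_zero (hg : IsBoxScale g) (t : ℝ) : g t = 0 ↔ t = 0 := by
  conv_lhs => rw [← hg.zero, g.injective.eq_iff]

theorem abs_le_iff (hg : IsBoxScale g) (t : ℝ) : |g t| ≤ 3/4 ↔ |t| ≤ 1 := by
  rw [abs_le, abs_le, ← g.le_iff_le (y := 1), ← g.le_iff_le (x := -1), hg.one, hg.neg_one, neg_div]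

theorem mem_box (hg : IsBoxScale g) {q : Plane} : q ∈ Box ↔ |g q.1| ≤ 3/4 ∧ |g q.2| ≤ 3/4 := by
  rw [hg.abs_le_iff, hg.abs_le_iff]; rfl

theorem mem_stairs (hg : IsBoxScale g) {q : Plane} : (q ∈ stairs (-1/2) ↔ ((g q.1, g q.2) : Plane) ∈ stairs (-1/2)) ∧
    (q ∈ stairs (1/2) ↔ ((g q.1, g q.2) : Plane) ∈ stairs (1/2)) := by
  simp only [stairs, mem_ofPred_eq, hg.le_half, hg.half_le, hg.eq_half, hg.le_neg_half, hg.neg_half_le,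
    hg.eq_neg_half, and_self]

theorem mem_highTurn (hg : IsBoxScale g) {Z : Set ℝ} (hZ : ∀ t, g t ∈ Z ↔ t ∈ Z) {q : Plane} :
    q ∈ highTurn Z ↔ ((g q.1, g q.2) : Plane) ∈ highTurn Z := by
  simp only [highTurn, mem_ofPred_eq, hg.eq_half, hg.eq_zero, hg.zero_le, hZ]

theorem mem_lowTurn (hg : IsBoxScale g) {Z : Set ℝ} (hZ : ∀ t, g t ∈ Z ↔ t ∈ Z) {q : Plane} :
    q ∈ lowTurn Z ↔ ((g q.1, g q.2) : Plane) ∈ lowTurn Z := by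
  simp only [lowTurn, mem_ofPred_eq, hg.le_half, hg.half_le, hg.eq_half, hg.neg_half_le,
    hg.eq_neg_half, hg.eq_zero, hg.zero_le, hZ]

end IsBoxScale

/-- The chart of the plane around the point `(x, y)`. -/
def boxChart (g : ℝ ≃o ℝ) (x y : ℝ) : Plane ≃ₜ Plane :=
  (g.toHomeomorph.trans (Homeomorph.addLeft x)).prodCongr (g.toHomeomorph.trans (Homeomorph.addLeft y))

theorem boxChart_apply (g : ℝ ≃o ℝ) (x y : ℝ) (q : Plane) :
    boxChart g x y q = (x + g q.1, y + g q.2) := rfl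

/-- The interval from `a` to `b`, seen from `c`. -/
def rays (a b c : ℕ) : Set ℝ :=
  {t | (min a b < c ∧ c < max a b) ∨ (c = min a b ∧ 0 ≤ t) ∨ (c = max a b ∧ t ≤ 0)}

/-- A window of radius less than `1` around an integer contains no other integer, so it sees
nothing, everything, or a half-line that starts at its centre. -/
theorem add_mem_uIcc_iff {a b c : ℕ} (hab : a ≠ b) {t : ℝ} (ht : |t| ≤ 3/4) :
    (c : ℝ) + t ∈ uIcc (a : ℝ) b ↔ t ∈ rays a b c := by
  obtain ⟨h1, h2⟩ := abs_le.1 ht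
  have key : ∀ k l : ℕ, k < l → (k : ℝ) + 1 ≤ l := fun k l h => by exact_mod_cast h
  wlog h : a < b generalizing a b
  · have h' : b < a := by omega
    have e : (c : ℝ) + t ∈ uIcc (b : ℝ) a ↔ t ∈ rays b a c := this hab.symm h'
    rw [uIcc_comm, e]
    simp only [rays, min_comm, max_comm]
  rw [uIcc_of_le (by exact_mod_cast h.le)]
  simp only [rays, mem_ofPred_eq, min_eq_left h.le, max_eq_right h.le, mem_Icc]
  have hab := key a b h
  rcases lt_trichotomy c a with h3 | h3 | h3
  · have := key c a h3
    constructor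
    · rintro ⟨h5, -⟩; linarith
    · rintro (h5 | h5 | h5) <;> omega
  · subst h3
    constructor
    · rintro ⟨h5, -⟩; right; left; exact ⟨rfl, by linarith⟩
    · rintro (h5 | h5 | h5)
      · omega
      · constructor <;> linarith [h5.2]
      · omega
  · have := key a c h3
    rcases lt_trichotomy c b with h4 | h4 | h4
    · have := key c b h4
      constructor
      · intro _; left; exact ⟨h3, h4⟩
      · intro _; constructor <;> linarith
    · subst h4
      constructor
      · rintro ⟨-, h5⟩; right; right; exact ⟨rfl, by linarith⟩
      · rintro (h5 | h5 | h5)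
        · omega
        · omega
        · constructor <;> linarith [h5.2]
    · have := key b c h4
      constructor
      · rintro ⟨-, h5⟩; linarith
      · rintro (h5 | h5 | h5) <;> omega

theorem IsBoxScale.mem_rays {g : ℝ ≃o ℝ} (hg : IsBoxScale g) (a b c : ℕ) (t : ℝ) :
    g t ∈ rays a b c ↔ t ∈ rays a b c := by
  simp only [rays, mem_ofPred_eq, hg.le_zero, hg.zero_le]

theorem zero_mem_rays {a b c : ℕ} : 0 ∈ rays a b c ↔ min a b ≤ c ∧ c ≤ max a b := by
  simp only [rays, mem_ofPred_eq, le_refl, and_true]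
  have := min_le_max (a := a) (b := b)
  omega

theorem rays_cases {a b c : ℕ} (hab : a ≠ b) :
    (¬ (c = a ∨ c = b) ∧ (rays a b c = ∅ ∨ rays a b c = univ)) ∨
      ((c = a ∨ c = b) ∧ (rays a b c = Ici 0 ∨ rays a b c = Iic 0)) := by
  by_cases h : c = a ∨ c = b
  · refine Or.inr ⟨h, ?_⟩
    by_cases h1 : c = min a b
    · left; ext t; simp only [rays, mem_ofPred_eq, mem_Ici]
      have : ¬ c = max a b := by omega
      have : ¬ (min a b < c ∧ c < max a b) := by omega
      tauto
    · right; ext t; simp only [rays, mem_ofPred_eq, mem_Iic]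
      have : c = max a b := by omega
      have : ¬ (min a b < c ∧ c < max a b) := by omega
      tauto
  · refine Or.inl ⟨h, ?_⟩
    have h1 : ¬ c = min a b := by omega
    have h2 : ¬ c = max a b := by omega
    by_cases h3 : min a b < c ∧ c < max a b
    · right; ext t; simp [rays, h3]
    · left; ext t; simp only [rays, mem_ofPred_eq, mem_empty_iff_false]; tauto

namespace RectDiagram

variable {n : ℕ} {D : RectDiagram n} {s l r el er : Fin n}

theorem add_eq_natCast_iff {a b : ℕ} {t : ℝ} (ht : |t| ≤ 3/4) : (a : ℝ) + t = b ↔ a = b ∧ t = 0 := by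
  obtain ⟨h1, h2⟩ := abs_le.1 ht
  constructor
  · intro h
    have hab : a = b := by
      rcases lt_trichotomy a b with h' | h' | h'
      · have : (a : ℝ) + 1 ≤ b := by exact_mod_cast h'
        linarith
      · exact h'
      · have : (b : ℝ) + 1 ≤ a := by exact_mod_cast h'
        linarith
    subst hab
    exact ⟨rfl, by linarith⟩
  · rintro ⟨rfl, rfl⟩; simp

theorem natCast_val_ne {a b : Fin n} (h : a ≠ b) : (a : ℕ) ≠ (b : ℕ) := fun e => h (Fin.ext e)

theorem boxChart_mem_vEdge {g : ℝ ≃o ℝ} (hg : IsBoxScale g) {i j k : Fin n} {q : Plane} (hq : q ∈ Box) :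
    boxChart g (i : ℕ) (j : ℕ) q ∈ D.vEdge k ↔ k = i ∧ q.1 = 0 ∧ q.2 ∈ rays (D.X i) (D.O i) j := by
  obtain ⟨h1, h2⟩ := hg.mem_box.1 hq
  simp only [boxChart_apply, vEdge, vseg, mem_ofPred_eq]
  rw [add_eq_natCast_iff h1, add_mem_uIcc_iff (natCast_val_ne (D.ne k)) h2, hg.eq_zero, hg.mem_rays,
    Fin.val_inj, and_assoc, eq_comm]
  refine and_congr_right ?_
  rintro rfl
  rfl

theorem boxChart_mem_hEdge {g : ℝ ≃o ℝ} (hg : IsBoxScale g) {i j k : Fin n} {q : Plane} (hq : q ∈ Box) :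
    boxChart g (i : ℕ) (j : ℕ) q ∈ D.hEdge k ↔
      k = j ∧ q.2 = 0 ∧ q.1 ∈ rays (D.X.symm j) (D.O.symm j) i := by
  obtain ⟨h1, h2⟩ := hg.mem_box.1 hq
  simp only [boxChart_apply, hEdge, hseg, mem_ofPred_eq]
  rw [add_eq_natCast_iff h2, add_mem_uIcc_iff (natCast_val_ne (D.symm_ne k)) h1, hg.eq_zero, hg.mem_rays,
    Fin.val_inj, and_assoc, eq_comm]
  refine and_congr_right ?_
  rintro rfl
  rfl

theorem incident_iff {i j : Fin n} :
    (j = D.X i ∨ j = D.O i) ↔ (i = D.X.symm j ∨ i = D.O.symm j) := by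
  rw [Equiv.eq_symm_apply, Equiv.eq_symm_apply, eq_comm, eq_comm (a := j)]

/-- Both the column and the row at a grid point end there or neither does. This leaves exactly the
local frames treated by `localMove_stairs`: four straight configurations and four corners. -/
theorem rays_col_cases {i j : Fin n} :
    (¬ (j = D.X i ∨ j = D.O i) ∧ (rays (D.X i) (D.O i) j = ∅ ∨ rays (D.X i) (D.O i) j = univ)) ∨
      ((j = D.X i ∨ j = D.O i) ∧ (rays (D.X i) (D.O i) j = Ici 0 ∨ rays (D.X i) (D.O i) j = Iic 0)) := by
  have := rays_cases (c := (j : ℕ)) (natCast_val_ne (D.ne i))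
  rwa [Fin.val_inj, Fin.val_inj] at this

theorem rays_row_cases {i j : Fin n} :
    (¬ (j = D.X i ∨ j = D.O i) ∧
      (rays (D.X.symm j) (D.O.symm j) i = ∅ ∨ rays (D.X.symm j) (D.O.symm j) i = univ)) ∨
      ((j = D.X i ∨ j = D.O i) ∧
        (rays (D.X.symm j) (D.O.symm j) i = Ici 0 ∨ rays (D.X.symm j) (D.O.symm j) i = Iic 0)) := by
  have := rays_cases (c := (i : ℕ)) (natCast_val_ne (D.symm_ne j))
  rwa [Fin.val_inj, Fin.val_inj, ← incident_iff] at this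

/-- The frame near the point `(i, j)`, if the vertical edge `i` is not adjacent to `s`. -/
theorem placed_interior {g : ℝ ≃o ℝ} (hg : IsBoxScale g) {i j : Fin n} (hi : D.X i ≠ s ∧ D.O i ≠ s)
    (hj : j ≠ s) : Placed (D.rest s) (boxChart g (i : ℕ) (j : ℕ))
      {q | (q.1 = 0 ∧ q.2 ∈ rays (D.X i) (D.O i) j) ∨
        (q.2 = 0 ∧ q.1 ∈ rays (D.X.symm j) (D.O.symm j) i)} ∅
      {q | q = 0 ∧ 0 ∈ rays (D.X i) (D.O i) j ∧ 0 ∈ rays (D.X.symm j) (D.O.symm j) i ∧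
        ¬ (j = D.X i ∨ j = D.O i)} := by
  refine ⟨fun q hq => ?_, fun q hq => ?_, fun q hq => ?_, fun c hc => ?_⟩
  · simp only [rest, mem_ofPred_eq, boxChart_mem_vEdge hg hq, boxChart_mem_hEdge hg hq]
    constructor
    · rintro (⟨k, -, -, -, h⟩ | ⟨k, -, -, h⟩)
      exacts [Or.inl h, Or.inr h]
    · rintro (h | h)
      exacts [Or.inl ⟨i, hi.1, hi.2, rfl, h⟩, Or.inr ⟨j, hj, rfl, h⟩]
  · simp only [rest, mem_ofPred_eq, mem_empty_iff_false, iff_false]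
    rintro ⟨k, m, h1, h2, h3, h4⟩
    obtain ⟨b1, b2⟩ := hg.mem_box.1 hq
    rw [boxChart_apply, Prod.ext_iff] at h4
    have := ((add_eq_natCast_iff b1).1 h4.1).1
    obtain rfl : i = k := Fin.ext this
    tauto
  · simp only [rest, mem_ofPred_eq, boxChart_mem_vEdge hg hq, boxChart_mem_hEdge hg hq]
    constructor
    · rintro ⟨k, m, h1, h2, ⟨rfl, h3, h4⟩, ⟨rfl, h5, h6⟩, h7⟩
      rw [h3] at h6
      rw [h5] at h4
      exact ⟨Prod.ext h3 h5, h4, h6, h7⟩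
    · rintro ⟨rfl, h1, h2, h3⟩
      exact ⟨i, j, hi, hj, ⟨rfl, rfl, h1⟩, ⟨rfl, rfl, h2⟩, h3⟩
  · obtain ⟨rfl, h1, -, h3⟩ := hc
    have hu : rays (D.X i) (D.O i) j = univ := by
      rcases D.rays_col_cases with ⟨-, h | h⟩ | ⟨h, -⟩
      · rw [h] at h1; exact absurd h1 (by simp)
      · exact h
      · exact absurd h h3
    filter_upwards [box_mem_nhds (c := 0) (by simp) (by simp)] with q hq
    simp only [rest, mem_ofPred_eq, boxChart_mem_vEdge hg hq, hu, mem_univ, and_true]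
    constructor
    · rintro ⟨k, -, -, -, h⟩; exact h
    · intro h; exact ⟨i, hi.1, hi.2, rfl, h⟩

/-- The frame near the point `(i, j)`, if the vertical edge `i` is adjacent to `s`. -/
theorem placed_end {g : ℝ ≃o ℝ} (hg : IsBoxScale g) {i j : Fin n} (hi : D.X i = s ∨ D.O i = s)
    (hj : j ≠ s) : Placed (D.rest s) (boxChart g (i : ℕ) (j : ℕ))
      {q | q.2 = 0 ∧ q.1 ∈ rays (D.X.symm j) (D.O.symm j) i} {q | q = 0 ∧ (j = D.X i ∨ j = D.O i)} ∅ := by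
  refine ⟨fun q hq => ?_, fun q hq => ?_, fun q hq => ?_, fun c hc => ?_⟩
  · simp only [rest, mem_ofPred_eq, boxChart_mem_vEdge hg hq, boxChart_mem_hEdge hg hq]
    constructor
    · rintro (⟨k, h1, h2, rfl, -⟩ | ⟨k, -, -, h⟩)
      · exact absurd hi (by simp [h1, h2])
      · exact h
    · exact fun h => Or.inr ⟨j, hj, rfl, h⟩
  · obtain ⟨b1, b2⟩ := hg.mem_box.1 hq
    simp only [rest, mem_ofPred_eq, boxChart_apply, Prod.ext_iff, add_eq_natCast_iff b1,
      add_eq_natCast_iff b2, hg.eq_zero, Fin.val_inj, Prod.fst_zero, Prod.snd_zero]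
    constructor
    · rintro ⟨k, m, h1, h2, h3, ⟨rfl, h4⟩, rfl, h5⟩
      exact ⟨⟨h4, h5⟩, h3⟩
    · rintro ⟨⟨h4, h5⟩, h3⟩
      exact ⟨i, j, hi, hj, h3, ⟨rfl, h4⟩, rfl, h5⟩
  · simp only [rest, mem_ofPred_eq, boxChart_mem_vEdge hg hq, mem_empty_iff_false, iff_false]
    rintro ⟨k, m, h1, -, ⟨rfl, -⟩, -⟩
    exact absurd hi (by simp [h1])
  · simp at hc

/-- The number of moves needed at the column `t` to pass the row `j`. -/
def cost (D : RectDiagram n) (j : Fin n) (t : ℕ) : ℕ :=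
  if min (D.X.symm j : ℕ) (D.O.symm j) ≤ t ∧ t ≤ max (D.X.symm j : ℕ) (D.O.symm j) then 1 else 0

theorem one_le_cost {i j : Fin n} (h : 0 ∈ rays (D.X.symm j) (D.O.symm j) i) : 1 ≤ D.cost j i := by
  rw [cost, if_pos (zero_mem_rays.1 h)]

theorem mem_splitPath_left {l r el er i j x y : ℝ} (h1 : l + 1 ≤ i) (h2 : i + 1 ≤ r)
    (hx : |x| ≤ 3/4) : (i + x, j + y) ∈ splitPath l el r er (j - 1/2) (j + 1/2) (i - 1/2) ↔
      (x, y) ∈ stairs (-1/2) := by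
  obtain ⟨a1, a2⟩ := abs_le.1 hx
  have e1 : ¬ i + x = l := fun h => by linarith
  have e2 : ¬ i + x = r := fun h => by linarith
  simp only [splitPath, stairs, mem_ofPred_eq, e1, e2, false_and, false_or, or_false]
  grind

theorem mem_splitPath_right {l r el er i j x y : ℝ} (h1 : l + 1 ≤ i) (h2 : i + 1 ≤ r)
    (hx : |x| ≤ 3/4) : (i + x, j + y) ∈ splitPath l el r er (j - 1/2) (j + 1/2) (i + 1/2) ↔
      (x, y) ∈ stairs (1/2) := by
  obtain ⟨a1, a2⟩ := abs_le.1 hx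
  have e1 : ¬ i + x = l := fun h => by linarith
  have e2 : ¬ i + x = r := fun h => by linarith
  simp only [splitPath, stairs, mem_ofPred_eq, e1, e2, false_and, false_or, or_false]
  grind

/-- The two paths differ only on the boundary of the square of half-side `1/2` around `(i, j)`,
which lies inside the box of radius `3/4`. -/
theorem splitPath_agree {l r el er i j x y : ℝ} (h1 : l + 1 ≤ i) (h2 : i + 1 ≤ r)
    (h : ¬ (|x| ≤ 3/4 ∧ |y| ≤ 3/4)) :
    (i + x, j + y) ∈ splitPath l el r er (j - 1/2) (j + 1/2) (i - 1/2) ↔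
      (i + x, j + y) ∈ splitPath l el r er (j - 1/2) (j + 1/2) (i + 1/2) := by
  have h' : x < -3/4 ∨ 3/4 < x ∨ y < -3/4 ∨ 3/4 < y := by
    by_contra hcon
    push Not at hcon
    exact h ⟨abs_le.2 ⟨by linarith, by linarith⟩, abs_le.2 ⟨by linarith, by linarith⟩⟩
  clear h
  simp only [splitPath, mem_ofPred_eq]
  generalize (i + x = l ∧ j + y ∈ uIcc el (j - 1/2)) = P
  generalize (i + x = r ∧ j + y ∈ uIcc er (j + 1/2)) = Q
  simp only [le_antisymm_iff]
  grind (splits := 30)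

/-- A column strictly between the ends is not adjacent to `s` and so belongs to the frame. The step
passes it in the box around `(i, j)`. -/
theorem reach_interior {i j : Fin n} (hE : D.Ends s l r el er) (hj : j ≠ s) (hli : l < i) (hir : i < r)
    {L L' : LinkDiagram}
    (hL : (D.rest s).Rep (splitPath (l : ℕ) (el : ℕ) (r : ℕ) (er : ℕ) ((j : ℕ) - 1/2) ((j : ℕ) + 1/2)
      ((i : ℕ) - 1/2)) L)
    (hL' : (D.rest s).Rep (splitPath (l : ℕ) (el : ℕ) (r : ℕ) (er : ℕ) ((j : ℕ) - 1/2) ((j : ℕ) + 1/2)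
      ((i : ℕ) + 1/2)) L') : Reach (D.cost j i) L L' := by
  obtain ⟨g, hg⟩ := exists_isBoxScale
  have hi : D.X i ≠ s ∧ D.O i ≠ s := by
    rw [← not_or]
    intro h
    rcases hE.eq_or_eq h with rfl | rfl
    · exact absurd hli (lt_irrefl _)
    · exact absurd hir (lt_irrefl _)
  have h1 : ((l : ℕ) : ℝ) + 1 ≤ (i : ℕ) := by exact_mod_cast hli
  have h2 : ((i : ℕ) : ℝ) + 1 ≤ (r : ℕ) := by exact_mod_cast hir
  refine localMove_stairs (V := rays (D.X i) (D.O i) j) (H := rays (D.X.symm j) (D.O.symm j) i)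
    (inc := j = D.X i ∨ j = D.O i) ?_ one_le_cost
    (D.rest s) (boxChart g (i : ℕ) (j : ℕ)) _ _ L L' (placed_interior hg hi hj) ?_ ?_ ?_ hL hL'
  · have c1 := D.rays_col_cases (i := i) (j := j)
    have c2 := D.rays_row_cases (i := i) (j := j)
    tauto
  · intro q hq
    rw [hg.mem_stairs.1, boxChart_apply, mem_splitPath_left h1 h2 (hg.mem_box.1 hq).1]
  · intro q hq
    rw [hg.mem_stairs.2, boxChart_apply, mem_splitPath_right h1 h2 (hg.mem_box.1 hq).1]
  · intro q hq
    rw [hg.mem_box] at hq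
    rw [boxChart_apply, splitPath_agree h1 h2 hq]

end RectDiagram

/-! ### The ends of the overpass at a row -/

/-- The intervals in which the overpass comes along the vertical axis, before and after it passes
a horizontal edge. -/
def EndIntervals (Z Z' : Set ℝ) : Prop :=
  (Z = Iic (1/2) ∧ Z' = Iic (-1/2)) ∨ (Z = Ici (1/2) ∧ Z' = Ici (-1/2)) ∨
    (Z = Icc 0 (1/2) ∧ Z' = Icc (-1/2) 0)

theorem EndIntervals.map {g : ℝ ≃o ℝ} (hg : IsBoxScale g) {Z Z' : Set ℝ} (h : EndIntervals Z Z') (t : ℝ) :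
    (g t ∈ Z ↔ t ∈ Z) ∧ (g t ∈ Z' ↔ t ∈ Z') ∧ (-g t ∈ Z ↔ -t ∈ Z) ∧ (-g t ∈ Z' ↔ -t ∈ Z') := by
  have e1 : ∀ t : ℝ, -t ≤ 1/2 ↔ -1/2 ≤ t := fun t => by constructor <;> intro h <;> linarith
  have e2 : ∀ t : ℝ, -t ≤ -1/2 ↔ 1/2 ≤ t := fun t => by constructor <;> intro h <;> linarith
  have e3 : ∀ t : ℝ, 1/2 ≤ -t ↔ t ≤ -1/2 := fun t => by constructor <;> intro h <;> linarith
  have e4 : ∀ t : ℝ, -1/2 ≤ -t ↔ t ≤ 1/2 := fun t => by constructor <;> intro h <;> linarith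
  rcases h with ⟨rfl, rfl⟩ | ⟨rfl, rfl⟩ | ⟨rfl, rfl⟩ <;>
    simp only [mem_Iic, mem_Ici, mem_Icc, e1, e2, e3, e4, neg_nonneg, neg_nonpos, hg.le_half, hg.half_le,
      hg.le_neg_half, hg.neg_half_le, hg.le_zero, hg.zero_le, and_self]

theorem neg_mem_highTurn {Z : Set ℝ} {q : Plane} : -q ∈ highTurn Z ↔
    (q.1 = 0 ∧ -q.2 ∈ Z) ∨ (q.2 = -1/2 ∧ q.1 ≤ 0) := by
  simp only [highTurn, mem_ofPred_eq, Prod.fst_neg, Prod.snd_neg, neg_eq_zero, neg_nonneg]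
  have : -q.2 = 1/2 ↔ q.2 = -1/2 := by constructor <;> intro h <;> linarith
  rw [this]

theorem neg_mem_lowTurn {Z : Set ℝ} {q : Plane} : -q ∈ lowTurn Z ↔
    (q.1 = 0 ∧ -q.2 ∈ Z) ∨ (q.2 = 1/2 ∧ -1/2 ≤ q.1 ∧ q.1 ≤ 0) ∨
      (q.1 = -1/2 ∧ -1/2 ≤ q.2 ∧ q.2 ≤ 1/2) ∨ (q.2 = -1/2 ∧ q.1 ≤ -1/2) := by
  simp only [lowTurn, mem_ofPred_eq, Prod.fst_neg, Prod.snd_neg, neg_eq_zero, neg_nonneg]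
  refine or_congr Iff.rfl ?_
  generalize q.1 = x
  generalize q.2 = y
  grind

/-- The three cases are those of a column coming from below the row, from above it, or starting on
it. In the first two the column fills a half-line of the window, in the last a segment of length
`1/2`. -/
theorem exists_endIntervals_left {e j : ℕ} : ∃ Z Z', EndIntervals Z Z' ∧
    (e ≠ j → (Z = Iic (1/2) ∧ Z' = Iic (-1/2)) ∨ (Z = Ici (1/2) ∧ Z' = Ici (-1/2))) ∧
    (e = j → Z = Icc 0 (1/2) ∧ Z' = Icc (-1/2) 0) ∧
    ∀ y : ℝ, |y| ≤ 3/4 → ((j : ℝ) + y ∈ uIcc (e : ℝ) (j + 1/2) ↔ y ∈ Z) ∧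
      ((j : ℝ) + y ∈ uIcc (e : ℝ) (j - 1/2) ↔ y ∈ Z') := by
  rcases lt_trichotomy e j with h | h | h
  · have h' : (e : ℝ) + 1 ≤ j := by exact_mod_cast h
    refine ⟨_, _, Or.inl ⟨rfl, rfl⟩, fun _ => Or.inl ⟨rfl, rfl⟩, fun h => by omega, fun y hy => ?_⟩
    obtain ⟨h1, h2⟩ := abs_le.1 hy
    rw [uIcc_of_le (by linarith), uIcc_of_le (by linarith)]
    simp only [mem_Icc, mem_Iic]
    grind
  · subst h
    refine ⟨_, _, Or.inr (Or.inr ⟨rfl, rfl⟩), fun h => absurd rfl h, fun _ => ⟨rfl, rfl⟩, fun y hy => ?_⟩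
    rw [uIcc_of_le (by linarith), uIcc_of_ge (by linarith)]
    simp only [mem_Icc]
    grind
  · have h' : (j : ℝ) + 1 ≤ e := by exact_mod_cast h
    refine ⟨_, _, Or.inr (Or.inl ⟨rfl, rfl⟩), fun _ => Or.inr ⟨rfl, rfl⟩, fun h => by omega, fun y hy => ?_⟩
    obtain ⟨h1, h2⟩ := abs_le.1 hy
    rw [uIcc_of_ge (by linarith), uIcc_of_ge (by linarith)]
    simp only [mem_Icc, mem_Ici]
    grind

theorem exists_endIntervals_right {e j : ℕ} : ∃ Z Z', EndIntervals Z Z' ∧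
    (e ≠ j → (Z = Iic (1/2) ∧ Z' = Iic (-1/2)) ∨ (Z = Ici (1/2) ∧ Z' = Ici (-1/2))) ∧
    (e = j → Z = Icc 0 (1/2) ∧ Z' = Icc (-1/2) 0) ∧
    ∀ y : ℝ, |y| ≤ 3/4 → ((j : ℝ) + y ∈ uIcc (e : ℝ) (j - 1/2) ↔ -y ∈ Z) ∧
      ((j : ℝ) + y ∈ uIcc (e : ℝ) (j + 1/2) ↔ -y ∈ Z') := by
  rcases lt_trichotomy e j with h | h | h
  · have h' : (e : ℝ) + 1 ≤ j := by exact_mod_cast h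
    refine ⟨_, _, Or.inr (Or.inl ⟨rfl, rfl⟩), fun _ => Or.inr ⟨rfl, rfl⟩, fun h => by omega, fun y hy => ?_⟩
    obtain ⟨h1, h2⟩ := abs_le.1 hy
    rw [uIcc_of_le (by linarith), uIcc_of_le (by linarith)]
    simp only [mem_Icc, mem_Ici]
    grind
  · subst h
    refine ⟨_, _, Or.inr (Or.inr ⟨rfl, rfl⟩), fun h => absurd rfl h, fun _ => ⟨rfl, rfl⟩, fun y hy => ?_⟩
    rw [uIcc_of_ge (by linarith), uIcc_of_le (by linarith)]
    simp only [mem_Icc]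
    grind
  · have h' : (j : ℝ) + 1 ≤ e := by exact_mod_cast h
    refine ⟨_, _, Or.inl ⟨rfl, rfl⟩, fun _ => Or.inl ⟨rfl, rfl⟩, fun h => by omega, fun y hy => ?_⟩
    obtain ⟨h1, h2⟩ := abs_le.1 hy
    rw [uIcc_of_ge (by linarith), uIcc_of_ge (by linarith)]
    simp only [mem_Icc, mem_Iic]
    grind

/-- The two positions of the end of the overpass agree away from the horizontal edge. -/
theorem mem_uIcc_agree {e j y : ℝ} (hy : y < -3/4 ∨ 3/4 < y) :
    j + y ∈ uIcc e (j + 1/2) ↔ j + y ∈ uIcc e (j - 1/2) := by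
  simp only [mem_uIcc]
  grind

theorem lt_or_lt_of_not_box {x y : ℝ} (h : ¬ (|x| ≤ 3/4 ∧ |y| ≤ 3/4)) :
    (x < -3/4 ∨ 3/4 < x) ∨ y < -3/4 ∨ 3/4 < y := by
  by_contra hcon
  push Not at hcon
  exact h ⟨abs_le.2 ⟨by linarith, by linarith⟩, abs_le.2 ⟨by linarith, by linarith⟩⟩

namespace RectDiagram

theorem mem_rowPath_left {l r el er j x y : ℝ} {Z : Set ℝ} (h1 : l + 1 ≤ r) (hx : |x| ≤ 3/4)
    (hZ : j + y ∈ uIcc el (j + 1/2) ↔ y ∈ Z) :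
    (l + x, j + y) ∈ rowPath l el r er (j + 1/2) ↔ (x, y) ∈ highTurn Z := by
  obtain ⟨a1, a2⟩ := abs_le.1 hx
  have e1 : ¬ l + x = r := fun h => by linarith
  simp only [rowPath, highTurn, mem_ofPred_eq, e1, false_and, or_false, hZ]
  generalize (y ∈ Z) = P
  grind

theorem mem_splitPath_low {l r el er j x y : ℝ} {Z : Set ℝ} (h1 : l + 1 ≤ r) (hx : |x| ≤ 3/4)
    (hZ : j + y ∈ uIcc el (j - 1/2) ↔ y ∈ Z) :
    (l + x, j + y) ∈ splitPath l el r er (j - 1/2) (j + 1/2) (l + 1/2) ↔ (x, y) ∈ lowTurn Z := by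
  obtain ⟨a1, a2⟩ := abs_le.1 hx
  have e1 : ¬ l + x = r := fun h => by linarith
  simp only [splitPath, lowTurn, mem_ofPred_eq, e1, false_and, or_false, hZ]
  generalize (y ∈ Z) = P
  grind

theorem rowPath_agree_left {l r el er j x y : ℝ} (h1 : l + 1 ≤ r) (h : ¬ (|x| ≤ 3/4 ∧ |y| ≤ 3/4)) :
    (l + x, j + y) ∈ rowPath l el r er (j + 1/2) ↔
      (l + x, j + y) ∈ splitPath l el r er (j - 1/2) (j + 1/2) (l + 1/2) := by
  have h' := lt_or_lt_of_not_box h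
  clear h
  have hv : x = 0 → (j + y ∈ uIcc el (j + 1/2) ↔ j + y ∈ uIcc el (j - 1/2)) := by
    rintro rfl
    refine mem_uIcc_agree ?_
    grind
  simp only [rowPath, splitPath, mem_ofPred_eq]
  generalize (l + x = r ∧ j + y ∈ uIcc er (j + 1/2)) = Q
  generalize (j + y ∈ uIcc el (j + 1/2)) = P at *
  generalize (j + y ∈ uIcc el (j - 1/2)) = P' at *
  simp only [le_antisymm_iff] at *
  grind (splits := 30)

theorem mem_splitPath_high {l r el er j x y : ℝ} {Z : Set ℝ} (h1 : l + 1 ≤ r) (hx : |x| ≤ 3/4)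
    (hZ : j + y ∈ uIcc er (j + 1/2) ↔ -y ∈ Z) :
    (r + x, j + y) ∈ splitPath l el r er (j - 1/2) (j + 1/2) (r - 1/2) ↔ -((x, y) : Plane) ∈ lowTurn Z := by
  obtain ⟨a1, a2⟩ := abs_le.1 hx
  have e1 : ¬ r + x = l := fun h => by linarith
  rw [neg_mem_lowTurn]
  simp only [splitPath, mem_ofPred_eq, e1, false_and, false_or, hZ]
  generalize (-y ∈ Z) = P
  grind

theorem mem_rowPath_right {l r el er j x y : ℝ} {Z : Set ℝ} (h1 : l + 1 ≤ r) (hx : |x| ≤ 3/4)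
    (hZ : j + y ∈ uIcc er (j - 1/2) ↔ -y ∈ Z) :
    (r + x, j + y) ∈ rowPath l el r er (j - 1/2) ↔ -((x, y) : Plane) ∈ highTurn Z := by
  obtain ⟨a1, a2⟩ := abs_le.1 hx
  have e1 : ¬ r + x = l := fun h => by linarith
  rw [neg_mem_highTurn]
  simp only [rowPath, mem_ofPred_eq, e1, false_and, false_or, hZ]
  generalize (-y ∈ Z) = P
  grind

theorem rowPath_agree_right {l r el er j x y : ℝ} (h1 : l + 1 ≤ r) (h : ¬ (|x| ≤ 3/4 ∧ |y| ≤ 3/4)) :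
    (r + x, j + y) ∈ splitPath l el r er (j - 1/2) (j + 1/2) (r - 1/2) ↔
      (r + x, j + y) ∈ rowPath l el r er (j - 1/2) := by
  have h' := lt_or_lt_of_not_box h
  clear h
  have hv : x = 0 → (j + y ∈ uIcc er (j + 1/2) ↔ j + y ∈ uIcc er (j - 1/2)) := by
    rintro rfl
    refine mem_uIcc_agree ?_
    grind
  simp only [rowPath, splitPath, mem_ofPred_eq]
  generalize (r + x = l ∧ j + y ∈ uIcc el (j - 1/2)) = Q
  generalize (j + y ∈ uIcc er (j + 1/2)) = P at *
  generalize (j + y ∈ uIcc er (j - 1/2)) = P' at *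
  simp only [le_antisymm_iff] at *
  grind (splits := 30)

variable {n : ℕ} {D : RectDiagram n} {s l r el er : Fin n}

theorem Ends.incident_left (hE : D.Ends s l r el er) {j : Fin n} (hj : j ≠ s) :
    (j = D.X l ∨ j = D.O l) ↔ el = j := by
  rcases hE.ends with ⟨h1, h2, -⟩ | ⟨h1, h2, -⟩
  · rw [h1, h2]; simp [hj, eq_comm]
  · rw [h1, h2]; simp [hj, eq_comm]

theorem Ends.incident_right (hE : D.Ends s l r el er) {j : Fin n} (hj : j ≠ s) :
    (j = D.X r ∨ j = D.O r) ↔ er = j := by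
  rcases hE.ends with ⟨-, -, h1, h2⟩ | ⟨-, -, h1, h2⟩
  · rw [h1, h2]; simp [hj, eq_comm]
  · rw [h1, h2]; simp [hj, eq_comm]

theorem Ends.left_mem (hE : D.Ends s l r el er) : D.X l = s ∨ D.O l = s :=
  hE.ends.imp (fun h => h.1) fun h => h.1

theorem Ends.right_mem (hE : D.Ends s l r el er) : D.X r = s ∨ D.O r = s :=
  hE.ends.symm.imp (fun h => h.2.2.1) fun h => h.2.2.1

theorem Ends.add_one_le (hE : D.Ends s l r el er) : ((l : ℕ) : ℝ) + 1 ≤ (r : ℕ) := by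
  exact_mod_cast hE.lt

/-- The column `l` belongs to the overpass, so the frame shows at most row `j` here. The end of the
overpass lies in this box exactly when `el = j`. -/
theorem reach_left {j : Fin n} (hE : D.Ends s l r el er) (hj : j ≠ s) {L L' : LinkDiagram}
    (hL : (D.rest s).Rep (rowPath (l : ℕ) (el : ℕ) (r : ℕ) (er : ℕ) ((j : ℕ) + 1/2)) L)
    (hL' : (D.rest s).Rep (splitPath (l : ℕ) (el : ℕ) (r : ℕ) (er : ℕ) ((j : ℕ) - 1/2) ((j : ℕ) + 1/2)
      ((l : ℕ) + 1/2)) L') : Reach (D.cost j l) L L' := by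
  obtain ⟨g, hg⟩ := exists_isBoxScale
  obtain ⟨Z, Z', hZZ, h1, h2, h3⟩ := exists_endIntervals_left (e := el) (j := j)
  have hlr := hE.add_one_le
  refine localMove_turn (Z := Z) (Z' := Z') (H := rays (D.X.symm j) (D.O.symm j) l)
    (K := {q | q = 0 ∧ (j = D.X l ∨ j = D.O l)}) ?_ one_le_cost
    (D.rest s) (boxChart g (l : ℕ) (j : ℕ)) _ _ L L' (placed_end hg hE.left_mem hj) ?_ ?_ ?_ hL hL'
  · rcases D.rays_row_cases (i := l) (j := j) with ⟨c1, c2⟩ | ⟨c1, c2⟩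
    · left
      refine ⟨h1 ?_, by simp [c1], c2⟩
      rw [hE.incident_left hj] at c1
      exact fun h => c1 (Fin.ext h)
    · right
      have c3 := (hE.incident_left hj).1 c1
      obtain ⟨e1, e2⟩ := h2 (congrArg _ c3)
      refine ⟨e1, e2, ?_, c2⟩
      ext q; simp [c1]
  · intro q hq
    obtain ⟨b1, b2⟩ := hg.mem_box.1 hq
    rw [hg.mem_highTurn fun t => (hZZ.map hg t).1, boxChart_apply, mem_rowPath_left hlr b1 (h3 _ b2).1]
  · intro q hq
    obtain ⟨b1, b2⟩ := hg.mem_box.1 hq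
    rw [hg.mem_lowTurn fun t => (hZZ.map hg t).2.1, boxChart_apply, mem_splitPath_low hlr b1 (h3 _ b2).2]
  · intro q hq
    rw [hg.mem_box] at hq
    rw [boxChart_apply, rowPath_agree_left hlr hq]

/-- A half turn makes the right end a left end, and lowering becomes raising; reversing time then
reduces to the local moves for left ends. -/
theorem reach_right {j : Fin n} (hE : D.Ends s l r el er) (hj : j ≠ s) {L L' : LinkDiagram}
    (hL : (D.rest s).Rep (splitPath (l : ℕ) (el : ℕ) (r : ℕ) (er : ℕ) ((j : ℕ) - 1/2) ((j : ℕ) + 1/2)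
      ((r : ℕ) - 1/2)) L)
    (hL' : (D.rest s).Rep (rowPath (l : ℕ) (el : ℕ) (r : ℕ) (er : ℕ) ((j : ℕ) - 1/2)) L') :
    Reach (D.cost j r) L L' := by
  obtain ⟨g, hg⟩ := exists_isBoxScale
  obtain ⟨Z, Z', hZZ, h1, h2, h3⟩ := exists_endIntervals_right (e := er) (j := j)
  have hlr := hE.add_one_le
  have H := localMove_turn (Z := Z) (Z' := Z') (H := {t | -t ∈ rays (D.X.symm j) (D.O.symm j) r})
    (K := {q | q = 0 ∧ (j = D.X r ∨ j = D.O r)}) (c := D.cost j r) ?_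
    (fun h => one_le_cost (by simpa using h))
  · refine H.rotate (D.rest s) (boxChart g (r : ℕ) (j : ℕ)) _ _ L L' ?_ ?_ ?_ ?_ hL hL'
    · convert placed_end hg hE.right_mem hj using 1
      · ext q; simp
      · ext q; simp
      · ext q; simp
    · intro q hq
      obtain ⟨b1, b2⟩ := hg.mem_box.1 hq
      rw [boxChart_apply, mem_splitPath_high hlr b1 (h3 _ b2).2]
      simp only [mem_ofPred_eq, neg_mem_lowTurn, (hZZ.map hg _).2.2.2, hg.le_half, hg.eq_half,
        hg.le_neg_half, hg.neg_half_le, hg.eq_neg_half, hg.eq_zero, hg.le_zero]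
    · intro q hq
      obtain ⟨b1, b2⟩ := hg.mem_box.1 hq
      rw [boxChart_apply, mem_rowPath_right hlr b1 (h3 _ b2).1]
      simp only [mem_ofPred_eq, neg_mem_highTurn, (hZZ.map hg _).2.2.1, hg.eq_neg_half, hg.eq_zero,
        hg.le_zero]
    · intro q hq
      rw [hg.mem_box] at hq
      rw [boxChart_apply, rowPath_agree_right hlr hq]
  · rcases D.rays_row_cases (i := r) (j := j) with ⟨c1, c2⟩ | ⟨c1, c2⟩
    · left
      refine ⟨h1 ?_, by simp [c1], ?_⟩
      · rw [hE.incident_right hj] at c1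
        exact fun h => c1 (Fin.ext h)
      · rcases c2 with c2 | c2 <;> rw [c2] <;> simp
    · right
      have c3 := (hE.incident_right hj).1 c1
      obtain ⟨e1, e2⟩ := h2 (congrArg _ c3)
      refine ⟨e1, e2, ?_, ?_⟩
      · ext q; simp [c1]
      · rcases c2 with c2 | c2 <;> rw [c2]
        · right; ext t; simp
        · left; ext t; simp

end RectDiagram

/-! ### The sweep -/

theorem sub_half_ne_natCast (k i : ℕ) : (k : ℝ) - 1/2 ≠ i := by
  intro h
  have h1 : ((2 * k : ℕ) : ℝ) = ((2 * i + 1 : ℕ) : ℝ) := by push_cast; linarith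
  have h2 : 2 * k = 2 * i + 1 := by exact_mod_cast h1
  omega

theorem add_half_ne_natCast (k i : ℕ) : (k : ℝ) + 1/2 ≠ i := by
  intro h
  have h1 : ((2 * k + 1 : ℕ) : ℝ) = ((2 * i : ℕ) : ℝ) := by push_cast; linarith
  have h2 : 2 * k + 1 = 2 * i := by exact_mod_cast h1
  omega

namespace RectDiagram

variable {n : ℕ} {D : RectDiagram n} {s l r el er : Fin n}

/-- Passing one horizontal edge. -/
theorem reach_row {j : Fin n} (hE : D.Ends s l r el er) (hj : j ≠ s) {L L' : LinkDiagram}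
    (hL : (D.rest s).Rep (rowPath (l : ℕ) (el : ℕ) (r : ℕ) (er : ℕ) ((j : ℕ) + 1/2)) L)
    (hL' : (D.rest s).Rep (rowPath (l : ℕ) (el : ℕ) (r : ℕ) (er : ℕ) ((j : ℕ) - 1/2)) L') :
    Reach (∑ t ∈ Finset.Icc (l : ℕ) r, D.cost j t) L L' := by
  have hlt : (l : ℕ) < r := hE.lt
  -- The intermediate diagrams have the step at `t + 1/2`, between two columns, and its two heights
  -- at `j ± 1/2`, between rows; no two edges become collinear.
  have hex : ∀ t : ℕ, (l : ℕ) ≤ t → t < (r : ℕ) → ∃ M, (D.rest s).Rep (splitPath (l : ℕ) (el : ℕ) (r : ℕ)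
      (er : ℕ) ((j : ℕ) - 1/2) ((j : ℕ) + 1/2) ((t : ℝ) + 1/2)) M := fun t h1 h2 => by
    have h1' : ((l : ℕ) : ℝ) ≤ t := by exact_mod_cast h1
    have h2' : (t : ℝ) + 1 ≤ (r : ℕ) := by exact_mod_cast h2
    exact exists_rep_split hE (fun k => sub_half_ne_natCast _ _) (fun k => add_half_ne_natCast _ _)
      (by linarith) (fun k => add_half_ne_natCast _ _) (by linarith) (by linarith)
  have key : ∀ t : ℕ, (l : ℕ) ≤ t → t < (r : ℕ) → ∀ M, (D.rest s).Rep (splitPath (l : ℕ) (el : ℕ)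
      (r : ℕ) (er : ℕ) ((j : ℕ) - 1/2) ((j : ℕ) + 1/2) ((t : ℝ) + 1/2)) M →
      Reach (∑ t ∈ Finset.Icc (l : ℕ) t, D.cost j t) L M := by
    intro t ht
    induction t, ht using Nat.le_induction with
    | base =>
      intro _ M hM
      rw [Finset.Icc_self, Finset.sum_singleton]
      exact reach_left hE hj hL hM
    | succ t ht ih =>
      intro htr M hM
      obtain ⟨M', hM'⟩ := hex t ht (by omega)
      rw [Finset.sum_Icc_succ_top (by omega)]
      refine (ih (by omega) M' hM').trans ?_
      have htn : t + 1 < n := htr.trans r.2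
      refine reach_interior (i := ⟨t + 1, htn⟩) hE hj (Fin.lt_def.2 (by simp; omega)) (Fin.lt_def.2 htr)
        (hM'.congr ?_) hM
      congr 1
      push_cast
      ring
  obtain ⟨t, ht⟩ : ∃ t, (r : ℕ) = t + 1 := ⟨r - 1, by omega⟩
  obtain ⟨M, hM⟩ := hex t (by omega) (by omega)
  rw [ht, Finset.sum_Icc_succ_top (by omega), ← ht]
  refine (key t (by omega) (by omega) M hM).trans (reach_right hE hj (hM.congr ?_) hL')
  congr 1
  rw [ht]
  push_cast
  ring

/-- The number of moves needed to pass the row `j` with the row `s`. -/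
def rowCost (D : RectDiagram n) (s j : Fin n) : ℕ :=
  ∑ t ∈ Finset.Icc (min (D.X.symm s : ℕ) (D.O.symm s)) (max (D.X.symm s : ℕ) (D.O.symm s)), D.cost j t

theorem Ends.rowCost_eq (hE : D.Ends s l r el er) (j : Fin n) :
    D.rowCost s j = ∑ t ∈ Finset.Icc (l : ℕ) r, D.cost j t := by
  have hlr : (l : ℕ) ≤ r := hE.lt.le
  rcases hE.ends with ⟨h1, -, h2, -⟩ | ⟨h1, -, h2, -⟩
  · have e1 : D.X.symm s = l := by rw [← h1, Equiv.symm_apply_apply]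
    have e2 : D.O.symm s = r := by rw [← h2, Equiv.symm_apply_apply]
    rw [rowCost, e1, e2, min_eq_left hlr, max_eq_right hlr]
  · have e1 : D.O.symm s = l := by rw [← h1, Equiv.symm_apply_apply]
    have e2 : D.X.symm s = r := by rw [← h2, Equiv.symm_apply_apply]
    rw [rowCost, e1, e2, min_eq_right hlr, max_eq_left hlr]

/-- At most one move per column. -/
theorem rowCost_le (D : RectDiagram n) (s j : Fin n) : D.rowCost s j ≤ n := by
  obtain ⟨l, r, el, er, hE⟩ := D.exists_ends s
  rw [hE.rowCost_eq]
  refine (Finset.sum_le_card_nsmul _ _ 1 fun t _ => ?_).trans ?_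
  · unfold cost; split_ifs <;> simp
  · have := r.2
    simp only [Nat.card_Icc, smul_eq_mul, mul_one]
    omega

/-- The diagram with the horizontal edge `s` just below the height `k`. -/
noncomputable def below (D : RectDiagram n) (s : Fin n) (k : ℕ) : RealDiagram (Fin n) (Fin n) :=
  D.moveRow s ((k : ℝ) - 1/2) fun _ _ => sub_half_ne_natCast _ _

theorem reach_below (D : RectDiagram n) {s j : Fin n} (hj : j ≠ s) :
    Reach (D.rowCost s j) (D.below s (j + 1)).toLinkDiagram (D.below s j).toLinkDiagram := by
  obtain ⟨l, r, el, er, hE⟩ := D.exists_ends s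
  rw [hE.rowCost_eq]
  refine reach_row hE hj ((rep_moveRow hE _).congr ?_) (rep_moveRow hE _)
  congr 1
  push_cast
  ring

/-- The number of moves needed to pass the rows from `k` to `m - 1` with the top row. -/
def sweepCost {m : ℕ} (D : RectDiagram (m + 1)) (k : ℕ) : ℕ :=
  ∑ j : Fin (m + 1), if k ≤ j ∧ (j : ℕ) < m then D.rowCost (Fin.last m) j else 0

/-- Descending induction on `k`, one row at a time; the edge finally lies just below row `k`. -/
theorem reach_sweep {m : ℕ} (D : RectDiagram (m + 1)) {k : ℕ} (hk : k ≤ m) :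
    Reach (D.sweepCost k) (D.below (Fin.last m) m).toLinkDiagram (D.below (Fin.last m) k).toLinkDiagram := by
  induction hk using Nat.decreasingInduction with
  | self => exact (Reach.of_isotopic (.refl _)).mono (Nat.zero_le _)
  | of_succ k hk ih =>
    have hk' : k < m + 1 := by omega
    have e : D.sweepCost k = D.sweepCost (k + 1) + D.rowCost (Fin.last m) ⟨k, hk'⟩ := by
      have e0 : D.rowCost (Fin.last m) ⟨k, hk'⟩ =
          ∑ j, if j = ⟨k, hk'⟩ then D.rowCost (Fin.last m) j else 0 := by simp
      unfold sweepCost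
      rw [e0, ← Finset.sum_add_distrib]
      refine Finset.sum_congr rfl fun j _ => ?_
      by_cases h : j = ⟨k, hk'⟩
      · subst h; simp [hk]
      · have h' : (j : ℕ) ≠ k := fun e => h (Fin.ext e)
        have : (k ≤ (j : ℕ) ∧ (j : ℕ) < m) ↔ (k + 1 ≤ (j : ℕ) ∧ (j : ℕ) < m) := by omega
        simp [h, this]
    rw [e]
    refine ih.trans (D.reach_below (j := ⟨k, hk'⟩) ?_)
    rw [ne_eq, Fin.ext_iff]
    simp only [Fin.val_last]
    omega

theorem sweepCost_le {m : ℕ} (D : RectDiagram (m + 1)) {k : ℕ} : D.sweepCost k ≤ (m - k) * (m + 1) := by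
  unfold sweepCost
  rw [← Finset.sum_filter]
  refine (Finset.sum_le_card_nsmul _ _ (m + 1) fun j _ => D.rowCost_le _ j).trans ?_
  rw [smul_eq_mul]
  refine Nat.mul_le_mul_right _ ?_
  rw [← Nat.card_Ico]
  refine Finset.card_le_card_of_injOn (fun j : Fin (m + 1) => (j : ℕ)) ?_ (fun _ _ _ _ h => Fin.ext h)
  intro j hj
  simpa using hj

/-! ### Drawings of rectangular diagrams -/

/-- A drawing of a rectangular diagram, with the same order of the columns, and the order of the rows
given by a permutation. -/
theorem isotopic_permRows (D : RectDiagram n) (π : Equiv.Perm (Fin n)) (G : RealDiagram (Fin n) (Fin n))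
    (hX : G.X = D.X) (hO : G.O = D.O) (hx : ∀ i j, i < j → G.x i < G.x j)
    (hy : ∀ i j, π i < π j → G.y i < G.y j)
    (hB : ∀ i, ∀ j ∈ G.B, (G.x i, G.y j) ∈ G.vEdge i → (G.x i, G.y j) ∈ G.hEdge j → G.Incident i j) :
    (D.permRows π).toLinkDiagram.PlanarIsotopic G.toLinkDiagram := by
  -- Three steps: relabelling the rows by `π` does not change the drawing; coordinates with the same
  -- order give isotopic drawings; and the rows of `G.B` carry no crossings, so their being over is
  -- immaterial.
  let H : RealDiagram (Fin n) (Fin n) :=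
    { X := D.X, O := D.O, ne := D.ne, x := fun i => (i : ℕ), y := fun j => (π j : ℕ)
      x_inj := fun i j h => natCast_fin_inj h
      y_inj := fun i j h => π.injective (natCast_fin_inj h)
      B := ∅ }
  let H' : RealDiagram (Fin n) (Fin n) :=
    { X := D.X, O := D.O, ne := D.ne, x := G.x, y := G.y, x_inj := G.x_inj, y_inj := G.y_inj, B := ∅ }
  have hv : ∀ i, H.vEdge i = (D.permRows π).vEdge i := fun i => rfl
  have hh : ∀ j, H.hEdge j = (D.permRows π).hEdge (π j) := fun j => by
    simp [RealDiagram.hEdge, hEdge, permRows, H]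
  have e1 : (D.permRows π).toLinkDiagram.PlanarIsotopic H.toLinkDiagram := by
    refine LinkDiagram.Carries.planarIsotopic_of_refl ⟨fun p => ?_, fun p => ?_, fun c _ => ?_⟩
    · change p ∈ (⋃ i, H.vEdge i) ∪ ⋃ j, H.hEdge j ↔
        p ∈ (⋃ i, (D.permRows π).vEdge i) ∪ ⋃ j, (D.permRows π).hEdge j
      rw [← π.surjective.iUnion_comp (fun j => (D.permRows π).hEdge j)]
      simp only [hv, hh]
    · change (∃ i j, p ∈ H.vEdge i ∧ p ∈ H.hEdge j ∧ ¬ (j = D.X i ∨ j = D.O i)) ↔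
        ∃ i j, p ∈ (D.permRows π).vEdge i ∧ p ∈ (D.permRows π).hEdge j ∧ j ≠ π (D.X i) ∧ j ≠ π (D.O i)
      refine exists_congr fun i => ?_
      conv_rhs => rw [π.surjective.exists]
      simp only [hv, hh, not_or, ne_eq, π.injective.eq_iff]
    · refine Filter.Eventually.of_forall fun p => ?_
      change p ∈ H.picture.overAt c ↔ p ∈ ⋃ i, (D.permRows π).vEdge i
      have : H.picture.overAt c = ⋃ i, H.vEdge i := if_neg (by simp [H])
      rw [this]
      rfl
  have e2 : H.toLinkDiagram.PlanarIsotopic H'.toLinkDiagram := by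
    refine RealDiagram.isotopic_of_order H H' rfl rfl rfl (fun i j h => hx i j ?_) fun i j h => hy i j ?_
    · change ((i : ℕ) : ℝ) < (j : ℕ) at h
      exact Fin.lt_def.2 (by exact_mod_cast h)
    · change ((π i : ℕ) : ℝ) < (π j : ℕ) at h
      exact Fin.lt_def.2 (by exact_mod_cast h)
  have e3 : G.toLinkDiagram.PlanarIsotopic H'.toLinkDiagram := by
    refine RealDiagram.isotopic_of_over G H' hX.symm hO.symm rfl rfl fun i j h1 h2 h3 => ?_
    exact iff_of_false (by simp [H']) fun h => h3 (hB i j h h1 h2)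
  exact (e1.trans e2).trans e3.symm

end RectDiagram

/-- There is no crossing on the top row. -/
theorem RealDiagram.incident_of_top {ι κ : Type} {G : RealDiagram ι κ} {i : ι} {j : κ} (h : ∀ k, G.y k ≤ G.y j)
    (hv : (G.x i, G.y j) ∈ G.vEdge i) : G.Incident i j := by
  have := hv.2
  rw [mem_uIcc] at this
  rcases this with this | this
  · exact Or.inr (G.y_inj (le_antisymm this.2 (h _)))
  · exact Or.inl (G.y_inj (le_antisymm this.2 (h _)))

/-- There is no crossing on the bottom row. -/
theorem RealDiagram.incident_of_bottom {ι κ : Type} {G : RealDiagram ι κ} {i : ι} {j : κ} (h : ∀ k, G.y j ≤ G.y k)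
    (hv : (G.x i, G.y j) ∈ G.vEdge i) : G.Incident i j := by
  have := hv.2
  rw [mem_uIcc] at this
  rcases this with this | this
  · exact Or.inl (G.y_inj (le_antisymm (h _) this.1))
  · exact Or.inr (G.y_inj (le_antisymm (h _) this.1))

namespace RectDiagram

variable {m : ℕ}

theorem below_y (D : RectDiagram (m + 1)) (k : ℕ) (j : Fin (m + 1)) :
    (D.below (Fin.last m) k).y j = if j = Fin.last m then (k : ℝ) - 1/2 else (j : ℕ) := rfl

/-- At height `m - 1/2` the top row is still the highest one and has no crossings, so it may count
as an overpass at no cost. -/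
theorem isotopic_below_top (D : RectDiagram (m + 1)) :
    D.toLinkDiagram.PlanarIsotopic (D.below (Fin.last m) m).toLinkDiagram := by
  have hy : ∀ j : Fin (m + 1), j ≠ Fin.last m → ((j : ℕ) : ℝ) + 1 ≤ m := fun j hj => by
    have : (j : ℕ) < m := Fin.val_lt_last hj
    exact_mod_cast this
  refine isotopic_permRows D (Equiv.refl _) _ rfl rfl (fun i j h => ?_) (fun i j h => ?_) ?_
  · change ((i : ℕ) : ℝ) < (j : ℕ)
    exact_mod_cast h
  · change i < j at h
    have h' : ((i : ℕ) : ℝ) < (j : ℕ) := by exact_mod_cast h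
    rw [below_y, below_y, if_neg (ne_of_lt (lt_of_lt_of_le h (Fin.le_last _)))]
    split_ifs with h1
    · have := hy i (ne_of_lt (lt_of_lt_of_le h (Fin.le_last _)))
      linarith
    · exact h'
  · rintro i j hj hv -
    obtain rfl : j = Fin.last m := hj
    refine RealDiagram.incident_of_top (fun k => ?_) hv
    rw [below_y, below_y, if_pos rfl]
    split_ifs with h1
    · exact le_rfl
    · linarith [hy k h1]

/-- The rotation of the top row to the bottom. -/
theorem reach_rotate (D : RectDiagram (m + 1)) :
    Reach (D.sweepCost 0) D.toLinkDiagram (D.permRows (finRotate (m + 1))).toLinkDiagram := by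
  have h1 := (Reach.of_isotopic D.isotopic_below_top).trans (D.reach_sweep (Nat.zero_le m))
  -- At height `-1/2` the row is the lowest one, again without crossings, and the other rows keep
  -- their order.
  have h2 : (D.permRows (finRotate (m + 1))).toLinkDiagram.PlanarIsotopic
      (D.below (Fin.last m) 0).toLinkDiagram := by
    refine isotopic_permRows D _ _ rfl rfl (fun i j h => ?_) (fun i j h => ?_) ?_
    · change ((i : ℕ) : ℝ) < (j : ℕ)
      exact_mod_cast h
    · rw [below_y, below_y]
      by_cases hj : j = Fin.last m
      · rw [hj, finRotate_last] at h
        exact absurd h (Fin.not_lt_zero _)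
      · rw [if_neg hj]
        by_cases hi : i = Fin.last m
        · rw [if_pos hi]
          have : (0 : ℝ) ≤ (j : ℕ) := Nat.cast_nonneg _
          push_cast
          linarith
        · rw [if_neg hi]
          rw [Fin.lt_def, coe_finRotate_of_ne_last hi, coe_finRotate_of_ne_last hj] at h
          exact_mod_cast Nat.lt_of_succ_lt_succ h
    · rintro i j hj hv -
      obtain rfl : j = Fin.last m := hj
      refine RealDiagram.incident_of_bottom (fun k => ?_) hv
      rw [below_y, below_y, if_pos rfl]
      split_ifs with h1
      · exact le_rfl
      · have : (0 : ℝ) ≤ (k : ℕ) := Nat.cast_nonneg _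
        push_cast
        linarith
  exact (h1.trans (.of_isotopic h2.symm)).mono (by omega)

end RectDiagram

/-! ## Symmetries of rectangular diagrams -/

namespace RectDiagram

variable {n m : ℕ}

/-- Reflection in the diagonal turns vertical edges into horizontal ones and thereby reverses the
rule for crossings; switching all crossings restores it. -/
theorem isotopic_transpose (D : RectDiagram n) :
    (D.transpose.toLinkDiagram.mirror.map (Homeomorph.prodComm ℝ ℝ)).PlanarIsotopic D.toLinkDiagram := by
  have hv : ∀ (i : Fin n) (p : Plane), (p.2, p.1) ∈ D.transpose.vEdge i ↔ p ∈ D.hEdge i := fun i p => Iff.rfl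
  have hh : ∀ (i : Fin n) (p : Plane), (p.2, p.1) ∈ D.transpose.hEdge i ↔ p ∈ D.vEdge i := fun i p => Iff.rfl
  have hI : ∀ i j, (j ≠ D.X i ∧ j ≠ D.O i) ↔ (i ≠ D.X.symm j ∧ i ≠ D.O.symm j) := fun i j => by
    simp only [ne_eq, Equiv.eq_symm_apply, eq_comm]
  have hs : ∀ p : Plane, ((p.2, p.1) ∈ D.transpose.picture.shadow) ↔ p ∈ D.picture.shadow := fun p => by
    change ((p.2, p.1) ∈ (⋃ i, D.transpose.vEdge i) ∪ ⋃ i, D.transpose.hEdge i) ↔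
      p ∈ (⋃ i, D.vEdge i) ∪ ⋃ i, D.hEdge i
    simp only [mem_union, mem_iUnion, hv, hh]
    exact or_comm
  have hc : ∀ p : Plane, ((p.2, p.1) ∈ D.transpose.picture.cross) ↔ p ∈ D.picture.cross := fun p => by
    change (∃ i j, (p.2, p.1) ∈ D.transpose.vEdge i ∧ (p.2, p.1) ∈ D.transpose.hEdge j ∧
      j ≠ D.X.symm i ∧ j ≠ D.O.symm i) ↔ ∃ i j, p ∈ D.vEdge i ∧ p ∈ D.hEdge j ∧ j ≠ D.X i ∧ j ≠ D.O i
    simp only [hv, hh]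
    rw [exists_comm]
    refine exists_congr fun i => exists_congr fun j => ?_
    rw [hI]
    tauto
  refine LinkDiagram.Carries.planarIsotopic_of_refl ⟨fun p => (hs p).symm, fun p => (hc p).symm, fun c h => ?_⟩
  obtain ⟨i, j, hi, hj, hX, hO⟩ := (hc c).1 h
  have v1 : c.2 ≠ (D.X i : ℕ) := by rw [hj.1]; exact natCast_fin_ne hX
  have v2 : c.2 ≠ (D.O i : ℕ) := by rw [hj.1]; exact natCast_fin_ne hO
  have h1 : c.1 ≠ (D.X.symm j : ℕ) := by
    rw [hi.1]; exact natCast_fin_ne ((hI i j).1 ⟨hX, hO⟩).1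
  have h2 : c.1 ≠ (D.O.symm j : ℕ) := by
    rw [hi.1]; exact natCast_fin_ne ((hI i j).1 ⟨hX, hO⟩).2
  filter_upwards [D.eventually_vEdge_interior i c hi v1 v2, D.eventually_hEdge_interior j c hj h1 h2]
    with p p1 p2
  change (p ∈ ⋃ i, D.vEdge i) ↔ ((p.2, p.1) ∈ D.transpose.picture.shadow ∧
    (p.2, p.1) ∉ ⋃ i, D.transpose.vEdge i) ∨ (p.2, p.1) = (c.2, c.1)
  rw [hs]
  change _ ↔ (p ∈ (⋃ i, D.vEdge i) ∪ ⋃ i, D.hEdge i) ∧ _ ∨ _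
  simp only [mem_iUnion, hv] at p1 p2 ⊢
  simp only [mem_union, mem_iUnion, p1, p2, Prod.ext_iff]
  tauto

theorem reach_of_transpose {B : ℕ} {D : RectDiagram n} {D' : RectDiagram m}
    (h : Reach B D.transpose.toLinkDiagram D'.transpose.toLinkDiagram) :
    Reach B D.toLinkDiagram D'.toLinkDiagram :=
  (((Reach.of_isotopic D.isotopic_transpose.symm).trans (h.mirror.map _)).trans
    (.of_isotopic D'.isotopic_transpose)).mono (by omega)

/-- Reflection in the horizontal axis. -/
noncomputable def flipHomeo : Plane ≃ₜ Plane := (Homeomorph.refl ℝ).prodCongr (Homeomorph.neg ℝ)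

/-- This reflection keeps vertical edges vertical, so no crossing has to be switched. -/
theorem isotopic_flip (D : RectDiagram n) :
    (D.permRows Fin.revPerm).toLinkDiagram.PlanarIsotopic (D.toLinkDiagram.map flipHomeo) := by
  let G : RealDiagram (Fin n) (Fin n) :=
    { X := D.X, O := D.O, ne := D.ne, x := fun i => (i : ℕ), y := fun j => -((j : ℕ) : ℝ)
      x_inj := fun i j h => natCast_fin_inj h
      y_inj := fun i j h => natCast_fin_inj (neg_injective h)
      B := ∅ }
  have h1 : (D.permRows Fin.revPerm).toLinkDiagram.PlanarIsotopic G.toLinkDiagram := by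
    refine isotopic_permRows D _ G rfl rfl (fun i j h => ?_) (fun i j h => ?_) (by simp [G])
    · change ((i : ℕ) : ℝ) < (j : ℕ)
      exact_mod_cast h
    · have h' : j < i := Fin.rev_lt_rev.1 h
      change -((i : ℕ) : ℝ) < -(j : ℕ)
      exact neg_lt_neg (by exact_mod_cast h')
  refine h1.trans ?_
  have hm : ∀ a b t : ℝ, -t ∈ uIcc a b ↔ t ∈ uIcc (-a) (-b) := fun a b t => by
    simp only [mem_uIcc, neg_le, le_neg]
    tauto
  have hv : ∀ (i : Fin n) (p : Plane), (p.1, -p.2) ∈ D.vEdge i ↔ p ∈ G.vEdge i := fun i p => by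
    change (_ ∧ _) ↔ (_ ∧ _)
    rw [hm]
  have hh : ∀ (i : Fin n) (p : Plane), (p.1, -p.2) ∈ D.hEdge i ↔ p ∈ G.hEdge i := fun i p => by
    change (-p.2 = ((i : ℕ) : ℝ) ∧ _) ↔ (p.2 = -((i : ℕ) : ℝ) ∧ _)
    rw [neg_eq_iff_eq_neg]
  refine LinkDiagram.Carries.planarIsotopic_of_refl ⟨fun p => ?_, fun p => ?_, fun c _ => ?_⟩
  · change (p.1, -p.2) ∈ (⋃ i, D.vEdge i) ∪ (⋃ i, D.hEdge i) ↔ p ∈ (⋃ i, G.vEdge i) ∪ ⋃ i, G.hEdge i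
    simp only [mem_union, mem_iUnion, hv, hh]
  · change (∃ i j, (p.1, -p.2) ∈ D.vEdge i ∧ (p.1, -p.2) ∈ D.hEdge j ∧ j ≠ D.X i ∧ j ≠ D.O i) ↔
      ∃ i j, p ∈ G.vEdge i ∧ p ∈ G.hEdge j ∧ ¬ (j = D.X i ∨ j = D.O i)
    simp only [hv, hh, not_or, ne_eq]
  · refine Filter.Eventually.of_forall fun p => ?_
    have : G.picture.overAt c = ⋃ i, G.vEdge i := if_neg (by simp [G])
    change (p.1, -p.2) ∈ (⋃ i, D.vEdge i) ↔ p ∈ G.picture.overAt c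
    rw [this]
    simp only [mem_iUnion, hv]

theorem reach_of_flip {B : ℕ} {D : RectDiagram n} {D' : RectDiagram m}
    (h : Reach B (D.permRows Fin.revPerm).toLinkDiagram (D'.permRows Fin.revPerm).toLinkDiagram) :
    Reach B D.toLinkDiagram D'.toLinkDiagram := by
  have hflip : ∀ {k : ℕ} (E : RectDiagram k), (E.permRows Fin.revPerm).permRows Fin.revPerm = E := fun E => by
    ext i <;> simp [permRows]
  have hfl := (((Reach.of_isotopic (isotopic_flip (D.permRows Fin.revPerm))).trans (h.map flipHomeo)).trans
    (.of_isotopic (isotopic_flip (D'.permRows Fin.revPerm)).symm)).mono (l := B) (by omega)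
  rw [hflip, hflip] at hfl
  exact hfl

/-! ## Rotations and exchanges -/

/-- Every such diagram draws the same unit square without crossings, with different labels at most.
This is needed because the bound for exchanges is `0` when `n = 2`. -/
theorem isotopic_two (D D' : RectDiagram 2) : D.toLinkDiagram.PlanarIsotopic D'.toLinkDiagram := by
  have key : ∀ (X O : Equiv.Perm (Fin 2)), (∀ i, X i ≠ O i) → ∀ i,
      uIcc ((X i : ℕ) : ℝ) (O i : ℕ) = uIcc 0 1 := by
    intro X O h i
    have : ∀ a b : Fin 2, a ≠ b → uIcc ((a : ℕ) : ℝ) (b : ℕ) = uIcc 0 1 := by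
      intro a b hab
      fin_cases a <;> fin_cases b <;> simp at hab ⊢
    exact this _ _ (h i)
  have hv : ∀ E : RectDiagram 2, ∀ i, E.vEdge i = vseg (i : ℕ) 0 1 := fun E i => by
    simp only [vEdge, vseg, key E.X E.O E.ne]
  have hh : ∀ E : RectDiagram 2, ∀ i, E.hEdge i = hseg (i : ℕ) 0 1 := fun E i => by
    simp only [hEdge, hseg, key E.X.symm E.O.symm E.symm_ne]
  have hc : ∀ (E : RectDiagram 2) (p : Plane), p ∉ E.toLinkDiagram.cross := by
    rintro E p ⟨i, j, -, -, h1, h2⟩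
    have : ∀ a b c : Fin 2, a ≠ b → c ≠ a → c ≠ b → False := by decide
    exact this _ _ _ (E.ne i) h1 h2
  refine LinkDiagram.Carries.planarIsotopic_of_refl
    ⟨fun p => ?_, fun p => iff_of_false (hc _ _) (hc _ _), fun c h => absurd h (hc _ _)⟩
  change p ∈ (⋃ i, D'.vEdge i) ∪ (⋃ i, D'.hEdge i) ↔ p ∈ (⋃ i, D.vEdge i) ∪ ⋃ i, D.hEdge i
  simp only [hv, hh]

/-- The general estimate is `6`, too large for the merge bound `4` at `n = 3`; the finitely many
pairs of permutations are checked directly. -/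
theorem sweepCost_three (D : RectDiagram 3) : D.sweepCost 0 ≤ 4 := by
  have : ∀ (X O : Equiv.Perm (Fin 3)) (h : ∀ i, X i ≠ O i), (⟨X, O, h⟩ : RectDiagram 3).sweepCost (m := 2) 0 ≤ 4 := by
    decide
  exact this D.X D.O D.ne

/-- The exchange, if no vertical edge at the bottom edge meets the interior of the top edge. -/
theorem reach_exchange_of_nested (D : RectDiagram (m + 1)) (hm : m ≠ 0)
    (h : ∀ k, (D.X k = 0 ∨ D.O k = 0) → ((k : ℕ) : ℝ) ∈
      uIcc ((D.X.symm (Fin.last m) : ℕ) : ℝ) (D.O.symm (Fin.last m) : ℕ) →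
      D.X k = Fin.last m ∨ D.O k = Fin.last m) :
    Reach (D.sweepCost 1 + (D.permRows (Equiv.swap (Fin.last m) 0)).sweepCost 0) D.toLinkDiagram
      (D.permRows (Equiv.swap (Fin.last m) 0)).toLinkDiagram := by
  have h1 := (Reach.of_isotopic D.isotopic_below_top).trans (D.reach_sweep (k := 1) (by omega))
  have h0 : (0 : Fin (m + 1)) ≠ Fin.last m := fun e => hm (congrArg Fin.val e).symm
  -- The swept edge lies at height `1/2`, just above the bottom row. From below, the order is: old
  -- bottom, old top, the rest. Rotating the top row of the exchanged diagram to the bottom gives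
  -- the same order.
  have h2 : (D.permRows ((Equiv.swap (Fin.last m) 0).trans (finRotate (m + 1)))).toLinkDiagram.PlanarIsotopic
      (D.below (Fin.last m) 1).toLinkDiagram := by
    have hπ : ∀ i : Fin (m + 1), ((((Equiv.swap (Fin.last m) 0).trans (finRotate (m + 1))) i : Fin (m + 1)) : ℕ) =
        if i = Fin.last m then 1 else if i = 0 then 0 else (i : ℕ) + 1 := fun i => by
      rw [Equiv.trans_apply]
      split_ifs with h1 h2
      · rw [h1, Equiv.swap_apply_left, coe_finRotate_of_ne_last h0]; rfl
      · rw [h2, Equiv.swap_apply_right, finRotate_last]; rfl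
      · rw [Equiv.swap_apply_of_ne_of_ne h1 h2, coe_finRotate_of_ne_last h1]
    refine isotopic_permRows D _ _ rfl rfl (fun i j h => ?_) (fun i j h => ?_) ?_
    · change ((i : ℕ) : ℝ) < (j : ℕ)
      exact_mod_cast h
    · rw [Fin.lt_def, hπ, hπ] at h
      rw [below_y, below_y]
      have c0 : ∀ k : Fin (m + 1), k ≠ 0 → (1 : ℝ) ≤ (k : ℕ) := fun k hk => by
        exact_mod_cast Nat.one_le_iff_ne_zero.2 fun e => hk (Fin.ext e)
      have c1 : i < j → ((i : ℕ) : ℝ) < (j : ℕ) := fun h => by exact_mod_cast h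
      rw [Fin.lt_def] at c1
      have z : (((0 : Fin (m + 1)) : ℕ) : ℝ) = 0 := by simp
      by_cases hi0 : i = 0
      · rw [if_neg (hi0 ▸ h0), hi0, z]
        split_ifs with hj
        · norm_num
        · have hj0 : j ≠ 0 := fun e => by
            rw [hi0, e] at h
            exact lt_irrefl _ h
          linarith [c0 j hj0]
      · have hj0 : j ≠ 0 := fun e => by
          rw [e, if_neg h0, if_pos rfl] at h
          exact Nat.not_lt_zero _ h
        have := c0 j hj0
        rw [if_neg hi0, if_neg hj0] at h
        split_ifs at h ⊢ with a1 a2 a2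
        · omega
        · push_cast; linarith
        · omega
        · exact c1 (by omega)
    · rintro i j hj hv hh
      obtain rfl : j = Fin.last m := hj
      by_contra hI
      have hI' : ¬ (D.X i = Fin.last m ∨ D.O i = Fin.last m) := fun e => hI (e.imp Eq.symm Eq.symm)
      have hx := hh.2
      have hy := hv.2
      have c0 : ∀ k : Fin (m + 1), k ≠ 0 → (1 : ℝ) ≤ (k : ℕ) := fun k hk => by
        exact_mod_cast Nat.one_le_iff_ne_zero.2 fun e => hk (Fin.ext e)
      by_cases hk : D.X i = 0 ∨ D.O i = 0
      -- Only columns that reach the bottom row can cross the height `1/2`, and `h` excludes these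
      -- as crossings.
      · exact hI' (h i hk hx)
      · rw [not_or] at hk hI'
        simp only [below_y, if_true] at hy
        change _ ∈ uIcc ((D.below (Fin.last m) 1).y (D.X i)) ((D.below (Fin.last m) 1).y (D.O i)) at hy
        rw [below_y, below_y, if_neg hI'.1, if_neg hI'.2, mem_uIcc] at hy
        have := c0 _ hk.1
        have := c0 _ hk.2
        push_cast at hy
        rcases hy with hy | hy <;> linarith [hy.1]
  have h3 := (D.permRows (Equiv.swap (Fin.last m) 0)).reach_rotate.symm
  exact ((h1.trans (.of_isotopic h2.symm)).trans h3).mono (by omega)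

/-- If a column of the bottom edge does cross the lowered top edge, then, the edges not being
interleaved, the bottom edge lies within the span of the top edge. The hypothesis of
`reach_exchange_of_nested` then holds for the exchanged diagram, and the sequence found there is
reversed. -/
theorem reach_exchange (D D' : RectDiagram (m + 1)) (hm : m ≠ 0) (h : D.IsExteriorHorizontalExchange D') :
    ∃ E E' : RectDiagram (m + 1), Reach (E.sweepCost 1 + E'.sweepCost 0) D.toLinkDiagram D'.toLinkDiagram := by
  obtain ⟨t, b, ht, hb, hI, rfl⟩ := h
  obtain rfl : t = Fin.last m := Fin.ext (by simpa using ht)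
  obtain rfl : b = 0 := Fin.ext hb
  set D' := D.permRows (Equiv.swap (Fin.last m) 0) with hD'
  have hmem : ∀ a b c : Fin (m + 1), ((a : ℕ) : ℝ) ∈ uIcc ((b : ℕ) : ℝ) (c : ℕ) ↔ min b c ≤ a ∧ a ≤ max b c := by
    intro a b c
    rw [mem_uIcc]
    simp only [Nat.cast_le, Fin.val_fin_le, min_le_iff, le_max_iff]
    constructor
    · rintro (h | h)
      exacts [⟨Or.inl h.1, Or.inr h.2⟩, ⟨Or.inr h.1, Or.inl h.2⟩]
    · rintro ⟨h1 | h1, h2 | h2⟩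
      · exact (le_total a c).imp (fun h => ⟨h1, h⟩) fun h => ⟨h, h2⟩
      · exact Or.inl ⟨h1, h2⟩
      · exact Or.inr ⟨h1, h2⟩
      · exact (le_total b a).imp (fun h => ⟨h, h2⟩) fun h => ⟨h1, h⟩
  by_cases h1 : ∀ k, (D.X k = 0 ∨ D.O k = 0) → ((k : ℕ) : ℝ) ∈
      uIcc ((D.X.symm (Fin.last m) : ℕ) : ℝ) (D.O.symm (Fin.last m) : ℕ) →
      D.X k = Fin.last m ∨ D.O k = Fin.last m
  · exact ⟨D, D', D.reach_exchange_of_nested hm h1⟩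
  · have hinv : D'.permRows (Equiv.swap (Fin.last m) 0) = D := by ext i <;> simp [permRows, hD']
    have h2 := D'.reach_exchange_of_nested hm ?_
    · rw [hinv] at h2
      exact ⟨D', D, h2.symm⟩
    · intro k hk hk'
      have e1 : D'.X.symm (Fin.last m) = D.X.symm 0 := by simp [hD', permRows]
      have e2 : D'.O.symm (Fin.last m) = D.O.symm 0 := by simp [hD', permRows]
      have e3 : ∀ j, (Equiv.swap (Fin.last m) 0) j = 0 ↔ j = Fin.last m := fun j => by
        rw [← Equiv.eq_symm_apply]; simp
      have e4 : ∀ j, (Equiv.swap (Fin.last m) 0) j = Fin.last m ↔ j = 0 := fun j => by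
        rw [← Equiv.eq_symm_apply]; simp
      have e5 : ∀ i, D'.X i = (Equiv.swap (Fin.last m) 0) (D.X i) := fun i => rfl
      have e6 : ∀ i, D'.O i = (Equiv.swap (Fin.last m) 0) (D.O i) := fun i => rfl
      rw [e1, e2] at hk'
      rw [e5, e6, e3, e3] at hk
      rw [e5, e6, e4, e4]
      push Not at h1
      obtain ⟨l, hl, hl', hl2⟩ := h1
      rw [hmem] at hk' hl'
      simp only [ne_eq, ← Equiv.eq_symm_apply] at hk hl hl2 ⊢
      unfold Interleaved at hI
      generalize D.X.symm 0 = x0 at *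
      generalize D.O.symm 0 = o0 at *
      generalize D.X.symm (Fin.last m) = x1 at *
      generalize D.O.symm (Fin.last m) = o1 at *
      clear_value D'
      clear hinv e1 e2 e3 e4 e5 e6 hmem hD' D'
      simp only [Fin.lt_def, Fin.le_def, Fin.ext_iff, Fin.coe_min, Fin.coe_max] at *
      omega

/-- Moving the bottom row to the top reverses the rotation of another diagram, which is why the cost
is that of some `E`; columns are treated by transposition. -/
theorem reach_rotation (D D' : RectDiagram (m + 1)) (h : D.IsRotation D') :
    ∃ E : RectDiagram (m + 1), Reach (E.sweepCost 0) D.toLinkDiagram D'.toLinkDiagram := by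
  have key : ∀ (D : RectDiagram (m + 1)) (π : Equiv.Perm (Fin (m + 1))),
      (π = finRotate (m + 1) ∨ π = (finRotate (m + 1)).symm) →
      ∃ E : RectDiagram (m + 1), Reach (E.sweepCost 0) D.toLinkDiagram (D.permRows π).toLinkDiagram := by
    rintro D π (rfl | rfl)
    · exact ⟨D, D.reach_rotate⟩
    · have h := (D.permRows (finRotate (m + 1)).symm).reach_rotate.symm
      have e : (D.permRows (finRotate (m + 1)).symm).permRows (finRotate (m + 1)) = D := by
        ext i <;> simp [permRows]
      rw [e] at h
      exact ⟨_, h⟩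
  obtain ⟨π, hπ, rfl | rfl⟩ := h
  · exact key D π hπ
  · obtain ⟨E, hE⟩ := key D.transpose π hπ
    exact ⟨E, reach_of_transpose hE⟩

end RectDiagram

/-! ## Merges -/

theorem LocalIso.swap {S S' : Set Plane} (H : LocalIso ∅ ∅ S S') :
    LocalIso ∅ ∅ {q | q.swap ∈ S} {q | q.swap ∈ S'} := by
  obtain ⟨φ, h1, -, -, h4⟩ := H
  have hbox : ∀ q : Plane, q.swap ∈ Box ↔ q ∈ Box := fun q => and_comm
  have e : ∀ q, conjHomeo (Homeomorph.prodComm ℝ ℝ) φ q = (φ q.swap).swap := fun q => rfl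
  refine ⟨conjHomeo (Homeomorph.prodComm ℝ ℝ) φ, fun q hq => ?_, by simp, by simp, fun q hq => ?_⟩
  · rw [e, h1 _ (fun h => hq ((hbox q).1 h)), Prod.swap_swap]
  · rw [e, mem_ofPred_eq, Prod.swap_swap]
    exact h4 _ ((hbox q).2 hq)

/-- An arc with two horizontal edges and a short vertical edge between them. -/
def foldedPath (b u v : ℝ) : Set Plane :=
  {q | (q.1 = -1 ∧ q.2 ∈ uIcc 1 (-1)) ∨ (q.1 = 1 ∧ q.2 ∈ uIcc 1 u) ∨ (q.1 = b ∧ q.2 ∈ uIcc (-1) v) ∨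
    (q.2 = 1 ∧ q.1 ∈ uIcc (-1) 1) ∨ (q.2 = -1 ∧ q.1 ∈ uIcc (-1) b)}

/-- The arc with a single horizontal edge. -/
def unfoldedPath (b u v : ℝ) : Set Plane :=
  {q | (q.1 = 1 ∧ q.2 ∈ uIcc (-1) u) ∨ (q.1 = b ∧ q.2 ∈ uIcc (-1) v) ∨ (q.2 = -1 ∧ q.1 ∈ uIcc 1 b)}

/-- If `b = 2`, the arc follows the upper, left and lower side of the square and is retracted to the
right side, a finger with the axes interchanged. If `b = -2`, it follows the left and upper side and
is flipped to the lower and right side. -/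
theorem localIso_unfold {b u v : ℝ} (hb : b = 2 ∨ b = -2) (hu : 3 ≤ u) (hv : 3 ≤ v) :
    LocalIso ∅ ∅ {q | ((3/2 * q.1, 3/2 * q.2) : Plane) ∈ foldedPath b u v}
      {q | ((3/2 * q.1, 3/2 * q.2) : Plane) ∈ unfoldedPath b u v} := by
  have e : ∀ t : ℝ, 3/2 * (0 + 2/3 * t) = t := fun t => by ring
  have hu' : (1:ℝ) ≤ u := by linarith
  have hu'' : (-1:ℝ) ≤ u := by linarith
  have hv' : (-1:ℝ) ≤ v := by linarith
  rcases hb with rfl | rfl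
  · have h : LocalIso ∅ ∅ {q : Plane | ((3/2 * q.2, 3/2 * q.1) : Plane) ∈ foldedPath 2 u v}
      {q | ((3/2 * q.2, 3/2 * q.1) : Plane) ∈ unfoldedPath 2 u v} := by
      refine localIso_finger 0 0 (2/3) (2/3) (by norm_num) (by norm_num) (by norm_num [abs_of_pos])
        (by norm_num [abs_of_pos])
        {q | (q.2 = 1 ∧ 1 ≤ q.1 ∧ q.1 ≤ u) ∨ (q.2 = 2 ∧ -1 ≤ q.1 ∧ q.1 ≤ v) ∨ (q.1 = -1 ∧ 1 ≤ q.2 ∧ q.2 ≤ 2)}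
        _ rfl ?_ ?_ ?_ (by simp) (by simp)
      · intro q hq
        simp only [mem_ofPred_eq, le_abs] at *
        grind
      · intro q
        simp only [foldedPath, mem_ofPred_eq, e, uIcc_of_le hu', uIcc_of_le hv', mem_Icc,
          uIcc_of_ge (show (-1:ℝ) ≤ 1 by norm_num), uIcc_of_le (show (-1:ℝ) ≤ 1 by norm_num),
          uIcc_of_le (show (-1:ℝ) ≤ 2 by norm_num)]
        generalize q.1 = x
        generalize q.2 = y
        clear e
        grind (splits := 40)
      · intro q
        simp only [unfoldedPath, mem_ofPred_eq, e, uIcc_of_le hu'', uIcc_of_le hv', mem_Icc,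
          uIcc_of_le (show (1:ℝ) ≤ 2 by norm_num)]
        generalize q.1 = x
        generalize q.2 = y
        clear e
        grind (splits := 40)
    exact h.swap
  · refine localIso_mono transversal_id 0 0 (2/3) (2/3) (by norm_num) (by norm_num) (by norm_num [abs_of_pos])
      (by norm_num [abs_of_pos])
      {q | (q.1 = 1 ∧ 1 ≤ q.2 ∧ q.2 ≤ u) ∨ (q.1 = -2 ∧ -1 ≤ q.2 ∧ q.2 ≤ v) ∨ (q.2 = -1 ∧ -2 ≤ q.1 ∧ q.1 ≤ -1)}
      _ rfl ?_ ?_ ?_ (Or.inr (by simp)) (by simp)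
    · intro q hq
      simp only [mem_ofPred_eq, le_abs] at *
      grind
    · intro q
      simp only [foldedPath, mem_ofPred_eq, e, uIcc_of_le hu', uIcc_of_le hv', mem_Icc,
        uIcc_of_ge (show (-1:ℝ) ≤ 1 by norm_num), uIcc_of_le (show (-1:ℝ) ≤ 1 by norm_num),
        uIcc_of_ge (show (-2:ℝ) ≤ -1 by norm_num)]
      generalize q.1 = x
      generalize q.2 = y
      clear e
      grind (splits := 40)
    · intro q
      simp only [unfoldedPath, mem_ofPred_eq, e, uIcc_of_le hu'', uIcc_of_le hv', mem_Icc,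
        uIcc_of_ge (show (-2:ℝ) ≤ 1 by norm_num)]
      generalize q.1 = x
      generalize q.2 = y
      clear e
      grind (splits := 40)

/-- The arc is changed inside the box only. -/
theorem foldedPath_outside {b u v : ℝ} (hb : b = 2 ∨ b = -2) (hu : 3 ≤ u) (hv : 3 ≤ v) {q : Plane}
    (hq : ¬ (|q.1| ≤ 3/2 ∧ |q.2| ≤ 3/2)) : q ∈ foldedPath b u v ↔ q ∈ unfoldedPath b u v := by
  have hu' : (1:ℝ) ≤ u := by linarith
  have hu'' : (-1:ℝ) ≤ u := by linarith
  have hv' : (-1:ℝ) ≤ v := by linarith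
  rw [abs_le, abs_le] at hq
  rcases hb with rfl | rfl
  · simp only [foldedPath, unfoldedPath, mem_ofPred_eq, uIcc_of_le hu', uIcc_of_le hu'', uIcc_of_le hv', mem_Icc,
      uIcc_of_ge (show (-1:ℝ) ≤ 1 by norm_num), uIcc_of_le (show (-1:ℝ) ≤ 1 by norm_num),
      uIcc_of_le (show (-1:ℝ) ≤ 2 by norm_num), uIcc_of_le (show (1:ℝ) ≤ 2 by norm_num)]
    generalize q.1 = x at *
    generalize q.2 = y at *
    grind (splits := 40)
  · simp only [foldedPath, unfoldedPath, mem_ofPred_eq, uIcc_of_le hu', uIcc_of_le hu'', uIcc_of_le hv', mem_Icc,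
      uIcc_of_ge (show (-1:ℝ) ≤ 1 by norm_num), uIcc_of_le (show (-1:ℝ) ≤ 1 by norm_num),
      uIcc_of_ge (show (-2:ℝ) ≤ -1 by norm_num), uIcc_of_ge (show (-2:ℝ) ≤ 1 by norm_num)]
    generalize q.1 = x at *
    generalize q.2 = y at *
    grind (splits := 40)

/-- A coordinate on the line that is normalized at three points. -/
theorem exists_coordinate {u v w : ℝ} (huv : u ≠ v) (hw : w ∉ uIcc u v) : ∃ f : ℝ ≃ₜ ℝ,
    (∀ a b t, f t ∈ uIcc (f a) (f b) ↔ t ∈ uIcc a b) ∧ f u = -1 ∧ f v = 1 ∧ (f w = 2 ∨ f w = -2) := by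
  wlog h : u < v generalizing u v w
  · have hneg : ∀ a b t : ℝ, -t ∈ uIcc (-a) (-b) ↔ t ∈ uIcc a b := fun a b t => by
      simp only [mem_uIcc, neg_le_neg_iff]
      tauto
    obtain ⟨f, h1, h2, h3, h4⟩ := this (u := -u) (v := -v) (w := -w) (fun e => huv (neg_injective e))
      (by rwa [hneg]) (neg_lt_neg (lt_of_le_of_ne (not_lt.1 h) huv.symm))
    exact ⟨(Homeomorph.neg ℝ).trans f, fun a b t => (h1 _ _ _).trans (hneg a b t), h2, h3, h4⟩
  rw [uIcc_of_le h.le, mem_Icc, not_and_or, not_le, not_le] at hw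
  have key : ∀ x x' : Fin 3 → ℝ, StrictMono x → StrictMono x' → ∃ f : ℝ ≃ₜ ℝ,
      (∀ a b t, f t ∈ uIcc (f a) (f b) ↔ t ∈ uIcc a b) ∧ ∀ i, f (x i) = x' i := fun x x' hx hx' => by
    obtain ⟨f, hf⟩ := exists_orderIso_family x x' (fun i j hij => hx' (hx.lt_iff_lt.1 hij)) hx.injective
    exact ⟨f.toHomeomorph, RealDiagram.mem_uIcc_map f, hf⟩
  have hmono : ∀ a b c : ℝ, a < b → b < c → StrictMono ![a, b, c] := fun a b c h1 h2 => by
    rw [Fin.strictMono_iff_lt_succ]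
    intro i
    fin_cases i <;> simpa
  rcases hw with hw | hw
  · obtain ⟨f, h1, h2⟩ := key _ _ (hmono w u v hw h) (hmono (-2) (-1) 1 (by norm_num) (by norm_num))
    exact ⟨f, h1, h2 1, h2 2, Or.inr (h2 0)⟩
  · obtain ⟨f, h1, h2⟩ := key _ _ (hmono u v w h hw) (hmono (-1) 1 2 (by norm_num) (by norm_num))
    exact ⟨f, h1, h2 0, h2 1, Or.inl (h2 2)⟩

namespace RealDiagram

/-! ### Edges described by their incidences -/

section incidence

variable {ι κ : Type} {G : RealDiagram ι κ}

theorem Incident.hEdge_eq {p q : ι} {j : κ} (hp : G.Incident p j) (hq : G.Incident q j) (hpq : p ≠ q) :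
    G.hEdge j = hseg (G.y j) (G.x p) (G.x q) := by
  rcases hp with hp | hp <;> rcases hq with hq | hq
  · exact absurd (G.X.injective (hp.symm.trans hq)) hpq
  · have e1 : G.X.symm j = p := by rw [hp, Equiv.symm_apply_apply]
    have e2 : G.O.symm j = q := by rw [hq, Equiv.symm_apply_apply]
    rw [hEdge, e1, e2]
  · have e1 : G.O.symm j = p := by rw [hp, Equiv.symm_apply_apply]
    have e2 : G.X.symm j = q := by rw [hq, Equiv.symm_apply_apply]
    rw [hEdge, e1, e2, hseg, uIcc_comm]
    rfl
  · exact absurd (G.O.injective (hp.symm.trans hq)) hpq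

theorem Incident.vEdge_eq {p q : κ} {i : ι} (hp : G.Incident i p) (hq : G.Incident i q) (hpq : p ≠ q) :
    G.vEdge i = vseg (G.x i) (G.y p) (G.y q) := by
  rcases hp with hp | hp <;> rcases hq with hq | hq
  · exact absurd (hp.trans hq.symm) hpq
  · rw [vEdge, hp, hq]
  · rw [vEdge, hp, hq, vseg, uIcc_comm]
    rfl
  · exact absurd (hp.trans hq.symm) hpq

theorem Incident.row_eq_or_eq {p q k : κ} {i : ι} (hp : G.Incident i p) (hq : G.Incident i q) (hpq : p ≠ q)
    (hk : G.Incident i k) : k = p ∨ k = q := by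
  unfold Incident at *
  grind

theorem Incident.col_eq_or_eq {p q k : ι} {j : κ} (hp : G.Incident p j) (hq : G.Incident q j) (hpq : p ≠ q)
    (hk : G.Incident k j) : k = p ∨ k = q := by
  have h1 := G.X.injective
  have h2 := G.O.injective
  rcases hp with hp | hp <;> rcases hq with hq | hq <;> rcases hk with hk | hk
  · exact absurd (h1 (hp.symm.trans hq)) hpq
  · exact absurd (h1 (hp.symm.trans hq)) hpq
  · exact Or.inl (h1 (hk.symm.trans hp))
  · exact Or.inr (h2 (hk.symm.trans hq))
  · exact Or.inr (h1 (hk.symm.trans hq))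
  · exact Or.inl (h2 (hk.symm.trans hp))
  · exact absurd (h2 (hp.symm.trans hq)) hpq
  · exact absurd (h2 (hp.symm.trans hq)) hpq

theorem Incident.exists_row {i : ι} {j : κ} (h : G.Incident i j) : ∃ j', j' ≠ j ∧ G.Incident i j' := by
  rcases h with rfl | rfl
  · exact ⟨G.O i, (G.ne i).symm, Or.inr rfl⟩
  · exact ⟨G.X i, G.ne i, Or.inl rfl⟩

end incidence

set_option maxHeartbeats 1000000 in
/-- Two adjacent horizontal edges at the bottom that are joined by a vertical edge are amalgamated. -/
theorem reach_amalgamate {ι κ ι' κ' : Type} [Finite ι] [Finite κ] [Finite ι'] [Finite κ']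
    {G : RealDiagram ι κ} {G' : RealDiagram ι' κ'} {i c o : ι} {rc ro : κ} {r' : κ'} (e : ι' → ι) (ρ : κ → κ')
    (he : ∀ k, k ≠ i ↔ ∃ k', e k' = k) (hx : ∀ k, G'.x k = G.x (e k))
    (hρ : Function.Surjective ρ) (hρc : ρ rc = r') (hρo : ρ ro = r') (hρr : ∀ j, ρ j = r' → j = rc ∨ j = ro)
    (hy : ∀ j, j ≠ rc → G'.y (ρ j) = G.y j)
    (hX : ∀ k, G'.X k = ρ (G.X (e k))) (hO : ∀ k, G'.O k = ρ (G.O (e k)))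
    (hB : G.B = {rc, ro}) (hB' : G'.B = {r'})
    (hic : G.Incident i rc) (hio : G.Incident i ro) (hc : G.Incident c rc) (ho : G.Incident o ro)
    (hci : c ≠ i) (hoi : o ≠ i) (hyc : G.y rc = G.y ro + 1/2)
    (hyy : ∀ j, j ≠ rc → j ≠ ro → G.y rc + 1/2 ≤ G.y j) (hw : G.x o ∉ uIcc (G.x i) (G.x c)) :
    Reach 0 G.toLinkDiagram G'.toLinkDiagram := by
  have hr : rc ≠ ro := fun h => by rw [h] at hyc; linarith
  have hco : c ≠ o := fun h => hw (h ▸ right_mem_uIcc)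
  have hI : ∀ k j', G'.Incident k j' ↔ ∃ j, ρ j = j' ∧ G.Incident (e k) j := fun k j' => by
    unfold Incident
    rw [hX, hO]
    constructor
    · rintro (h | h)
      exacts [⟨_, h.symm, Or.inl rfl⟩, ⟨_, h.symm, Or.inr rfl⟩]
    · rintro ⟨j, rfl, rfl | rfl⟩
      exacts [Or.inl rfl, Or.inr rfl]
  have hei : ∀ k, e k ≠ i := fun k => (he _).2 ⟨k, rfl⟩
  have hinj : ∀ k k', e k = e k' → k = k' := fun k k' h => G'.x_inj (by rw [hx, hx, h])
  have hρinj : ∀ j j', j ≠ rc → j' ≠ rc → ρ j = ρ j' → j = j' := fun j j' h1 h2 h =>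
    G.y_inj (by rw [← hy j h1, ← hy j' h2, h])
  have hρne : ∀ j, j ≠ rc → j ≠ ro → ρ j ≠ r' := fun j h1 h2 h => (hρr j h).elim h1 h2
  have hI2 : ∀ k j, j ≠ rc → j ≠ ro → (G'.Incident k (ρ j) ↔ G.Incident (e k) j) := fun k j h1 h2 => by
    rw [hI]
    refine ⟨?_, fun h => ⟨j, rfl, h⟩⟩
    rintro ⟨j', h, h'⟩
    have h3 : j' ≠ rc := fun e => hρne j h1 h2 (by rw [← h, e, hρc])
    rwa [← hρinj j' j h3 h1 h]
  obtain ⟨ec, hec, hec'⟩ := hc.exists_row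
  obtain ⟨eo, heo, heo'⟩ := ho.exists_row
  -- The row `ro` has only the columns `i` and `o`, and `c` is neither; so the column `c` leads away
  -- from the two rows. The same holds for `o`.
  have hec2 : ec ≠ ro := fun h => (hio.col_eq_or_eq ho hoi.symm (h ▸ hec')).elim hci hco
  have heo2 : eo ≠ rc := fun h => (hic.col_eq_or_eq hc hci.symm (h ▸ heo')).elim hoi hco.symm
  obtain ⟨c', hc'⟩ := (he c).1 hci
  obtain ⟨o', ho'⟩ := (he o).1 hoi
  have hco' : c' ≠ o' := fun h => hco (by rw [← hc', ← ho', h])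
  have ic : G'.Incident c' r' := (hI _ _).2 ⟨rc, hρc, hc' ▸ hc⟩
  have io : G'.Incident o' r' := (hI _ _).2 ⟨ro, hρo, ho' ▸ ho⟩
  have iec : G'.Incident c' (ρ ec) := (hI2 _ _ hec hec2).2 (hc' ▸ hec')
  have ieo : G'.Incident o' (ρ eo) := (hI2 _ _ heo2 heo).2 (ho' ▸ heo')
  have hyr : G'.y r' = G.y ro := by rw [← hρo, hy ro hr.symm]
  have hcols : ∀ k, k ≠ i → k ≠ c → k ≠ o → ∀ j, G.Incident k j → j ≠ rc ∧ j ≠ ro := fun k h1 h2 h3 j h =>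
    ⟨fun e => (hic.col_eq_or_eq hc hci.symm (e ▸ h)).elim h1 h2,
      fun e => (hio.col_eq_or_eq ho hoi.symm (e ▸ h)).elim h1 h3⟩
  have hrows : ∀ j, j ≠ rc → j ≠ ro → ∀ k, G.Incident k j → k ≠ i := fun j h1 h2 k h e =>
    (hic.row_eq_or_eq hio hr (e ▸ h)).elim h1 h2
  have hv : ∀ k, e k ≠ c → e k ≠ o → G'.vEdge k = G.vEdge (e k) := fun k h1 h2 => by
    have h3 := hcols (e k) (hei k) h1 h2
    have a1 := h3 _ (Or.inl rfl)
    have a2 := h3 _ (Or.inr rfl)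
    rw [vEdge, vEdge, hx, hX, hO, hy _ a1.1, hy _ a2.1]
  have hh : ∀ j, j ≠ rc → j ≠ ro → G'.hEdge (ρ j) = G.hEdge j := fun j h1 h2 => by
    have p1 : G.Incident (G.X.symm j) j := Or.inl (by simp)
    have p2 : G.Incident (G.O.symm j) j := Or.inr (by simp)
    obtain ⟨a, ha⟩ := (he _).1 (hrows j h1 h2 _ p1)
    obtain ⟨b, hb⟩ := (he _).1 (hrows j h1 h2 _ p2)
    have hab : a ≠ b := fun h => G.symm_ne j (by rw [← ha, ← hb, h])
    rw [((hI2 a j h1 h2).2 (ha ▸ p1)).hEdge_eq ((hI2 b j h1 h2).2 (hb ▸ p2)) hab, hy j h1, hx, hx, ha, hb]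
    rfl
  set A : Set ι := {i, c, o} with hA
  set A' : Set ι' := {c', o'} with hA'
  have mA : ∀ k, k ∈ A ↔ k = i ∨ k = c ∨ k = o := fun k => by simp [hA]
  have mA' : ∀ k, k ∈ A' ↔ k = c' ∨ k = o' := fun k => by simp [hA']
  have mB : ∀ j, j ∈ G.B ↔ j = rc ∨ j = ro := fun j => by simp [hB]
  have mB' : ∀ j, j ∈ G'.B ↔ j = r' := fun j => by simp [hB']
  have eA : ∀ k, e k ∉ A ↔ k ∉ A' := fun k => by
    rw [mA, mA', ← hc', ← ho']
    refine not_congr ⟨?_, ?_⟩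
    · rintro (h | h | h)
      exacts [absurd h (hei k), Or.inl (hinj _ _ h), Or.inr (hinj _ _ h)]
    · rintro (rfl | rfl)
      exacts [Or.inr (Or.inl rfl), Or.inr (Or.inr rfl)]
  have eB : ∀ j, ρ j ∉ G'.B ↔ j ∉ G.B := fun j => by
    rw [mB, mB']
    refine not_congr ⟨hρr j, ?_⟩
    rintro (rfl | rfl)
    exacts [hρc, hρo]
  have tA : ∀ P : ι → Prop, (∃ k, k ∉ A ∧ P k) ↔ ∃ k, k ∉ A' ∧ P (e k) := fun P => by
    constructor
    · rintro ⟨k, h1, h2⟩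
      obtain ⟨k', rfl⟩ := (he k).1 (fun h => h1 ((mA k).2 (Or.inl h)))
      exact ⟨k', (eA k').1 h1, h2⟩
    · rintro ⟨k, h1, h2⟩
      exact ⟨e k, (eA k).2 h1, h2⟩
  have tB : ∀ P : κ' → Prop, (∃ j, j ∉ G'.B ∧ P j) ↔ ∃ j, j ∉ G.B ∧ P (ρ j) := fun P => by
    rw [hρ.exists]
    simp only [eB]
  have vA : ∀ k, k ∉ A' → G'.vEdge k = G.vEdge (e k) := fun k h => by
    have h' := (eA k).2 h
    rw [mA] at h'
    push Not at h'
    exact hv k h'.2.1 h'.2.2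
  have hB2 : ∀ j, j ∉ G.B → G'.hEdge (ρ j) = G.hEdge j := fun j h => by
    rw [mB, not_or] at h
    exact hh j h.1 h.2
  have hI3 : ∀ k j, j ∉ G.B → (G'.Incident k (ρ j) ↔ G.Incident (e k) j) := fun k j h => by
    rw [mB, not_or] at h
    exact hI2 k j h.1 h.2
  have hFV : ∀ p, (∃ k, k ∉ A' ∧ p ∈ G'.vEdge k) ↔ ∃ k, k ∉ A ∧ p ∈ G.vEdge k := fun p => by
    rw [tA]
    exact exists_congr fun k => and_congr_right fun h => by rw [vA k h]
  have hFH : ∀ p, (∃ j, j ∉ G'.B ∧ p ∈ G'.hEdge j) ↔ ∃ j, j ∉ G.B ∧ p ∈ G.hEdge j := fun p => by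
    rw [tB]
    exact exists_congr fun k => and_congr_right fun h => by rw [hB2 k h]
  -- Outside the arc that is amalgamated the two diagrams have the same edges, so both are
  -- overpasses on one frame and a local isotopy can compare them.
  have hF : G'.frame A' = G.frame A := by
    simp only [frame, Frame.mk.injEq]
    refine ⟨?_, ?_, ?_, ?_⟩
    · ext p
      exact or_congr (hFV p) (hFH p)
    · ext p
      simp only [mem_ofPred_eq]
      rw [tA]
      refine exists_congr fun k => and_congr_right fun hk => ?_
      rw [tB]
      refine exists_congr fun j => and_congr_right fun hj => ?_
      rw [vA k hk, hB2 j hj, hI3 k j hj]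
    · ext p
      exact hFV p
    · ext p
      simp only [mem_ofPred_eq]
      have h1 : ∀ k, (∃ j, j ∉ G'.B ∧ G'.Incident k j ∧ p = (G'.x k, G'.y j)) ↔
          ∃ j, j ∉ G.B ∧ G.Incident (e k) j ∧ p = (G.x (e k), G.y j) := fun k => by
        rw [tB]
        refine exists_congr fun j => and_congr_right fun hj => ?_
        rw [hI3 k j hj, hx, hy j fun h => hj ((mB j).2 (Or.inl h))]
      simp only [h1]
      constructor
      · rintro ⟨k, hk, h⟩
        exact ⟨e k, by_contra fun h' => (eA k).1 h' hk, h⟩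
      · rintro ⟨k, hk, j, hj, hkj, h⟩
        have hj' := hj
        rw [mB, not_or] at hj'
        obtain ⟨k', rfl⟩ := (he k).1 (hrows j hj'.1 hj'.2 k hkj)
        exact ⟨k', by_contra fun h' => (eA k').2 h' hk, j, hj, hkj, h⟩
  have v1 := hic.vEdge_eq hio hr
  have v2 := hc.vEdge_eq hec' hec.symm
  have v3 := ho.vEdge_eq heo' heo.symm
  have v4 := hic.hEdge_eq hc hci.symm
  have v5 := hio.hEdge_eq ho hoi.symm
  have w1 := ic.vEdge_eq iec (hρne _ hec hec2).symm
  have w2 := io.vEdge_eq ieo (hρne _ heo2 heo).symm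
  have w3 := ic.hEdge_eq io hco'
  rw [hx, hc', hyr, hy ec hec] at w1
  rw [hx, ho', hyr, hy eo heo2] at w2
  rw [hx, hx, hc', ho', hyr] at w3
  have hyec := hyy ec hec hec2
  have hyeo := hyy eo heo2 heo
  have rep : (G.frame A).Rep (G.path A) G.toLinkDiagram := by
    refine G.rep_toLinkDiagram A (fun k j hj hk => ?_) fun k hk j hj h1 h2 => ?_
    · rw [mA]
      rcases (mB j).1 hj with rfl | rfl
      · exact (hic.col_eq_or_eq hc hci.symm hk).imp_right Or.inl
      · exact (hio.col_eq_or_eq ho hoi.symm hk).imp_right Or.inr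
    · rcases (mA k).1 hk with rfl | rfl | rfl <;> rcases (mB j).1 hj with rfl | rfl
      · exact hic
      · exact hio
      · exact hc
      · rw [v2] at h1
        have h3 := h1.2
        rw [uIcc_of_le (by linarith)] at h3
        have h4 : G.y rc ≤ G.y j := h3.1
        exfalso; linarith
      · rw [v4] at h2
        exact absurd h2.2 hw
      · exact ho
  have rep' : (G.frame A).Rep (G'.path A') G'.toLinkDiagram := by
    rw [← hF]
    refine G'.rep_toLinkDiagram A' (fun k j hj hk => ?_) fun k hk j hj _ _ => ?_
    · obtain rfl := (mB' j).1 hj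
      exact (mA' k).2 (ic.col_eq_or_eq io hco' hk)
    · obtain rfl := (mB' j).1 hj
      rcases (mA' k).1 hk with rfl | rfl
      exacts [ic, io]
  -- The abscissae of `i`, `c`, `o` are normalized to `-1`, `1`, `±2`; the condition `hw` says that
  -- `o` is not between the others. The heights of `ro` and `rc` become `-1` and `1`, and all others
  -- are then at least `3`.
  obtain ⟨f, f1, f2, f3, f4⟩ := exists_coordinate (fun h => hci (G.x_inj h).symm) hw
  set g : ℝ ≃ₜ ℝ := (Homeomorph.subRight (G.y ro)).trans
    ((Homeomorph.mulLeft₀ (4 : ℝ) (by norm_num)).trans (Homeomorph.subRight 1)) with hg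
  have hg' : ∀ t, g t = 4 * (t - G.y ro) - 1 := fun t => rfl
  have g1 : ∀ a b t, g t ∈ uIcc (g a) (g b) ↔ t ∈ uIcc a b := fun a b t => by
    simp only [hg', mem_uIcc]
    constructor <;> rintro (h | h)
    · exact Or.inl ⟨by linarith, by linarith⟩
    · exact Or.inr ⟨by linarith, by linarith⟩
    · exact Or.inl ⟨by linarith, by linarith⟩
    · exact Or.inr ⟨by linarith, by linarith⟩
  have g2 : g (G.y ro) = -1 := by rw [hg']; ring
  have g3 : g (G.y rc) = 1 := by rw [hg', hyc]; ring
  have g4 : 3 ≤ g (G.y ec) := by rw [hg']; linarith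
  have g5 : 3 ≤ g (G.y eo) := by rw [hg']; linarith
  set k : Plane ≃ₜ Plane := f.prodCongr g with hk
  set h : Plane ≃ₜ Plane := (scaleHomeo 0 0 (3/2) (3/2) (by norm_num) (by norm_num)).trans k.symm with hh'
  have hkh : ∀ q, k (h q) = (3/2 * q.1, 3/2 * q.2) := fun q => by
    simp [hh', scaleHomeo_apply]
  have mv : ∀ a b d p, p ∈ vseg a b d ↔ (k p).1 = f a ∧ (k p).2 ∈ uIcc (g b) (g d) := fun a b d p => by
    change _ ↔ f p.1 = f a ∧ g p.2 ∈ _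
    rw [f.injective.eq_iff, g1]
    rfl
  have mh : ∀ a b d p, p ∈ hseg a b d ↔ (k p).2 = g a ∧ (k p).1 ∈ uIcc (f b) (f d) := fun a b d p => by
    change _ ↔ g p.2 = g a ∧ f p.1 ∈ _
    rw [g.injective.eq_iff, f1]
    rfl
  have mT : ∀ p, p ∈ G.path A ↔ k p ∈ foldedPath (f (G.x o)) (g (G.y ec)) (g (G.y eo)) := fun p => by
    simp only [path, mem_ofPred_eq, mA, mB, or_and_right, exists_or, exists_eq_left, v1, v2, v3, v4, v5, mv, mh,
      f2, f3, g2, g3, foldedPath]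
    tauto
  have mT' : ∀ p, p ∈ G'.path A' ↔ k p ∈ unfoldedPath (f (G.x o)) (g (G.y ec)) (g (G.y eo)) := fun p => by
    simp only [path, mem_ofPred_eq, mA', mB', or_and_right, exists_or, exists_eq_left, w1, w2, w3, mv, mh,
      f3, g2, unfoldedPath]
    tauto
  have low : ∀ q ∈ Box, (h q).2 < G.y rc + 1/2 := fun q hq => by
    have h1 : g (h q).2 = 3/2 * q.2 := congrArg Prod.snd (hkh q)
    rw [hg'] at h1
    have := (abs_le.1 hq.2).2
    linarith
  have hRlow : ∀ p ∈ (G.frame A).R, G.y rc + 1/2 ≤ p.2 := by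
    rintro p (⟨k, hk, hp⟩ | ⟨j, hj, hp⟩)
    · rw [mA] at hk
      push Not at hk
      have h3 := hcols k hk.1 hk.2.1 hk.2.2
      have a1 := h3 _ (Or.inl rfl)
      have a2 := h3 _ (Or.inr rfl)
      exact (le_min (hyy _ a1.1 a1.2) (hyy _ a2.1 a2.2)).trans hp.2.1
    · rw [mB, not_or] at hj
      rw [hp.1]
      exact hyy j hj.1 hj.2
  -- The box reaches only to the normalized height `3/2`, so it contains nothing of the frame.
  have hplaced : Placed (G.frame A) h ∅ ∅ ∅ := by
    refine ⟨fun q hq => ?_, fun q hq => ?_, fun q hq => ?_, by simp⟩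
    · exact iff_of_false (fun h => absurd (hRlow _ h) (not_le.2 (low q hq))) (by simp)
    · refine iff_of_false ?_ (by simp)
      rintro ⟨k, -, j, hj, -, h3⟩
      rw [mB, not_or] at hj
      have h4 := low q hq
      rw [h3] at h4
      exact absurd (hyy j hj.1 hj.2) (not_le.2 h4)
    · refine iff_of_false ?_ (by simp)
      rintro ⟨k, hk, j, hj, h1, -⟩
      exact absurd (hRlow _ (Or.inl ⟨k, hk, h1⟩)) (not_le.2 (low q hq))
  refine (localIso_unfold f4 g4 g5).localMove _ h _ _ _ _ hplaced (fun q _ => ?_) (fun q _ => ?_) (fun q hq => ?_)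
    rep rep'
  · rw [mT, hkh]; rfl
  · rw [mT', hkh]; rfl
  · rw [mT, mT', hkh]
    refine foldedPath_outside f4 g4 g5 fun h => hq ?_
    simp only [abs_mul, abs_of_pos (show (0:ℝ) < 3/2 by norm_num)] at h
    exact ⟨by linarith [h.1], by linarith [h.2]⟩

end RealDiagram

namespace RectDiagram

variable {m : ℕ}

theorem sweepCost_antitone (D : RectDiagram (m + 1)) {k l : ℕ} (h : k ≤ l) : D.sweepCost l ≤ D.sweepCost k := by
  refine Finset.sum_le_sum fun j _ => ?_
  split_ifs <;> omega

/-- The new row of a row after a merge at the bottom. -/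
def mergeRow (j : Fin (m + 2)) : Fin (m + 1) := if h : j = Fin.last (m + 1) then 0 else j.castPred h

theorem mergeRow_last : mergeRow (Fin.last (m + 1)) = 0 := dif_pos rfl

theorem mergeRow_val {j : Fin (m + 2)} (h : j ≠ Fin.last (m + 1)) : (mergeRow j : ℕ) = j := by
  rw [mergeRow, dif_neg h]; rfl

theorem mergeRow_zero : mergeRow (0 : Fin (m + 2)) = 0 :=
  Fin.ext (mergeRow_val (fun h => by simp [Fin.ext_iff] at h))

theorem eq_of_mergeRow_eq_zero {j : Fin (m + 2)} (h : mergeRow j = 0) : j = 0 ∨ j = Fin.last (m + 1) := by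
  by_cases h1 : j = Fin.last (m + 1)
  · exact Or.inr h1
  · left
    have := mergeRow_val h1
    rw [h] at this
    exact Fin.ext this.symm

theorem mergeRow_surjective : Function.Surjective (mergeRow (m := m)) := fun j =>
  ⟨j.castSucc, Fin.ext (by rw [mergeRow_val (Fin.castSucc_lt_last j).ne]; rfl)⟩

/-- The drawing of a merged diagram with the columns of the original diagram. -/
noncomputable def mergeDrawing (D' : RectDiagram (m + 1)) (i : Fin (m + 2)) (z : ℝ) (hz : z < 1) :
    RealDiagram (Fin (m + 1)) (Fin (m + 1)) where
  X := D'.X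
  O := D'.O
  ne := D'.ne
  x k := (i.succAbove k : ℕ)
  y j := if j = 0 then z else (j : ℕ)
  x_inj k k' h := Fin.succAbove_right_injective (natCast_fin_inj h)
  y_inj j j' h := by
    have c0 : ∀ k : Fin (m + 1), k ≠ 0 → (1 : ℝ) ≤ (k : ℕ) := fun k hk => by
      exact_mod_cast Nat.one_le_iff_ne_zero.2 fun e => hk (Fin.ext e)
    beta_reduce at h
    split_ifs at h with h1 h2 h2
    · rw [h1, h2]
    · linarith [c0 j' h2]
    · linarith [c0 j h1]
    · exact natCast_fin_inj h
  B := {0}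

theorem isotopic_mergeDrawing (D' : RectDiagram (m + 1)) (i : Fin (m + 2)) (z : ℝ) (hz : z < 1) :
    D'.toLinkDiagram.PlanarIsotopic (D'.mergeDrawing i z hz).toLinkDiagram := by
  have c0 : ∀ k : Fin (m + 1), k ≠ 0 → (1 : ℝ) ≤ (k : ℕ) := fun k hk => by
    exact_mod_cast Nat.one_le_iff_ne_zero.2 fun e => hk (Fin.ext e)
  refine isotopic_permRows D' (Equiv.refl _) _ rfl rfl (fun k l h => ?_) (fun k l h => ?_) ?_
  · change ((i.succAbove k : ℕ) : ℝ) < (i.succAbove l : ℕ)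
    exact_mod_cast (Fin.strictMono_succAbove i h)
  · change k < l at h
    have hl : l ≠ 0 := (lt_of_le_of_lt (Fin.zero_le k) h).ne'
    change (if k = 0 then z else ((k : ℕ) : ℝ)) < if l = 0 then z else ((l : ℕ) : ℝ)
    rw [if_neg hl]
    split_ifs
    · linarith [c0 l hl]
    · exact_mod_cast h
  · rintro k j hj hv -
    obtain rfl : j = 0 := hj
    refine RealDiagram.incident_of_bottom (fun l => ?_) hv
    change (if (0 : Fin (m + 1)) = 0 then z else (((0 : Fin (m + 1)) : ℕ) : ℝ)) ≤ if l = 0 then z else ((l : ℕ) : ℝ)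
    rw [if_pos rfl]
    split_ifs with h
    · exact le_rfl
    · linarith [c0 l h]

/-- The swept row is stopped either just below or just above the bottom row, so that the joining
edge `i` has length `1/2`. Of the two rows, `rc` is the upper and `ro` the lower one, with further
columns `c` and `o`. The position is chosen so that column `o`, which rises from the lower row, does
not cross the upper one; then the three edges unfold freely. -/
theorem reach_merge_bottom (D : RectDiagram (m + 2)) (D' : RectDiagram (m + 1)) (i : Fin (m + 2))
    (hi : (D.X i = Fin.last (m + 1) ∧ D.O i = 0) ∨ (D.X i = 0 ∧ D.O i = Fin.last (m + 1)))
    (hX : ∀ k, D'.X k = mergeRow (D.X (i.succAbove k))) (hO : ∀ k, D'.O k = mergeRow (D.O (i.succAbove k))) :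
    Reach (D.sweepCost 0) D.toLinkDiagram D'.toLinkDiagram := by
  have c0 : ∀ k : Fin (m + 2), k ≠ 0 → (1 : ℝ) ≤ (k : ℕ) := fun k hk => by
    exact_mod_cast Nat.one_le_iff_ne_zero.2 fun e => hk (Fin.ext e)
  have h0 : (0 : Fin (m + 2)) ≠ Fin.last (m + 1) := fun h => by simp [Fin.ext_iff] at h
  have key : ∀ (k : ℕ) (rc ro c o : Fin (m + 2)),
      ((rc = 0 ∧ ro = Fin.last (m + 1) ∧ k = 0) ∨ (rc = Fin.last (m + 1) ∧ ro = 0 ∧ k = 1)) →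
      (rc = D.X c ∨ rc = D.O c) → (ro = D.X o ∨ ro = D.O o) → c ≠ i → o ≠ i →
      ((o : ℕ) : ℝ) ∉ uIcc ((i : ℕ) : ℝ) (c : ℕ) → Reach (D.sweepCost k) D.toLinkDiagram D'.toLinkDiagram := by
    intro k rc ro c o hk hc ho hci hoi hw
    set G₀ := D.below (Fin.last (m + 1)) k with hG₀
    set G : RealDiagram (Fin (m + 2)) (Fin (m + 2)) := { G₀ with B := {rc, ro} } with hG
    have hy : ∀ j, G.y j = if j = Fin.last (m + 1) then (k : ℝ) - 1/2 else (j : ℕ) := fun j => rfl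
    have hy0 : G.y 0 = 0 := by rw [hy, if_neg h0]; simp
    have hyl : G.y (Fin.last (m + 1)) = k - 1/2 := by rw [hy, if_pos rfl]
    have hic : G.Incident i rc := by
      rcases hk with ⟨rfl, -⟩ | ⟨rfl, -⟩ <;> rcases hi with h | h
      exacts [Or.inr h.2.symm, Or.inl h.1.symm, Or.inl h.1.symm, Or.inr h.2.symm]
    have hio : G.Incident i ro := by
      rcases hk with ⟨-, rfl, -⟩ | ⟨-, rfl, -⟩ <;> rcases hi with h | h
      exacts [Or.inl h.1.symm, Or.inr h.2.symm, Or.inr h.2.symm, Or.inl h.1.symm]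
    have hyc : G.y rc = G.y ro + 1/2 := by
      rcases hk with ⟨rfl, rfl, rfl⟩ | ⟨rfl, rfl, rfl⟩
      · rw [hy0, hyl]; norm_num
      · rw [hy0, hyl]; norm_num
    have hyy : ∀ j, j ≠ rc → j ≠ ro → G.y rc + 1/2 ≤ G.y j := by
      intro j h1 h2
      have h3 : j ≠ 0 ∧ j ≠ Fin.last (m + 1) := by
        rcases hk with ⟨rfl, rfl, rfl⟩ | ⟨rfl, rfl, rfl⟩
        exacts [⟨h1, h2⟩, ⟨h2, h1⟩]
      have h4 : G.y j = (j : ℕ) := by rw [hy, if_neg h3.2]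
      have h5 := c0 j h3.1
      rcases hk with ⟨rfl, rfl, rfl⟩ | ⟨rfl, rfl, rfl⟩
      · rw [hy0, h4]; linarith
      · rw [hyl, h4]; push_cast; linarith
    -- Neither row carries a crossing: `ro` is the lowest, and `rc` could only be crossed by column
    -- `o`, which `hw` excludes. So both rows may be declared part of the overpass.
    have e1 : G₀.toLinkDiagram.PlanarIsotopic G.toLinkDiagram := by
      refine RealDiagram.isotopic_of_over G₀ G rfl rfl rfl rfl fun p j h1 h2 h3 => ?_
      change (j = rc ∨ j = ro) ↔ j = Fin.last (m + 1)
      refine ⟨fun hj => ?_, fun hj => by rcases hk with ⟨-, rfl, -⟩ | ⟨rfl, -⟩; exacts [Or.inr hj, Or.inl hj]⟩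
      exfalso
      have hbot : ∀ l, G.y ro ≤ G.y l := fun l => by
        by_cases a1 : l = rc
        · rw [a1]; linarith
        · by_cases a2 : l = ro
          · rw [a2]
          · linarith [hyy l a1 a2]
      rcases hj with rfl | rfl
      · have h4 : ∀ l, l ≠ j → l ≠ ro → G.y j < G.y l := fun l a1 a2 => by linarith [hyy l a1 a2]
        have h5 : G.Incident p ro := by
          by_contra h6
          have h7 : G.y (G.X p) ⊓ G.y (G.O p) ≤ G.y j := h1.2.1
          have h8 := h4 (G.X p) (fun e => h3 (Or.inl e.symm)) (fun e => h6 (Or.inl e.symm))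
          have h9 := h4 (G.O p) (fun e => h3 (Or.inr e.symm)) (fun e => h6 (Or.inr e.symm))
          exact absurd h7 (not_le.2 (lt_min h8 h9))
        rcases hio.col_eq_or_eq ho hoi.symm h5 with rfl | rfl
        · exact h3 hic
        · have h6 : G.hEdge j = hseg (G.y j) (G.x i) (G.x c) := hic.hEdge_eq hc hci.symm
          have h7 : (G.x p, G.y j) ∈ G.hEdge j := h2
          rw [h6] at h7
          exact hw h7.2
      · exact h3 (RealDiagram.incident_of_bottom hbot h1)
    have hz : G.y ro < 1 := by
      rcases hk with ⟨rfl, rfl, rfl⟩ | ⟨rfl, rfl, rfl⟩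
      · rw [hyl]; norm_num
      · rw [hy0]; norm_num
    have e2 : Reach 0 G.toLinkDiagram (D'.mergeDrawing i (G.y ro) hz).toLinkDiagram := by
      refine RealDiagram.reach_amalgamate (r' := 0) i.succAbove mergeRow (fun l => Fin.exists_succAbove_eq_iff.symm)
        (fun _ => rfl) mergeRow_surjective ?_ ?_ (fun j hj => ?_) (fun j hj => ?_) hX hO rfl rfl hic hio hc ho hci hoi
        hyc hyy hw
      · rcases hk with ⟨rfl, -⟩ | ⟨rfl, -⟩
        exacts [mergeRow_zero, mergeRow_last]
      · rcases hk with ⟨-, rfl, -⟩ | ⟨-, rfl, -⟩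
        exacts [mergeRow_last, mergeRow_zero]
      · rcases hk with ⟨rfl, rfl, -⟩ | ⟨rfl, rfl, -⟩
        exacts [eq_of_mergeRow_eq_zero hj, (eq_of_mergeRow_eq_zero hj).symm]
      · change (if mergeRow j = 0 then G.y ro else ((mergeRow j : ℕ) : ℝ)) = G.y j
        split_ifs with h
        · congr 1
          rcases hk with ⟨rfl, rfl, -⟩ | ⟨rfl, rfl, -⟩
          exacts [((eq_of_mergeRow_eq_zero h).resolve_left hj).symm, ((eq_of_mergeRow_eq_zero h).resolve_right hj).symm]
        · have h1 : j ≠ Fin.last (m + 1) := fun e => h (e ▸ mergeRow_last)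
          rw [mergeRow_val h1, hy, if_neg h1]
    have e3 : Reach (D.sweepCost k) _ _ := D.reach_sweep (k := k) (by rcases hk with ⟨-, -, rfl⟩ | ⟨-, -, rfl⟩ <;> omega)
    exact (((((Reach.of_isotopic D.isotopic_below_top).trans e3).trans (.of_isotopic e1)).trans e2).trans
      (.of_isotopic (isotopic_mergeDrawing D' i _ hz).symm)).mono (by omega)
  have hex : ∀ j, (j = D.X i ∨ j = D.O i) → ∃ b, b ≠ i ∧ (j = D.X b ∨ j = D.O b) := by
    rintro j (rfl | rfl)
    · exact ⟨D.O.symm (D.X i), fun h => D.ne i ((Equiv.symm_apply_eq _).1 h), Or.inr (by simp)⟩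
    · exact ⟨D.X.symm (D.O i), fun h => D.ne i ((Equiv.symm_apply_eq _).1 h).symm, Or.inl (by simp)⟩
  obtain ⟨a, hai, ha⟩ := hex 0 (by rcases hi with h | h; exacts [Or.inr h.2.symm, Or.inl h.1.symm])
  obtain ⟨b, hbi, hb⟩ := hex (Fin.last (m + 1)) (by rcases hi with h | h; exacts [Or.inl h.1.symm, Or.inr h.2.symm])
  -- If both rows ended in one further column, the merged edge would be degenerate, which `D'.ne`
  -- forbids.
  have hab : a ≠ b := by
    rintro rfl
    obtain ⟨k, rfl⟩ := Fin.exists_succAbove_eq hai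
    refine D'.ne k ?_
    rw [hX, hO]
    rcases ha with ha | ha <;> rcases hb with hb | hb
    · exact absurd (ha.trans hb.symm) h0
    · rw [← ha, ← hb, mergeRow_zero, mergeRow_last]
    · rw [← ha, ← hb, mergeRow_zero, mergeRow_last]
    · exact absurd (ha.trans hb.symm) h0
  -- If `b` lies between `i` and `a`, then `a` does not lie between `i` and `b`, and the roles of
  -- the two rows are exchanged by stopping one row earlier.
  by_cases hw : ((b : ℕ) : ℝ) ∈ uIcc ((i : ℕ) : ℝ) (a : ℕ)
  · refine (key 1 _ _ b a (Or.inr ⟨rfl, rfl, rfl⟩) hb ha hbi hai fun hw' => ?_).mono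
      (D.sweepCost_antitone zero_le_one)
    simp only [mem_uIcc, Nat.cast_le] at hw hw'
    have h1 : (a : ℕ) ≠ b := fun h => hab (Fin.ext h)
    have h2 : (a : ℕ) ≠ i := fun h => hai (Fin.ext h)
    have h3 : (b : ℕ) ≠ i := fun h => hbi (Fin.ext h)
    omega
  · exact key 0 _ _ a b (Or.inl ⟨rfl, rfl, rfl⟩) ha hb hai hbi hw

/-- Placement of the new edge at the top is reduced to placement at the bottom by reflection in the
horizontal axis. The case `m = 0` is void, since a single row cannot hold two distinct ends. -/
theorem reach_horizontal_merge (D : RectDiagram (m + 1)) (D' : RectDiagram m)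
    (h : D.IsExteriorHorizontalMerge D') :
    ∃ E : RectDiagram (m + 1), Reach (E.sweepCost 0) D.toLinkDiagram D'.toLinkDiagram := by
  obtain ⟨i, hi, ρ, hρ, hk⟩ := h
  obtain _ | m := m
  · have : Subsingleton (Fin (0 + 1)) := Fin.subsingleton_one
    exact absurd (Subsingleton.elim _ _) (D.ne i)
  rcases hρ with hρ | hρ
  · have key : ∀ (j : Fin (m + 2)) (r : Fin (m + 1)), (r : ℕ) = ρ j → r.rev = mergeRow j.rev := fun j r hr => by
      rw [hρ] at hr
      refine Fin.ext ?_
      split_ifs at hr with h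
      · rw [h, Fin.rev_zero, mergeRow_last, Fin.val_rev, hr]
        simp
      · have h1 : (j : ℕ) ≠ 0 := fun e => h (Fin.ext e)
        have h2 : j.rev ≠ Fin.last (m + 1) := fun e => h (by rw [← Fin.rev_rev j, e, Fin.rev_last])
        rw [mergeRow_val h2, Fin.val_rev, Fin.val_rev]
        omega
    refine ⟨D.permRows Fin.revPerm, reach_of_flip (reach_merge_bottom _ _ i ?_ (fun k => ?_) fun k => ?_)⟩
    · simp only [permRows, Equiv.trans_apply, Fin.revPerm_apply]
      rcases hi with ⟨h1, h2⟩ | ⟨h1, h2⟩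
      · right; rw [h1, h2]; simp
      · left; rw [h1, h2]; simp
    · exact key _ _ (hk k).1
    · exact key _ _ (hk k).2
  · have key : ∀ j, ρ j = mergeRow j := fun j => by
      rw [hρ]
      split_ifs with h
      · rw [h, mergeRow_last]; rfl
      · rw [mergeRow_val h]
    exact ⟨D, reach_merge_bottom D D' i hi (fun k => Fin.ext ((hk k).1.trans (key _)))
      fun k => Fin.ext ((hk k).2.trans (key _))⟩

end RectDiagram

/-! ### Comparison of the costs with the bounds -/

theorem unknotsSplitsOrRealizes_of_reach {k : ℕ} {B : ℚ} {D D' : LinkDiagram} (h : Reach k D D') (hk : (k : ℚ) ≤ B) :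
    UnknotsSplitsOrRealizes B D D' := by
  obtain ⟨l, hl, h⟩ := h
  exact ⟨l, D', le_trans (by exact_mod_cast hl) hk, h, Or.inr (Or.inr rfl)⟩

theorem mainTheorem1 (n : ℕ) (hn : 2 ≤ n) (ε : ℕ) (hε : ε = 0 ∨ ε = 1) (hnε : n ≡ ε [MOD 2]) :
    (∀ D D' : RectDiagram n, D.IsExteriorExchange D' →
      UnknotsSplitsOrRealizes (3 * n ^ 2 - 4 * n - 4 - 3 * ε)
        D.toLinkDiagram D'.toLinkDiagram) ∧
    (∀ m : ℕ, m + 1 = n → ∀ (D : RectDiagram (m + 1)) (D' : RectDiagram m),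
      D.IsExteriorMerge D' →
        UnknotsSplitsOrRealizes ((3 * n ^ 2 - 4 * n - 4 - 3 * ε) / 2)
          D.toLinkDiagram D'.toLinkDiagram) ∧
    (∀ D D' : RectDiagram n, D.IsRotation D' →
      UnknotsSplitsOrRealizes ((3 * n ^ 2 - 4 * n - 2 - 3 * ε) / 2)
        D.toLinkDiagram D'.toLinkDiagram) := by
  have hε' : (ε : ℚ) ≤ 1 := by rcases hε with rfl | rfl <;> norm_num
  have hexch : ∀ (m : ℕ), m ≠ 0 → ∀ D D' : RectDiagram (m + 1), D.IsExteriorExchange D' →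
      ∃ E E' : RectDiagram (m + 1), Reach (E.sweepCost 1 + E'.sweepCost 0) D.toLinkDiagram D'.toLinkDiagram := by
    rintro m hm D D' (h | h)
    · exact RectDiagram.reach_exchange D D' hm h
    · obtain ⟨E, E', hE⟩ := RectDiagram.reach_exchange _ _ hm h
      exact ⟨E, E', RectDiagram.reach_of_transpose hE⟩
  have hmerge : ∀ (m : ℕ) (D : RectDiagram (m + 1)) (D' : RectDiagram m), D.IsExteriorMerge D' →
      ∃ E : RectDiagram (m + 1), Reach (E.sweepCost 0) D.toLinkDiagram D'.toLinkDiagram := by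
    rintro m D D' (h | h)
    · exact RectDiagram.reach_horizontal_merge D D' h
    · obtain ⟨E, hE⟩ := RectDiagram.reach_horizontal_merge _ _ h
      exact ⟨E, RectDiagram.reach_of_transpose hE⟩
  obtain rfl | rfl | hn4 : n = 2 ∨ n = 3 ∨ 4 ≤ n := by omega
  · obtain rfl : ε = 0 := by
      rcases hε with rfl | rfl
      · rfl
      · exact absurd hnε (by decide)
    refine ⟨fun D D' _ => ?_, fun m hm D D' _ => ?_, fun D D' _ => ?_⟩
    · exact unknotsSplitsOrRealizes_of_reach (.of_isotopic (D.isotopic_two D')) (by norm_num)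
    · obtain rfl : m = 1 := by omega
      exact absurd (Subsingleton.elim _ _) (D'.ne 0)
    · exact unknotsSplitsOrRealizes_of_reach (.of_isotopic (D.isotopic_two D')) (by norm_num)
  · refine ⟨fun D D' h => ?_, fun m hm D D' h => ?_, fun D D' h => ?_⟩
    -- One row costs at most `3` and a full sweep at most `4`; the bound at `n = 3` is `8`.
    · obtain ⟨E, E', hE⟩ := hexch 2 two_ne_zero D D' h
      have h1 := E.sweepCost_le (k := 1)
      have h2 := E'.sweepCost_three
      refine unknotsSplitsOrRealizes_of_reach (hE.mono (show _ ≤ 7 by omega)) ?_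
      push_cast
      linarith
    · obtain rfl : m = 2 := by omega
      obtain ⟨E, hE⟩ := hmerge 2 D D' h
      refine unknotsSplitsOrRealizes_of_reach (hE.mono E.sweepCost_three) ?_
      push_cast
      linarith
    · obtain ⟨E, hE⟩ := RectDiagram.reach_rotation D D' h
      refine unknotsSplitsOrRealizes_of_reach (hE.mono E.sweepCost_three) ?_
      push_cast
      linarith
  -- With `ε ≤ 1`, the exchange needs `(n - 2) n + (n - 1) n ≤ 3 n² - 4 n - 7`, and the merge, which
  -- is tighter, needs `2 n (n - 1) ≤ 3 n² - 4 n - 7`, that is `n² - 2 n ≥ 7`. The latter holds from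
  -- `n = 4` on. Writing `n = p + 4` makes every coefficient of the differences nonnegative.
  · obtain ⟨p, rfl⟩ : ∃ p, n = p + 3 + 1 := ⟨n - 4, by omega⟩
    have hp : (0 : ℚ) ≤ p := Nat.cast_nonneg p
    have hpp := mul_nonneg hp hp
    refine ⟨fun D D' h => ?_, fun m hm D D' h => ?_, fun D D' h => ?_⟩
    · obtain ⟨E, E', hE⟩ := hexch (p + 3) (by omega) D D' h
      refine unknotsSplitsOrRealizes_of_reach
        (hE.mono (add_le_add (E.sweepCost_le (k := 1)) (E'.sweepCost_le (k := 0)))) ?_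
      rw [show p + 3 - 1 = p + 2 from rfl, Nat.sub_zero]
      push_cast
      linarith
    · obtain rfl : m = p + 3 := by omega
      obtain ⟨E, hE⟩ := hmerge _ D D' h
      refine unknotsSplitsOrRealizes_of_reach (hE.mono (E.sweepCost_le (k := 0))) ?_
      rw [Nat.sub_zero]
      push_cast
      linarith
    · obtain ⟨E, hE⟩ := RectDiagram.reach_rotation D D' h
      refine unknotsSplitsOrRealizes_of_reach (hE.mono (E.sweepCost_le (k := 0))) ?_
      rw [Nat.sub_zero]
      push_cast
      linarith
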